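/- All digraphs are finite, without multiple edges, possibly with loops; $\mathbb N=\{0,1,2,\dots\}$. For a digraph $G$ let $\mathrm{dist}_G(u,v)$ be the length of a shortest directed path from $u$ to $v$, and for $r\in\mathbb N$ let $B_r^+(v)=\{w:\mathrm{dist}_G(v,w)\le r\}$ and $B_r^-(v)=\{u:\mathrm{dist}_G(u,v)\le r\}$. For $A\subseteq V(G)$ put $\overline A=V(G)\setminus A$, let $G[A\to\overline A]$ be the bipartite digraph of all edges of $G$ from $A$ to $\overline A$, and let $\nu$ be the maximum size of an induced matching (a set of edges, no two sharing an endpoint, such that no edge of the digraph meets two of them). A branch decomposition of $G$ is a pair $(T,f)$ of a tree $T$ with at least two vertices, all of whose internal vertices have degree $3$, and a bijection $f$ from $V(G)$ to the leaves of $T$. Its bi-mim-width is the maximum, over the edges $e$ of $T$, of $\nu(G[A_e\to\overline{A_e}])+\nu(G[\overline{A_e}\to A_e])$, where $(A_e,\overline{A_e})$ is the partition of $V(G)$ that the two components of $T-e$ induce through $f$. For a finite or co-finite set $\mu\subseteq\mathbb N$ let $d(\mu)=0$ if $\mu\in\{\mathbb N,\emptyset\}$, and otherwise $d(\mu)=1+\min\{\max\mu,\max(\mathbb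 N\setminus\mu)\}$, where the maximum of an infinite set is $\infty$. Running times are on a word RAM (unit-cost arithmetic on words, words of logarithmically many bits in the running-time bound); the input is the digraph, on the vertex set $\{0,\dots,n-1\}$, and the tree $T$, both as adjacency matrices, together with $f$. **(a)** Let $r\in\mathbb N$, let $\sigma^+,\sigma^-,\rho^+,\rho^-\subseteq\mathbb N$ be finite or co-finite, and let $d=\max\{d(\sigma^+),d(\sigma^-),d(\rho^+),d(\rho^-)\}$. Call $S\subseteq V(G)$ distance-$r$ $(\Sigma,\mathrm P)$-dominating if every $v\in S$ satisfies $|B_r^+(v)\cap S|\in\sigma^+$ and $|B_r^-(v)\cap S|\in\sigma^-$, and every $v\notin S$ satisfies $|B_r^+(v)\cap S|\in\rho^+$ and $|B_r^-(v)\cap S|\in\rho^-$. For each of minimization and maximization, there is an algorithm that, given any digraph $G$ on $n$ vertices and a branch decomposition of $G$ of bi-mim-width $w\ge 1$, computes an optimum-size distance-$r$ $(\Sigma,\mathrm P)$-dominating set of $G$, or reports that there is none, in time $O(n^{3drw+2})$; the implied constant does not depend on $G$, $n$ or $w$. **(b)** Let $r\in\mathbb N$, let $q\ge 1$, let $D$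 be a $q\times q$ matrix whose entries are pairs $D[i,j]=(\mu^+_{i,j},\mu^-_{i,j})$ of finite or co-finite subsets of $\mathbb N$, and let $d=\max_{i,j}\{d(\mu^+_{i,j}),d(\mu^-_{i,j})\}$. There is an algorithm that, given any digraph $G$ on $n$ vertices and a branch decomposition of $G$ of bi-mim-width $w$, decides whether there is a partition $(X_1,\dots,X_q)$ of $V(G)$ into possibly empty sets such that $|B_r^+(v)\cap X_j|\in\mu^+_{i,j}$ and $|B_r^-(v)\cap X_j|\in\mu^-_{i,j}$ for all $i,j$ and all $v\in X_i$, and finds one if there is, in time $O(q\cdot n^{3qdrw+2})$; the implied constant depends only on $r$ and $d$. -/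

import Mathlib

/-! ### Digraphs: distances, balls, induced matchings, cut functions -/

namespace Digraph

variable {V : Type*}

/-- `G.HasWalk k u v`: there is a directed walk with exactly `k` edges from `u` to `v`. -/
inductive HasWalk (G : Digraph V) : ℕ → V → V → Prop
  | nil (v : V) : HasWalk G 0 v v
  | cons {k : ℕ} {u v w : V} (h : G.Adj u v) (p : HasWalk G k v w) : HasWalk G (k + 1) u w

/-- The distance from `u` to `v`: the length of a shortest directed path (`⊤` if there is none).
A shortest directed walk is a path, so the minimum may be taken over walks. -/
noncomputable def edist (G : Digraph V) (u v : V) : ℕ∞ :=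
  ⨅ (k : ℕ) (_ : G.HasWalk k u v), (k : ℕ∞)

/-- The `r`-out-ball of `v`. -/
def outBall (G : Digraph V) (r : ℕ) (v : V) : Set V := {w | G.edist v w ≤ r}

/-- The `r`-in-ball of `v`. -/
def inBall (G : Digraph V) (r : ℕ) (v : V) : Set V := {u | G.edist u v ≤ r}

/-- `G[A → B]`: the edges of `G` from `A` to `B` (`A`, `B` disjoint). It is used for cuts only, where
`A ∪ B` is the whole vertex set. -/
def between (G : Digraph V) (A B : Set V) : Digraph V where
  Adj u v := u ∈ A ∧ v ∈ B ∧ G.Adj u v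

/-- A vertex `x` is an endpoint of the edge `e`. -/
def IsEndpoint (x : V) (e : V × V) : Prop := x = e.1 ∨ x = e.2

/-- Two edges meet if they have a common endpoint. -/
def Meets (e e' : V × V) : Prop := ∃ x, IsEndpoint x e ∧ IsEndpoint x e'

/-- `M` is an induced matching of `G`: a set of edges, no two of which share an endpoint, such that
no edge of `G` meets two distinct edges of `M`. -/
structure IsInducedMatching (G : Digraph V) (M : Finset (V × V)) : Prop where
  edges : ∀ e ∈ M, G.Adj e.1 e.2
  matching : ∀ e ∈ M, ∀ e' ∈ M, e ≠ e' → ¬ Meets e e'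
  induced : ∀ x y, G.Adj x y → ∀ e ∈ M, ∀ e' ∈ M, e ≠ e' → ¬ (Meets (x, y) e ∧ Meets (x, y) e')

/-- `ν(G)`: the maximum size of an induced matching of a finite digraph `G`. -/
noncomputable def inducedMatchingNumber (G : Digraph V) : ℕ :=
  sSup {k | ∃ M : Finset (V × V), G.IsInducedMatching M ∧ M.card = k}

/-- `bimim_G(A) = ν(G[A → Aᶜ]) + ν(G[Aᶜ → A])`. -/
noncomputable def bimimVal (G : Digraph V) (A : Set V) : ℕ :=
  (G.between A Aᶜ).inducedMatchingNumber + (G.between Aᶜ A).inducedMatchingNumber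

end Digraph

/-! ### Branch decompositions and bi-mim-width -/

/-- A leaf of a tree: a vertex of degree one. -/
def SimpleGraph.IsLeaf {W : Type*} (T : SimpleGraph W) (a : W) : Prop := (T.neighborSet a).ncard = 1

/-- A (finite) subcubic tree: a tree with at least two vertices, all of whose internal vertices have
degree three. -/
structure SimpleGraph.IsSubcubicTree {W : Type*} (T : SimpleGraph W) : Prop where
  finite : Finite W
  isTree : T.IsTree
  two_le : 2 ≤ Nat.card W
  degree_eq_three : ∀ a, ¬ T.IsLeaf a → (T.neighborSet a).ncard = 3

/-- A branch decomposition of a digraph with vertex set `V`: a subcubic tree together with a bijection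
from `V` to its leaves. -/
structure BranchDecomposition (V W : Type*) where
  /-- the tree -/
  tree : SimpleGraph W
  /-- the map from the vertices to the leaves -/
  toLeaf : V → W
  subcubic : tree.IsSubcubicTree
  bijOn : Set.BijOn toLeaf Set.univ {a | tree.IsLeaf a}

namespace BranchDecomposition

variable {V W : Type*}

/-- The side, at the first end of `e`, of the cut of `V` that an edge `e` of the tree displays. -/
def cut (B : BranchDecomposition V W) (e : B.tree.Dart) : Set V :=
  {v | (B.tree.deleteEdges {e.edge}).Reachable e.fst (B.toLeaf v)}

/-- The bi-mim-width of a branch decomposition of `G`. The maximum is over the oriented edges of the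
tree; the two orientations of an edge give the two sides of the same cut, hence the same value. -/
noncomputable def bimimWidth (B : BranchDecomposition V W) (G : Digraph V) : ℕ :=
  ⨆ e : B.tree.Dart, G.bimimVal (B.cut e)

end BranchDecomposition

/-! ### The problems -/

/-- Finite or co-finite sets of natural numbers. -/
def FiniteOrCofinite (μ : Set ℕ) : Prop := μ.Finite ∨ μᶜ.Finite

open Classical in
/-- The `d`-value of a finite or co-finite set of natural numbers: `0` for `ℕ` and for `∅`, otherwise
`1 + min (max μ) (max μᶜ)`, where the maximum of an infinite set is infinite. -/
noncomputable def dValue (μ : Set ℕ) : ℕ :=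
  if μ = Set.univ ∨ μ = ∅ then 0
  else (1 + min (⨆ x ∈ μ, (x : ℕ∞)) (⨆ x ∈ μᶜ, (x : ℕ∞))).toNat

/-- A quadruple `(σ⁺, σ⁻, ρ⁺, ρ⁻)` of finite or co-finite sets of natural numbers. -/
structure SigmaRho where
  sigmaOut : Set ℕ
  sigmaIn : Set ℕ
  rhoOut : Set ℕ
  rhoIn : Set ℕ
  sigmaOut_fc : FiniteOrCofinite sigmaOut
  sigmaIn_fc : FiniteOrCofinite sigmaIn
  rhoOut_fc : FiniteOrCofinite rhoOut
  rhoIn_fc : FiniteOrCofinite rhoIn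

/-- `d(Σ, Ρ)`. -/
noncomputable def SigmaRho.dValue (P : SigmaRho) : ℕ :=
  max (max (_root_.dValue P.sigmaOut) (_root_.dValue P.sigmaIn))
    (max (_root_.dValue P.rhoOut) (_root_.dValue P.rhoIn))

/-- `S` distance-`r` `(Σ, Ρ)`-dominates `G`. -/
def SigmaRho.DistDominates {V : Type*} (P : SigmaRho) (r : ℕ) (G : Digraph V) (S : Set V) : Prop :=
  ∀ v, (v ∈ S → (G.outBall r v ∩ S).ncard ∈ P.sigmaOut ∧ (G.inBall r v ∩ S).ncard ∈ P.sigmaIn) ∧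
    (v ∉ S → (G.outBall r v ∩ S).ncard ∈ P.rhoOut ∧ (G.inBall r v ∩ S).ncard ∈ P.rhoIn)

/-- Minimization or maximization. -/
inductive Objective
  | minimize
  | maximize

/-- `S` has optimum size among the sets with property `F`. -/
def Objective.IsOptimum {V : Type*} (opt : Objective) (F : Set V → Prop) (S : Set V) : Prop :=
  F S ∧ ∀ S', F S' →
    match opt with
    | .minimize => S.ncard ≤ S'.ncard
    | .maximize => S'.ncard ≤ S.ncard

/-- A `q × q` bi-neighborhood-constraint matrix with entries `(μ⁺ᵢⱼ, μ⁻ᵢⱼ)`. -/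
structure ConstraintMatrix (q : ℕ) where
  out : Matrix (Fin q) (Fin q) (Set ℕ)
  inn : Matrix (Fin q) (Fin q) (Set ℕ)
  out_fc : ∀ i j, FiniteOrCofinite (out i j)
  inn_fc : ∀ i j, FiniteOrCofinite (inn i j)

/-- `d(D)`. -/
noncomputable def ConstraintMatrix.dValue {q : ℕ} (D : ConstraintMatrix q) : ℕ :=
  Finset.univ.sup fun i => Finset.univ.sup fun j =>
    max (_root_.dValue (D.out i j)) (_root_.dValue (D.inn i j))

/-- `(X₁, …, X_q)` is a partition of the vertex set (with possibly empty parts) that is a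
distance-`r` `D`-partition of `G`. -/
def ConstraintMatrix.IsDistPartition {V : Type*} {q : ℕ} (D : ConstraintMatrix q) (r : ℕ)
    (G : Digraph V) (X : Fin q → Set V) : Prop :=
  (∀ v, ∃! i, v ∈ X i) ∧
    ∀ i j, ∀ v ∈ X i, (G.outBall r v ∩ X j).ncard ∈ D.out i j ∧
      (G.inBall r v ∩ X j).ncard ∈ D.inn i j

/-! ### The machine: a word RAM with structured programs -/

namespace WordRAM

/-- The memory: numbered variables, and numbered arrays whose cells are addressed by words. -/
structure Store where
  var : ℕ → ℕ
  arr : ℕ → ℕ → ℕ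

/-- Arithmetic expressions; subtraction is truncated, division is integer division (with `x / 0 = 0`). -/
inductive Expr
  | const (k : ℕ)
  | var (x : ℕ)
  | get (a : ℕ) (i : Expr)
  | add (e₁ e₂ : Expr)
  | sub (e₁ e₂ : Expr)
  | mul (e₁ e₂ : Expr)
  | div (e₁ e₂ : Expr)

/-- The value of an expression. -/
def Expr.eval (s : Store) : Expr → ℕ
  | const k => k
  | var x => s.var x
  | get a i => s.arr a (i.eval s)
  | add e₁ e₂ => e₁.eval s + e₂.eval s
  | sub e₁ e₂ => e₁.eval s - e₂.eval s
  | mul e₁ e₂ => e₁.eval s * e₂.eval s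
  | div e₁ e₂ => e₁.eval s / e₂.eval s

/-- All values that occur when the expression is evaluated (addresses included) are words, that is,
numbers of size at most `B`. -/
def Expr.Fits (B : ℕ) (s : Store) : Expr → Prop
  | const k => k ≤ B
  | var x => s.var x ≤ B
  | get a i => i.Fits B s ∧ s.arr a (i.eval s) ≤ B
  | add e₁ e₂ => e₁.Fits B s ∧ e₂.Fits B s ∧ e₁.eval s + e₂.eval s ≤ B
  | sub e₁ e₂ => e₁.Fits B s ∧ e₂.Fits B s
  | mul e₁ e₂ => e₁.Fits B s ∧ e₂.Fits B s ∧ e₁.eval s * e₂.eval s ≤ B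
  | div e₁ e₂ => e₁.Fits B s ∧ e₂.Fits B s

/-- The number of elementary operations in the evaluation of an expression. -/
def Expr.cost : Expr → ℕ
  | const _ => 1
  | var _ => 1
  | get _ i => i.cost + 1
  | add e₁ e₂ => e₁.cost + e₂.cost + 1
  | sub e₁ e₂ => e₁.cost + e₂.cost + 1
  | mul e₁ e₂ => e₁.cost + e₂.cost + 1
  | div e₁ e₂ => e₁.cost + e₂.cost + 1

/-- Programs. A test succeeds if the value of the expression is not zero. -/
inductive Program
  | skip
  | assign (x : ℕ) (e : Expr)
  | store (a : ℕ) (i e : Expr)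
  | seq (p₁ p₂ : Program)
  | ite (e : Expr) (p₁ p₂ : Program)
  | while (e : Expr) (p : Program)

/-- Write the variable `x`. -/
def Store.setVar (s : Store) (x k : ℕ) : Store :=
  { s with var := Function.update s.var x k }

/-- Write the cell `i` of the array `a`. -/
def Store.setArr (s : Store) (a i k : ℕ) : Store :=
  { s with arr := Function.update s.arr a (Function.update (s.arr a) i k) }

/-- `Run B p s t s'`: on a machine with words of size at most `B`, the program `p`, started with memory
`s`, halts after exactly `t` elementary operations with memory `s'`. A program that produces a number
greater than `B` has no run. -/
inductive Run (B : ℕ) : Program → Store → ℕ → Store → Prop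
  | skip (s : Store) : Run B .skip s 1 s
  | assign (s : Store) (x : ℕ) (e : Expr) (he : e.Fits B s) :
      Run B (.assign x e) s (e.cost + 1) (s.setVar x (e.eval s))
  | store (s : Store) (a : ℕ) (i e : Expr) (hi : i.Fits B s) (he : e.Fits B s) :
      Run B (.store a i e) s (i.cost + e.cost + 1) (s.setArr a (i.eval s) (e.eval s))
  | seq {p₁ p₂ : Program} {s s' s'' : Store} {t₁ t₂ : ℕ}
      (h₁ : Run B p₁ s t₁ s') (h₂ : Run B p₂ s' t₂ s'') : Run B (.seq p₁ p₂) s (t₁ + t₂) s''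
  | ite_true {e : Expr} {p₁ p₂ : Program} {s s' : Store} {t : ℕ} (he : e.Fits B s)
      (h : e.eval s ≠ 0) (h₁ : Run B p₁ s t s') : Run B (.ite e p₁ p₂) s (e.cost + 1 + t) s'
  | ite_false {e : Expr} {p₁ p₂ : Program} {s s' : Store} {t : ℕ} (he : e.Fits B s)
      (h : e.eval s = 0) (h₂ : Run B p₂ s t s') : Run B (.ite e p₁ p₂) s (e.cost + 1 + t) s'
  | while_true {e : Expr} {p : Program} {s s' s'' : Store} {t₁ t₂ : ℕ} (he : e.Fits B s)
      (h : e.eval s ≠ 0) (h₁ : Run B p s t₁ s') (h₂ : Run B (.while e p) s' t₂ s'') :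
      Run B (.while e p) s (e.cost + 1 + t₁ + t₂) s''
  | while_false {e : Expr} {p : Program} {s : Store} (he : e.Fits B s) (h : e.eval s = 0) :
      Run B (.while e p) s (e.cost + 1) s

/-- Started with memory `s`, the program `p` halts after at most `N` elementary operations, with memory
satisfying `Q`, on the machine whose words are the numbers of size at most `N`. -/
def Program.Computes (p : Program) (s : Store) (N : ℕ) (Q : Store → Prop) : Prop :=
  ∃ t s', Run N p s t s' ∧ t ≤ N ∧ Q s'

end WordRAM

/-! ### Input and output -/

open Classical in
/-- The adjacency matrix of a relation on `Fin n`, row by row. -/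
noncomputable def encodeRel {n : ℕ} (R : Fin n → Fin n → Prop) (k : ℕ) : ℕ :=
  if ∃ u v : Fin n, k = u * n + v ∧ R u v then 1 else 0

/-- The initial memory for a digraph on `n` vertices and a branch decomposition whose tree has `m`
nodes: the variables `0`, `1` hold `n`, `m`; the arrays `0`, `1` hold the adjacency matrices of the
digraph and of the tree; the array `2` holds the map to the leaves; everything else is `0`. -/
noncomputable def encodeInput {n m : ℕ} (G : Digraph (Fin n)) (B : BranchDecomposition (Fin n) (Fin m)) :
    WordRAM.Store where
  var
    | 0 => n
    | 1 => m
    | _ => 0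
  arr
    | 0 => encodeRel G.Adj
    | 1 => encodeRel B.tree.Adj
    | 2 => fun k => if h : k < n then (B.toLeaf ⟨k, h⟩ : ℕ) else 0
    | _ => fun _ => 0

/-- The vertex set that the final memory describes: the vertices whose cell of the array `0` is `1`. -/
def outputSet {n : ℕ} (s : WordRAM.Store) : Set (Fin n) := {v | s.arr 0 v = 1}

/-- The vertex sets `X₁, …, X_q` that the final memory describes: cell `v` of the array `0` holds the
(zero-based) index of the set of `v`. -/
def outputPartition {n q : ℕ} (s : WordRAM.Store) (i : Fin q) : Set (Fin n) :=
  {v | s.arr 0 v = (i : ℕ)}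

/-- The answer is right: either variable `0` is `1` and the array `0` holds an optimum-size
distance-`r` `(Σ, Ρ)`-dominating set, or variable `0` is `0` and there is no such set. -/
def SigmaRho.CorrectAnswer (P : SigmaRho) (r : ℕ) (opt : Objective) {n : ℕ} (G : Digraph (Fin n))
    (s : WordRAM.Store) : Prop :=
  (s.var 0 = 1 ∧ opt.IsOptimum (P.DistDominates r G) (outputSet s)) ∨
    (s.var 0 = 0 ∧ ¬ ∃ S : Set (Fin n), P.DistDominates r G S)

/-- The answer is right: either variable `0` is `1` and the array `0` holds a distance-`r`
`D`-partition, or variable `0` is `0` and there is no such partition. -/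
def ConstraintMatrix.CorrectAnswer {q : ℕ} (D : ConstraintMatrix q) (r : ℕ) {n : ℕ}
    (G : Digraph (Fin n)) (s : WordRAM.Store) : Prop :=
  (s.var 0 = 1 ∧ D.IsDistPartition r G (outputPartition s)) ∨
    (s.var 0 = 0 ∧ ¬ ∃ X : Fin q → Set (Fin n), D.IsDistPartition r G X)

/-!
Both problems ask for a colouring of the vertices in which the number of vertices of each colour in
the out-ball and in the in-ball of a vertex `v` lies in a set that depends on the colour of `v`
(`CountingProblem`; a set of vertices is a colouring with two colours, of which one is counted and one
costs). A finite or co-finite set with parameter at most `d` only sees the minimum of `d` and a number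
(`FiniteOrCofinite.min_mem_iff`). So all that a partial colouring of a vertex set `S` tells the rest of
the digraph is its signature: for each vertex outside `S`, each counter and each of the two directions
the count, capped at `d` (`Prob.sig`).

The algorithm is dynamic programming over the tree, rooted at the leaf of the vertex `0`. Below every
node lies a vertex set `S`. The table of the node has an entry for each signature of `S` and each
signature of the complement of `S`; it holds a cheapest colouring of `S` that has the former signature
and is correct on `S` when the complement contributes the latter (`Prob.IsBest`). At a node with
children `a` and `b`, signatures `i` of `a`, `j` of `b` and `k` of the complement of their union
determine the remaining ones: `i` and `j` that of the union, `j` and `k` that of the complement of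
`a`, `i` and `k` that of the complement of `b` (`Prob.IsCombination`). Hence a join takes time `M ^ 3`
times the length of a signature, where `M` bounds the number of signatures of a vertex set of the
decomposition (`wp_joinStep`), and `wp_main` collects the running time of everything.

The exponent of the bound comes from the number of signatures. Consider one counter and one direction,
and a multiset of vertices of `S` from which no element can be dropped without changing the capped
counts. Then each element is counted at some vertex outside `S` at which at most `d` elements are
counted. In a minimal set of such vertices that serves all the elements, each has a private element, and
these pairs form an induced matching between `S` and its complement in the relation `dist ≤ r`; so the
multiset has at most `d` times as many elements as such a matching (`MatchingBound.exists_small`). A path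
of length at most `r` across the cut crosses it at one of `r` steps, and for the pairs whose paths cross
it at the same step the crossing edges form an induced matching in the digraph. So the induced matchings
of this relation are at most `r` times as large as those of the digraph (`Digraph.matchingBound_within`).
With `c` counters and bi-mim-width `w` there are therefore at most `n ^ (c * d * r * w)` signatures
(`IsPartialList.le_pow`). They are listed without knowing `w`: adding single coloured vertices to the
signatures that are already in the list reaches all of them (`wp_enumerate`).

The bound needs `d`, `r` and `w` to be positive. If `d = 0`, no count matters; if `r = 0` or all edges
are loops, every ball is a single vertex. In these cases all vertices may get the same colour
(`wp_uniform`). An edge that is not a loop forces `w ≥ 1` (`BranchDecomposition.one_le_bimimWidth`).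

The programs are verified with a weakest precondition `wp B p s Q` on the final time and store. Runs
keep all cells of the memory below the word size (`Run.bdd`), so that only the sums, the products and
the constants of a program have to be checked (`Expr.Ok`); the conditions on the word size are in
`Bounds`.
-/

/-! ### Weakest preconditions for the word RAM -/

namespace WordRAM

instance (k : ℕ) : OfNat Expr k := ⟨Expr.const k⟩
instance : Add Expr := ⟨Expr.add⟩
instance : Sub Expr := ⟨Expr.sub⟩
instance : Mul Expr := ⟨Expr.mul⟩
instance : Div Expr := ⟨Expr.div⟩

@[simp] theorem eval_zero (s : Store) : Expr.eval s 0 = 0 := rfl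
@[simp] theorem eval_one (s : Store) : Expr.eval s 1 = 1 := rfl
@[simp] theorem eval_two (s : Store) : Expr.eval s 2 = 2 := rfl
@[simp] theorem eval_const (s : Store) (k : ℕ) : (Expr.const k).eval s = k := rfl
@[simp] theorem eval_var (s : Store) (x : ℕ) : (Expr.var x).eval s = s.var x := rfl
@[simp] theorem eval_get (s : Store) (a : ℕ) (i : Expr) :
    (Expr.get a i).eval s = s.arr a (i.eval s) := rfl
@[simp] theorem eval_add (s : Store) (e f : Expr) : (e + f).eval s = e.eval s + f.eval s := rfl
@[simp] theorem eval_sub (s : Store) (e f : Expr) : (e - f).eval s = e.eval s - f.eval s := rfl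
@[simp] theorem eval_mul (s : Store) (e f : Expr) : (e * f).eval s = e.eval s * f.eval s := rfl
@[simp] theorem eval_div (s : Store) (e f : Expr) : (e / f).eval s = e.eval s / f.eval s := rfl

@[simp] theorem cost_zero : Expr.cost 0 = 1 := rfl
@[simp] theorem cost_one : Expr.cost 1 = 1 := rfl
@[simp] theorem cost_two : Expr.cost 2 = 1 := rfl
@[simp] theorem cost_const (k : ℕ) : (Expr.const k).cost = 1 := rfl
@[simp] theorem cost_var (x : ℕ) : (Expr.var x).cost = 1 := rfl
@[simp] theorem cost_get (a : ℕ) (i : Expr) : (Expr.get a i).cost = i.cost + 1 := rfl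
@[simp] theorem cost_add (e f : Expr) : (e + f).cost = e.cost + f.cost + 1 := rfl
@[simp] theorem cost_sub (e f : Expr) : (e - f).cost = e.cost + f.cost + 1 := rfl
@[simp] theorem cost_mul (e f : Expr) : (e * f).cost = e.cost + f.cost + 1 := rfl
@[simp] theorem cost_div (e f : Expr) : (e / f).cost = e.cost + f.cost + 1 := rfl

/-- Every cell of the memory holds a word. Runs preserve this, so that only the constants, the sums
and the products that a program forms have to be checked against the word size. -/
def Bdd (B : ℕ) (s : Store) : Prop := (∀ x, s.var x ≤ B) ∧ ∀ a i, s.arr a i ≤ B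

/-- The part of `Expr.Fits` that is not implied by `Bdd`. -/
def Expr.Ok (B : ℕ) (s : Store) : Expr → Prop
  | const k => k ≤ B
  | var _ => True
  | get _ i => i.Ok B s
  | add e₁ e₂ => e₁.Ok B s ∧ e₂.Ok B s ∧ e₁.eval s + e₂.eval s ≤ B
  | sub e₁ e₂ => e₁.Ok B s ∧ e₂.Ok B s
  | mul e₁ e₂ => e₁.Ok B s ∧ e₂.Ok B s ∧ e₁.eval s * e₂.eval s ≤ B
  | div e₁ e₂ => e₁.Ok B s ∧ e₂.Ok B s

section Ok
variable (B : ℕ) (s : Store)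

@[simp] theorem ok_zero : Expr.Ok B s 0 ↔ True := iff_true_intro (Nat.zero_le _)
@[simp] theorem ok_one : Expr.Ok B s 1 ↔ 1 ≤ B := Iff.rfl
@[simp] theorem ok_two : Expr.Ok B s 2 ↔ 2 ≤ B := Iff.rfl
@[simp] theorem ok_const (k : ℕ) : (Expr.const k).Ok B s ↔ k ≤ B := Iff.rfl
@[simp] theorem ok_var (x : ℕ) : (Expr.var x).Ok B s ↔ True := Iff.rfl
@[simp] theorem ok_get (a : ℕ) (i : Expr) : (Expr.get a i).Ok B s ↔ i.Ok B s := Iff.rfl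
@[simp] theorem ok_add (e f : Expr) :
    (e + f).Ok B s ↔ e.Ok B s ∧ f.Ok B s ∧ e.eval s + f.eval s ≤ B := Iff.rfl
@[simp] theorem ok_sub (e f : Expr) : (e - f).Ok B s ↔ e.Ok B s ∧ f.Ok B s := Iff.rfl
@[simp] theorem ok_mul (e f : Expr) :
    (e * f).Ok B s ↔ e.Ok B s ∧ f.Ok B s ∧ e.eval s * f.eval s ≤ B := Iff.rfl
@[simp] theorem ok_div (e f : Expr) : (e / f).Ok B s ↔ e.Ok B s ∧ f.Ok B s := Iff.rfl

end Ok

variable {B : ℕ} {s s' : Store}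

theorem Expr.Fits.eval_le {e : Expr} (h : e.Fits B s) : e.eval s ≤ B := by
  induction e with
  | const k => exact h
  | var x => exact h
  | get a i ih => exact h.2
  | add e f ihe ihf => exact h.2.2
  | sub e f ihe ihf => exact (Nat.sub_le _ _).trans (ihe h.1)
  | mul e f ihe ihf => exact h.2.2
  | div e f ihe ihf => exact (Nat.div_le_self _ _).trans (ihe h.1)

theorem Expr.Ok.fits {e : Expr} (h : e.Ok B s) (hs : Bdd B s) : e.Fits B s := by
  induction e with
  | const k => exact h
  | var x => exact hs.1 x
  | get a i ih => exact ⟨ih h, hs.2 _ _⟩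
  | add e f ihe ihf => exact ⟨ihe h.1, ihf h.2.1, h.2.2⟩
  | sub e f ihe ihf => exact ⟨ihe h.1, ihf h.2⟩
  | mul e f ihe ihf => exact ⟨ihe h.1, ihf h.2.1, h.2.2⟩
  | div e f ihe ihf => exact ⟨ihe h.1, ihf h.2⟩

theorem Expr.Ok.eval_le {e : Expr} (h : e.Ok B s) (hs : Bdd B s) : e.eval s ≤ B :=
  (h.fits hs).eval_le

@[simp] theorem setVar_var (s : Store) (x k y : ℕ) :
    (s.setVar x k).var y = if y = x then k else s.var y := by
  simp [Store.setVar, Function.update_apply]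

@[simp] theorem setVar_arr (s : Store) (x k : ℕ) : (s.setVar x k).arr = s.arr := rfl

@[simp] theorem setArr_var (s : Store) (a i k : ℕ) : (s.setArr a i k).var = s.var := rfl

@[simp] theorem setArr_arr (s : Store) (a i k b j : ℕ) :
    (s.setArr a i k).arr b j = if b = a ∧ j = i then k else s.arr b j := by
  by_cases h : b = a
  · subst h; by_cases h' : j = i <;> simp [Store.setArr, h']
  · simp [Store.setArr, h]

theorem Bdd.setVar (hs : Bdd B s) {x k : ℕ} (hk : k ≤ B) : Bdd B (s.setVar x k) :=
  ⟨fun y => by rw [setVar_var]; split <;> [exact hk; exact hs.1 y], hs.2⟩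

theorem Bdd.setArr (hs : Bdd B s) {a i k : ℕ} (hk : k ≤ B) : Bdd B (s.setArr a i k) :=
  ⟨hs.1, fun b j => by rw [setArr_arr]; split <;> [exact hk; exact hs.2 b j]⟩

theorem Run.bdd {p : Program} {t : ℕ} (h : Run B p s t s') : Bdd B s → Bdd B s' := by
  induction h with
  | skip s => exact id
  | assign s x e he => exact fun hs => hs.setVar he.eval_le
  | store s a i e hi he => exact fun hs => hs.setArr he.eval_le
  | seq _ _ ih₁ ih₂ => exact fun hs => ih₂ (ih₁ hs)
  | ite_true _ _ _ ih => exact ih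
  | ite_false _ _ _ ih => exact ih
  | while_true _ _ _ _ ih₁ ih₂ => exact fun hs => ih₂ (ih₁ hs)
  | while_false _ _ => exact id

/-- Whether a program contains an assignment to the variable `x`. -/
def Program.writesVar (x : ℕ) : Program → Bool
  | .skip => false
  | .assign y _ => x == y
  | .store _ _ _ => false
  | .seq p₁ p₂ => p₁.writesVar x || p₂.writesVar x
  | .ite _ p₁ p₂ => p₁.writesVar x || p₂.writesVar x
  | .while _ p => p.writesVar x

/-- Whether a program contains an assignment to a cell of the array `a`. -/
def Program.writesArr (a : ℕ) : Program → Bool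
  | .skip => false
  | .assign _ _ => false
  | .store b _ _ => a == b
  | .seq p₁ p₂ => p₁.writesArr a || p₂.writesArr a
  | .ite _ p₁ p₂ => p₁.writesArr a || p₂.writesArr a
  | .while _ p => p.writesArr a

/-- The two memories agree on everything that `p` does not write. -/
structure Frame (p : Program) (s s' : Store) : Prop where
  var : ∀ x, p.writesVar x = false → s'.var x = s.var x
  arr : ∀ a, p.writesArr a = false → s'.arr a = s.arr a

theorem Run.frame {p : Program} {t : ℕ} (h : Run B p s t s') : Frame p s s' := by
  induction h with
  | skip s => exact ⟨fun _ _ => rfl, fun _ _ => rfl⟩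
  | assign s x e he =>
    refine ⟨fun y hy => ?_, fun _ _ => rfl⟩
    have : y ≠ x := by simpa [Program.writesVar] using hy
    simp [this]
  | store s a i e hi he =>
    refine ⟨fun _ _ => rfl, fun b hb => funext fun j => ?_⟩
    have : b ≠ a := by simpa [Program.writesArr] using hb
    simp [this]
  | seq _ _ ih₁ ih₂ =>
    refine ⟨fun y hy => ?_, fun b hb => ?_⟩
    · simp only [Program.writesVar, Bool.or_eq_false_iff] at hy
      rw [ih₂.var y hy.2, ih₁.var y hy.1]
    · simp only [Program.writesArr, Bool.or_eq_false_iff] at hb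
      rw [ih₂.arr b hb.2, ih₁.arr b hb.1]
  | ite_true _ _ _ ih =>
    refine ⟨fun y hy => ?_, fun b hb => ?_⟩
    · simp only [Program.writesVar, Bool.or_eq_false_iff] at hy
      exact ih.var y hy.1
    · simp only [Program.writesArr, Bool.or_eq_false_iff] at hb
      exact ih.arr b hb.1
  | ite_false _ _ _ ih =>
    refine ⟨fun y hy => ?_, fun b hb => ?_⟩
    · simp only [Program.writesVar, Bool.or_eq_false_iff] at hy
      exact ih.var y hy.2
    · simp only [Program.writesArr, Bool.or_eq_false_iff] at hb
      exact ih.arr b hb.2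
  | while_true _ _ _ _ ih₁ ih₂ =>
    exact ⟨fun y hy => by rw [ih₂.var y hy, ih₁.var y hy],
      fun b hb => by rw [ih₂.arr b hb, ih₁.arr b hb]⟩
  | while_false _ _ => exact ⟨fun _ _ => rfl, fun _ _ => rfl⟩

/-- `wp B p s Q`: if the memory `s` holds words only, then `p` halts, after a time `t` and with a
memory `s'` such that `Q t s'`. -/
def wp (B : ℕ) (p : Program) (s : Store) (Q : ℕ → Store → Prop) : Prop :=
  Bdd B s → ∃ t s', Run B p s t s' ∧ Q t s'

variable {p p₁ p₂ : Program} {Q Q' : ℕ → Store → Prop}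

theorem wp_mono (h : wp B p s Q)
    (hQ : ∀ t s', Bdd B s' → Frame p s s' → Q t s' → Q' t s') : wp B p s Q' := fun hs => by
  obtain ⟨t, s', hr, hq⟩ := h hs
  exact ⟨t, s', hr, hQ t s' (hr.bdd hs) hr.frame hq⟩

theorem wp_bdd (h : Bdd B s → wp B p s Q) : wp B p s Q := fun hs => h hs hs

theorem wp_skip (h : Q 1 s) : wp B .skip s Q := fun _ => ⟨1, s, .skip s, h⟩

theorem wp_assign {x : ℕ} {e : Expr} (he : e.Ok B s)
    (h : Q (e.cost + 1) (s.setVar x (e.eval s))) : wp B (.assign x e) s Q := fun hs =>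
  ⟨_, _, .assign s x e (he.fits hs), h⟩

theorem wp_store {a : ℕ} {i e : Expr} (hi : i.Ok B s) (he : e.Ok B s)
    (h : Q (i.cost + e.cost + 1) (s.setArr a (i.eval s) (e.eval s))) :
    wp B (.store a i e) s Q := fun hs =>
  ⟨_, _, .store s a i e (hi.fits hs) (he.fits hs), h⟩

theorem wp_seq (h : wp B p₁ s fun t₁ s₁ => wp B p₂ s₁ fun t₂ s₂ => Q (t₁ + t₂) s₂) :
    wp B (.seq p₁ p₂) s Q := fun hs => by
  obtain ⟨t₁, s₁, hr₁, h₁⟩ := h hs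
  obtain ⟨t₂, s₂, hr₂, h₂⟩ := h₁ (hr₁.bdd hs)
  exact ⟨_, _, .seq hr₁ hr₂, h₂⟩

theorem wp_assign_seq {x : ℕ} {e : Expr} (he : e.Ok B s)
    (h : wp B p (s.setVar x (e.eval s)) fun t s' => Q (e.cost + 1 + t) s') :
    wp B (.seq (.assign x e) p) s Q := wp_seq (wp_assign he h)

theorem wp_store_seq {a : ℕ} {i e : Expr} (hi : i.Ok B s) (he : e.Ok B s)
    (h : wp B p (s.setArr a (i.eval s) (e.eval s)) fun t s' => Q (i.cost + e.cost + 1 + t) s') :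
    wp B (.seq (.store a i e) p) s Q := wp_seq (wp_store hi he h)

/-- Sequential composition after a block with a known specification. -/
theorem wp_call_seq {Q₁ : ℕ → Store → Prop} (h₁ : wp B p₁ s Q₁)
    (h : ∀ t₁ s₁, Bdd B s₁ → Frame p₁ s s₁ → Q₁ t₁ s₁ →
      wp B p₂ s₁ fun t₂ s₂ => Q (t₁ + t₂) s₂) :
    wp B (.seq p₁ p₂) s Q := wp_seq (wp_mono h₁ h)

theorem wp_ite {e : Expr} (he : e.Ok B s)
    (h₁ : e.eval s ≠ 0 → wp B p₁ s fun t s' => Q (e.cost + 1 + t) s')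
    (h₂ : e.eval s = 0 → wp B p₂ s fun t s' => Q (e.cost + 1 + t) s') :
    wp B (.ite e p₁ p₂) s Q := fun hs => by
  by_cases h : e.eval s = 0
  · obtain ⟨t, s', hr, hq⟩ := h₂ h hs
    exact ⟨_, _, .ite_false (he.fits hs) h hr, hq⟩
  · obtain ⟨t, s', hr, hq⟩ := h₁ h hs
    exact ⟨_, _, .ite_true (he.fits hs) h hr, hq⟩

/-- The rule for loops with at most `K` iterations; `I k` is the invariant after `k` iterations. -/
theorem wp_while {e : Expr} (K T : ℕ) (I : ℕ → Store → Prop) (h0 : I 0 s)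
    (hok : ∀ k s', Bdd B s' → Frame p s s' → I k s' → e.Ok B s')
    (hlt : ∀ k s', Bdd B s' → Frame p s s' → I k s' → e.eval s' ≠ 0 → k < K)
    (hs : ∀ k s', Bdd B s' → Frame p s s' → I k s' → e.eval s' ≠ 0 →
      wp B p s' fun t s'' => t ≤ T ∧ I (k + 1) s'')
    (hQ : ∀ t k s', t ≤ K * (e.cost + 1 + T) + e.cost + 1 → Bdd B s' → Frame p s s' → I k s' →
      e.eval s' = 0 → Q t s') : wp B (.while e p) s Q := by
  have key : ∀ j k s', k + j = K + 1 → Bdd B s' → Frame p s s' → I k s' →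
      ∃ t s'', Run B (.while e p) s' t s'' ∧ t ≤ (K - k) * (e.cost + 1 + T) + e.cost + 1 ∧
        Bdd B s'' ∧ Frame p s s'' ∧ ∃ k', I k' s'' ∧ e.eval s'' = 0 := by
    intro j
    induction j with
    | zero =>
      intro k s' hk hb hf hI
      by_cases h : e.eval s' = 0
      · exact ⟨_, _, .while_false ((hok k s' hb hf hI).fits hb) h, by omega, hb, hf, k, hI, h⟩
      · have := hlt k s' hb hf hI h
        omega
    | succ j ih =>
      intro k s' hk hb hf hI
      by_cases h : e.eval s' = 0
      · exact ⟨_, _, .while_false ((hok k s' hb hf hI).fits hb) h, by omega, hb, hf, k, hI, h⟩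
      · have hkK := hlt k s' hb hf hI h
        obtain ⟨t₁, s₁, hr₁, ht₁, hI₁⟩ := hs k s' hb hf hI h hb
        have hf₁ : Frame p s s₁ :=
          ⟨fun y hy => by rw [hr₁.frame.var y hy, hf.var y hy],
            fun b hy => by rw [hr₁.frame.arr b hy, hf.arr b hy]⟩
        obtain ⟨t₂, s₂, hr₂, ht₂, hb₂, hf₂, k', hI₂, h₂⟩ :=
          ih (k + 1) s₁ (by omega) (hr₁.bdd hb) hf₁ hI₁
        refine ⟨_, _, .while_true ((hok k s' hb hf hI).fits hb) h hr₁ hr₂, ?_, hb₂, hf₂, k', hI₂, h₂⟩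
        obtain ⟨u, hu⟩ : ∃ u, K - k = u + 1 := ⟨K - k - 1, by omega⟩
        have hu' : K - (k + 1) = u := by omega
        rw [hu'] at ht₂
        rw [hu, Nat.succ_mul]
        omega
  intro hb
  obtain ⟨t, s'', hr, ht, hb', hf, k', hI, h⟩ :=
    key (K + 1) 0 s (by omega) hb ⟨fun _ _ => rfl, fun _ _ => rfl⟩ h0
  exact ⟨t, s'', hr, hQ t k' s'' (by simpa using ht) hb' hf hI h⟩

/-- `for x < y do p`, where `y` is a variable that `p` does not change. -/
def Program.forLt (x y : ℕ) (p : Program) : Program :=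
  .seq (.assign x 0) (.while (.var y - .var x) (.seq p (.assign x (.var x + 1))))

/-- The rule for counting loops. The invariant may not depend on the counter `x`, which is known to
hold the number of finished iterations. -/
theorem wp_forLt {x y : ℕ} (I : ℕ → Store → Prop) (T : ℕ)
    (hpx : p.writesVar x = false) (hpy : p.writesVar y = false) (hyx : (y == x) = false)
    (h0 : I 0 (s.setVar x 0))
    (hs : ∀ k s', k < s.var y → Bdd B s' → Frame (.forLt x y p) s s' → s'.var x = k →
      I k s' → wp B p s' fun t s'' => t ≤ T ∧ I (k + 1) (s''.setVar x (k + 1)))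
    (hQ : ∀ t s', t ≤ s.var y * (T + 8) + 6 → Bdd B s' → Frame (.forLt x y p) s s' →
      s'.var x = s.var y → I (s.var y) s' → Q t s') : wp B (.forLt x y p) s Q := by
  have hyx' : y ≠ x := by simpa using hyx
  refine wp_bdd fun hb => wp_assign_seq (Nat.zero_le _) ?_
  set s₀ := s.setVar x (Expr.eval s 0) with hs₀
  have hs₀y : s₀.var y = s.var y := by simp [hs₀, hyx']
  have hfr : ∀ s', Frame (.seq p (.assign x (.var x + 1))) s₀ s' →
      Frame (.forLt x y p) s s' := by
    intro s' hf
    constructor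
    · intro z hz
      simp only [Program.forLt, Program.writesVar, Bool.or_eq_false_iff] at hz
      rw [hf.var z (by simp [Program.writesVar, hz])]
      have : z ≠ x := by simpa using hz.1
      simp [hs₀, this]
    · intro a ha
      simp only [Program.forLt, Program.writesArr, Bool.or_eq_false_iff] at ha
      rw [hf.arr a (by simp [Program.writesArr, ha])]
      rfl
  have hvy : ∀ s', Frame (.seq p (.assign x (.var x + 1))) s₀ s' → s'.var y = s.var y := by
    intro s' hf
    rw [hf.var y (by simp [Program.writesVar, hpy, hyx']), hs₀y]
  refine wp_while (s.var y) (T + 4) (fun k s' => I k s' ∧ s'.var x = k ∧ k ≤ s.var y)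
    ⟨h0, by simp [hs₀], Nat.zero_le _⟩ ?_ ?_ ?_ ?_
  · intro k s' _ _ _
    simp
  · rintro k s' _ hf ⟨_, hx, _⟩ h
    simp only [eval_sub, eval_var, hvy s' hf, hx] at h
    omega
  · rintro k s' hb' hf ⟨hI, hx, hk⟩ h
    have hlt : k < s.var y := by
      simp only [eval_sub, eval_var, hvy s' hf, hx] at h
      omega
    refine wp_call_seq (hs k s' hlt hb' (hfr s' hf) hx hI) ?_
    rintro t₁ s₁ hb₁ hf₁ ⟨ht₁, hI₁⟩
    have hx₁ : s₁.var x = k := by rw [hf₁.var x hpx, hx]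
    have : k + 1 ≤ B := by
      have := hb.1 y
      omega
    refine wp_assign (by simp [hx₁]; omega) ?_
    simp only [eval_add, eval_var, eval_one, hx₁, cost_add, cost_var, cost_one]
    exact ⟨by omega, hI₁, by simp, hlt⟩
  · rintro t k s' ht hb' hf ⟨hI, hx, hk⟩ h
    have hkK : k = s.var y := by
      simp only [eval_sub, eval_var, hvy s' hf, hx] at h
      omega
    subst hkK
    refine hQ _ s' ?_ hb' (hfr s' hf) hx hI
    simp only [cost_sub, cost_var, cost_zero] at ht ⊢
    have e : s.var y * (1 + 1 + 1 + 1 + (T + 4)) = s.var y * (T + 8) := by ring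
    rw [e] at ht
    omega

/-- The time of a counting loop, coarsely. -/
theorem loop_time {K K' a T X t : ℕ} (ht : t ≤ K * (T + 8) + 6) (hT : T ≤ a * X) (hX : 1 ≤ X)
    (hK : K ≤ K') (hK' : 1 ≤ K') : t ≤ (a + 14) * (K' * X) := by
  have h1 : K * (T + 8) ≤ K' * (a * X + 8 * X) := Nat.mul_le_mul hK (by omega)
  have h2 : 1 ≤ K' * X := Nat.mul_pos hK' hX
  calc t ≤ K' * (a * X + 8 * X) + 6 * (K' * X) := by omega
    _ = (a + 14) * (K' * X) := by ring

/-- The expression whose value is `1` if the two values are equal and `0` otherwise. -/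
def Expr.eqE (e f : Expr) : Expr := 1 - ((e - f) + (f - e))

@[simp] theorem eval_eqE (s : Store) (e f : Expr) :
    (Expr.eqE e f).eval s = if e.eval s = f.eval s then 1 else 0 := by
  simp only [Expr.eqE, eval_sub, eval_one, eval_add]
  split <;> omega

@[simp] theorem cost_eqE (e f : Expr) : (Expr.eqE e f).cost = 2 * e.cost + 2 * f.cost + 5 := by
  simp only [Expr.eqE, cost_sub, cost_one, cost_add]
  omega

theorem ok_eqE {e f : Expr} (hs : Bdd B s) (hB : 1 ≤ B) (he : e.Ok B s) (hf : f.Ok B s) :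
    (Expr.eqE e f).Ok B s := by
  have := he.eval_le hs
  have := hf.eval_le hs
  simp only [Expr.eqE, ok_sub, ok_one, ok_add, eval_sub, he, hf, hB, true_and]
  omega

end WordRAM

/-! ### Signatures of partial colourings and the dynamic programming tables -/

/-- A colouring problem on the vertices `0, …, n - 1` in the form in which the machine solves it.
The colours are `0, …, q - 1`; the vertices of colour `j + off` are counted in the `j`-th counter,
`j < c`; counts are capped at `d`. The `0`-`1`-matrix `h` says which vertices lie in which out-balls,
the table `ok` which capped counts are allowed at a vertex of a given colour, and `wt` is the cost of
a colour. -/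
structure Prob where
  n : ℕ
  c : ℕ
  q : ℕ
  off : ℕ
  d : ℕ
  h : ℕ → ℕ
  ok : ℕ → ℕ
  wt : ℕ → ℕ

namespace Prob

variable (P : Prob)

/-- The number of positions of a signature: one for each counter, each of the two directions (even:
out-ball, odd: in-ball), and each vertex. Position `(2 * j + dir) * n + w` counts in the ball of `w`. -/
def R : ℕ := 2 * P.c * P.n

/-- The contribution of a vertex `u` of colour `col` to the position `p`. -/
def vecAt (col u p : ℕ) : ℕ :=
  if col = p / P.n / 2 + P.off then
    if p / P.n % 2 = 0 then P.h (p % P.n * P.n + u) else P.h (u * P.n + p % P.n)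
  else 0

/-- The uncapped counts of a multiset of coloured vertices `(col, u)`. -/
def total (l : Multiset (ℕ × ℕ)) (p : ℕ) : ℕ := (l.map fun x => P.vecAt x.1 x.2 p).sum

/-- The signature of a multiset of coloured vertices of `S`: the capped counts at the vertices outside
`S`. -/
def sig (S : Finset ℕ) (l : Multiset (ℕ × ℕ)) (p : ℕ) : ℕ :=
  if p % P.n ∈ S then 0 else min P.d (P.total l p)

/-- All members of `l` are coloured vertices of `S`. -/
def Adm (S : Finset ℕ) (l : Multiset (ℕ × ℕ)) : Prop := ∀ x ∈ l, x.1 < P.q ∧ x.2 ∈ S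

/-- The coloured vertices of `S`. -/
def coloured (S : Finset ℕ) (χ : ℕ → ℕ) : Multiset (ℕ × ℕ) := S.val.map fun u => (χ u, u)

/-- The rows `row 0, …, row (len - 1)` list the signatures on the side `S`, without repetition. -/
structure IsList (S : Finset ℕ) (len : ℕ) (row : ℕ → ℕ → ℕ) : Prop where
  inj : ∀ i < len, ∀ i' < len, (∀ p < P.R, row i p = row i' p) → i = i'
  sound : ∀ i < len, ∃ l, P.Adm S l ∧ ∀ p < P.R, row i p = P.sig S l p
  complete : ∀ l, P.Adm S l → ∃ i < len, ∀ p < P.R, row i p = P.sig S l p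

/-- The counts `f` are allowed at the vertex `v` of colour `col`. -/
def Allowed (col v : ℕ) (f : ℕ → ℕ) : Prop :=
  ∀ jj < 2 * P.c, P.ok ((col * (2 * P.c) + jj) * (P.d + 1) + min P.d (f (jj * P.n + v))) ≠ 0

/-- The colouring `χ` of `S` is correct at the vertices of `S` if the vertices outside `S` contribute
the counts `κ`. -/
def Valid (S : Finset ℕ) (χ κ : ℕ → ℕ) : Prop :=
  ∀ v ∈ S, P.Allowed (χ v) v fun p => P.total (coloured S χ) p + κ p

/-- The cost of a colouring of `S`. -/
def cost (S : Finset ℕ) (χ : ℕ → ℕ) : ℕ := ∑ u ∈ S, P.wt (χ u)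

/-- `sol` is a valid colouring of `S` with the signature `row`, where the vertices outside `S`
contribute the counts `κ`, and `val` is `1` more than its cost. It is `0` outside `S`, so that
solutions on disjoint sets can be added. -/
structure IsSol (S : Finset ℕ) (row κ : ℕ → ℕ) (val : ℕ) (sol : ℕ → ℕ) : Prop where
  lt : ∀ v ∈ S, sol v < P.q
  zero : ∀ v < P.n, v ∉ S → sol v = 0
  sig : ∀ p < P.R, P.sig S (coloured S sol) p = row p
  valid : P.Valid S sol κ
  val : val = P.cost S sol + 1

/-- The entry of a table for the signature `row` of `S` and the counts `κ` from outside is correct: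
`tv` is `0` if there is no valid colouring of `S` with this signature, and otherwise `1` more than the
minimum cost of such a colouring, which `sol` attains. -/
structure IsBest (S : Finset ℕ) (row κ : ℕ → ℕ) (tv : ℕ) (sol : ℕ → ℕ) : Prop where
  sound : tv ≠ 0 → P.IsSol S row κ tv sol
  complete : ∀ χ : ℕ → ℕ, (∀ v ∈ S, χ v < P.q) → (∀ p < P.R, P.sig S (coloured S χ) p = row p) →
    P.Valid S χ κ → tv ≠ 0 ∧ tv ≤ P.cost S χ + 1

/-- The table `tab` gives, for two rows of signatures, the row of the signature of the union. -/
def IsPairTable (S : Finset ℕ) (len₁ : ℕ) (row₁ : ℕ → ℕ → ℕ) (len₂ : ℕ) (row₂ : ℕ → ℕ → ℕ)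
    (len₃ : ℕ) (row₃ : ℕ → ℕ → ℕ) (tab : ℕ → ℕ → ℕ) : Prop :=
  ∀ i < len₁, ∀ j < len₂, tab i j < len₃ ∧ ∀ p < P.R,
    row₃ (tab i j) p = if p % P.n ∈ S then 0 else min P.d (row₁ i p + row₂ j p)

variable {P}

theorem total_add (l l' : Multiset (ℕ × ℕ)) (p : ℕ) :
    P.total (l + l') p = P.total l p + P.total l' p := by simp [total]

theorem total_cons (x : ℕ × ℕ) (l : Multiset (ℕ × ℕ)) (p : ℕ) :
    P.total (x ::ₘ l) p = P.vecAt x.1 x.2 p + P.total l p := by simp [total]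

theorem coloured_union {S T : Finset ℕ} (h : Disjoint S T) (χ : ℕ → ℕ) :
    coloured (S ∪ T) χ = coloured S χ + coloured T χ := by
  rw [← Finset.disjUnion_eq_union S T h]
  simp [coloured, Finset.disjUnion]

theorem coloured_congr {S : Finset ℕ} {χ χ' : ℕ → ℕ} (h : ∀ v ∈ S, χ v = χ' v) :
    coloured S χ = coloured S χ' :=
  Multiset.map_congr rfl fun v hv => by rw [h v hv]

theorem adm_coloured {S : Finset ℕ} {χ : ℕ → ℕ} (h : ∀ v ∈ S, χ v < P.q) :
    P.Adm S (coloured S χ) := by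
  intro x hx
  obtain ⟨u, hu, rfl⟩ := Multiset.mem_map.1 hx
  exact ⟨h u hu, hu⟩

theorem Adm.add {S T U : Finset ℕ} {l l' : Multiset (ℕ × ℕ)} (h : P.Adm S l) (h' : P.Adm T l')
    (hS : S ⊆ U) (hT : T ⊆ U) : P.Adm U (l + l') := by
  intro x hx
  rcases Multiset.mem_add.1 hx with hx | hx
  · exact ⟨(h x hx).1, hS (h x hx).2⟩
  · exact ⟨(h' x hx).1, hT (h' x hx).2⟩

theorem sig_add {S T U : Finset ℕ} (hS : S ⊆ U) (hT : T ⊆ U) (l l' : Multiset (ℕ × ℕ)) (p : ℕ) :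
    P.sig U (l + l') p = if p % P.n ∈ U then 0 else min P.d (P.sig S l p + P.sig T l' p) := by
  unfold sig
  split_ifs with h h₁ h₂ h₂
  · rfl
  · exact absurd (hS h₁) h
  · exact absurd (hS h₁) h
  · exact absurd (hT h₂) h
  · rw [total_add]; omega

theorem IsList.exists_pair {S T : Finset ℕ} {U : Finset ℕ} {len₁ len₂ len₃ : ℕ}
    {row₁ row₂ row₃ : ℕ → ℕ → ℕ} (h₁ : P.IsList S len₁ row₁) (h₂ : P.IsList T len₂ row₂)
    (h₃ : P.IsList U len₃ row₃) (hS : S ⊆ U) (hT : T ⊆ U) {i j : ℕ} (hi : i < len₁)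
    (hj : j < len₂) : ∃ k < len₃, ∀ p < P.R,
      row₃ k p = if p % P.n ∈ U then 0 else min P.d (row₁ i p + row₂ j p) := by
  obtain ⟨l, hl, hl'⟩ := h₁.sound i hi
  obtain ⟨l₂, hl₂, hl₂'⟩ := h₂.sound j hj
  obtain ⟨k, hk, hk'⟩ := h₃.complete _ (hl.add hl₂ hS hT)
  exact ⟨k, hk, fun p hp => by rw [hk' p hp, sig_add hS hT, hl' p hp, hl₂' p hp]⟩

theorem pos_lt {jj v : ℕ} (hjj : jj < 2 * P.c) (hv : v < P.n) : jj * P.n + v < P.R := by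
  unfold R
  calc jj * P.n + v < (jj + 1) * P.n := by linarith [Nat.succ_mul jj P.n]
    _ ≤ _ := Nat.mul_le_mul_right _ hjj

theorem pos_mod {jj v : ℕ} (hv : v < P.n) : (jj * P.n + v) % P.n = v := by
  rw [Nat.add_comm, Nat.add_mul_mod_self_right, Nat.mod_eq_of_lt hv]

theorem pos_div {jj v : ℕ} (hv : v < P.n) : (jj * P.n + v) / P.n = jj := by
  rw [Nat.add_comm, Nat.add_mul_div_right _ _ (by omega), Nat.div_eq_of_lt hv, zero_add]

theorem allowed_congr {col v : ℕ} {f g : ℕ → ℕ}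
    (h : ∀ jj < 2 * P.c, min P.d (f (jj * P.n + v)) = min P.d (g (jj * P.n + v))) :
    P.Allowed col v f ↔ P.Allowed col v g :=
  forall₂_congr fun jj hjj => by rw [h jj hjj]

/-- Whether a colouring of `S ∪ T` is correct at a vertex of `S` can be decided from its part on `S`
and the signature of its part on `T`. -/
theorem allowed_union {S T U : Finset ℕ} (hST : Disjoint S T) {χ κ κ' rowT : ℕ → ℕ}
    (hT : ∀ p < P.R, P.sig T (coloured T χ) p = rowT p) (hU : Disjoint S U)
    (hκ : ∀ p < P.R, κ' p = if p % P.n ∈ U then 0 else min P.d (rowT p + κ p)) {v : ℕ} (hv : v ∈ S)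
    (hvn : v < P.n) :
    (P.Allowed (χ v) v fun p => P.total (coloured (S ∪ T) χ) p + κ p) ↔
      P.Allowed (χ v) v fun p => P.total (coloured S χ) p + κ' p := by
  refine allowed_congr fun jj hjj => ?_
  have hp := pos_lt hjj hvn
  have hmT : (jj * P.n + v) % P.n ∉ T := by
    rw [pos_mod hvn]; exact Finset.disjoint_left.1 hST hv
  have hmU : (jj * P.n + v) % P.n ∉ U := by
    rw [pos_mod hvn]; exact Finset.disjoint_left.1 hU hv
  rw [coloured_union hST, total_add, hκ _ hp, ← hT _ hp, sig, if_neg hmT, if_neg hmU]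
  omega

theorem cost_union {S T : Finset ℕ} (hST : Disjoint S T) (χ : ℕ → ℕ) :
    P.cost (S ∪ T) χ = P.cost S χ + P.cost T χ := Finset.sum_union hST

theorem cost_congr {S : Finset ℕ} {χ χ' : ℕ → ℕ} (h : ∀ v ∈ S, χ v = χ' v) :
    P.cost S χ = P.cost S χ' := Finset.sum_congr rfl fun v hv => by rw [h v hv]

section Join

variable {S T : Finset ℕ} {rowS rowT rowU κ κS κT : ℕ → ℕ}

/-- The data of one combination in a join: `rowU`, `κS` and `κT` are the signatures of the union of
the parts on `S` and `T`, on `T` and outside, and on `S` and outside. -/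
structure IsCombination (P : Prob) (S T : Finset ℕ) (rowS rowT rowU κ κS κT : ℕ → ℕ) : Prop where
  union : ∀ p < P.R, rowU p = if p % P.n ∈ S ∪ T then 0 else min P.d (rowS p + rowT p)
  left : ∀ p < P.R, κS p = if p % P.n ∈ Finset.range P.n \ S then 0 else min P.d (rowT p + κ p)
  right : ∀ p < P.R, κT p = if p % P.n ∈ Finset.range P.n \ T then 0 else min P.d (rowS p + κ p)

theorem IsCombination.valid_iff (hc : IsCombination P S T rowS rowT rowU κ κS κT)
    (hST : Disjoint S T) (hS : ∀ v ∈ S, v < P.n) (hT : ∀ v ∈ T, v < P.n) {χ : ℕ → ℕ}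
    (h₁ : ∀ p < P.R, P.sig S (coloured S χ) p = rowS p)
    (h₂ : ∀ p < P.R, P.sig T (coloured T χ) p = rowT p) :
    P.Valid (S ∪ T) χ κ ↔ P.Valid S χ κS ∧ P.Valid T χ κT := by
  have e₁ : ∀ v ∈ S, _ := fun v hv =>
    allowed_union hST h₂ Finset.disjoint_sdiff hc.left hv (hS v hv)
  have e₂ : ∀ v ∈ T, _ := fun v hv =>
    allowed_union hST.symm h₁ Finset.disjoint_sdiff hc.right hv (hT v hv)
  rw [Finset.union_comm] at e₂
  constructor
  · exact fun h => ⟨fun v hv => (e₁ v hv).1 (h v (Finset.mem_union_left _ hv)),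
      fun v hv => (e₂ v hv).1 (h v (Finset.mem_union_right _ hv))⟩
  · rintro ⟨h, h'⟩ v hv
    rcases Finset.mem_union.1 hv with hv | hv
    · exact (e₁ v hv).2 (h v hv)
    · exact (e₂ v hv).2 (h' v hv)

/-- Two solutions for the parts combine to one for the union. -/
theorem IsCombination.sound (hc : IsCombination P S T rowS rowT rowU κ κS κT)
    (hST : Disjoint S T) (hS : ∀ v ∈ S, v < P.n) (hT : ∀ v ∈ T, v < P.n) {a b : ℕ}
    {χ ψ : ℕ → ℕ} (ha : P.IsBest S rowS κS a χ) (hb : P.IsBest T rowT κT b ψ) (ha0 : a ≠ 0)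
    (hb0 : b ≠ 0) {sol : ℕ → ℕ} (hsol : ∀ v < P.n, sol v = χ v + ψ v) :
    P.IsSol (S ∪ T) rowU κ (a + b - 1) sol := by
  obtain ⟨a₁, a₂, a₃, a₄, a₅⟩ := ha.sound ha0
  obtain ⟨b₁, b₂, b₃, b₄, b₅⟩ := hb.sound hb0
  have eS : ∀ v ∈ S, sol v = χ v := fun v hv => by
    rw [hsol v (hS v hv), b₂ v (hS v hv) (Finset.disjoint_left.1 hST hv), add_zero]
  have eT : ∀ v ∈ T, sol v = ψ v := fun v hv => by
    rw [hsol v (hT v hv), a₂ v (hT v hv) (Finset.disjoint_right.1 hST hv), zero_add]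
  have cS := coloured_congr eS
  have cT := coloured_congr eT
  refine ⟨fun v hv => ?_, fun v hv hv' => ?_, fun p hp => ?_, ?_, ?_⟩
  · rcases Finset.mem_union.1 hv with hv | hv
    · rw [eS v hv]; exact a₁ v hv
    · rw [eT v hv]; exact b₁ v hv
  · rw [Finset.mem_union, not_or] at hv'
    rw [hsol v hv, a₂ v hv hv'.1, b₂ v hv hv'.2]
  · rw [coloured_union hST, sig_add Finset.subset_union_left Finset.subset_union_right, cS, cT,
      a₃ p hp, b₃ p hp, hc.union p hp]
  · rw [hc.valid_iff hST hS hT (by rwa [cS]) (by rwa [cT])]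
    refine ⟨fun v hv => ?_, fun v hv => ?_⟩
    · rw [cS, eS v hv]; exact a₄ v hv
    · rw [cT, eT v hv]; exact b₄ v hv
  · rw [cost_union hST, cost_congr eS, cost_congr eT]
    omega

/-- The best value for the union is at most the sum of the best values of suitable parts. -/
theorem IsCombination.complete (hc : IsCombination P S T rowS rowT rowU κ κS κT)
    (hST : Disjoint S T) (hS : ∀ v ∈ S, v < P.n) (hT : ∀ v ∈ T, v < P.n) {a b : ℕ}
    {χ ψ : ℕ → ℕ} (ha : P.IsBest S rowS κS a χ) (hb : P.IsBest T rowT κT b ψ) {φ : ℕ → ℕ}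
    (hφ : ∀ v ∈ S ∪ T, φ v < P.q) (h₁ : ∀ p < P.R, P.sig S (coloured S φ) p = rowS p)
    (h₂ : ∀ p < P.R, P.sig T (coloured T φ) p = rowT p) (hv : P.Valid (S ∪ T) φ κ) :
    a ≠ 0 ∧ b ≠ 0 ∧ a + b - 1 ≤ P.cost (S ∪ T) φ + 1 := by
  obtain ⟨hv₁, hv₂⟩ := (hc.valid_iff hST hS hT h₁ h₂).1 hv
  obtain ⟨a₁, a₂⟩ := ha.complete φ (fun v hv => hφ v (Finset.mem_union_left _ hv)) h₁ hv₁
  obtain ⟨b₁, b₂⟩ := hb.complete φ (fun v hv => hφ v (Finset.mem_union_right _ hv)) h₂ hv₂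
  rw [cost_union hST]
  omega

end Join

end Prob

/-! ### Lists of signatures in memory -/

namespace WordRAM

-- The numbers of the variables `x…` and of the arrays `a…` of the programs.

notation "xN" => 0
notation "xM" => 1
notation "xR" => 2
notation "xE" => 3
notation "xNQ" => 4
notation "xC" => 5
notation "xQ" => 6
notation "xNodes" => 7
notation "xRes" => 10
notation "xI" => 11
notation "xP" => 12
notation "xFlag" => 13
notation "xLen" => 14
notation "xW" => 15
notation "xJ" => 16
notation "xVal" => 17
notation "xSide" => 20
notation "xIdx" => 21
notation "xCol" => 22
notation "xU" => 23
notation "xT" => 24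

notation "aMask" => 5
notation "aRow" => 10
notation "aLen" => 11
notation "aBuf" => 12
notation "aH" => 18

/-- The address of the cell `p` of the row `i` of the list of the side `e`; there are `E` sides, and
rows have length `R`. -/
def addr (R E e i p : ℕ) : ℕ := (i * R + p) * E + e

theorem addr_inj {R E e e' i i' p p' : ℕ} (he : e < E) (he' : e' < E) (hp : p < R) (hp' : p' < R) :
    addr R E e i p = addr R E e' i' p' ↔ e = e' ∧ i = i' ∧ p = p' := by
  constructor
  · intro h
    unfold addr at h
    have h₁ : e = e' := by
      have := congrArg (· % E) h
      simpa [Nat.add_comm, Nat.add_mul_mod_self_right, Nat.mod_eq_of_lt he,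
        Nat.mod_eq_of_lt he'] using this
    subst h₁
    have h₂ : i * R + p = i' * R + p' :=
      Nat.eq_of_mul_eq_mul_right (by omega) (Nat.add_right_cancel h)
    have h₃ : p = p' := by
      have := congrArg (· % R) h₂
      simpa [Nat.add_comm, Nat.add_mul_mod_self_right, Nat.mod_eq_of_lt hp,
        Nat.mod_eq_of_lt hp'] using this
    subst h₃
    exact ⟨rfl, Nat.eq_of_mul_eq_mul_right (by omega) (Nat.add_right_cancel h₂), rfl⟩
  · rintro ⟨rfl, rfl, rfl⟩; rfl

theorem addr_lt {R E e i p M : ℕ} (he : e < E) (hp : p < R) (hi : i < M) :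
    addr R E e i p < M * R * E := by
  have h1 : i * R + p < M * R := by
    calc i * R + p < (i + 1) * R := by linarith [Nat.succ_mul i R]
      _ ≤ _ := Nat.mul_le_mul_right _ hi
  unfold addr
  calc (i * R + p) * E + e < (i * R + p + 1) * E := by linarith [Nat.succ_mul (i * R + p) E]
    _ ≤ _ := Nat.mul_le_mul_right _ h1

/-- An expression for `addr`. -/
def Expr.addr (R E e i p : Expr) : Expr := (i * R + p) * E + e

@[simp] theorem eval_addr (s : Store) (R E e i p : Expr) :
    (Expr.addr R E e i p).eval s
      = WordRAM.addr (R.eval s) (E.eval s) (e.eval s) (i.eval s) (p.eval s) := rfl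

@[simp] theorem cost_addr (R E e i p : Expr) :
    (Expr.addr R E e i p).cost = i.cost + R.cost + p.cost + E.cost + e.cost + 4 := by
  simp only [Expr.addr, cost_add, cost_mul]; omega

theorem ok_addr {B : ℕ} {s : Store} {R E e i p : Expr} {M : ℕ} (hR : R.Ok B s) (hE : E.Ok B s)
    (he : e.Ok B s) (hi : i.Ok B s) (hp : p.Ok B s) (hlt : e.eval s < E.eval s)
    (hplt : p.eval s < R.eval s) (hilt : i.eval s < M) (hM : M * R.eval s * E.eval s ≤ B) :
    (Expr.addr R E e i p).Ok B s := by
  have h1 := addr_lt hlt hplt hilt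
  unfold WordRAM.addr at h1
  have h2 : i.eval s * R.eval s + p.eval s ≤ (i.eval s * R.eval s + p.eval s) * E.eval s :=
    Nat.le_mul_of_pos_right _ (by omega)
  simp only [Expr.addr, ok_add, ok_mul, eval_add, eval_mul, hR, hE, he, hi, hp, true_and]
  omega

/-- The cell `p` of the row `i` of the list of the side `e`. -/
def Store.row (s : Store) (R E e i p : ℕ) : ℕ := s.arr aRow (addr R E e i p)

/-- Search the row that is held in the buffer in the list of the side `xSide`; the result is `0` if
it is not there, and otherwise `1` more than its index. -/
def Program.find : Program :=
  .seq (.assign xLen (.get aLen (.var xSide))) <|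
  .seq (.assign xRes 0) <|
  .forLt xI xLen <|
  .seq (.assign xFlag 0) <|
  .seq (.forLt xP xR <|
    .ite (.eqE (.get aRow (.addr (.var xR) (.var xE) (.var xSide) (.var xI) (.var xP)))
      (.get aBuf (.var xP))) .skip (.assign xFlag 1)) <|
  .ite (.var xFlag) .skip (.assign xRes (.var xI + 1))

variable {B : ℕ} {s : Store}

theorem wp_find {R E e L M : ℕ} (hR : s.var xR = R) (hE : s.var xE = E) (he : s.var xSide = e)
    (heE : e < E) (hL : s.arr aLen e = L) (hLM : L ≤ M) (hM : 1 ≤ M) (hR1 : 1 ≤ R)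
    (hB : M * R * E ≤ B) :
    wp B .find s fun t s' => t ≤ 100 * (M * R) ∧
      ((s'.var xRes = 0 ∧ ∀ i < L, ∃ p < R, s.row R E e i p ≠ s.arr aBuf p) ∨
        ∃ i < L, s'.var xRes = i + 1 ∧ ∀ p < R, s.row R E e i p = s.arr aBuf p) := by
  have hB1 : 1 ≤ B := le_trans (Nat.mul_pos (Nat.mul_pos hM hR1) (by omega)) hB
  refine wp_assign_seq (by simp) (wp_assign_seq (by simp) ?_)
  refine wp_forLt (fun k s' => (s'.var xRes = 0 ∧ ∀ i < k, ∃ p < R, s.row R E e i p ≠ s.arr aBuf p) ∨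
    ∃ i < k, s'.var xRes = i + 1 ∧ ∀ p < R, s.row R E e i p = s.arr aBuf p) (80 * R) rfl rfl rfl
    (by simp) ?_ ?_
  · intro k s₁ hk hb₁ hf₁ hx₁ hI
    simp only [setVar_var, eval_get, eval_var] at hk
    simp only [he, hL] at hk
    simp at hk
    have hrow : s₁.arr aRow = s.arr aRow := hf₁.arr _ rfl
    have hbuf : s₁.arr aBuf = s.arr aBuf := hf₁.arr _ rfl
    have hR₁ : s₁.var xR = R := (hf₁.var _ rfl).trans hR
    have hE₁ : s₁.var xE = E := (hf₁.var _ rfl).trans hE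
    have he₁ : s₁.var xSide = e := (hf₁.var _ rfl).trans he
    refine wp_assign_seq (by simp) (wp_seq ?_)
    refine wp_forLt (fun k' s' => (s'.var xFlag = 0 ∧ ∀ p < k', s.row R E e k p = s.arr aBuf p) ∨
      (s'.var xFlag = 1 ∧ ∃ p < R, s.row R E e k p ≠ s.arr aBuf p)) 40 rfl rfl rfl
      (by simp) ?_ ?_
    · intro p s₂ hp hb₂ hf₂ hx₂ hI₂
      have hR₂ : s₂.var xR = R := (hf₂.var _ rfl).trans hR₁
      have hE₂ : s₂.var xE = E := (hf₂.var _ rfl).trans hE₁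
      have he₂ : s₂.var xSide = e := (hf₂.var _ rfl).trans he₁
      have hi₂ : s₂.var xI = k := (hf₂.var _ rfl).trans hx₁
      have hrow₂ : s₂.arr aRow = s.arr aRow := (hf₂.arr _ rfl).trans hrow
      have hbuf₂ : s₂.arr aBuf = s.arr aBuf := (hf₂.arr _ rfl).trans hbuf
      have hp' : p < R := by simpa [hR₁] using hp
      refine wp_ite (ok_eqE hb₂ hB1 (ok_addr (M := M) trivial trivial trivial trivial trivial
        (by simp [he₂, hE₂, heE]) (by simp [hx₂, hR₂, hp']) (by simp [hi₂]; omega)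
        (by simpa [hR₂, hE₂])) trivial) ?_ ?_
      · intro h
        simp only [eval_eqE, eval_get, eval_addr, eval_var, hR₂, hE₂, he₂, hi₂, hx₂, hrow₂, hbuf₂] at h
        have h' : s.row R E e k p = s.arr aBuf p := by simpa [Store.row] using h
        refine wp_skip ⟨by simp, ?_⟩
        rcases hI₂ with ⟨h1, h2⟩ | h1
        · refine .inl ⟨by simpa using h1, fun p' hp' => ?_⟩
          rcases Nat.lt_succ_iff_lt_or_eq.1 hp' with h3 | rfl
          exacts [h2 p' h3, h']
        · exact .inr (by simpa using h1)
      · intro h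
        simp only [eval_eqE, eval_get, eval_addr, eval_var, hR₂, hE₂, he₂, hi₂, hx₂, hrow₂, hbuf₂] at h
        have h' : ¬ s.row R E e k p = s.arr aBuf p := by simpa [Store.row] using h
        exact wp_assign (by simpa) ⟨by simp, .inr ⟨by simp, p, hp', h'⟩⟩
    · intro t s₂ ht hb₂ hf₂ hx₂ hI₂
      have hi₂ : s₂.var xI = k := (hf₂.var _ rfl).trans hx₁
      have hres₂ : s₂.var xRes = s₁.var xRes := hf₂.var _ rfl
      simp only [setVar_var] at ht hI₂
      simp [hR₁] at ht hI₂
      have hkB : k + 1 ≤ B := by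
        have h1 : M ≤ M * R * E := by
          rw [mul_assoc]
          exact Nat.le_mul_of_pos_right _ (Nat.mul_pos hR1 (by omega))
        omega
      refine wp_ite trivial (fun h => wp_skip ?_) (fun h => wp_assign ?_ ?_)
      · refine ⟨by simp; omega, ?_⟩
        rcases hI₂ with ⟨h1, _⟩ | ⟨_, p, hp⟩
        · exact absurd h1 h
        rcases hI with ⟨h1, h2⟩ | ⟨i, hi, h1, h2⟩
        · refine .inl ⟨by simp [hres₂, h1], fun i hi => ?_⟩
          rcases Nat.lt_succ_iff_lt_or_eq.1 hi with h3 | rfl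
          exacts [h2 i h3, ⟨p, hp⟩]
        · exact .inr ⟨i, by omega, by simp [hres₂, h1], h2⟩
      · simp [hi₂]; omega
      · refine ⟨by simp; omega, ?_⟩
        rcases hI₂ with ⟨_, h2⟩ | ⟨h1, _⟩
        · exact .inr ⟨k, by omega, by simp [hi₂], h2⟩
        · simp [h1] at h
  · intro t s₁ ht hb₁ hf₁ hx₁ hI
    simp only [setVar_var, eval_get, eval_var, he, hL] at ht hI
    simp at ht hI
    refine ⟨?_, hI⟩
    have := loop_time (a := 80) (K' := M) ht (le_refl _) hR1 hLM hM
    have h1 : 1 ≤ M * R := Nat.mul_pos hM hR1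
    simp
    omega

end WordRAM

open Prob

namespace Prob

variable (P : Prob)

/-- The signature row after the addition of a vertex `u` of colour `col`. -/
def addRow (S : Finset ℕ) (row : ℕ → ℕ) (col u p : ℕ) : ℕ :=
  if p % P.n ∈ S then 0 else min P.d (row p + P.vecAt col u p)

/-- The rows `row 0, …, row (len - 1)` are distinct signatures on the side `S`, starting with the
signature of the empty multiset. -/
structure IsPartialList (S : Finset ℕ) (len : ℕ) (row : ℕ → ℕ → ℕ) : Prop where
  pos : 1 ≤ len
  zero : ∀ p < P.R, row 0 p = 0
  inj : ∀ i < len, ∀ i' < len, (∀ p < P.R, row i p = row i' p) → i = i'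
  sound : ∀ i < len, ∃ l, P.Adm S l ∧ ∀ p < P.R, row i p = P.sig S l p

variable {P}

theorem sig_zero (S : Finset ℕ) (p : ℕ) : P.sig S 0 p = 0 := by simp [sig, total]

theorem sig_le (S : Finset ℕ) (l : Multiset (ℕ × ℕ)) (p : ℕ) : P.sig S l p ≤ P.d := by
  unfold sig; split <;> omega

theorem sig_cons (S : Finset ℕ) (col u : ℕ) (l : Multiset (ℕ × ℕ)) (p : ℕ) :
    P.sig S ((col, u) ::ₘ l) p = P.addRow S (P.sig S l) col u p := by
  unfold addRow sig
  split_ifs with h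
  · rfl
  · rw [total_cons]; simp only; omega

theorem addRow_congr {S : Finset ℕ} {row row' : ℕ → ℕ} {col u p : ℕ} (h : row p = row' p) :
    P.addRow S row col u p = P.addRow S row' col u p := by unfold addRow; rw [h]

theorem IsPartialList.le_d {S : Finset ℕ} {len : ℕ} {row : ℕ → ℕ → ℕ}
    (h : P.IsPartialList S len row) {i p : ℕ} (hi : i < len) (hp : p < P.R) : row i p ≤ P.d := by
  obtain ⟨l, _, hl⟩ := h.sound i hi
  rw [hl p hp]; exact sig_le _ _ _

/-- A list stays a list of distinct signatures when the result of adding a vertex to one of its rows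
is appended, if this is new. -/
theorem IsPartialList.append {S : Finset ℕ} {len : ℕ} {row row' : ℕ → ℕ → ℕ} {idx col u : ℕ}
    (h : P.IsPartialList S len row) (hidx : idx < len) (hcol : col < P.q) (hu : u ∈ S)
    (hnew : ∀ i < len, ∃ p < P.R, row i p ≠ P.addRow S (row idx) col u p)
    (hr : ∀ i < len, ∀ p < P.R, row' i p = row i p)
    (hr' : ∀ p < P.R, row' len p = P.addRow S (row idx) col u p) :
    P.IsPartialList S (len + 1) row' where
  pos := by omega
  zero p hp := by rw [hr 0 h.pos p hp, h.zero p hp]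
  inj i hi i' hi' hii := by
    rcases Nat.lt_succ_iff_lt_or_eq.1 hi with hi | rfl <;>
      rcases Nat.lt_succ_iff_lt_or_eq.1 hi' with hi' | rfl
    · exact h.inj i hi i' hi' fun p hp => by rw [← hr i hi p hp, hii p hp, hr i' hi' p hp]
    · obtain ⟨p, hp, hne⟩ := hnew i hi
      exact absurd (by rw [← hr i hi p hp, hii p hp, hr' p hp]) hne
    · obtain ⟨p, hp, hne⟩ := hnew i' hi'
      exact absurd (by rw [← hr i' hi' p hp, ← hii p hp, hr' p hp]) hne
    · rfl
  sound i hi := by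
    rcases Nat.lt_succ_iff_lt_or_eq.1 hi with hi | rfl
    · obtain ⟨l, hl, hl'⟩ := h.sound i hi
      exact ⟨l, hl, fun p hp => by rw [hr i hi p hp, hl' p hp]⟩
    · obtain ⟨l, hl, hl'⟩ := h.sound idx hidx
      refine ⟨(col, u) ::ₘ l, fun x hx => ?_, fun p hp => ?_⟩
      · rcases Multiset.mem_cons.1 hx with rfl | hx
        exacts [⟨hcol, hu⟩, hl x hx]
      · rw [hr' p hp, sig_cons, addRow_congr (hl' p hp)]

/-- A list of distinct signatures that is closed under the addition of a vertex is complete. -/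
theorem IsPartialList.isList {S : Finset ℕ} {len : ℕ} {row : ℕ → ℕ → ℕ}
    (h : P.IsPartialList S len row)
    (hcl : ∀ idx < len, ∀ u ∈ S, ∀ col < P.q, ∃ i < len, ∀ p < P.R,
      row i p = P.addRow S (row idx) col u p) : P.IsList S len row where
  inj := h.inj
  sound := h.sound
  complete l := by
    induction l using Multiset.induction with
    | empty => exact fun _ => ⟨0, h.pos, fun p hp => by rw [h.zero p hp, sig_zero]⟩
    | cons x l ih =>
      intro hl
      obtain ⟨i, hi, hi'⟩ := ih fun y hy => hl y (Multiset.mem_cons_of_mem hy)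
      have hx := hl x (Multiset.mem_cons_self x l)
      obtain ⟨k, hk, hk'⟩ := hcl i hi x.2 hx.2 x.1 hx.1
      exact ⟨k, hk, fun p hp => by rw [hk' p hp, ← Prod.mk.eta (p := x), sig_cons,
        addRow_congr (hi' p hp)]⟩

end Prob

namespace WordRAM

notation "aOk" => 3
notation "aWt" => 4

/-- The size conditions under which the program works on words of size `B`, with lists of signatures
of at most `M` rows and `E` sides. -/
structure Bounds (P : Prob) (B M E : ℕ) : Prop where
  n_pos : 1 ≤ P.n
  c_pos : 1 ≤ P.c
  q_pos : 1 ≤ P.q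
  M_pos : 1 ≤ M
  row_le : M * P.R * E ≤ B
  nn_le : P.n * P.n ≤ B
  en_le : E * P.n ≤ B
  d_le : 2 * P.d + 2 ≤ B
  off_le : P.c + P.off ≤ P.q
  q_le : 2 * P.q ≤ B
  nq_le : P.n * P.q ≤ B
  cell_le : M * M * (P.n + 1) * E ≤ B
  cube_le : M * M * M ≤ B
  ok_le : P.q * (2 * P.c) * (P.d + 1) ≤ B
  wt_le : ∀ k, P.wt k ≤ 1
  h_le : ∀ k, P.h k ≤ 1

/-- The read-only part of the memory: the parameters, the matrix, the tables, and the vertex sets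
`S e` of the sides `e < E`. -/
structure Env (P : Prob) (E : ℕ) (S : ℕ → Finset ℕ) (s : Store) : Prop where
  n : s.var xN = P.n
  width : s.var xR = P.R
  sides : s.var xE = E
  nq : s.var xNQ = P.n * P.q
  c : s.var xC = 2 * P.c
  q : s.var xQ = P.q
  nodes : s.var xNodes = E / 2
  h : s.arr aH = P.h
  ok : s.arr aOk = P.ok
  wt : s.arr aWt = P.wt
  mask : ∀ e < E, ∀ w < P.n, s.arr aMask (e * P.n + w) = if w ∈ S e then 1 else 0

/-- The program does not write the read-only part of the memory. -/
def Program.keepsEnv (p : Program) : Bool :=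
  !(p.writesVar xN || p.writesVar xR || p.writesVar xE || p.writesVar xNQ || p.writesVar xC ||
    p.writesVar xQ || p.writesVar xNodes || p.writesArr aH || p.writesArr aOk || p.writesArr aWt || p.writesArr aMask)

variable {P : Prob} {E M B : ℕ} {S : ℕ → Finset ℕ} {s s' : Store}

theorem Env.frame {p : Program} (h : Env P E S s) (hf : Frame p s s') (hp : p.keepsEnv = true) :
    Env P E S s' := by
  simp only [Program.keepsEnv, Bool.not_eq_true', Bool.or_eq_false_iff] at hp
  obtain ⟨⟨⟨⟨⟨⟨⟨⟨⟨⟨h0, h1⟩, h2⟩, h3⟩, h4⟩, h5⟩, h10⟩, h6⟩, h7⟩, h8⟩, h9⟩ := hp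
  exact ⟨(hf.var _ h0).trans h.n, (hf.var _ h1).trans h.width, (hf.var _ h2).trans h.sides,
    (hf.var _ h3).trans h.nq, (hf.var _ h4).trans h.c, (hf.var _ h5).trans h.q,
    (hf.var _ h10).trans h.nodes,
    (hf.arr _ h6).trans h.h, (hf.arr _ h7).trans h.ok, (hf.arr _ h8).trans h.wt,
    fun e he w hw => by rw [hf.arr _ h9]; exact h.mask e he w hw⟩

theorem Env.setVar (h : Env P E S s) {x k : ℕ} (hx : (Program.assign x 0).keepsEnv = true) :
    Env P E S (s.setVar x k) := by
  refine h.frame (p := .assign x 0) ⟨fun y hy => ?_, fun _ _ => rfl⟩ hx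
  have : y ≠ x := by simpa [Program.writesVar] using hy
  simp [this]

theorem Env.setArr (h : Env P E S s) {a i k : ℕ} (ha : (Program.store a 0 0).keepsEnv = true) :
    Env P E S (s.setArr a i k) := by
  refine h.frame (p := .store a 0 0) ⟨fun _ _ => rfl, fun b hb => funext fun j => ?_⟩ ha
  have : b ≠ a := by simpa [Program.writesArr] using hb
  simp [this]

theorem Bounds.R_pos (hb : Bounds P B M E) : 1 ≤ P.R :=
  Nat.mul_pos (Nat.mul_pos two_pos hb.c_pos) hb.n_pos

theorem Bounds.MR_pos (hb : Bounds P B M E) : 1 ≤ M * P.R := Nat.mul_pos hb.M_pos hb.R_pos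

theorem Bounds.one_le (hb : Bounds P B M E) : 1 ≤ B := le_trans (by omega) hb.d_le

theorem Bounds.M_le (hb : Bounds P B M E) (hE : 1 ≤ E) : M ≤ B := by
  refine le_trans ?_ hb.row_le
  rw [mul_assoc]
  exact Nat.le_mul_of_pos_right _ (Nat.mul_pos hb.R_pos hE)

theorem Bounds.E_le (hb : Bounds P B M E) : E ≤ B :=
  le_trans (Nat.le_mul_of_pos_right _ hb.n_pos) hb.en_le

theorem mul_add_lt {a b i j : ℕ} (hi : i < a) (hj : j < b) : i * b + j < a * b := by
  calc i * b + j < (i + 1) * b := by linarith [Nat.succ_mul i b]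
    _ ≤ _ := Nat.mul_le_mul_right _ hi

theorem ok_mul_add {e f g : Expr} {a b : ℕ} (he : e.Ok B s) (hf : f.Ok B s) (hg : g.Ok B s)
    (h1 : e.eval s < a) (h2 : f.eval s = b) (h3 : g.eval s < b) (h : a * b ≤ B) :
    (e * f + g).Ok B s := by
  have := mul_add_lt h1 h3
  simp only [ok_add, ok_mul, he, hf, hg, eval_mul, h2, true_and]
  omega

theorem addr_row_lt {s s' : Store} (h : s'.arr aRow = s.arr aRow) : s'.row = s.row := by
  funext R E e i p
  unfold Store.row; rw [h]

/-- Add the vertex `xU` of colour `xCol` to the row `xIdx` of the side `xSide`; the result is put into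
the buffer. -/
def Program.addVec (off d : ℕ) : Program :=
  .forLt xP xR <|
  .seq (.assign xJ (.var xP / .var xN)) <|
  .seq (.assign xW (.var xP - .var xJ * .var xN)) <|
  .seq (.assign xVal (.get aRow (.addr (.var xR) (.var xE) (.var xSide) (.var xIdx) (.var xP)))) <|
  .seq (.ite (.eqE (.var xCol) (.var xJ / 2 + .const off))
    (.ite (.var xJ - 2 * (.var xJ / 2))
      (.assign xVal (.var xVal + .get aH (.var xU * .var xN + .var xW)))
      (.assign xVal (.var xVal + .get aH (.var xW * .var xN + .var xU)))) .skip) <|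
  .ite (.get aMask (.var xSide * .var xN + .var xW)) (.store aBuf (.var xP) 0)
    (.store aBuf (.var xP) (.var xVal - (.var xVal - .const d)))

theorem wp_addVec (hb : Bounds P B M E) (hs : Env P E S s) {e idx col u : ℕ}
    (he : s.var xSide = e) (heE : e < E) (hidx : s.var xIdx = idx) (hidxM : idx < M)
    (hcol : s.var xCol = col) (hu : s.var xU = u) (hun : u < P.n)
    (hrow : ∀ p < P.R, s.row P.R E e idx p ≤ P.d) :
    wp B (.addVec P.off P.d) s fun t s' => t ≤ 130 * P.R ∧
      ∀ p < P.R, s'.arr aBuf p = P.addRow (S e) (s.row P.R E e idx) col u p := by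
  have hB1 := hb.one_le
  refine wp_forLt (fun k s' => ∀ p < k, s'.arr aBuf p = P.addRow (S e) (s.row P.R E e idx) col u p)
    100 rfl rfl rfl (by simp) ?_ ?_
  · intro p s₁ hp hb₁ hf₁ hx₁ hI
    have hs₁ := hs.frame hf₁ rfl
    have he₁ : s₁.var xSide = e := (hf₁.var _ rfl).trans he
    have hidx₁ : s₁.var xIdx = idx := (hf₁.var _ rfl).trans hidx
    have hcol₁ : s₁.var xCol = col := (hf₁.var _ rfl).trans hcol
    have hu₁ : s₁.var xU = u := (hf₁.var _ rfl).trans hu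
    have hrow₁ : s₁.arr aRow = s.arr aRow := hf₁.arr _ rfl
    rw [hs.width] at hp
    have hdiv : p / P.n * P.n + p % P.n = p := Nat.div_add_mod' p P.n
    have hmod : p % P.n < P.n := Nat.mod_lt _ hb.n_pos
    have hpB : p ≤ B := by have := hb₁.1 xP; omega
    have hj2 : p / P.n / 2 < P.c := by
      rw [Nat.div_div_eq_div_mul]
      exact Nat.div_lt_of_lt_mul (by unfold Prob.R at hp; linarith)
    refine wp_assign_seq (by simp) (wp_assign_seq ?_ (wp_assign_seq ?_ ?_))
    · simp [hx₁, hs₁.n]; omega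
    · refine ok_addr (M := M) trivial trivial trivial trivial trivial ?_ ?_ ?_ ?_ <;>
        simp [he₁, hs₁.sides, hx₁, hs₁.width, hidx₁, heE, hidxM, hp, hb.row_le]
    simp only [eval_div, eval_var, eval_sub, eval_mul, eval_get, eval_addr, setVar_var, hx₁, hs₁.n,
      setVar_arr]
    simp [hs₁.width, hs₁.sides, he₁, hidx₁, hrow₁]
    have hw : p - p / P.n * P.n = p % P.n := by omega
    rw [hw]
    set s₂ := ((s₁.setVar xJ (p / P.n)).setVar xW (p % P.n)).setVar xVal
      (s.arr aRow (addr P.R E e idx p)) with hs₂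
    have hrowp : s.arr aRow (addr P.R E e idx p) ≤ P.d := hrow p hp
    have hcost : ∀ k, k < p → k ≠ p := fun k hk => hk.ne
    have hval : wp B (.ite (.eqE (.var xCol) (.var xJ / 2 + .const P.off))
        (.ite (.var xJ - 2 * (.var xJ / 2))
          (.assign xVal (.var xVal + .get aH (.var xU * .var xN + .var xW)))
          (.assign xVal (.var xVal + .get aH (.var xW * .var xN + .var xU)))) .skip) s₂
        fun t s' => t ≤ 40 ∧ s'.var xVal = s.row P.R E e idx p + P.vecAt col u p := by
      refine wp_bdd fun hbs => wp_ite (ok_eqE hbs hB1 trivial ?_) (fun h => ?_) (fun h => ?_)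
      · have := hb.off_le
        have := hb.q_le
        have := hb.d_le
        simp [hs₂]
        omega
      · have h' : col = p / P.n / 2 + P.off := by
          simpa [hs₂, hcol₁] using h
        refine wp_ite ?_ (fun h1 => ?_) (fun h1 => ?_)
        · simp [hs₂]
          have := Nat.mul_div_le (p / P.n) 2
          have := Nat.div_le_self p P.n
          have := hb.off_le
          have := hb.q_le
          have := hb.c_pos
          have := hb.d_le
          omega
        · have h1' : ¬ p / P.n % 2 = 0 := by
            simp [hs₂] at h1; omega
          have := hb.h_le (u * P.n + p % P.n)
          have := hb.d_le
          have := mul_add_lt hun hmod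
          have := hb.nn_le
          refine wp_assign ?_ ⟨by simp, ?_⟩
          · simp [hs₂, hu₁, hs₁.n, hs₁.h]; omega
          · simp [hs₂, hu₁, hs₁.n, hs₁.h, Prob.vecAt, h', h1', Store.row]
        · have h1' : p / P.n % 2 = 0 := by
            simp [hs₂] at h1; omega
          have := hb.h_le (p % P.n * P.n + u)
          have := hb.d_le
          have := mul_add_lt hmod hun
          have := hb.nn_le
          refine wp_assign ?_ ⟨by simp, ?_⟩
          · simp [hs₂, hu₁, hs₁.n, hs₁.h]; omega
          · simp [hs₂, hu₁, hs₁.n, hs₁.h, Prob.vecAt, h', h1', Store.row]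
      · have h' : ¬ col = p / P.n / 2 + P.off := by
          simpa [hs₂, hcol₁] using h
        refine wp_skip ⟨by simp, ?_⟩
        simp [hs₂, Prob.vecAt, h', Store.row]
    refine wp_call_seq hval ?_
    rintro t₃ s₃ hb₃ hf₃ ⟨ht₃, hv₃⟩
    have hs₃ : Env P E S s₃ := (((hs₁.setVar rfl).setVar rfl).setVar rfl).frame hf₃ rfl
    have hp₃ : s₃.var xP = p := by rw [hf₃.var _ rfl]; simp [hs₂, hx₁]
    have he₃ : s₃.var xSide = e := by rw [hf₃.var _ rfl]; simp [hs₂, he₁]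
    have hw₃ : s₃.var xW = p % P.n := by rw [hf₃.var _ rfl]; simp [hs₂]
    have hbuf₃ : s₃.arr aBuf = s₁.arr aBuf := by rw [hf₃.arr _ rfl]; simp [hs₂]
    have hmask := hs₃.mask e heE _ hmod
    refine wp_ite (ok_mul_add trivial trivial trivial (a := E) (b := P.n) (by simp [he₃, heE])
      (by simp [hs₃.n]) (by simp [hw₃, hmod]) hb.en_le) (fun h => ?_) (fun h => ?_)
    · have h' : p % P.n ∈ S e := by
        simpa [he₃, hs₃.n, hw₃, hmask] using h
      refine wp_store trivial (by simp) ⟨by simp; omega, fun p' hp' => ?_⟩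
      rcases hp'.lt_or_eq with h3 | rfl
      · simp [hp₃, h3.ne, hbuf₃, hI p' h3]
      · simp [hp₃, Prob.addRow, h']
    · have h' : p % P.n ∉ S e := by
        simpa [he₃, hs₃.n, hw₃, hmask] using h
      refine wp_store trivial (by simp; have := hb.d_le; omega) ⟨by simp; omega, fun p' hp' => ?_⟩
      rcases hp'.lt_or_eq with h3 | rfl
      · simp [hp₃, h3.ne, hbuf₃, hI p' h3]
      · simp [hp₃, Prob.addRow, h', hv₃]; omega
  · intro t s₁ ht hb₁ hf₁ hx₁ hI
    rw [hs.width] at ht hI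
    exact ⟨by have := hb.R_pos; omega, hI⟩

end WordRAM

open Prob

namespace WordRAM

variable {P : Prob} {E M B : ℕ} {S : ℕ → Finset ℕ} {s s' : Store}

/-- Append the row in the buffer to the list of the side `xSide`. -/
def Program.append : Program :=
  .seq (.assign xLen (.get aLen (.var xSide))) <|
  .seq (.forLt xP xR <|
    .store aRow (.addr (.var xR) (.var xE) (.var xSide) (.var xLen) (.var xP))
      (.get aBuf (.var xP))) <|
  .store aLen (.var xSide) (.var xLen + 1)

theorem wp_append (hb : Bounds P B M E) (hs : Env P E S s) {e L : ℕ}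
    (he : s.var xSide = e) (heE : e < E) (hL : s.arr aLen e = L) (hLM : L < M) :
    wp B .append s fun t s' => t ≤ 50 * P.R ∧
      (∀ e', s'.arr aLen e' = if e' = e then L + 1 else s.arr aLen e') ∧
      (∀ p < P.R, s'.row P.R E e L p = s.arr aBuf p) ∧
      ∀ e' < E, ∀ i, ∀ p < P.R, (e' ≠ e ∨ i ≠ L) → s'.row P.R E e' i p = s.row P.R E e' i p := by
  refine wp_assign_seq (by simp) ?_
  simp only [eval_get, eval_var, he, hL]
  refine wp_seq (wp_forLt (fun k s' => (∀ p < k, s'.row P.R E e L p = s.arr aBuf p) ∧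
      ∀ e' < E, ∀ i, ∀ p < P.R, (e' ≠ e ∨ i ≠ L) → s'.row P.R E e' i p = s.row P.R E e' i p)
    15 rfl rfl rfl ⟨by simp, fun _ _ _ _ _ _ => rfl⟩ ?_ ?_)
  · intro p s₁ hp hb₁ hf₁ hx₁ hI
    have hs₁ : Env P E S s₁ := (hs.setVar (x := xLen) rfl).frame hf₁ rfl
    have he₁ : s₁.var xSide = e := by rw [hf₁.var _ rfl]; simpa using he
    have hL₁ : s₁.var xLen = L := by rw [hf₁.var _ rfl]; simp
    have hbuf₁ : s₁.arr aBuf = s.arr aBuf := hf₁.arr _ rfl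
    have hp' : p < P.R := by simpa [hs.width] using hp
    refine wp_store (ok_addr (M := M) trivial trivial trivial trivial trivial
      (by simp [he₁, hs₁.sides, heE]) (by simp [hx₁, hs₁.width, hp']) (by simp [hL₁, hLM])
      (by simpa [hs₁.sides, hs₁.width] using hb.row_le)) trivial ⟨by simp, ?_, ?_⟩
    · intro p' hp''
      rcases Nat.lt_succ_iff_lt_or_eq.1 hp'' with h3 | rfl
      · have := hI.1 p' h3
        simp only [Store.row] at this ⊢
        simp [hx₁, hs₁.width, hs₁.sides, he₁, hL₁, this, addr_inj heE heE (h3.trans hp') hp', h3.ne]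
      · simp [Store.row, hx₁, hs₁.width, hs₁.sides, he₁, hL₁, hbuf₁]
    · intro e' he' i p' hp'' hne
      have := hI.2 e' he' i p' hp'' hne
      simp only [Store.row] at this ⊢
      simp only [setVar_arr, setArr_arr, eval_addr, eval_var, hs₁.width, hs₁.sides, he₁, hL₁, hx₁,
        addr_inj he' heE hp'' hp', this, true_and]
      rw [if_neg]
      rintro ⟨rfl, rfl, -⟩
      simp at hne
  · intro t s₁ ht hb₁ hf₁ hx₁ hI
    have he₁ : s₁.var xSide = e := by rw [hf₁.var _ rfl]; simpa using he
    have hL₁ : s₁.var xLen = L := by rw [hf₁.var _ rfl]; simp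
    have hlen₁ : s₁.arr aLen = s.arr aLen := hf₁.arr _ rfl
    simp only [setVar_var] at ht hI
    simp [hs.width] at ht hI
    have := hb.M_le (by omega)
    have := hb.R_pos
    refine wp_store trivial (by simp [hL₁]; omega) ⟨by simp; omega, ?_, ?_, ?_⟩
    · intro e'
      simp [he₁, hL₁, hlen₁]
    · intro p hp
      have := hI.1 p hp
      simpa [Store.row] using this
    · intro e' he' i p hp hne
      have := hI.2 e' he' i p hp hne
      simpa [Store.row] using this

/-- The invariant of the enumeration of the signatures on the side `e`: the rows before `idx` are
completely processed, and the row `idx` for the first `k` pairs of a vertex and a colour. The lists of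
the other sides are those of the memory `s₀`. -/
structure EnumInv (P : Prob) (E M : ℕ) (S : Finset ℕ) (e : ℕ) (s₀ : Store) (idx k : ℕ) (s : Store) :
    Prop where
  len_le : s.arr aLen e ≤ M
  idx_le : idx ≤ s.arr aLen e
  list : P.IsPartialList S (s.arr aLen e) (s.row P.R E e)
  closed : ∀ idx' < idx, ∀ u ∈ S, ∀ col < P.q, ∃ i < s.arr aLen e, ∀ p < P.R,
    s.row P.R E e i p = P.addRow S (s.row P.R E e idx') col u p
  closed_idx : ∀ t < k, t / P.q ∈ S → ∃ i < s.arr aLen e, ∀ p < P.R,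
    s.row P.R E e i p = P.addRow S (s.row P.R E e idx) (t % P.q) (t / P.q) p
  other : ∀ e' < E, e' ≠ e → s.arr aLen e' = s₀.arr aLen e' ∧
    ∀ i, ∀ p < P.R, s.row P.R E e' i p = s₀.row P.R E e' i p

theorem EnumInv.congr {S : Finset ℕ} {e : ℕ} {s₀ : Store} {idx k : ℕ}
    (h : EnumInv P E M S e s₀ idx k s) (h₁ : s'.arr aLen = s.arr aLen)
    (h₂ : s'.arr aRow = s.arr aRow) : EnumInv P E M S e s₀ idx k s' := by
  have h₂' : s'.row = s.row := addr_row_lt h₂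
  exact ⟨by rw [h₁]; exact h.len_le, by rw [h₁]; exact h.idx_le, by rw [h₁, h₂']; exact h.list,
    by rw [h₁, h₂']; exact h.closed, by rw [h₁, h₂']; exact h.closed_idx,
    by rw [h₁, h₂']; exact h.other⟩

/-- Try to extend the row `xIdx` by the vertex and the colour that `xT` encodes. -/
def Program.extend (off d : ℕ) : Program :=
  .seq (.assign xU (.var xT / .var xQ)) <|
  .seq (.assign xCol (.var xT - .var xU * .var xQ)) <|
  .ite (.get aMask (.var xSide * .var xN + .var xU))
    (.seq (.addVec off d) <| .seq .find <| .ite (.var xRes) .skip .append) .skip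

/-- No list of distinct signatures on a side has more than `M` rows. -/
def ListBound (P : Prob) (M E : ℕ) (S : ℕ → Finset ℕ) : Prop :=
  ∀ e < E, S e ⊆ Finset.range P.n ∧ ∀ len row, P.IsPartialList (S e) len row → len ≤ M

/-- One step of the enumeration: the sum of the row `idx` and the coloured vertex number `k` is in the
list afterwards. -/
theorem wp_extend (hb : Bounds P B M E) (hs : Env P E S s) (hM : ListBound P M E S) {e idx k : ℕ}
    {s₀ : Store} (he : s.var xSide = e) (heE : e < E) (hidx : s.var xIdx = idx)
    (hk : s.var xT = k) (hkn : k < P.n * P.q) (hidxL : idx < s.arr aLen e)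
    (hI : EnumInv P E M (S e) e s₀ idx k s) :
    wp B (.extend P.off P.d) s fun t s' => t ≤ 320 * (M * P.R) ∧
      idx < s'.arr aLen e ∧ EnumInv P E M (S e) e s₀ idx (k + 1) s' := by
  have hMR := hb.MR_pos
  have hRMR : P.R ≤ M * P.R := Nat.le_mul_of_pos_left _ hb.M_pos
  have hun : k / P.q < P.n := Nat.div_lt_of_lt_mul (by rwa [mul_comm])
  have hdm := Nat.div_add_mod' k P.q
  have hcol : k % P.q < P.q := Nat.mod_lt _ hb.q_pos
  have hkB : k ≤ B := le_trans hkn.le hb.nq_le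
  refine wp_assign_seq (by simp) (wp_assign_seq ?_ ?_)
  · simp [hk, hs.q]; omega
  simp only [eval_div, eval_var, eval_sub, eval_mul, setVar_var, hk, hs.q]
  simp only [reduceIte, Nat.reduceEqDiff]
  have hcol' : k - k / P.q * P.q = k % P.q := by omega
  rw [hcol']
  set s₁ := (s.setVar xU (k / P.q)).setVar xCol (k % P.q) with hs₁
  have hE₁ : Env P E S s₁ := (hs.setVar rfl).setVar rfl
  have he₁ : s₁.var xSide = e := by simp [hs₁, he]
  have hidx₁ : s₁.var xIdx = idx := by simp [hs₁, hidx]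
  have hu₁ : s₁.var xU = k / P.q := by simp [hs₁]
  have hcol₁ : s₁.var xCol = k % P.q := by simp [hs₁]
  have hI₁ : EnumInv P E M (S e) e s₀ idx k s₁ := hI.congr rfl rfl
  have hidxL₁ : idx < s₁.arr aLen e := hidxL
  have hmask := hE₁.mask e heE _ hun
  clear_value s₁
  refine wp_ite (ok_mul_add trivial trivial trivial (a := E) (b := P.n) (by simp [he₁, heE])
    (by simp [hE₁.n]) (by simp [hu₁, hun]) hb.en_le) (fun h => ?_) (fun h => ?_)
  · have huS : k / P.q ∈ S e := by simpa [he₁, hE₁.n, hu₁, hmask] using h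
    refine wp_call_seq (wp_addVec hb hE₁ he₁ heE hidx₁ (lt_of_lt_of_le hidxL₁ hI₁.len_le) hcol₁ hu₁
      hun (fun p hp => hI₁.list.le_d hidxL₁ hp)) ?_
    rintro t₂ s₂ hb₂ hf₂ ⟨ht₂, hbuf₂⟩
    have hE₂ := hE₁.frame hf₂ rfl
    have he₂ : s₂.var xSide = e := (hf₂.var _ rfl).trans he₁
    have hI₂ : EnumInv P E M (S e) e s₀ idx k s₂ := hI₁.congr (hf₂.arr _ rfl) (hf₂.arr _ rfl)
    have hidxL₂ : idx < s₂.arr aLen e := by rw [hf₂.arr _ rfl]; exact hidxL₁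
    have hrow₂ : s₂.row = s₁.row := addr_row_lt (hf₂.arr _ rfl)
    rw [← hrow₂] at hbuf₂
    refine wp_call_seq (wp_find hE₂.width hE₂.sides he₂ heE rfl hI₂.len_le hb.M_pos hb.R_pos
      hb.row_le) ?_
    rintro t₃ s₃ hb₃ hf₃ ⟨ht₃, hres⟩
    have hE₃ := hE₂.frame hf₃ rfl
    have he₃ : s₃.var xSide = e := (hf₃.var _ rfl).trans he₂
    have hI₃ : EnumInv P E M (S e) e s₀ idx k s₃ := hI₂.congr (hf₃.arr _ rfl) (hf₃.arr _ rfl)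
    have hlen₃ : s₃.arr aLen = s₂.arr aLen := hf₃.arr _ rfl
    have hrow₃ : s₃.row = s₂.row := addr_row_lt (hf₃.arr _ rfl)
    have hbuf₃ : s₃.arr aBuf = s₂.arr aBuf := hf₃.arr _ rfl
    rw [← hbuf₃, ← hrow₃] at hbuf₂
    rw [← hrow₃, ← hbuf₃, ← hlen₃] at hres
    rw [← hlen₃] at hidxL₂
    refine wp_ite trivial (fun h => wp_skip ?_) (fun h => ?_)
    · refine ⟨by simp; omega, hidxL₂, hI₃.len_le, hI₃.idx_le, hI₃.list, hI₃.closed, ?_, hI₃.other⟩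
      intro t ht htS
      rcases Nat.lt_succ_iff_lt_or_eq.1 ht with h3 | rfl
      · exact hI₃.closed_idx t h3 htS
      · rcases hres with ⟨h0, _⟩ | ⟨i, hi, _, hi'⟩
        · exact absurd h0 h
        · exact ⟨i, hi, fun p hp => by rw [hi' p hp, hbuf₂ p hp]⟩
    · have hnew : ∀ i < s₃.arr aLen e, ∃ p < P.R,
          s₃.row P.R E e i p ≠ P.addRow (S e) (s₃.row P.R E e idx) (k % P.q) (k / P.q) p := by
        rcases hres with ⟨_, h1⟩ | ⟨i, _, h1, _⟩
        · intro i hi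
          obtain ⟨p, hp, hne⟩ := h1 i hi
          exact ⟨p, hp, by rwa [← hbuf₂ p hp]⟩
        · have : s₃.var xRes = 0 := h
          omega
      have hlt : s₃.arr aLen e < M := by
        refine (hM e heE).2 (s₃.arr aLen e + 1) (fun i p => if i = s₃.arr aLen e then s₃.arr aBuf p
          else s₃.row P.R E e i p) ?_
        exact hI₃.list.append hidxL₂ hcol huS hnew (fun i hi p hp => if_neg hi.ne)
          (fun p hp => by simp [hbuf₂ p hp])
      refine wp_mono (wp_append hb hE₃ he₃ heE rfl hlt) ?_
      rintro t₄ s₄ hb₄ hf₄ ⟨ht₄, hlen₄, hnew₄, hold₄⟩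
      have hlen₄' : s₄.arr aLen e = s₃.arr aLen e + 1 := by rw [hlen₄, if_pos rfl]
      have hold : ∀ i < s₃.arr aLen e, ∀ p < P.R, s₄.row P.R E e i p = s₃.row P.R E e i p :=
        fun i hi p hp => hold₄ e heE i p hp (.inr hi.ne)
      refine ⟨by simp; omega, by omega, by omega, ?_, ?_, ?_, ?_, ?_⟩
      · have := hI₃.idx_le; omega
      · rw [hlen₄']
        exact hI₃.list.append hidxL₂ hcol huS hnew hold
          (fun p hp => by rw [hnew₄ p hp, hbuf₂ p hp])
      · intro idx' hidx' u hu col hcol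
        obtain ⟨i, hi, hi'⟩ := hI₃.closed idx' hidx' u hu col hcol
        exact ⟨i, by omega, fun p hp => by
          rw [hold i hi p hp, hi' p hp, addRow_congr (hold idx' (by omega) p hp)]⟩
      · intro t ht htS
        rcases Nat.lt_succ_iff_lt_or_eq.1 ht with h3 | rfl
        · obtain ⟨i, hi, hi'⟩ := hI₃.closed_idx t h3 htS
          exact ⟨i, by omega, fun p hp => by
            rw [hold i hi p hp, hi' p hp, addRow_congr (hold idx hidxL₂ p hp)]⟩
        · exact ⟨s₃.arr aLen e, by omega, fun p hp => by
            rw [hnew₄ p hp, hbuf₂ p hp, addRow_congr (hold idx hidxL₂ p hp)]⟩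
      · intro e' he' hne
        obtain ⟨h1, h2⟩ := hI₃.other e' he' hne
        exact ⟨by rw [hlen₄, if_neg hne, h1], fun i p hp => by
          rw [hold₄ e' he' i p hp (.inl hne), h2 i p hp]⟩
  · have huS : k / P.q ∉ S e := by simpa [he₁, hE₁.n, hu₁, hmask] using h
    refine wp_skip ⟨by simp; omega, hidxL₁, hI₁.len_le, hI₁.idx_le, hI₁.list, hI₁.closed, ?_, hI₁.other⟩
    intro t ht htS
    rcases Nat.lt_succ_iff_lt_or_eq.1 ht with h3 | rfl
    · exact hI₁.closed_idx t h3 htS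
    · exact absurd htS huS

/-- Enumerate the signatures on the side `xSide`. -/
def Program.enumerate (off d : ℕ) : Program :=
  .seq (.store aLen (.var xSide) 1) <|
  .seq (.assign xIdx 0) <|
  .while (.get aLen (.var xSide) - .var xIdx) <|
  .seq (.forLt xT xNQ (.extend off d)) (.assign xIdx (.var xIdx + 1))

/-- The list of the side `e` in memory is complete, and starts with the zero row. -/
structure HasList (P : Prob) (E M : ℕ) (S : ℕ → Finset ℕ) (e : ℕ) (s : Store) : Prop where
  len_le : s.arr aLen e ≤ M
  zero : ∀ p < P.R, s.row P.R E e 0 p = 0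
  list : P.IsList (S e) (s.arr aLen e) (s.row P.R E e)

theorem HasList.len_pos {e : ℕ} (h : HasList P E M S e s) : 0 < s.arr aLen e := by
  obtain ⟨i, hi, _⟩ := h.list.complete 0 (by simp [Adm])
  omega

theorem HasList.le_d {e i p : ℕ} (h : HasList P E M S e s) (hi : i < s.arr aLen e) (hp : p < P.R) :
    s.row P.R E e i p ≤ P.d := by
  obtain ⟨l, _, hl⟩ := h.list.sound i hi
  rw [hl p hp]; exact sig_le _ _ _

theorem HasList.congr {e : ℕ} (h : HasList P E M S e s) (h₁ : s'.arr aLen e = s.arr aLen e)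
    (h₂ : ∀ i, ∀ p < P.R, s'.row P.R E e i p = s.row P.R E e i p) : HasList P E M S e s' where
  len_le := by rw [h₁]; exact h.len_le
  zero p hp := by rw [h₂ 0 p hp, h.zero p hp]
  list := by
    rw [h₁]
    refine ⟨fun i hi i' hi' hii => h.list.inj i hi i' hi' fun p hp => ?_, fun i hi => ?_,
      fun l hl => ?_⟩
    · rw [← h₂ i p hp, hii p hp, h₂ i' p hp]
    · obtain ⟨l, hl, hl'⟩ := h.list.sound i hi
      exact ⟨l, hl, fun p hp => by rw [h₂ i p hp, hl' p hp]⟩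
    · obtain ⟨i, hi, hi'⟩ := h.list.complete l hl
      exact ⟨i, hi, fun p hp => by rw [h₂ i p hp, hi' p hp]⟩

/-- A list that is closed under the addition of a coloured vertex and has the zero row contains all
signatures, by induction on the multiset. The loop ends because there are at most `M` signatures. -/
theorem wp_enumerate (hb : Bounds P B M E) (hs : Env P E S s) (hM : ListBound P M E S) {e : ℕ}
    (he : s.var xSide = e) (heE : e < E) (hzero : ∀ p < P.R, s.row P.R E e 0 p = 0) :
    wp B (.enumerate P.off P.d) s fun t s' => t ≤ 400 * (M * (P.n * P.q * (M * P.R))) ∧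
      HasList P E M S e s' ∧ ∀ e' < E, e' ≠ e → s'.arr aLen e' = s.arr aLen e' ∧
        ∀ i, ∀ p < P.R, s'.row P.R E e' i p = s.row P.R E e' i p := by
  have hMR := hb.MR_pos
  have hM1 := hb.M_pos
  have hnq : 1 ≤ P.n * P.q := Nat.mul_pos hb.n_pos hb.q_pos
  refine wp_store_seq trivial (by simpa using hb.one_le) (wp_assign_seq (by simp) ?_)
  simp only [eval_var, he, eval_one, eval_zero]
  set s₁ := (s.setArr aLen e 1).setVar xIdx 0 with hs₁
  have hE₁ : Env P E S s₁ := by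
    refine Env.setVar ?_ rfl
    exact Env.setArr hs rfl
  have hX : 1 ≤ P.n * P.q * (M * P.R) := Nat.mul_pos hnq hMR
  have he₁ : s₁.var xSide = e := by simp [hs₁, he]
  refine wp_while M (340 * (P.n * P.q * (M * P.R)))
    (fun k s' => s'.var xIdx = k ∧ EnumInv P E M (S e) e s k 0 s') ?_ ?_ ?_ ?_ ?_
  · refine ⟨by simp [hs₁], ?_⟩
    have hlen : s₁.arr aLen e = 1 := by simp [hs₁]
    have hrow : s₁.row = s.row := addr_row_lt (by simp [hs₁]; funext j; simp)
    refine ⟨by omega, by omega, ?_, by simp, by simp, ?_⟩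
    · rw [hlen, hrow]
      refine ⟨le_refl _, hzero, by omega, fun i hi => ⟨0, by simp [Adm], fun p hp => ?_⟩⟩
      rw [Nat.lt_one_iff.1 hi, hzero p hp, sig_zero]
    · intro e' he' hne
      exact ⟨by simp [hs₁, hne], fun i p hp => by rw [hrow]⟩
  · intro k s' _ _ _
    simp
  · rintro k s₂ hb₂ hf₂ ⟨hx₂, hI₂⟩ h
    have he₂ : s₂.var xSide = e := (hf₂.var _ rfl).trans he₁
    simp only [eval_sub, eval_get, eval_var, he₂, hx₂] at h
    have := hI₂.len_le
    omega
  · rintro k s₂ hb₂ hf₂ ⟨hx₂, hI₂⟩ h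
    have he₂ : s₂.var xSide = e := (hf₂.var _ rfl).trans he₁
    have hE₂ := hE₁.frame hf₂ rfl
    simp only [eval_sub, eval_get, eval_var, he₂, hx₂] at h
    have hkL : k < s₂.arr aLen e := by omega
    refine wp_seq (wp_forLt (fun j s' => k < s'.arr aLen e ∧ EnumInv P E M (S e) e s k j s')
      (320 * (M * P.R)) rfl rfl rfl ⟨hkL, hI₂.congr rfl rfl⟩ ?_ ?_)
    · rintro j s₃ hj hb₃ hf₃ hx₃ ⟨hkL₃, hI₃⟩
      rw [hE₂.nq] at hj
      refine wp_mono (wp_extend hb (hE₂.frame hf₃ rfl) hM ((hf₃.var _ rfl).trans he₂) heE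
        ((hf₃.var _ rfl).trans hx₂) hx₃ hj hkL₃ hI₃) ?_
      rintro t s₄ hb₄ hf₄ ⟨ht, hkL₄, hI₄⟩
      exact ⟨ht, hkL₄, hI₄.congr rfl rfl⟩
    · rintro t s₃ ht hb₃ hf₃ hx₃ ⟨hkL₃, hI₃⟩
      rw [hE₂.nq] at ht hI₃
      have hx₃' : s₃.var xIdx = k := (hf₃.var _ rfl).trans hx₂
      have := hI₃.len_le
      have := hb.M_le (by omega)
      have ht' := loop_time ht (le_refl _) hMR (le_refl _) hnq
      refine wp_assign (by simp [hx₃']; omega) ⟨by simp; omega, by simp [hx₃'], ?_⟩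
      refine ⟨hI₃.len_le, hkL₃, hI₃.list, ?_, by simp, hI₃.other⟩
      intro idx' hidx' u hu col hcol
      rcases Nat.lt_succ_iff_lt_or_eq.1 hidx' with h3 | rfl
      · exact hI₃.closed idx' h3 u hu col hcol
      · have hun : u < P.n := by simpa using (hM e heE).1 hu
        have := hI₃.closed_idx (u * P.q + col) (mul_add_lt hun hcol)
        rw [show (u * P.q + col) / P.q = u from by
            rw [Nat.add_comm, Nat.add_mul_div_right _ _ (by omega), Nat.div_eq_of_lt hcol, zero_add],
          show (u * P.q + col) % P.q = col from by
            rw [Nat.add_comm, Nat.add_mul_mod_self_right, Nat.mod_eq_of_lt hcol]] at this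
        exact this hu
  · rintro t k s₂ ht hb₂ hf₂ ⟨hx₂, hI₂⟩ h
    have he₂ : s₂.var xSide = e := (hf₂.var _ rfl).trans he₁
    simp only [eval_sub, eval_get, eval_var, he₂, hx₂] at h
    have hk : k = s₂.arr aLen e := by have := hI₂.idx_le; omega
    refine ⟨?_, ⟨hI₂.len_le, hI₂.list.zero, hI₂.list.isList ?_⟩, hI₂.other⟩
    · have ht' := loop_time (a := 345) (X := P.n * P.q * (M * P.R)) (T := 340 * (P.n * P.q * (M * P.R)) + 5) (K := M) (t := t) ?_ (by omega) hX (le_refl _) hM1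
      · have : 1 ≤ M * (P.n * P.q * (M * P.R)) := Nat.mul_pos hM1 hX
        simp; omega
      · refine ht.trans ?_
        simp only [cost_sub, cost_get, cost_var]
        have : M * (1 + 1 + 1 + 1 + 1 + 340 * (P.n * P.q * (M * P.R)))
          ≤ M * (340 * (P.n * P.q * (M * P.R)) + 5 + 8) := Nat.mul_le_mul_left _ (by omega)
        omega
    · rw [← hk]
      exact fun idx hidx u hu col hcol => by
        simpa only [hk] using hI₂.closed idx hidx u hu col hcol

/-- Enumerate the signatures on all sides. -/
def Program.enumerateAll (off d : ℕ) : Program := .forLt xSide xE (.enumerate off d)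

theorem wp_enumerateAll (hb : Bounds P B M E) (hs : Env P E S s) (hM : ListBound P M E S)
    (hE : 1 ≤ E) (hzero : ∀ e < E, ∀ p < P.R, s.row P.R E e 0 p = 0) :
    wp B (.enumerateAll P.off P.d) s fun t s' =>
      t ≤ 450 * (E * (M * (P.n * P.q * (M * P.R)))) ∧ ∀ e < E, HasList P E M S e s' := by
  refine wp_forLt (fun k s' => (∀ e < k, HasList P E M S e s') ∧
      ∀ e < E, k ≤ e → ∀ p < P.R, s'.row P.R E e 0 p = 0)
    (400 * (M * (P.n * P.q * (M * P.R)))) rfl rfl rfl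
    ⟨by simp, fun e he _ p hp => hzero e he p hp⟩ ?_ ?_
  · rintro k s₁ hk hb₁ hf₁ hx₁ ⟨h1, h2⟩
    rw [hs.sides] at hk
    refine wp_mono (wp_enumerate hb (hs.frame hf₁ rfl) hM hx₁ hk (h2 k hk (le_refl _))) ?_
    rintro t s₂ hb₂ hf₂ ⟨ht, h3, h4⟩
    refine ⟨ht, fun e he => ?_, fun e he hke p hp => ?_⟩
    · rcases Nat.lt_succ_iff_lt_or_eq.1 he with h5 | rfl
      · obtain ⟨h6, h7⟩ := h4 e (h5.trans hk) h5.ne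
        exact (h1 e h5).congr h6 h7
      · exact h3.congr rfl fun _ _ _ => rfl
    · exact ((h4 e he (by omega)).2 0 p hp).trans (h2 e he (by omega) p hp)
  · rintro t s₁ ht hb₁ hf₁ hx₁ ⟨h1, -⟩
    rw [hs.sides] at ht h1
    have hX : 1 ≤ M * (P.n * P.q * (M * P.R)) :=
      Nat.mul_pos hb.M_pos (Nat.mul_pos (Nat.mul_pos hb.n_pos hb.q_pos) hb.MR_pos)
    have := loop_time ht (le_refl _) hX (le_refl _) hE
    exact ⟨by omega, h1⟩

end WordRAM

open Prob

namespace WordRAM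

notation "xK" => 30
notation "xS" => 31
notation "xS'" => 32
notation "xCnt" => 33
notation "xA" => 34
notation "xA'" => 35
notation "xLen'" => 36
notation "xNode" => 37
notation "xCell" => 38
notation "xCand" => 39
notation "xOld" => 40
notation "aPair" => 13
notation "aTab" => 14
notation "aSol" => 15

variable {P : Prob} {E M B : ℕ} {S : ℕ → Finset ℕ} {s s' : Store}

/-- Put the signature of the union for the row `xA` of the side `xS` and the row `xA'` of the side
`xS'` into the buffer; the union lies on the side `xSide`. -/
def Program.addRows (d : ℕ) : Program :=
  .forLt xP xR <|
  .seq (.assign xW (.var xP - .var xP / .var xN * .var xN)) <|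
  .ite (.get aMask (.var xSide * .var xN + .var xW)) (.store aBuf (.var xP) 0) <|
  .seq (.assign xVal (.get aRow (.addr (.var xR) (.var xE) (.var xS) (.var xA) (.var xP)) +
    .get aRow (.addr (.var xR) (.var xE) (.var xS') (.var xA') (.var xP)))) <|
  .store aBuf (.var xP) (.var xVal - (.var xVal - .const d))

theorem wp_addRows (hb : Bounds P B M E) (hs : Env P E S s) {e e₁ e₂ i j : ℕ}
    (he : s.var xSide = e) (heE : e < E) (he₁ : s.var xS = e₁) (heE₁ : e₁ < E)
    (he₂ : s.var xS' = e₂) (heE₂ : e₂ < E) (hi : s.var xA = i) (hiM : i < M)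
    (hj : s.var xA' = j) (hjM : j < M) (hrow₁ : ∀ p < P.R, s.row P.R E e₁ i p ≤ P.d)
    (hrow₂ : ∀ p < P.R, s.row P.R E e₂ j p ≤ P.d) :
    wp B (.addRows P.d) s fun t s' => t ≤ 100 * P.R ∧ ∀ p < P.R, s'.arr aBuf p =
      if p % P.n ∈ S e then 0 else min P.d (s.row P.R E e₁ i p + s.row P.R E e₂ j p) := by
  refine wp_forLt (fun k s' => ∀ p < k, s'.arr aBuf p =
      if p % P.n ∈ S e then 0 else min P.d (s.row P.R E e₁ i p + s.row P.R E e₂ j p))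
    80 rfl rfl rfl (by simp) ?_ ?_
  · intro p s₁ hp hb₁ hf₁ hx₁ hI
    rw [hs.width] at hp
    have hdiv : p / P.n * P.n + p % P.n = p := Nat.div_add_mod' p P.n
    have hmod : p % P.n < P.n := Nat.mod_lt _ hb.n_pos
    have hpB : p ≤ B := by have := hb₁.1 xP; omega
    have hs₁ := hs.frame hf₁ rfl
    refine wp_assign_seq ?_ ?_
    · simp [hx₁, hs₁.n]; omega
    have hw : p - p / P.n * P.n = p % P.n := by omega
    simp only [eval_div, eval_var, eval_sub, eval_mul, hx₁, hs₁.n, hw]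
    set s₂ := s₁.setVar xW (p % P.n) with hs₂
    have hE₂ : Env P E S s₂ := hs₁.setVar rfl
    have h1 : s₂.var xSide = e := by simp [hs₂, (hf₁.var xSide rfl).trans he]
    have h2 : s₂.var xS = e₁ := by simp [hs₂, (hf₁.var xS rfl).trans he₁]
    have h3 : s₂.var xS' = e₂ := by simp [hs₂, (hf₁.var xS' rfl).trans he₂]
    have h4 : s₂.var xA = i := by simp [hs₂, (hf₁.var xA rfl).trans hi]
    have h5 : s₂.var xA' = j := by simp [hs₂, (hf₁.var xA' rfl).trans hj]
    have h6 : s₂.var xP = p := by simp [hs₂, hx₁]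
    have h7 : s₂.var xW = p % P.n := by simp [hs₂]
    have h8 : s₂.arr aRow = s.arr aRow := hf₁.arr _ rfl
    have h9 : s₂.arr aBuf = s₁.arr aBuf := rfl
    clear_value s₂
    have hmask := hE₂.mask e heE _ hmod
    have hd := hb.d_le
    have hr₁ := hrow₁ p hp
    have hr₂ := hrow₂ p hp
    simp only [Store.row] at hr₁ hr₂ ⊢
    refine wp_ite (ok_mul_add trivial trivial trivial (a := E) (b := P.n) (by simp [h1, heE])
      (by simp [hE₂.n]) (by simp [h7, hmod]) hb.en_le) (fun h => ?_) (fun h => ?_)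
    · have h' : p % P.n ∈ S e := by simpa [h1, hE₂.n, h7, hmask] using h
      refine wp_store trivial (by simp) ⟨by simp, fun p' hp' => ?_⟩
      rcases Nat.lt_succ_iff_lt_or_eq.1 hp' with hlt | rfl
      · simp [h6, hlt.ne, h9, hI p' hlt, Store.row]
      · simp [h6, h']
    · have h' : p % P.n ∉ S e := by simpa [h1, hE₂.n, h7, hmask] using h
      refine wp_assign_seq ⟨?_, ?_, ?_⟩ (wp_store trivial ?_ ⟨by simp, fun p' hp' => ?_⟩)
      · refine ok_addr (M := M) trivial trivial trivial trivial trivial ?_ ?_ ?_ ?_ <;>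
          simp [h2, h4, h6, hE₂.width, hE₂.sides, hp, heE₁, hiM, hb.row_le]
      · refine ok_addr (M := M) trivial trivial trivial trivial trivial ?_ ?_ ?_ ?_ <;>
          simp [h3, h5, h6, hE₂.width, hE₂.sides, hp, heE₂, hjM, hb.row_le]
      · simp only [eval_get, eval_addr, eval_var, h2, h3, h4, h5, h6, h8, hE₂.width, hE₂.sides]
        omega
      · simp; omega
      · rcases Nat.lt_succ_iff_lt_or_eq.1 hp' with hlt | rfl
        · simp [h6, hlt.ne, h9, hI p' hlt, Store.row]
        · simp [h2, h3, h4, h5, h6, h8, hE₂.width, hE₂.sides, h']; omega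
  · intro t s₁ ht hb₁ hf₁ hx₁ hI
    rw [hs.width] at ht hI
    exact ⟨by have := hb.R_pos; omega, hI⟩

/-- Fill the pair table number `xK` for the sides `xS` and `xS'` and their union on the side `xSide`. -/
def Program.pairTable (d : ℕ) : Program :=
  .seq (.assign xLen' (.get aLen (.var xS'))) <|
  .seq (.assign xCnt (.get aLen (.var xS) * .var xLen')) <|
  .forLt xT xCnt <|
  .seq (.assign xA (.var xT / .var xLen')) <|
  .seq (.assign xA' (.var xT - .var xA * .var xLen')) <|
  .seq (.addRows d) <|
  .seq .find <|
  .store aPair (.var xT * .const 3 + .var xK) (.var xRes - 1)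

theorem wp_pairTable (hb : Bounds P B M E) (hE3 : 3 ≤ E) (hs : Env P E S s) {e e₁ e₂ k : ℕ}
    (he : s.var xSide = e) (heE : e < E) (he₁ : s.var xS = e₁) (heE₁ : e₁ < E)
    (he₂ : s.var xS' = e₂) (heE₂ : e₂ < E) (hk : s.var xK = k) (hk3 : k < 3)
    (hl : HasList P E M S e s) (hl₁ : HasList P E M S e₁ s) (hl₂ : HasList P E M S e₂ s)
    (hS₁ : S e₁ ⊆ S e) (hS₂ : S e₂ ⊆ S e) :
    wp B (.pairTable P.d) s fun t s' => t ≤ 300 * (M * M * (M * P.R)) ∧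
      P.IsPairTable (S e) (s.arr aLen e₁) (s.row P.R E e₁) (s.arr aLen e₂) (s.row P.R E e₂)
        (s.arr aLen e) (s.row P.R E e) (fun i j => s'.arr aPair ((i * s.arr aLen e₂ + j) * 3 + k)) ∧
      ∀ k' < 3, k' ≠ k → ∀ j, s'.arr aPair (j * 3 + k') = s.arr aPair (j * 3 + k') := by
  have hMR := hb.MR_pos
  have hRMR : P.R ≤ M * P.R := Nat.le_mul_of_pos_left _ hb.M_pos
  have hMM : M * M * 3 ≤ B := by
    refine le_trans ?_ hb.cell_le
    rw [mul_assoc (M * M)]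
    exact Nat.mul_le_mul_left _ (by nlinarith [hb.n_pos])
  have hM1 : 1 ≤ M * M := Nat.mul_pos hb.M_pos hb.M_pos
  have hLL : s.arr aLen e₁ * s.arr aLen e₂ ≤ M * M := Nat.mul_le_mul hl₁.len_le hl₂.len_le
  refine wp_assign_seq (by simp) (wp_assign_seq (by simp [he₁, he₂]; omega) ?_)
  simp only [eval_get, eval_var, he₂, eval_mul, setVar_arr, setVar_var]
  simp only [reduceIte, Nat.reduceEqDiff, he₁]
  set s₁ := (s.setVar xLen' (s.arr aLen e₂)).setVar xCnt (s.arr aLen e₁ * s.arr aLen e₂) with hs₁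
  have hE₁ : Env P E S s₁ := (hs.setVar rfl).setVar rfl
  have hcnt : s₁.var xCnt = s.arr aLen e₁ * s.arr aLen e₂ := by simp [hs₁]
  have hlen' : s₁.var xLen' = s.arr aLen e₂ := by simp [hs₁]
  have q1 : s₁.var xSide = e := by simp [hs₁, he]
  have q2 : s₁.var xS = e₁ := by simp [hs₁, he₁]
  have q3 : s₁.var xS' = e₂ := by simp [hs₁, he₂]
  have q4 : s₁.var xK = k := by simp [hs₁, hk]
  have q5 : s₁.arr = s.arr := rfl
  clear_value s₁
  refine wp_forLt (fun j s' => (∀ t < j, s'.arr aPair (t * 3 + k) < s.arr aLen e ∧ ∀ p < P.R,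
      s.row P.R E e (s'.arr aPair (t * 3 + k)) p = if p % P.n ∈ S e then 0 else
        min P.d (s.row P.R E e₁ (t / s.arr aLen e₂) p + s.row P.R E e₂ (t % s.arr aLen e₂) p)) ∧
      ∀ k' < 3, k' ≠ k → ∀ j, s'.arr aPair (j * 3 + k') = s.arr aPair (j * 3 + k'))
    (250 * (M * P.R)) rfl rfl rfl ⟨by simp, fun k' _ _ j => by simp [q5]⟩ ?_ ?_
  · rintro j s₂ hj hb₂ hf₂ hx₂ ⟨hI, hI'⟩
    rw [hcnt] at hj
    have hjd : j / s.arr aLen e₂ < s.arr aLen e₁ := Nat.div_lt_of_lt_mul (by rwa [mul_comm])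
    have hjm : j % s.arr aLen e₂ < s.arr aLen e₂ := Nat.mod_lt _ hl₂.len_pos
    have hdm := Nat.div_add_mod' j (s.arr aLen e₂)
    have r0 : s₂.var xLen' = s.arr aLen e₂ := (hf₂.var _ rfl).trans hlen'
    have hjB : j ≤ B := by omega
    refine wp_assign_seq (by simp) (wp_assign_seq ?_ ?_)
    · simp [hx₂, r0]; omega
    simp only [eval_div, eval_var, eval_sub, eval_mul, setVar_var, hx₂, r0]
    simp only [reduceIte, Nat.reduceEqDiff]
    have hmod : j - j / s.arr aLen e₂ * s.arr aLen e₂ = j % s.arr aLen e₂ := by omega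
    rw [hmod]
    set s₃ := (s₂.setVar xA (j / s.arr aLen e₂)).setVar xA' (j % s.arr aLen e₂) with hs₃
    have hE₃ : Env P E S s₃ := ((hE₁.frame hf₂ rfl).setVar rfl).setVar rfl
    have r1 : s₃.var xSide = e := by simp [hs₃, (hf₂.var xSide rfl).trans q1]
    have r2 : s₃.var xS = e₁ := by simp [hs₃, (hf₂.var xS rfl).trans q2]
    have r3 : s₃.var xS' = e₂ := by simp [hs₃, (hf₂.var xS' rfl).trans q3]
    have r4 : s₃.var xK = k := by simp [hs₃, (hf₂.var xK rfl).trans q4]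
    have r5 : s₃.var xA = j / s.arr aLen e₂ := by simp [hs₃]
    have r6 : s₃.var xA' = j % s.arr aLen e₂ := by simp [hs₃]
    have r7 : s₃.var xT = j := by simp [hs₃, hx₂]
    have r8 : s₃.row = s.row := addr_row_lt ((hf₂.arr _ rfl).trans (by rw [q5]))
    have r9 : s₃.arr aLen = s.arr aLen := (hf₂.arr _ rfl).trans (by rw [q5])
    have r10 : s₃.arr aPair = s₂.arr aPair := rfl
    clear_value s₃
    refine wp_call_seq (wp_addRows hb hE₃ r1 heE r2 heE₁ r3 heE₂ r5 (by have := hl₁.len_le; omega)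
      r6 (by have := hl₂.len_le; omega) (fun p hp => by rw [r8]; exact hl₁.le_d hjd hp)
      (fun p hp => by rw [r8]; exact hl₂.le_d hjm hp)) ?_
    rintro t₄ s₄ hb₄ hf₄ ⟨ht₄, hbuf₄⟩
    have hE₄ := hE₃.frame hf₄ rfl
    have u8 : s₄.row = s.row := (addr_row_lt (hf₄.arr _ rfl)).trans r8
    have u9 : s₄.arr aLen = s.arr aLen := (hf₄.arr _ rfl).trans r9
    refine wp_call_seq (wp_find (M := M) hE₄.width hE₄.sides ((hf₄.var _ rfl).trans r1) heE
      (by rw [u9]) hl.len_le hb.M_pos hb.R_pos hb.row_le) ?_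
    rintro t₅ s₅ hb₅ hf₅ ⟨ht₅, hres⟩
    have w7 : s₅.var xT = j := by rw [hf₅.var _ rfl, hf₄.var _ rfl, r7]
    have w4 : s₅.var xK = k := by rw [hf₅.var _ rfl, hf₄.var _ rfl, r4]
    have w10 : s₅.arr aPair = s₂.arr aPair := by rw [hf₅.arr _ rfl, hf₄.arr _ rfl, r10]
    rw [u8] at hres
    rw [r8] at hbuf₄
    obtain ⟨i, hi, hri, hrow⟩ : ∃ i < s.arr aLen e, s₅.var xRes = i + 1 ∧
        ∀ p < P.R, s.row P.R E e i p = s₄.arr aBuf p := by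
      rcases hres with ⟨_, h⟩ | h
      · obtain ⟨i, hi, hi'⟩ := hl₁.list.exists_pair hl₂.list hl.list hS₁ hS₂ hjd hjm
        obtain ⟨p, hp, hne⟩ := h i hi
        exact absurd (by rw [hi' p hp, hbuf₄ p hp]) hne
      · exact h
    have hB3 : 3 ≤ B := by omega
    refine wp_store ?_ (by simpa using hb.one_le) ⟨by simp; omega, fun t ht => ?_,
      fun k' hk' hne t => ?_⟩
    · refine ok_mul_add trivial (by simpa) trivial (a := M * M) (b := 3) ?_ rfl ?_ hMM
      · simp [w7]; omega
      · simp [w4, hk3]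
    · simp only [setVar_arr, setArr_arr, eval_add, eval_mul, eval_var, eval_const, w7, w4, eval_sub,
        eval_one, hri, w10, true_and]
      rcases Nat.lt_succ_iff_lt_or_eq.1 ht with hlt | rfl
      · rw [if_neg (by omega)]
        exact hI t hlt
      · rw [if_pos rfl, Nat.add_sub_cancel]
        exact ⟨hi, fun p hp => by rw [hrow p hp, hbuf₄ p hp]⟩
    · simp only [setVar_arr, setArr_arr, eval_add, eval_mul, eval_var, eval_const, w7, w4, w10,
        true_and]
      rw [if_neg (by omega)]
      exact hI' k' hk' hne t
  · rintro t s₂ ht hb₂ hf₂ hx₂ ⟨hI, hI'⟩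
    rw [hcnt] at ht hI
    have := loop_time ht (le_refl _) hMR hLL hM1
    have hX : 1 ≤ M * M * (M * P.R) := Nat.mul_pos hM1 hMR
    refine ⟨by simp; omega, fun i hi j hj => ?_, hI'⟩
    have h := hI (i * s.arr aLen e₂ + j) (mul_add_lt hi hj)
    rw [show (i * s.arr aLen e₂ + j) / s.arr aLen e₂ = i from by
        rw [Nat.add_comm, Nat.add_mul_div_right _ _ (by omega), Nat.div_eq_of_lt hj, zero_add],
      show (i * s.arr aLen e₂ + j) % s.arr aLen e₂ = j from by
        rw [Nat.add_comm, Nat.add_mul_mod_self_right, Nat.mod_eq_of_lt hj]] at h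
    exact h

/-! ### Tables of partial solutions in memory -/

/-- The cell `p` of the entry `cell` of the table of the node `x`: for `p < n` the colour of the
vertex `p` in the stored solution, for `p = n` the stored value. -/
def Store.tab (s : Store) (n nodes x cell p : ℕ) : ℕ := s.arr aTab (addr (n + 1) nodes x cell p)

/-- An expression for the address of a cell of the entry `xCell` of the table of the node `xNode`. -/
def Expr.tabAddr (x cell p : Expr) : Expr := .addr (.var xN + 1) (.var xNodes) x cell p

/-- Replace the entry `xCell` of the table of the node `xNode` by the solution in the array `aSol` with
the value `xCand`, if this is better. -/
def Program.relax : Program :=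
  .seq (.assign xOld (.get aTab (.tabAddr (.var xNode) (.var xCell) (.var xN)))) <|
  .ite (1 - .var xOld + (.var xOld - .var xCand))
    (.seq (.store aTab (.tabAddr (.var xNode) (.var xCell) (.var xN)) (.var xCand)) <|
      .forLt xW xN <|
        .store aTab (.tabAddr (.var xNode) (.var xCell) (.var xW)) (.get aSol (.var xW))) .skip

theorem ok_tabAddr (hb : Bounds P B M E) (hs : Env P E S s) {x cell p : Expr} (hx : x.Ok B s)
    (hcell : cell.Ok B s) (hp : p.Ok B s) (h1 : x.eval s < E / 2) (h2 : cell.eval s < M * M)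
    (h3 : p.eval s ≤ P.n) : (Expr.tabAddr x cell p).Ok B s := by
  have := hb.nn_le
  have h4 : P.n + 1 ≤ M * M * (P.n + 1) * E := by
    rw [mul_assoc, mul_comm, mul_assoc]
    exact Nat.le_mul_of_pos_right _ (Nat.mul_pos (by omega) (by omega))
  have := hb.cell_le
  refine ok_addr (M := M * M) ?_ trivial hx hcell hp (by simpa [hs.nodes] using h1)
    (by simp [hs.n]; omega) h2 ?_
  · simp [hs.n]; omega
  · simp only [eval_add, eval_var, eval_one, hs.n, hs.nodes]
    exact le_trans (Nat.mul_le_mul_left _ (by omega)) hb.cell_le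

/-- The effect of `relax` on the entry `(x, cell)`, whose stored value and solution are compared with
the value `cand` and the solution `sol`. -/
structure Relaxed (n nodes x cell cand : ℕ) (sol : ℕ → ℕ) (s s' : Store) : Prop where
  other : ∀ x' < nodes, ∀ cell', (x' ≠ x ∨ cell' ≠ cell) →
    ∀ p ≤ n, s'.tab n nodes x' cell' p = s.tab n nodes x' cell' p
  cases : (s'.tab n nodes x cell n = cand ∧ (∀ p < n, s'.tab n nodes x cell p = sol p) ∧
      (s.tab n nodes x cell n = 0 ∨ cand ≤ s.tab n nodes x cell n)) ∨
    ((∀ p ≤ n, s'.tab n nodes x cell p = s.tab n nodes x cell p) ∧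
      s.tab n nodes x cell n ≠ 0 ∧ s.tab n nodes x cell n ≤ cand)

theorem wp_relax (hb : Bounds P B M E) (hs : Env P E S s) {x cell cand : ℕ}
    (hx : s.var xNode = x) (hxE : x < E / 2) (hcell : s.var xCell = cell) (hcM : cell < M * M)
    (hcand : s.var xCand = cand) :
    wp B .relax s fun t s' => t ≤ 100 * P.R ∧ Relaxed P.n (E / 2) x cell cand (s.arr aSol) s s' := by
  have hnR : P.n ≤ P.R := Nat.le_mul_of_pos_left _ (Nat.mul_pos two_pos hb.c_pos)
  have hn1 := hb.n_pos
  refine wp_assign_seq (ok_tabAddr hb hs trivial trivial trivial (by simpa [hx]) (by simpa [hcell])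
    (by simp [hs.n])) ?_
  have hold : Expr.eval s (.get aTab (.tabAddr (.var xNode) (.var xCell) (.var xN)))
      = s.tab P.n (E / 2) x cell P.n := by
    simp [Expr.tabAddr, Store.tab, hs.n, hs.nodes, hx, hcell]
  rw [hold]
  set s₁ := s.setVar xOld (s.tab P.n (E / 2) x cell P.n) with hs₁
  have hE₁ : Env P E S s₁ := hs.setVar rfl
  have q1 : s₁.var xNode = x := by simp [hs₁, hx]
  have q2 : s₁.var xCell = cell := by simp [hs₁, hcell]
  have q3 : s₁.var xCand = cand := by simp [hs₁, hcand]
  have q4 : s₁.var xOld = s.tab P.n (E / 2) x cell P.n := by simp [hs₁]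
  have q5 : s₁.arr = s.arr := rfl
  clear_value s₁
  refine wp_bdd fun hb₁ => wp_ite ?_ (fun h => ?_) (fun h => wp_skip ?_)
  · have := hb.one_le
    have := hb₁.1 xOld
    simp; omega
  · simp only [eval_add, eval_sub, eval_one, eval_var, q4, q3] at h
    refine wp_store_seq (ok_tabAddr hb hE₁ trivial trivial trivial (by simpa [q1]) (by simpa [q2])
      (by simp [hE₁.n])) trivial ?_
    have ha : Expr.eval s₁ (.tabAddr (.var xNode) (.var xCell) (.var xN))
        = addr (P.n + 1) (E / 2) x cell P.n := by
      simp [Expr.tabAddr, hE₁.n, hE₁.nodes, q1, q2]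
    rw [ha, eval_var, q3]
    set s₂ := s₁.setArr aTab (addr (P.n + 1) (E / 2) x cell P.n) cand with hs₂
    have hE₂ : Env P E S s₂ := Env.setArr hE₁ rfl
    refine wp_forLt (fun k s' => (∀ p < k, s'.tab P.n (E / 2) x cell p = s.arr aSol p) ∧
      s'.tab P.n (E / 2) x cell P.n = cand ∧
      ∀ x' < E / 2, ∀ cell', (x' ≠ x ∨ cell' ≠ cell) →
        ∀ p ≤ P.n, s'.tab P.n (E / 2) x' cell' p = s.tab P.n (E / 2) x' cell' p) 20 rfl rfl rfl ?_ ?_ ?_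
    · refine ⟨by simp, by simp [Store.tab, hs₂], fun x' hx' cell' hne p hp => ?_⟩
      simp only [Store.tab, setVar_arr, hs₂, setArr_arr, q5,
        addr_inj hx' hxE (show p < P.n + 1 by omega) (show P.n < P.n + 1 by omega)]
      rw [if_neg]
      rintro ⟨-, rfl, rfl, -⟩
      simp at hne
    · rintro k s₃ hk hb₃ hf₃ hx₃ ⟨h1, h2, h3⟩
      rw [hE₂.n] at hk
      have hE₃ : Env P E S s₃ := hE₂.frame hf₃ rfl
      have w1 : s₃.var xNode = x := (hf₃.var _ rfl).trans q1
      have w2 : s₃.var xCell = cell := (hf₃.var _ rfl).trans q2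
      have w3 : s₃.arr aSol = s.arr aSol := by
        rw [hf₃.arr _ rfl]; funext j; simp [hs₂, q5]
      have ha₃ : Expr.eval s₃ (.tabAddr (.var xNode) (.var xCell) (.var xW))
          = addr (P.n + 1) (E / 2) x cell k := by
        simp [Expr.tabAddr, hE₃.n, hE₃.nodes, w1, w2, hx₃]
      refine wp_store (ok_tabAddr hb hE₃ trivial trivial trivial (by simpa [w1]) (by simpa [w2])
        (by simp [hx₃]; omega)) trivial ?_
      rw [ha₃]
      refine ⟨by simp [Expr.tabAddr], fun p hp => ?_, ?_, fun x' hx' cell' hne p hp => ?_⟩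
      · rcases Nat.lt_succ_iff_lt_or_eq.1 hp with hlt | rfl
        · have := h1 p hlt
          simp only [Store.tab] at this
          simp only [Store.tab, setVar_arr, setArr_arr, addr_inj hxE hxE
            (show p < P.n + 1 by omega) (show k < P.n + 1 by omega), this]
          rw [if_neg (by omega)]
        · simp [Store.tab, hx₃, w3]
      · simp only [Store.tab] at h2
        simp only [Store.tab, setVar_arr, setArr_arr, addr_inj hxE hxE
            (show P.n < P.n + 1 by omega) (show k < P.n + 1 by omega), h2]
        rw [if_neg (by omega)]
      · have := h3 x' hx' cell' hne p hp
        simp only [Store.tab] at this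
        simp only [Store.tab, setVar_arr, setArr_arr, addr_inj hx' hxE
            (show p < P.n + 1 by omega) (show k < P.n + 1 by omega), this]
        rw [if_neg]
        rintro ⟨-, rfl, rfl, -⟩
        simp at hne
    · rintro t s₃ ht hb₃ hf₃ hx₃ ⟨h1, h2, h3⟩
      rw [hE₂.n] at ht h1
      refine ⟨by simp [Expr.tabAddr]; omega, h3, .inl ⟨h2, h1, by omega⟩⟩
  · simp only [eval_add, eval_sub, eval_one, eval_var, q4, q3] at h
    refine ⟨by simp [Expr.tabAddr]; omega, fun x' _ cell' _ p _ => by simp [Store.tab, q5],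
      .inr ⟨fun p _ => by simp [Store.tab, q5], by omega, by omega⟩⟩

end WordRAM

open Prob

/-! ### The tables of the leaves -/

namespace Prob

variable {P : Prob}

theorem IsSol.congr {S : Finset ℕ} {row κ sol sol' : ℕ → ℕ} {val : ℕ} (h : P.IsSol S row κ val sol)
    (hS : S ⊆ Finset.range P.n) (he : ∀ v < P.n, sol' v = sol v) : P.IsSol S row κ val sol' := by
  have hS' : ∀ v ∈ S, sol' v = sol v := fun v hv => he v (by simpa using hS hv)
  have hc := coloured_congr hS'
  refine ⟨fun v hv => by rw [hS' v hv]; exact h.lt v hv, fun v hv hv' => by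
    rw [he v hv]; exact h.zero v hv hv', by rw [hc]; exact h.sig, fun v hv => ?_, by
    rw [cost_congr hS']; exact h.val⟩
  rw [hc, hS' v hv]
  exact h.valid v hv

theorem coloured_singleton (v : ℕ) (χ : ℕ → ℕ) : coloured {v} χ = {(χ v, v)} := by
  simp [coloured]

theorem total_singleton (col v p : ℕ) : P.total {(col, v)} p = P.vecAt col v p := by
  simp [total]

theorem valid_singleton {v : ℕ} {χ κ : ℕ → ℕ} :
    P.Valid {v} χ κ ↔ P.Allowed (χ v) v fun p => P.vecAt (χ v) v p + κ p := by
  simp [Valid, coloured_singleton, total_singleton]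

end Prob

namespace WordRAM

notation "xV" => 41
notation "xOut" => 42
notation "xLenO" => 43
notation "xKk" => 44
notation "xJJ" => 45
notation "xFlag'" => 46
notation "xPos" => 47
notation "aLeaf" => 2

variable {P : Prob} {E M B : ℕ} {S : ℕ → Finset ℕ} {s s' : Store}

/-- The stored entries of the table of the node `x` are solutions. -/
def TabSound (P : Prob) (nodes : ℕ) (T : Finset ℕ) (li lo : ℕ) (rI rO : ℕ → ℕ → ℕ) (x : ℕ)
    (s : Store) : Prop :=
  ∀ i < li, ∀ k < lo, s.tab P.n nodes x (i * lo + k) P.n ≠ 0 →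
    P.IsSol T (rI i) (rO k) (s.tab P.n nodes x (i * lo + k) P.n) (s.tab P.n nodes x (i * lo + k))

/-- The stored entries of the table of the node `x` are optimum solutions. -/
def HasTable (P : Prob) (nodes : ℕ) (T : Finset ℕ) (li lo : ℕ) (rI rO : ℕ → ℕ → ℕ) (x : ℕ)
    (s : Store) : Prop :=
  ∀ i < li, ∀ k < lo,
    P.IsBest T (rI i) (rO k) (s.tab P.n nodes x (i * lo + k) P.n) (s.tab P.n nodes x (i * lo + k))

theorem mul_add_inj {lo i i' k k' : ℕ} (hk : k < lo) (hk' : k' < lo) (h : i * lo + k = i' * lo + k') :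
    i = i' ∧ k = k' := by
  have h₃ : k = k' := by
    have := congrArg (· % lo) h
    simpa [Nat.add_comm, Nat.add_mul_mod_self_right, Nat.mod_eq_of_lt hk,
      Nat.mod_eq_of_lt hk'] using this
  subst h₃
  exact ⟨Nat.eq_of_mul_eq_mul_right (by omega) (Nat.add_right_cancel h), rfl⟩

theorem mul_add_div' {lo i k : ℕ} (hk : k < lo) : (i * lo + k) / lo = i := by
  rw [Nat.add_comm, Nat.add_mul_div_right _ _ (by omega), Nat.div_eq_of_lt hk, zero_add]

theorem Relaxed.tabSound {nodes x cand i k : ℕ} {sol : ℕ → ℕ} {T : Finset ℕ} {li lo : ℕ}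
    {rI rO : ℕ → ℕ → ℕ} (hx : x < nodes) (hk : k < lo)
    (hr : Relaxed P.n nodes x (i * lo + k) cand sol s s') (hT : T ⊆ Finset.range P.n)
    (h : TabSound P nodes T li lo rI rO x s) (hsol : P.IsSol T (rI i) (rO k) cand sol) :
    TabSound P nodes T li lo rI rO x s' := by
  have aux : ∀ i' k', (∀ p ≤ P.n, s'.tab P.n nodes x (i' * lo + k') p
      = s.tab P.n nodes x (i' * lo + k') p) → i' < li → k' < lo →
      s'.tab P.n nodes x (i' * lo + k') P.n ≠ 0 →
      P.IsSol T (rI i') (rO k') (s'.tab P.n nodes x (i' * lo + k') P.n)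
        (s'.tab P.n nodes x (i' * lo + k')) := by
    intro i' k' he hi' hk' h0
    rw [he P.n (le_refl _)] at h0 ⊢
    exact (h i' hi' k' hk' h0).congr hT fun v hv => he v hv.le
  intro i' hi' k' hk' h0
  by_cases hc : i' * lo + k' = i * lo + k
  · obtain ⟨rfl, rfl⟩ := mul_add_inj hk' hk hc
    rcases hr.cases with ⟨h1, h2, _⟩ | ⟨h1, _, _⟩
    · rw [h1]
      exact hsol.congr hT h2
    · exact aux _ _ h1 hi' hk' h0
  · exact aux i' k' (hr.other x hx _ (.inr hc)) hi' hk' h0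

theorem Relaxed.le_cand {nodes x cell cand : ℕ} {sol : ℕ → ℕ}
    (hr : Relaxed P.n nodes x cell cand sol s s') (hc : cand ≠ 0) :
    s'.tab P.n nodes x cell P.n ≠ 0 ∧ s'.tab P.n nodes x cell P.n ≤ cand := by
  rcases hr.cases with ⟨h1, _, _⟩ | ⟨h1, h2, h3⟩
  · rw [h1]; exact ⟨hc, le_refl _⟩
  · rw [h1 _ (le_refl _)]; exact ⟨h2, h3⟩

theorem Relaxed.mono {nodes x cell cand : ℕ} {sol : ℕ → ℕ} (hx : x < nodes)
    (hr : Relaxed P.n nodes x cell cand sol s s') (hc : cand ≠ 0) {cell' v : ℕ}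
    (h : s.tab P.n nodes x cell' P.n ≠ 0 ∧ s.tab P.n nodes x cell' P.n ≤ v) :
    s'.tab P.n nodes x cell' P.n ≠ 0 ∧ s'.tab P.n nodes x cell' P.n ≤ v := by
  by_cases hcell : cell' = cell
  · subst hcell
    rcases hr.cases with ⟨h1, _, h2⟩ | ⟨h1, _, _⟩
    · rw [h1]; omega
    · rwa [h1 _ (le_refl _)]
  · rwa [hr.other x hx _ (.inr hcell) _ (le_refl _)]

/-- Check whether the vertex `xV` of colour `xCol` is correct if the row `xKk` of the side `xOut`
holds the counts from outside. -/
def Program.check (off d : ℕ) : Program :=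
  .seq (.assign xFlag' 1) <|
  .forLt xJJ xC <|
  .seq (.assign xPos (.var xJJ * .var xN + .var xV)) <|
  .seq (.assign xVal (.get aRow (.addr (.var xR) (.var xE) (.var xOut) (.var xKk) (.var xPos)))) <|
  .seq (.ite (.eqE (.var xCol) (.var xJJ / 2 + .const off))
    (.assign xVal (.var xVal + .get aH (.var xV * .var xN + .var xV))) .skip) <|
  .ite (.get aOk ((.var xCol * .var xC + .var xJJ) * .const (d + 1) +
    (.var xVal - (.var xVal - .const d)))) .skip (.assign xFlag' 0)

theorem wp_check (hb : Bounds P B M E) (hs : Env P E S s) {e k v col : ℕ} (he : s.var xOut = e)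
    (heE : e < E) (hk : s.var xKk = k) (hkM : k < M) (hv : s.var xV = v) (hvn : v < P.n)
    (hcol : s.var xCol = col) (hcolq : col < P.q) (hrow : ∀ p < P.R, s.row P.R E e k p ≤ P.d) :
    wp B (.check P.off P.d) s fun t s' => t ≤ 100 * P.R ∧ (s'.var xFlag' ≠ 0 ↔
      P.Allowed col v fun p => P.vecAt col v p + s.row P.R E e k p) := by
  have hd := hb.d_le
  have hcR : 2 * P.c ≤ P.R := Nat.le_mul_of_pos_right _ hb.n_pos
  have hR1 := hb.R_pos
  refine wp_assign_seq (by simpa using hb.one_le) ?_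
  refine wp_forLt (fun j s' => s'.var xFlag' ≠ 0 ↔ ∀ jj < j,
      P.ok ((col * (2 * P.c) + jj) * (P.d + 1) +
        min P.d (P.vecAt col v (jj * P.n + v) + s.row P.R E e k (jj * P.n + v))) ≠ 0)
    70 rfl rfl rfl (by simp) ?_ ?_
  · intro jj s₁ hjj hb₁ hf₁ hx₁ hI
    have hE₁ : Env P E S s₁ := (Env.setVar hs rfl).frame hf₁ rfl
    have hjj' : jj < 2 * P.c := by simpa [hs.c] using hjj
    have q1 : s₁.var xOut = e := by rw [hf₁.var _ rfl]; simpa using he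
    have q2 : s₁.var xKk = k := by rw [hf₁.var _ rfl]; simpa using hk
    have q3 : s₁.var xV = v := by rw [hf₁.var _ rfl]; simpa using hv
    have q4 : s₁.var xCol = col := by rw [hf₁.var _ rfl]; simpa using hcol
    have q5 : s₁.arr aRow = s.arr aRow := hf₁.arr _ rfl
    have hpos := pos_lt hjj' hvn
    have hRB : P.R ≤ B := by
      refine le_trans ?_ hb.row_le
      calc P.R ≤ M * P.R := Nat.le_mul_of_pos_left _ hb.M_pos
        _ ≤ M * P.R * E := Nat.le_mul_of_pos_right _ (by omega)
    refine wp_assign_seq (ok_mul_add trivial trivial trivial (a := 2 * P.c) (b := P.n) (by simpa [hx₁])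
      (by simp [hE₁.n]) (by simp [q3, hvn]) hRB) (wp_assign_seq ?_ ?_)
    · refine ok_addr (M := M) trivial trivial trivial trivial trivial ?_ ?_ ?_ ?_ <;>
        simp [q1, q2, q3, hE₁.width, hE₁.sides, hE₁.n, hx₁, hpos, heE, hkM, hb.row_le]
    simp only [eval_add, eval_mul, eval_var, hx₁, hE₁.n, q3, eval_get, eval_addr, setVar_arr,
      setVar_var]
    simp only [reduceIte, Nat.reduceEqDiff, hE₁.width, hE₁.sides, q1, q2, q5]
    change wp B _ ((s₁.setVar xPos (jj * P.n + v)).setVar xVal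
      (s.row P.R E e k (jj * P.n + v))) _
    set s₂ := (s₁.setVar xPos (jj * P.n + v)).setVar xVal (s.row P.R E e k (jj * P.n + v)) with hs₂
    have hE₂ : Env P E S s₂ := (Env.setVar (Env.setVar hE₁ rfl) rfl)
    have hr := hrow _ hpos
    have hval : wp B (.ite (.eqE (.var xCol) (.var xJJ / 2 + .const P.off))
        (.assign xVal (.var xVal + .get aH (.var xV * .var xN + .var xV))) .skip) s₂
        fun t s' => t ≤ 30 ∧ s'.var xVal
          = P.vecAt col v (jj * P.n + v) + s.row P.R E e k (jj * P.n + v) := by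
      have hvec : P.vecAt col v (jj * P.n + v)
          = if col = jj / 2 + P.off then P.h (v * P.n + v) else 0 := by
        unfold Prob.vecAt
        rw [pos_div hvn, pos_mod hvn, ite_self]
      have h1 : Expr.eval s₂ (.eqE (.var xCol) (.var xJJ / 2 + .const P.off))
          = if col = jj / 2 + P.off then 1 else 0 := by
        simp [hs₂, q4, hx₁]
      have hh := hb.h_le (v * P.n + v)
      have := mul_add_lt hvn hvn
      have := hb.nn_le
      refine wp_bdd fun hbs => wp_ite (ok_eqE hbs hb.one_le trivial ?_) (fun h => ?_) (fun h => ?_)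
      · have := hb.off_le
        have := hb.q_le
        simp [hs₂, hx₁]; omega
      · rw [h1] at h
        have h' : col = jj / 2 + P.off := by simpa using h
        refine wp_assign (by simp [hs₂, q3, hE₁.n, hE₁.h]; omega) ⟨by simp, ?_⟩
        rw [hvec, if_pos h']
        simp [hs₂, q3, hE₁.n, hE₁.h, Nat.add_comm]
      · rw [h1] at h
        have h' : ¬ col = jj / 2 + P.off := by simpa using h
        refine wp_skip ⟨by simp, ?_⟩
        rw [hvec, if_neg h']
        simp [hs₂]
    refine wp_call_seq hval ?_
    rintro t₃ s₃ hb₃ hf₃ ⟨ht₃, hv₃⟩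
    have hE₃ := hE₂.frame hf₃ rfl
    have u1 : s₃.var xCol = col := by rw [hf₃.var _ rfl]; simpa [hs₂] using q4
    have u2 : s₃.var xJJ = jj := by rw [hf₃.var _ rfl]; simpa [hs₂] using hx₁
    have u3 : s₃.var xFlag' = s₁.var xFlag' := by rw [hf₃.var _ rfl]; simp [hs₂]
    have hcap : ∀ y, y - (y - P.d) = min P.d y := fun y => by omega
    have h1 := mul_add_lt hcolq hjj'
    have hev : Expr.eval s₃ (.get aOk ((.var xCol * .var xC + .var xJJ) * .const (P.d + 1) +
        (.var xVal - (.var xVal - .const P.d)))) = P.ok ((col * (2 * P.c) + jj) * (P.d + 1) +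
        min P.d (P.vecAt col v (jj * P.n + v) + s.row P.R E e k (jj * P.n + v))) := by
      simp [hE₃.ok, hE₃.c, u1, u2, hv₃, hcap]
    refine wp_ite ?_ (fun h => wp_skip ?_) (fun h => wp_assign (by simp) ?_)
    · have h2 : P.q * (2 * P.c) ≤ B := by
        refine le_trans ?_ hb.ok_le
        exact Nat.le_mul_of_pos_right _ (by omega)
      refine ok_mul_add (a := P.q * (2 * P.c)) (b := P.d + 1)
        (ok_mul_add trivial trivial trivial (a := P.q) (b := 2 * P.c) (by simpa [u1]) (by simp [hE₃.c])
          (by simpa [u2]) h2) ?_ ?_ ?_ ?_ ?_ hb.ok_le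
      · simp; omega
      · simp; omega
      · simpa [u1, u2, hE₃.c] using h1
      · simp
      · simp; omega
    · rw [hev] at h
      refine ⟨by simp; omega, ?_⟩
      simp only [u3, hI]
      refine ⟨fun h1 j hj => ?_, fun h1 j hj => h1 j (by omega)⟩
      rcases Nat.lt_succ_iff_lt_or_eq.1 hj with hlt | rfl
      exacts [h1 j hlt, h]
    · rw [hev] at h
      refine ⟨by simp; omega, ?_⟩
      simp only [setVar_var, if_true, eval_zero, ne_eq, not_true, false_iff]
      exact fun h1 => h1 jj (by omega) h
  · intro t s₁ ht hb₁ hf₁ hx₁ hI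
    simp only [setVar_var] at ht hI
    simp only [Nat.reduceEqDiff, if_false, hs.c] at ht hI
    refine ⟨by simp; omega, hI⟩

/-- Handle the colour `xCol` at the leaf of the vertex `xV`. -/
def Program.leafColour (off d : ℕ) : Program :=
  .seq (.addVec off d) <|
  .seq .find <|
  .seq (.store aSol (.var xV) (.var xCol)) <|
  .forLt xKk xLenO <|
  .seq (.check off d) <|
  .ite (.var xFlag')
    (.seq (.assign xCell ((.var xRes - 1) * .var xLenO + .var xKk)) <|
      .seq (.assign xCand (.get aWt (.var xCol) + 1)) .relax) .skip

/-- Compute the table of the leaf of the vertex `xV`. -/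
def Program.leafTable (off d : ℕ) : Program :=
  .seq (.assign xNode (.get aLeaf (.var xV))) <|
  .seq (.assign xSide (2 * .var xNode)) <|
  .seq (.assign xOut (2 * .var xNode + 1)) <|
  .seq (.assign xLenO (.get aLen (.var xOut))) <|
  .seq (.assign xIdx 0) <|
  .seq (.assign xU (.var xV)) <|
  .seq (.forLt xCol xQ (.leafColour off d)) (.store aSol (.var xV) 0)

/-- The invariant of the computation of a leaf table: all pairs of a colour and a row of the outer
list for which `D` holds have been taken into account. -/
structure LeafInv (P : Prob) (nodes v li lo : ℕ) (rI rO : ℕ → ℕ → ℕ) (x : ℕ) (s₀ : Store)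
    (D : ℕ → ℕ → Prop) (s : Store) : Prop where
  sound : TabSound P nodes {v} li lo rI rO x s
  complete : ∀ col < P.q, ∀ k < lo, D col k → ∀ i < li,
    (∀ p < P.R, P.sig {v} {(col, v)} p = rI i p) →
    P.Allowed col v (fun p => P.vecAt col v p + rO k p) →
    s.tab P.n nodes x (i * lo + k) P.n ≠ 0 ∧ s.tab P.n nodes x (i * lo + k) P.n ≤ P.wt col + 1
  other : ∀ x' < nodes, x' ≠ x → ∀ cell, ∀ p ≤ P.n,
    s.tab P.n nodes x' cell p = s₀.tab P.n nodes x' cell p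

theorem LeafInv.congr {nodes v li lo x : ℕ} {rI rO : ℕ → ℕ → ℕ} {s₀ : Store} {D D' : ℕ → ℕ → Prop}
    (h : LeafInv P nodes v li lo rI rO x s₀ D s) (hD : ∀ col k, k < lo → D' col k → D col k)
    (h₁ : s'.arr aTab = s.arr aTab) : LeafInv P nodes v li lo rI rO x s₀ D' s' := by
  have h₂ : s'.tab = s.tab := by funext n nodes x cell p; unfold Store.tab; rw [h₁]
  refine ⟨?_, ?_, by rw [h₂]; exact h.other⟩
  · have := h.sound
    unfold TabSound at this ⊢
    rwa [h₂]
  · intro col hcol k hk hd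
    rw [h₂]
    exact h.complete col hcol k hk (hD col k hk hd)

theorem wp_leafColour (hb : Bounds P B M E) (hs : Env P E S s) {x v col : ℕ}
    {s₀ : Store} (hxE : x < E / 2) (hvn : v < P.n) (hSx : S (2 * x) = {v})
    (hl : ∀ e < E, HasList P E M S e s) (q0 : s.var xNode = x) (q1 : s.var xSide = 2 * x)
    (q2 : s.var xOut = 2 * x + 1) (q3 : s.var xLenO = s.arr aLen (2 * x + 1)) (q4 : s.var xIdx = 0)
    (q5 : s.var xU = v) (q6 : s.var xV = v) (q7 : s.var xCol = col) (hcol : col < P.q)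
    (hsol : ∀ w < P.n, w ≠ v → s.arr aSol w = 0)
    (hI : LeafInv P (E / 2) v (s.arr aLen (2 * x)) (s.arr aLen (2 * x + 1)) (s.row P.R E (2 * x))
      (s.row P.R E (2 * x + 1)) x s₀ (fun col' _ => col' < col) s) :
    wp B (.leafColour P.off P.d) s fun t s' => t ≤ 700 * (M * P.R) ∧
      (∀ w < P.n, w ≠ v → s'.arr aSol w = 0) ∧
      LeafInv P (E / 2) v (s.arr aLen (2 * x)) (s.arr aLen (2 * x + 1)) (s.row P.R E (2 * x))
        (s.row P.R E (2 * x + 1)) x s₀ (fun col' _ => col' < col + 1) s' := by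
  have hMR := hb.MR_pos
  have hR1 := hb.R_pos
  have hRMR : P.R ≤ M * P.R := Nat.le_mul_of_pos_left _ hb.M_pos
  have he : 2 * x < E := by omega
  have he' : 2 * x + 1 < E := by omega
  have hSn : ({v} : Finset ℕ) ⊆ Finset.range P.n := by simpa using hvn
  have hlI := hl _ he
  have hlO := hl _ he'
  have hnR : P.n ≤ P.R := Nat.le_mul_of_pos_left _ (Nat.mul_pos two_pos hb.c_pos)
  have hn1 := hb.n_pos
  have hMMB : M * M ≤ B := by
    refine le_trans ?_ hb.cell_le
    rw [mul_assoc (M * M)]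
    exact Nat.le_mul_of_pos_right _ (Nat.mul_pos (by omega) (by omega))
  refine wp_call_seq (wp_addVec hb hs q1 he q4 hb.M_pos q7 q5 hvn
    (fun p hp => hlI.le_d hlI.len_pos hp)) ?_
  rintro t₁ s₁ hb₁ hf₁ ⟨ht₁, hbuf₁⟩
  have hE₁ := hs.frame hf₁ rfl
  have r8 : s₁.row = s.row := addr_row_lt (hf₁.arr _ rfl)
  have r9 : s₁.arr aLen = s.arr aLen := hf₁.arr _ rfl
  refine wp_call_seq (wp_find (M := M) hE₁.width hE₁.sides ((hf₁.var _ rfl).trans q1) he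
    (by rw [r9]) hlI.len_le hb.M_pos hb.R_pos hb.row_le) ?_
  rintro t₂ s₂ hb₂ hf₂ ⟨ht₂, hres⟩
  rw [r8] at hres
  have hbuf : ∀ p < P.R, s₁.arr aBuf p = P.sig {v} {(col, v)} p := by
    intro p hp
    have h := sig_cons (P := P) {v} col v 0 p
    rw [Multiset.cons_zero] at h
    rw [hbuf₁ p hp, h, hSx]
    exact addRow_congr (by rw [hlI.zero p hp, sig_zero])
  obtain ⟨i, hi, hri, hrow⟩ : ∃ i < s.arr aLen (2 * x), s₂.var xRes = i + 1 ∧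
      ∀ p < P.R, s.row P.R E (2 * x) i p = P.sig {v} {(col, v)} p := by
    rcases hres with ⟨_, h⟩ | ⟨i, hi, h1, h2⟩
    · obtain ⟨i, hi, hi'⟩ := hlI.list.complete {(col, v)} (by simp [Adm, hcol, hSx])
      obtain ⟨p, hp, hne⟩ := h i hi
      rw [hSx] at hi'
      exact absurd (by rw [hi' p hp, hbuf p hp]) hne
    · exact ⟨i, hi, h1, fun p hp => by rw [h2 p hp, hbuf p hp]⟩
  refine wp_store_seq trivial trivial ?_
  have q6₂ : s₂.var xV = v := by rw [hf₂.var _ rfl, hf₁.var _ rfl, q6]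
  have q7₂ : s₂.var xCol = col := by rw [hf₂.var _ rfl, hf₁.var _ rfl, q7]
  simp only [eval_var, q6₂, q7₂]
  set s₃ := s₂.setArr aSol v col with hs₃
  have hE₃ : Env P E S s₃ := Env.setArr (hE₁.frame hf₂ rfl) rfl
  have u0 : s₃.var xNode = x := by rw [hs₃, setArr_var, hf₂.var _ rfl, hf₁.var _ rfl, q0]
  have u2 : s₃.var xOut = 2 * x + 1 := by rw [hs₃, setArr_var, hf₂.var _ rfl, hf₁.var _ rfl, q2]
  have u3 : s₃.var xLenO = s.arr aLen (2 * x + 1) := by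
    rw [hs₃, setArr_var, hf₂.var _ rfl, hf₁.var _ rfl, q3]
  have u6 : s₃.var xV = v := by rw [hs₃, setArr_var, q6₂]
  have u7 : s₃.var xCol = col := by rw [hs₃, setArr_var, q7₂]
  have u10 : s₃.var xRes = i + 1 := by rw [hs₃, setArr_var, hri]
  have u8 : s₃.row = s.row := by
    refine Eq.trans (addr_row_lt ?_) r8
    rw [← hf₂.arr aRow rfl, hs₃]; funext j; simp
  have u11 : s₃.arr aTab = s.arr aTab := by
    rw [← hf₁.arr aTab rfl, ← hf₂.arr aTab rfl, hs₃]; funext j; simp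
  have usol : ∀ w < P.n, s₃.arr aSol w = if w = v then col else 0 := by
    intro w hw
    by_cases hwv : w = v
    · simp [hs₃, hwv]
    · simp [hs₃, hwv]
      rw [hf₂.arr _ rfl, hf₁.arr _ rfl]
      exact hsol w hw hwv
  clear_value s₃
  refine wp_forLt (fun kk s' => LeafInv P (E / 2) v (s.arr aLen (2 * x)) (s.arr aLen (2 * x + 1))
      (s.row P.R E (2 * x)) (s.row P.R E (2 * x + 1)) x s₀
      (fun col' k => col' < col ∨ col' = col ∧ k < kk) s') (250 * P.R) rfl rfl rfl ?_ ?_ ?_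
  · exact hI.congr (fun col' k _ h => by omega) u11
  · intro k s₄ hk hb₄ hf₄ hx₄ hI₄
    rw [u3] at hk
    have hE₄ := hE₃.frame hf₄ rfl
    have w8 : s₄.row = s.row := (addr_row_lt (hf₄.arr _ rfl)).trans u8
    refine wp_call_seq (wp_check hb hE₄ ((hf₄.var _ rfl).trans u2) he' hx₄
      (lt_of_lt_of_le hk hlO.len_le) ((hf₄.var _ rfl).trans u6) hvn ((hf₄.var _ rfl).trans u7) hcol
      (fun p hp => by rw [w8]; exact hlO.le_d hk hp)) ?_
    rintro t₅ s₅ hb₅ hf₅ ⟨ht₅, hflag⟩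
    rw [w8] at hflag
    have hE₅ := hE₄.frame hf₅ rfl
    have v0 : s₅.var xNode = x := by rw [hf₅.var _ rfl, hf₄.var _ rfl, u0]
    have v3 : s₅.var xLenO = s.arr aLen (2 * x + 1) := by rw [hf₅.var _ rfl, hf₄.var _ rfl, u3]
    have v7 : s₅.var xCol = col := by rw [hf₅.var _ rfl, hf₄.var _ rfl, u7]
    have v10 : s₅.var xRes = i + 1 := by rw [hf₅.var _ rfl, hf₄.var _ rfl, u10]
    have v12 : s₅.var xKk = k := by rw [hf₅.var _ rfl, hx₄]
    have vsol : s₅.arr aSol = s₃.arr aSol := by rw [hf₅.arr _ rfl, hf₄.arr _ rfl]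
    have hI₅ := hI₄.congr (fun _ _ _ h => h) (hf₅.arr aTab rfl)
    have hcell : i * s.arr aLen (2 * x + 1) + k < M * M :=
      lt_of_lt_of_le (mul_add_lt hi hk) (Nat.mul_le_mul hlI.len_le hlO.len_le)
    have hsol₅ : ∀ w < P.n, s₅.arr aSol w = if w = v then col else 0 := by rw [vsol]; exact usol
    refine wp_ite trivial (fun h => ?_) (fun h => wp_skip ?_)
    · have hal := hflag.1 h
      refine wp_assign_seq ?_ (wp_assign_seq ?_ ?_)
      · have h1 := hb.one_le
        simp [v10, v3, v12]; omega
      · have := hb.wt_le col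
        have := hb.d_le
        simp [hE₅.wt, v7]; omega
      simp only [eval_add, eval_mul, eval_sub, eval_var, eval_one, v10, v3, v12, eval_get,
        setVar_arr, setVar_var, hE₅.wt]
      simp only [reduceIte, Nat.reduceEqDiff, v7, Nat.add_sub_cancel]
      set s₆ := (s₅.setVar xCell (i * s.arr aLen (2 * x + 1) + k)).setVar xCand (P.wt col + 1) with hs₆
      have hE₆ : Env P E S s₆ := (hE₅.setVar rfl).setVar rfl
      refine wp_mono (wp_relax hb hE₆ (x := x) (by simp [hs₆, v0]) hxE
        (cell := i * s.arr aLen (2 * x + 1) + k) (by simp [hs₆]) hcell (cand := P.wt col + 1)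
        (by simp [hs₆])) ?_
      rintro t₇ s₇ hb₇ hf₇ ⟨ht₇, hrel⟩
      have hI₆ : LeafInv P (E / 2) v (s.arr aLen (2 * x)) (s.arr aLen (2 * x + 1))
        (s.row P.R E (2 * x)) (s.row P.R E (2 * x + 1)) x s₀ _ s₆ := hI₅.congr (fun _ _ _ h => h) rfl
      have hvv : s₆.arr aSol v = col := by
        have := hsol₅ v hvn
        simpa [hs₆] using this
      have hIsSol : P.IsSol {v} (s.row P.R E (2 * x) i) (s.row P.R E (2 * x + 1) k) (P.wt col + 1)
          (s₆.arr aSol) := by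
        refine ⟨by simpa [hvv] using hcol, fun w hw hwv => ?_, fun p hp => ?_, ?_, ?_⟩
        · have := hsol₅ w hw
          simpa [hs₆, show w ≠ v by simpa using hwv] using this
        · rw [coloured_singleton, hvv, hrow p hp]
        · rw [valid_singleton, hvv]
          exact hal
        · simp [Prob.cost, hvv]
      refine ⟨by simp; omega, ?_, ?_, ?_⟩
      · exact (show Relaxed P.n (E / 2) x _ _ _ s₆ (s₇.setVar xKk (k + 1)) from
          ⟨hrel.other, hrel.cases⟩).tabSound hxE hk hSn hI₆.sound hIsSol
      · intro col' hcol' k' hk' hD i' hi' hrow' hal'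
        change s₇.tab P.n (E / 2) x (i' * s.arr aLen (2 * x + 1) + k') P.n ≠ 0 ∧
          s₇.tab P.n (E / 2) x (i' * s.arr aLen (2 * x + 1) + k') P.n ≤ P.wt col' + 1
        by_cases hnew : col' = col ∧ k' = k
        · obtain ⟨rfl, rfl⟩ := hnew
          have : i' = i := hlI.list.inj i' hi' i hi fun p hp => by rw [← hrow' p hp, hrow p hp]
          subst this
          exact hrel.le_cand (by omega)
        · exact hrel.mono hxE (by omega) (hI₆.complete col' hcol' k' hk' (by omega) i' hi' hrow' hal')
      · intro x' hx' hne cell p hp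
        exact (hrel.other x' hx' cell (.inl hne) p hp).trans (hI₆.other x' hx' hne cell p hp)
    · have hal : ¬ _ := fun h1 => hflag.2 h1 h
      refine ⟨by simp; omega, hI₅.sound, ?_, hI₅.other⟩
      intro col' hcol' k' hk' hD i' hi' hrow' hal'
      by_cases hnew : col' = col ∧ k' = k
      · obtain ⟨rfl, rfl⟩ := hnew
        exact absurd hal' hal
      · exact hI₅.complete col' hcol' k' hk' (by omega) i' hi' hrow' hal'
  · intro t s₄ ht hb₄ hf₄ hx₄ hI₄
    rw [u3] at ht hI₄
    have ht' := loop_time ht (le_refl _) hR1 hlO.len_le hb.M_pos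
    refine ⟨by simp; omega, fun w hw hwv => ?_, ?_⟩
    · rw [hf₄.arr _ rfl, usol w hw, if_neg hwv]
    · exact hI₄.congr (fun col' k hk h => by omega) rfl

theorem wp_leafTable (hb : Bounds P B M E) (hs : Env P E S s) {x v : ℕ}
    (hxE : x < E / 2) (hvn : v < P.n) (hSx : S (2 * x) = {v})
    (hl : ∀ e < E, HasList P E M S e s) (q6 : s.var xV = v) (hx : s.arr aLeaf v = x)
    (hsol : ∀ w < P.n, s.arr aSol w = 0)
    (htab : ∀ cell, ∀ p ≤ P.n, s.tab P.n (E / 2) x cell p = 0) :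
    wp B (.leafTable P.off P.d) s fun t s' => t ≤ 800 * (P.q * (M * P.R)) ∧
      (∀ w < P.n, s'.arr aSol w = 0) ∧
      HasTable P (E / 2) (S (2 * x)) (s.arr aLen (2 * x)) (s.arr aLen (2 * x + 1))
        (s.row P.R E (2 * x)) (s.row P.R E (2 * x + 1)) x s' ∧
      ∀ x' < E / 2, x' ≠ x → ∀ cell, ∀ p ≤ P.n,
        s'.tab P.n (E / 2) x' cell p = s.tab P.n (E / 2) x' cell p := by
  have hMR := hb.MR_pos
  have hEB := hb.E_le
  have h2B : 2 ≤ B := by have := hb.d_le; omega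
  refine wp_assign_seq trivial (wp_assign_seq (by simp [q6, hx]; omega)
    (wp_assign_seq (by simp [q6, hx]; omega) (wp_assign_seq trivial
      (wp_assign_seq (by simp) (wp_assign_seq trivial ?_)))))
  simp only [eval_get, eval_var, q6, hx, eval_mul, eval_two, setVar_var, eval_add, eval_one,
    setVar_arr, eval_zero]
  simp only [reduceIte, Nat.reduceEqDiff]
  set s₁ := (((((s.setVar xNode x).setVar xSide (2 * x)).setVar xOut (2 * x + 1)).setVar xLenO
    (s.arr aLen (2 * x + 1))).setVar xIdx 0).setVar xU v with hs₁
  have hE₁ : Env P E S s₁ :=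
    (((((hs.setVar rfl).setVar rfl).setVar rfl).setVar rfl).setVar rfl).setVar rfl
  have u0 : s₁.var xNode = x := by simp [hs₁]
  have u1 : s₁.var xSide = 2 * x := by simp [hs₁]
  have u2 : s₁.var xOut = 2 * x + 1 := by simp [hs₁]
  have u3 : s₁.var xLenO = s.arr aLen (2 * x + 1) := by simp [hs₁]
  have u4 : s₁.var xIdx = 0 := by simp [hs₁]
  have u5 : s₁.var xU = v := by simp [hs₁]
  have u6 : s₁.var xV = v := by simp [hs₁, q6]
  have u7 : s₁.arr = s.arr := rfl
  clear_value s₁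
  refine wp_seq (wp_forLt (fun col s' => (∀ w < P.n, w ≠ v → s'.arr aSol w = 0) ∧
      LeafInv P (E / 2) v (s.arr aLen (2 * x)) (s.arr aLen (2 * x + 1)) (s.row P.R E (2 * x))
        (s.row P.R E (2 * x + 1)) x s (fun col' _ => col' < col) s')
    (700 * (M * P.R)) rfl rfl rfl ⟨fun w hw _ => ?_, ?_, ?_, ?_⟩ ?_ ?_)
  · simpa [u7] using hsol w hw
  · intro i hi k hk h
    exact absurd (by simpa [Store.tab, u7] using htab (i * s.arr aLen (2 * x + 1) + k) P.n (le_refl _)) h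
  · intro col _ k _ h
    omega
  · intro x' _ _ cell p _
    simp [Store.tab, u7]
  · rintro col s₂ hcol hb₂ hf₂ hx₂ ⟨h1, h2⟩
    rw [hE₁.q] at hcol
    have r8 : s₂.row = s.row := addr_row_lt (by rw [hf₂.arr _ rfl, u7])
    have r9 : s₂.arr aLen = s.arr aLen := by rw [hf₂.arr _ rfl, u7]
    have hl₂ : ∀ e < E, HasList P E M S e s₂ := fun e he =>
      (hl e he).congr (by rw [r9]) fun _ _ _ => by rw [r8]
    have := wp_leafColour (s₀ := s) hb (hE₁.frame hf₂ rfl) hxE hvn hSx hl₂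
      ((hf₂.var _ rfl).trans u0) ((hf₂.var _ rfl).trans u1) ((hf₂.var _ rfl).trans u2)
      ((hf₂.var _ rfl).trans (by rw [u3, r9])) ((hf₂.var _ rfl).trans u4) ((hf₂.var _ rfl).trans u5)
      ((hf₂.var _ rfl).trans u6) hx₂ hcol h1 (by rw [r8, r9]; exact h2)
    rw [r8, r9] at this
    refine wp_mono this ?_
    rintro t s₃ hb₃ hf₃ ⟨ht, h3, h4⟩
    exact ⟨ht, h3, h4.congr (fun _ _ _ h => h) rfl⟩
  · rintro t s₂ ht hb₂ hf₂ hx₂ ⟨h1, h2⟩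
    rw [hE₁.q] at ht h2
    have ht' := loop_time ht (le_refl _) hMR (le_refl _) hb.q_pos
    have : 1 ≤ P.q * (M * P.R) := Nat.mul_pos hb.q_pos hMR
    have hv₂ : s₂.var xV = v := (hf₂.var _ rfl).trans u6
    have h3 : LeafInv P (E / 2) v (s.arr aLen (2 * x)) (s.arr aLen (2 * x + 1)) (s.row P.R E (2 * x))
        (s.row P.R E (2 * x + 1)) x s (fun col' _ => col' < P.q) (s₂.setArr aSol v 0) :=
      h2.congr (fun _ _ _ h => h) (by funext j; simp)
    refine wp_store trivial (by simp) ?_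
    simp only [eval_var, hv₂, eval_zero]
    refine ⟨by simp; omega, fun w hw => ?_, ?_, h3.other⟩
    · by_cases hwv : w = v
      · simp [hwv]
      · simpa [hwv] using h1 w hw hwv
    · intro i hi k hk
      refine ⟨fun h => by rw [hSx]; exact h3.sound i hi k hk h, fun χ hχ hsig hval => ?_⟩
      rw [hSx] at hχ hsig hval ⊢
      rw [coloured_singleton] at hsig
      have hcol := hχ v (by simp)
      have := h3.complete (χ v) hcol k hk hcol i hi hsig (valid_singleton.1 hval)
      simpa [Prob.cost] using this

/-- The sets `S (2 * x)` of the nodes `x < N` are obtained from the singletons of the leaves by `K`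
disjoint unions, the last of which gives all vertices; `S (2 * x + 1)` is the complement. -/
structure JoinSeq (n N K : ℕ) (S : ℕ → Finset ℕ) (leaf X A A' : ℕ → ℕ) : Prop where
  sub : ∀ x < N, S (2 * x) ⊆ Finset.range n
  compl : ∀ x < N, S (2 * x + 1) = Finset.range n \ S (2 * x)
  leaf_lt : ∀ v < n, leaf v < N
  leaf_set : ∀ v < n, S (2 * leaf v) = {v}
  lt : ∀ t < K, X t < N
  left_lt : ∀ t < K, A t < N
  right_lt : ∀ t < K, A' t < N
  union : ∀ t < K, S (2 * X t) = S (2 * A t) ∪ S (2 * A' t)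
  disjoint : ∀ t < K, Disjoint (S (2 * A t)) (S (2 * A' t))
  not_leaf : ∀ t < K, ∀ v < n, X t ≠ leaf v
  inj : ∀ t < K, ∀ t' < t, X t' ≠ X t
  left_ready : ∀ t < K, (∃ v < n, A t = leaf v) ∨ ∃ t' < t, A t = X t'
  right_ready : ∀ t < K, (∃ v < n, A' t = leaf v) ∨ ∃ t' < t, A' t = X t'
  top : ∃ t < K, t + 1 = K ∧ S (2 * X t) = Finset.range n

/-- The table of the node `x` is correct with respect to the lists in the memory `s₀`. -/
def NodeTable (P : Prob) (E : ℕ) (S : ℕ → Finset ℕ) (s₀ : Store) (x : ℕ) (s : Store) : Prop :=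
  HasTable P (E / 2) (S (2 * x)) (s₀.arr aLen (2 * x)) (s₀.arr aLen (2 * x + 1))
    (s₀.row P.R E (2 * x)) (s₀.row P.R E (2 * x + 1)) x s

theorem HasTable.congr {nodes li lo x : ℕ} {T : Finset ℕ} {rI rO : ℕ → ℕ → ℕ}
    (h : HasTable P nodes T li lo rI rO x s) (hT : T ⊆ Finset.range P.n)
    (he : ∀ cell, ∀ p ≤ P.n, s'.tab P.n nodes x cell p = s.tab P.n nodes x cell p) :
    HasTable P nodes T li lo rI rO x s' := by
  intro i hi k hk
  have h1 := h i hi k hk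
  refine ⟨fun h0 => ?_, fun χ => ?_⟩
  · rw [he _ _ (le_refl _)] at h0 ⊢
    exact (h1.sound h0).congr hT fun v hv => he _ v hv.le
  · rw [he _ _ (le_refl _)]
    exact h1.complete χ

/-- Compute the tables of all leaves. -/
def Program.leafTables (off d : ℕ) : Program := .forLt xV xN (.leafTable off d)

theorem wp_leafTables (hb : Bounds P B M E) (hs : Env P E S s) {K : ℕ}
    {X A A' : ℕ → ℕ} (hj : JoinSeq P.n (E / 2) K S (s.arr aLeaf) X A A')
    (hl : ∀ e < E, HasList P E M S e s) (hsol : ∀ w < P.n, s.arr aSol w = 0)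
    (htab : ∀ x < E / 2, ∀ cell, ∀ p ≤ P.n, s.tab P.n (E / 2) x cell p = 0) :
    wp B (.leafTables P.off P.d) s fun t s' => t ≤ 850 * (P.n * (P.q * (M * P.R))) ∧
      (∀ v < P.n, NodeTable P E S s (s.arr aLeaf v) s') ∧
      ∀ x < E / 2, (∀ v < P.n, x ≠ s.arr aLeaf v) → ∀ cell, ∀ p ≤ P.n,
        s'.tab P.n (E / 2) x cell p = 0 := by
  have hX : 1 ≤ P.q * (M * P.R) := Nat.mul_pos hb.q_pos hb.MR_pos
  have hinj : ∀ v < P.n, ∀ w < P.n, s.arr aLeaf v = s.arr aLeaf w → v = w := by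
    intro v hv w hw h
    have h1 := hj.leaf_set v hv
    rw [h, hj.leaf_set w hw] at h1
    exact (Finset.singleton_inj.1 h1).symm
  refine wp_forLt (fun k s' => (∀ w < P.n, s'.arr aSol w = 0) ∧
      (∀ v < P.n, v < k → NodeTable P E S s (s.arr aLeaf v) s') ∧
      ∀ x < E / 2, (∀ v < P.n, v < k → x ≠ s.arr aLeaf v) → ∀ cell, ∀ p ≤ P.n,
        s'.tab P.n (E / 2) x cell p = 0) (800 * (P.q * (M * P.R))) rfl rfl rfl
    ⟨hsol, by simp, fun x hx _ => htab x hx⟩ ?_ ?_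
  · rintro v s₁ hv hb₁ hf₁ hx₁ ⟨h1, h2, h3⟩
    rw [hs.n] at hv
    have r8 : s₁.row = s.row := addr_row_lt (hf₁.arr _ rfl)
    have r9 : s₁.arr aLen = s.arr aLen := hf₁.arr _ rfl
    have hl₁ : ∀ e < E, HasList P E M S e s₁ := fun e he =>
      (hl e he).congr (by rw [r9]) fun _ _ _ => by rw [r8]
    have := wp_leafTable hb (hs.frame hf₁ rfl) (hj.leaf_lt v hv) hv (hj.leaf_set v hv) hl₁ hx₁
      (by rw [hf₁.arr _ rfl]) h1 (h3 _ (hj.leaf_lt v hv) fun w hw hwv h => by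
        have := hinj v hv w hw h; omega)
    rw [r8, r9] at this
    refine wp_mono this ?_
    rintro t s₂ hb₂ hf₂ ⟨ht, h4, h5, h6⟩
    refine ⟨ht, h4, fun w hw hwv => ?_, fun x hx hne => ?_⟩
    · rcases Nat.lt_succ_iff_lt_or_eq.1 hwv with hlt | rfl
      · refine (h2 w hw hlt).congr (hj.sub _ (hj.leaf_lt w hw)) ?_
        exact h6 _ (hj.leaf_lt w hw) fun h => hlt.ne (hinj w hw v hv h)
      · exact HasTable.congr (s := s₂) h5 (hj.sub _ (hj.leaf_lt w hw)) fun _ _ _ => rfl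
    · intro cell p hp
      refine (h6 x hx (hne v hv (by omega)) cell p hp).trans ?_
      exact h3 x hx (fun w hw hwv => hne w hw (by omega)) cell p hp
  · rintro t s₁ ht hb₁ hf₁ hx₁ ⟨_, h2, h3⟩
    rw [hs.n] at ht h2 h3
    have := loop_time ht (le_refl _) hX (le_refl _) hb.n_pos
    exact ⟨by omega, fun v hv => h2 v hv hv, fun x hx hne => h3 x hx fun v hv _ => hne v hv⟩

end WordRAM

open Prob

/-! ### The tables of the joins -/

namespace WordRAM

notation "xStep" => 49
notation "xLeft" => 50
notation "xRight" => 51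
notation "xLR" => 52
notation "xLX" => 53
notation "xLLo" => 54
notation "xLRo" => 55
notation "xIJ" => 56
notation "xOuter" => 57
notation "xCellL" => 58
notation "xCellR" => 59
notation "xValL" => 60
notation "xValR" => 61
notation "xSteps" => 62
notation "aX" => 7
notation "aLeft" => 8
notation "aRight" => 9

variable {P : Prob} {E M B : ℕ} {S : ℕ → Finset ℕ} {s s' : Store}

/-- Put the sum of the solutions in two table entries into the array `aSol`. -/
def Program.addSol : Program :=
  .forLt xW xN <|
  .store aSol (.var xW) (.get aTab (.tabAddr (.var xLeft) (.var xCellL) (.var xW)) +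
    .get aTab (.tabAddr (.var xRight) (.var xCellR) (.var xW)))

theorem wp_addSol (hb : Bounds P B M E) (hs : Env P E S s) {a b ca cb : ℕ} (ha : s.var xLeft = a)
    (haE : a < E / 2) (hbr : s.var xRight = b) (hbE : b < E / 2) (hca : s.var xCellL = ca)
    (hcaM : ca < M * M) (hcb : s.var xCellR = cb) (hcbM : cb < M * M)
    (h₁ : ∀ w < P.n, s.tab P.n (E / 2) a ca w ≤ P.q) (h₂ : ∀ w < P.n, s.tab P.n (E / 2) b cb w ≤ P.q) :
    wp B .addSol s fun t s' => t ≤ 50 * P.R ∧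
      ∀ w < P.n, s'.arr aSol w = s.tab P.n (E / 2) a ca w + s.tab P.n (E / 2) b cb w := by
  have hnR : P.n ≤ P.R := Nat.le_mul_of_pos_left _ (Nat.mul_pos two_pos hb.c_pos)
  have hR1 := hb.R_pos
  refine wp_forLt (fun k s' => ∀ w < k, s'.arr aSol w
    = s.tab P.n (E / 2) a ca w + s.tab P.n (E / 2) b cb w) 30 rfl rfl rfl (by simp) ?_ ?_
  · intro w s₁ hw hb₁ hf₁ hx₁ hI
    rw [hs.n] at hw
    have hE₁ := hs.frame hf₁ rfl
    have q1 : s₁.var xLeft = a := (hf₁.var _ rfl).trans ha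
    have q2 : s₁.var xRight = b := (hf₁.var _ rfl).trans hbr
    have q3 : s₁.var xCellL = ca := (hf₁.var _ rfl).trans hca
    have q4 : s₁.var xCellR = cb := (hf₁.var _ rfl).trans hcb
    have q5 : s₁.arr aTab = s.arr aTab := hf₁.arr _ rfl
    have e1 : Expr.eval s₁ (.get aTab (.tabAddr (.var xLeft) (.var xCellL) (.var xW)))
        = s.tab P.n (E / 2) a ca w := by
      simp [Expr.tabAddr, Store.tab, hE₁.n, hE₁.nodes, q1, q3, hx₁, q5]
    have e2 : Expr.eval s₁ (.get aTab (.tabAddr (.var xRight) (.var xCellR) (.var xW)))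
        = s.tab P.n (E / 2) b cb w := by
      simp [Expr.tabAddr, Store.tab, hE₁.n, hE₁.nodes, q2, q4, hx₁, q5]
    have := h₁ w hw
    have := h₂ w hw
    have := hb.q_le
    refine wp_store trivial ⟨?_, ?_, ?_⟩ ⟨by simp [Expr.tabAddr], fun w' hw' => ?_⟩
    · exact ok_tabAddr hb hE₁ trivial trivial trivial (by simpa [q1]) (by simpa [q3])
        (by simp [hx₁]; omega)
    · exact ok_tabAddr hb hE₁ trivial trivial trivial (by simpa [q2]) (by simpa [q4])
        (by simp [hx₁]; omega)
    · rw [e1, e2]; omega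
    · rw [eval_add, e1, e2]
      rcases Nat.lt_succ_iff_lt_or_eq.1 hw' with hlt | rfl
      · simp [hx₁, hlt.ne, hI w' hlt]
      · simp [hx₁]
  · intro t s₁ ht hb₁ hf₁ hx₁ hI
    rw [hs.n] at ht hI
    exact ⟨by omega, hI⟩

/-- Handle one combination of a row for the left child, a row for the right child and a row for the
outside, encoded in `xT`. -/
def Program.combine : Program :=
  .seq (.assign xIJ (.var xT / .var xLX)) <|
  .seq (.assign xOuter (.var xT - .var xIJ * .var xLX)) <|
  .seq (.assign xA (.var xIJ / .var xLR)) <|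
  .seq (.assign xA' (.var xIJ - .var xA * .var xLR)) <|
  .seq (.assign xCellL (.var xA * .var xLLo +
    .get aPair ((.var xA' * .var xLX + .var xOuter) * .const 3 + 1))) <|
  .seq (.assign xCellR (.var xA' * .var xLRo +
    .get aPair ((.var xA * .var xLX + .var xOuter) * .const 3 + 2))) <|
  .seq (.assign xValL (.get aTab (.tabAddr (.var xLeft) (.var xCellL) (.var xN)))) <|
  .seq (.assign xValR (.get aTab (.tabAddr (.var xRight) (.var xCellR) (.var xN)))) <|
  .ite (.var xValL) (.ite (.var xValR)
    (.seq .addSol <|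
      .seq (.assign xCand (.var xValL + .var xValR - 1)) <|
      .seq (.assign xCell (.get aPair (.var xIJ * .const 3) * .var xLX + .var xOuter)) .relax)
    .skip) .skip

/-- The three pair tables of a join of the nodes `a` and `b` to the node `x`. -/
structure PairTables (P : Prob) (E : ℕ) (S : ℕ → Finset ℕ) (x a b : ℕ) (s₀ s : Store) : Prop where
  inner : P.IsPairTable (S (2 * x)) (s₀.arr aLen (2 * a)) (s₀.row P.R E (2 * a))
    (s₀.arr aLen (2 * b)) (s₀.row P.R E (2 * b)) (s₀.arr aLen (2 * x)) (s₀.row P.R E (2 * x))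
    fun i j => s.arr aPair ((i * s₀.arr aLen (2 * b) + j) * 3 + 0)
  left : P.IsPairTable (S (2 * a + 1)) (s₀.arr aLen (2 * b)) (s₀.row P.R E (2 * b))
    (s₀.arr aLen (2 * x + 1)) (s₀.row P.R E (2 * x + 1)) (s₀.arr aLen (2 * a + 1))
    (s₀.row P.R E (2 * a + 1)) fun j k => s.arr aPair ((j * s₀.arr aLen (2 * x + 1) + k) * 3 + 1)
  right : P.IsPairTable (S (2 * b + 1)) (s₀.arr aLen (2 * a)) (s₀.row P.R E (2 * a))
    (s₀.arr aLen (2 * x + 1)) (s₀.row P.R E (2 * x + 1)) (s₀.arr aLen (2 * b + 1))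
    (s₀.row P.R E (2 * b + 1)) fun i k => s.arr aPair ((i * s₀.arr aLen (2 * x + 1) + k) * 3 + 2)

/-- The sets of a node `x` with the children `a` and `b`. -/
structure IsJoin (n N : ℕ) (S : ℕ → Finset ℕ) (x a b : ℕ) : Prop where
  lt : x < N
  left_lt : a < N
  right_lt : b < N
  left_ne : a ≠ x
  right_ne : b ≠ x
  sub : S (2 * x) ⊆ Finset.range n
  union : S (2 * x) = S (2 * a) ∪ S (2 * b)
  disjoint : Disjoint (S (2 * a)) (S (2 * b))
  compl : S (2 * x + 1) = Finset.range n \ S (2 * x)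
  left_compl : S (2 * a + 1) = Finset.range n \ S (2 * a)
  right_compl : S (2 * b + 1) = Finset.range n \ S (2 * b)

/-- The row of the left child's outer list that belongs to a combination, as an entry of its table. -/
def cellL (a x : ℕ) (s₀ s : Store) (i j k : ℕ) : ℕ :=
  i * s₀.arr aLen (2 * a + 1) + s.arr aPair ((j * s₀.arr aLen (2 * x + 1) + k) * 3 + 1)

/-- The row of the right child's outer list that belongs to a combination, as an entry of its table. -/
def cellR (b x : ℕ) (s₀ s : Store) (i j k : ℕ) : ℕ :=
  j * s₀.arr aLen (2 * b + 1) + s.arr aPair ((i * s₀.arr aLen (2 * x + 1) + k) * 3 + 2)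

/-- The row of the inner list of the join that belongs to a combination. -/
def cellX (b : ℕ) (s₀ s : Store) (i j : ℕ) : ℕ :=
  s.arr aPair ((i * s₀.arr aLen (2 * b) + j) * 3)

theorem PairTables.isCombination {x a b : ℕ} {s₀ : Store} (h : PairTables P E S x a b s₀ s)
    (hj : IsJoin P.n (E / 2) S x a b) {i j k : ℕ} (hi : i < s₀.arr aLen (2 * a))
    (hjb : j < s₀.arr aLen (2 * b)) (hk : k < s₀.arr aLen (2 * x + 1)) :
    IsCombination P (S (2 * a)) (S (2 * b)) (s₀.row P.R E (2 * a) i) (s₀.row P.R E (2 * b) j)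
      (s₀.row P.R E (2 * x) (cellX b s₀ s i j)) (s₀.row P.R E (2 * x + 1) k)
      (s₀.row P.R E (2 * a + 1) (s.arr aPair ((j * s₀.arr aLen (2 * x + 1) + k) * 3 + 1)))
      (s₀.row P.R E (2 * b + 1) (s.arr aPair ((i * s₀.arr aLen (2 * x + 1) + k) * 3 + 2))) where
  union := by rw [← hj.union]; exact (h.inner i hi j hjb).2
  left := by rw [← hj.left_compl]; exact (h.left j hjb k hk).2
  right := by rw [← hj.right_compl]; exact (h.right i hi k hk).2

/-- The invariant of the loop over the combinations of a join: the first `t` have been handled. -/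
structure JoinInv (P : Prob) (E : ℕ) (S : ℕ → Finset ℕ) (x a b : ℕ) (s₀ sp : Store) (t : ℕ)
    (s : Store) : Prop where
  sound : TabSound P (E / 2) (S (2 * x)) (s₀.arr aLen (2 * x)) (s₀.arr aLen (2 * x + 1))
    (s₀.row P.R E (2 * x)) (s₀.row P.R E (2 * x + 1)) x s
  complete : ∀ i < s₀.arr aLen (2 * a), ∀ j < s₀.arr aLen (2 * b), ∀ k < s₀.arr aLen (2 * x + 1),
    (i * s₀.arr aLen (2 * b) + j) * s₀.arr aLen (2 * x + 1) + k < t →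
    s₀.tab P.n (E / 2) a (cellL a x s₀ sp i j k) P.n ≠ 0 →
    s₀.tab P.n (E / 2) b (cellR b x s₀ sp i j k) P.n ≠ 0 →
    s.tab P.n (E / 2) x (cellX b s₀ sp i j * s₀.arr aLen (2 * x + 1) + k) P.n ≠ 0 ∧
    s.tab P.n (E / 2) x (cellX b s₀ sp i j * s₀.arr aLen (2 * x + 1) + k) P.n ≤
      s₀.tab P.n (E / 2) a (cellL a x s₀ sp i j k) P.n +
        s₀.tab P.n (E / 2) b (cellR b x s₀ sp i j k) P.n - 1
  other : ∀ x' < E / 2, x' ≠ x → ∀ cell, ∀ p ≤ P.n,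
    s.tab P.n (E / 2) x' cell p = s₀.tab P.n (E / 2) x' cell p

theorem JoinInv.congr {x a b : ℕ} {s₀ sp : Store} {t : ℕ} (h : JoinInv P E S x a b s₀ sp t s)
    (h₁ : s'.arr aTab = s.arr aTab) : JoinInv P E S x a b s₀ sp t s' := by
  have h₂ : s'.tab = s.tab := by funext n nodes x cell p; unfold Store.tab; rw [h₁]
  refine ⟨?_, by rw [h₂]; exact h.complete, by rw [h₂]; exact h.other⟩
  have := h.sound
  unfold TabSound at this ⊢
  rwa [h₂]

set_option maxHeartbeats 1600000 in
/-- A combination of valid colourings of the two parts is valid for the union, and its cost is the sum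
of the costs; the values are `1` more than the costs, whence the `- 1`. -/
theorem wp_combine (hb : Bounds P B M E) (hs : Env P E S s) {x a b : ℕ} {s₀ sp : Store}
    (hj : IsJoin P.n (E / 2) S x a b) (hl : ∀ e < E, HasList P E M S e s₀)
    (hp : PairTables P E S x a b s₀ sp) (hsp : s.arr aPair = sp.arr aPair)
    (ha : NodeTable P E S s₀ a s₀) (hbt : NodeTable P E S s₀ b s₀) {t : ℕ} (hx : s.var xNode = x)
    (hxa : s.var xLeft = a) (hxb : s.var xRight = b) (hxT : s.var xT = t)
    (hLR : s.var xLR = s₀.arr aLen (2 * b)) (hLX : s.var xLX = s₀.arr aLen (2 * x + 1))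
    (hLLo : s.var xLLo = s₀.arr aLen (2 * a + 1)) (hLRo : s.var xLRo = s₀.arr aLen (2 * b + 1))
    (ht : t < s₀.arr aLen (2 * a) * s₀.arr aLen (2 * b) * s₀.arr aLen (2 * x + 1))
    (hI : JoinInv P E S x a b s₀ sp t s) :
    wp B .combine s fun t' s' => t' ≤ 350 * P.R ∧ JoinInv P E S x a b s₀ sp (t + 1) s' := by
  have hR1 := hb.R_pos
  have hxE := hj.lt
  have haE := hj.left_lt
  have hbE := hj.right_lt
  have hLb := (hl (2 * b) (by omega)).len_pos
  have hLx := (hl (2 * x + 1) (by omega)).len_pos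
  have hMa := (hl (2 * a) (by omega)).len_le
  have hMb := (hl (2 * b) (by omega)).len_le
  have hMx := (hl (2 * x) (by omega)).len_le
  have hMxo := (hl (2 * x + 1) (by omega)).len_le
  have hMao := (hl (2 * a + 1) (by omega)).len_le
  have hMbo := (hl (2 * b + 1) (by omega)).len_le
  set La := s₀.arr aLen (2 * a) with hLa
  set Lb := s₀.arr aLen (2 * b) with hLbd
  set Lx := s₀.arr aLen (2 * x + 1) with hLxd
  set Lao := s₀.arr aLen (2 * a + 1) with hLaod
  set Lbo := s₀.arr aLen (2 * b + 1) with hLbod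
  obtain ⟨ij, k, hk, rfl⟩ : ∃ ij k, k < Lx ∧ t = ij * Lx + k :=
    ⟨t / Lx, t % Lx, Nat.mod_lt _ hLx, (Nat.div_add_mod' t Lx).symm⟩
  have hij : ij < La * Lb := by
    by_contra h
    have := Nat.mul_le_mul_right Lx (not_lt.1 h)
    omega
  obtain ⟨i, j, hjL, rfl⟩ : ∃ i j, j < Lb ∧ ij = i * Lb + j :=
    ⟨ij / Lb, ij % Lb, Nat.mod_lt _ hLb, (Nat.div_add_mod' ij Lb).symm⟩
  have hi : i < La := by
    by_contra h
    have := Nat.mul_le_mul_right Lb (not_lt.1 h)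
    omega
  have hMM3 : M * M * 3 ≤ B := by
    refine le_trans ?_ hb.cell_le
    rw [mul_assoc (M * M)]
    exact Nat.mul_le_mul_left _ (by have := hb.n_pos; have : 4 ≤ E ∨ E < 4 := by omega
                                    rcases this with h | h
                                    · nlinarith
                                    · have := hj.left_ne; omega)
  have hpL := (hp.left j hjL k hk).1
  have hpR := (hp.right i hi k hk).1
  have hpX := (hp.inner i hi j hjL).1
  have c1 : cellL a x s₀ sp i j k < M * M := lt_of_lt_of_le (mul_add_lt hi hpL) (Nat.mul_le_mul hMa hMao)
  have c2 : cellR b x s₀ sp i j k < M * M := lt_of_lt_of_le (mul_add_lt hjL hpR) (Nat.mul_le_mul hMb hMbo)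
  have c3 : cellX b s₀ sp i j * Lx + k < M * M :=
    lt_of_lt_of_le (mul_add_lt hpX hk) (Nat.mul_le_mul hMx hMxo)
  have b1 : j * Lx + k < M * M := lt_of_lt_of_le (mul_add_lt hjL hk) (Nat.mul_le_mul hMb hMxo)
  have b2 : i * Lx + k < M * M := lt_of_lt_of_le (mul_add_lt hi hk) (Nat.mul_le_mul hMa hMxo)
  have b3 : i * Lb + j < M * M := lt_of_lt_of_le (mul_add_lt hi hjL) (Nat.mul_le_mul hMa hMb)
  refine wp_bdd fun hbd => ?_
  have htB : (i * Lb + j) * Lx + k ≤ B := by rw [← hxT]; exact hbd.1 _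
  refine wp_assign_seq (by simp) ?_
  have e1 : Expr.eval s (.var xT / .var xLX) = i * Lb + j := by
    simp [hxT, hLX, mul_add_div' hk]
  rw [e1]
  set s₁ := s.setVar xIJ (i * Lb + j) with hs₁
  have e2 : Expr.eval s₁ (.var xT - .var xIJ * .var xLX) = k := by
    simp [hs₁, hxT, hLX]
  refine wp_assign_seq (by simp [hs₁, hLX]; omega) ?_
  rw [e2]
  set s₂ := s₁.setVar xOuter k with hs₂
  have e3 : Expr.eval s₂ (.var xIJ / .var xLR) = i := by
    simp [hs₂, hs₁, hLR, mul_add_div' hjL]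
  refine wp_assign_seq (by simp) ?_
  rw [e3]
  set s₃ := s₂.setVar xA i with hs₃
  have e4 : Expr.eval s₃ (.var xIJ - .var xA * .var xLR) = j := by
    simp [hs₃, hs₂, hs₁, hLR]
  refine wp_assign_seq (by simp [hs₃, hs₂, hs₁, hLR]; omega) ?_
  rw [e4]
  set s₄ := s₃.setVar xA' j with hs₄
  have hcL : i * Lao + sp.arr aPair ((j * Lx + k) * 3 + 1) = cellL a x s₀ sp i j k := rfl
  have hcR : j * Lbo + sp.arr aPair ((i * Lx + k) * 3 + 2) = cellR b x s₀ sp i j k := rfl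
  have hcX : sp.arr aPair ((i * Lb + j) * 3) = cellX b s₀ sp i j := rfl
  have e5 : Expr.eval s₄ (.var xA * .var xLLo +
      .get aPair ((.var xA' * .var xLX + .var xOuter) * .const 3 + 1)) = cellL a x s₀ sp i j k := by
    simp [hs₄, hs₃, hs₂, hs₁, hLLo, hLX, hsp, hcL]
  refine wp_assign_seq (by simp [hs₄, hs₃, hs₂, hs₁, hLLo, hLX, hsp, hcL]; omega) ?_
  rw [e5]
  set s₅ := s₄.setVar xCellL (cellL a x s₀ sp i j k) with hs₅
  have e6 : Expr.eval s₅ (.var xA' * .var xLRo +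
      .get aPair ((.var xA * .var xLX + .var xOuter) * .const 3 + 2)) = cellR b x s₀ sp i j k := by
    simp [hs₅, hs₄, hs₃, hs₂, hs₁, hLRo, hLX, hsp, hcR]
  refine wp_assign_seq (by simp [hs₅, hs₄, hs₃, hs₂, hs₁, hLRo, hLX, hsp, hcR]; omega) ?_
  rw [e6]
  set s₆ := s₅.setVar xCellR (cellR b x s₀ sp i j k) with hs₆
  have hE₆ : Env P E S s₆ :=
    (((((hs.setVar rfl).setVar rfl).setVar rfl).setVar rfl).setVar rfl).setVar rfl
  have hta : ∀ cell, ∀ p ≤ P.n, s.tab P.n (E / 2) a cell p = s₀.tab P.n (E / 2) a cell p :=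
    hI.other a haE hj.left_ne
  have htb : ∀ cell, ∀ p ≤ P.n, s.tab P.n (E / 2) b cell p = s₀.tab P.n (E / 2) b cell p :=
    hI.other b hbE hj.right_ne
  set va := s₀.tab P.n (E / 2) a (cellL a x s₀ sp i j k) P.n with hva
  set vb := s₀.tab P.n (E / 2) b (cellR b x s₀ sp i j k) P.n with hvb
  have e7 : Expr.eval s₆ (.get aTab (.tabAddr (.var xLeft) (.var xCellL) (.var xN))) = va := by
    rw [hva, ← hta _ _ (le_refl _)]
    simp only [Expr.tabAddr, Store.tab, eval_get, eval_addr, eval_add, eval_var, eval_one, hE₆.n,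
      hE₆.nodes]
    simp [hs₆, hs₅, hs₄, hs₃, hs₂, hs₁, hxa]
  refine wp_assign_seq (ok_tabAddr hb hE₆ trivial trivial trivial
    (by simpa [hs₆, hs₅, hs₄, hs₃, hs₂, hs₁, hxa]) (by simpa [hs₆, hs₅])
    (by simp [hE₆.n])) ?_
  rw [e7]
  set s₇ := s₆.setVar xValL va with hs₇
  have hE₇ : Env P E S s₇ := hE₆.setVar rfl
  have e8 : Expr.eval s₇ (.get aTab (.tabAddr (.var xRight) (.var xCellR) (.var xN))) = vb := by
    rw [hvb, ← htb _ _ (le_refl _)]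
    simp only [Expr.tabAddr, Store.tab, eval_get, eval_addr, eval_add, eval_var, eval_one, hE₇.n,
      hE₇.nodes]
    simp [hs₇, hs₆, hs₅, hs₄, hs₃, hs₂, hs₁, hxb]
  refine wp_assign_seq (ok_tabAddr hb hE₇ trivial trivial trivial
    (by simpa [hs₇, hs₆, hs₅, hs₄, hs₃, hs₂, hs₁, hxb]) (by simpa [hs₇, hs₆])
    (by simp [hE₇.n])) ?_
  rw [e8]
  set s₈ := s₇.setVar xValR vb with hs₈
  have hE₈ : Env P E S s₈ := hE₇.setVar rfl
  have w1 : s₈.var xNode = x := by simp [hs₈, hs₇, hs₆, hs₅, hs₄, hs₃, hs₂, hs₁, hx]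
  have w2 : s₈.var xLeft = a := by simp [hs₈, hs₇, hs₆, hs₅, hs₄, hs₃, hs₂, hs₁, hxa]
  have w3 : s₈.var xRight = b := by simp [hs₈, hs₇, hs₆, hs₅, hs₄, hs₃, hs₂, hs₁, hxb]
  have w4 : s₈.var xCellL = cellL a x s₀ sp i j k := by simp [hs₈, hs₇, hs₆, hs₅]
  have w5 : s₈.var xCellR = cellR b x s₀ sp i j k := by simp [hs₈, hs₇, hs₆]
  have w6 : s₈.var xValL = va := by simp [hs₈, hs₇]
  have w7 : s₈.var xValR = vb := by simp [hs₈]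
  have w8 : s₈.var xIJ = i * Lb + j := by simp [hs₈, hs₇, hs₆, hs₅, hs₄, hs₃, hs₂, hs₁]
  have w9 : s₈.var xOuter = k := by simp [hs₈, hs₇, hs₆, hs₅, hs₄, hs₃, hs₂]
  have w10 : s₈.var xLX = Lx := by simp [hs₈, hs₇, hs₆, hs₅, hs₄, hs₃, hs₂, hs₁, hLX]
  have w11 : s₈.arr = s.arr := rfl
  have hI₈ : JoinInv P E S x a b s₀ sp ((i * Lb + j) * Lx + k) s₈ := hI.congr rfl
  clear_value s₈
  have hskip : va = 0 ∨ vb = 0 → JoinInv P E S x a b s₀ sp ((i * Lb + j) * Lx + k + 1) s₈ := by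
    intro h0
    refine ⟨hI₈.sound, ?_, hI₈.other⟩
    intro i' hi' j' hj' k' hk' hlt ha0 hb0
    rcases Nat.lt_succ_iff_lt_or_eq.1 hlt with h1 | h1
    · exact hI₈.complete i' hi' j' hj' k' hk' h1 ha0 hb0
    · obtain ⟨h2, rfl⟩ := mul_add_inj hk' hk h1
      obtain ⟨rfl, rfl⟩ := mul_add_inj hj' hjL h2
      rcases h0 with h0 | h0
      exacts [absurd h0 ha0, absurd h0 hb0]
  refine wp_ite trivial (fun h1 => wp_ite trivial (fun h2 => ?_) (fun h2 => wp_skip ?_))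
    (fun h1 => wp_skip ?_)
  · have ha0 : va ≠ 0 := by simpa [w6] using h1
    have hb0 : vb ≠ 0 := by simpa [w7] using h2
    have hbestA := ha i hi _ hpL
    have hbestB := hbt j hjL _ hpR
    have hsolA := hbestA.sound ha0
    have hsolB := hbestB.sound hb0
    have hSa : S (2 * a) ⊆ Finset.range P.n :=
      fun w hw => hj.sub (by rw [hj.union]; exact Finset.mem_union_left _ hw)
    have hSb : S (2 * b) ⊆ Finset.range P.n :=
      fun w hw => hj.sub (by rw [hj.union]; exact Finset.mem_union_right _ hw)
    have hta₈ : ∀ cell, ∀ p ≤ P.n, s₈.tab P.n (E / 2) a cell p = s₀.tab P.n (E / 2) a cell p :=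
      hI₈.other a haE hj.left_ne
    have htb₈ : ∀ cell, ∀ p ≤ P.n, s₈.tab P.n (E / 2) b cell p = s₀.tab P.n (E / 2) b cell p :=
      hI₈.other b hbE hj.right_ne
    have hleA : ∀ w < P.n, s₈.tab P.n (E / 2) a (cellL a x s₀ sp i j k) w ≤ P.q := by
      intro w hw
      rw [hta₈ _ _ hw.le]
      by_cases hwS : w ∈ S (2 * a)
      · exact (hsolA.lt w hwS).le
      · exact (hsolA.zero w hw hwS).le.trans (Nat.zero_le _)
    have hleB : ∀ w < P.n, s₈.tab P.n (E / 2) b (cellR b x s₀ sp i j k) w ≤ P.q := by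
      intro w hw
      rw [htb₈ _ _ hw.le]
      by_cases hwS : w ∈ S (2 * b)
      · exact (hsolB.lt w hwS).le
      · exact (hsolB.zero w hw hwS).le.trans (Nat.zero_le _)
    refine wp_call_seq (wp_addSol hb hE₈ w2 haE w3 hbE w4 c1 w5 c2 hleA hleB) ?_
    rintro t₉ s₉ hb₉ hf₉ ⟨ht₉, hsol₉⟩
    have hE₉ := hE₈.frame hf₉ rfl
    have hcost : ∀ T : Finset ℕ, T ⊆ Finset.range P.n → ∀ χ, P.cost T χ ≤ P.n := by
      intro T hT χ
      calc P.cost T χ ≤ ∑ _u ∈ T, 1 := Finset.sum_le_sum fun u _ => hb.wt_le _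
        _ = T.card := by simp
        _ ≤ P.n := by simpa using Finset.card_le_card hT
    have hvaB : va ≤ P.n + 1 := by
      have h3 : va = P.cost _ _ + 1 := hsolA.val
      exact h3.trans_le (Nat.succ_le_succ (hcost _ hSa _))
    have hvbB : vb ≤ P.n + 1 := by
      have h3 : vb = P.cost _ _ + 1 := hsolB.val
      exact h3.trans_le (Nat.succ_le_succ (hcost _ hSb _))
    have h2n : 2 * (P.n + 1) ≤ B := by
      refine le_trans ?_ hb.cell_le
      have h3 : 1 ≤ M * M := Nat.mul_pos hb.M_pos hb.M_pos
      calc 2 * (P.n + 1) = 1 * (P.n + 1) * 2 := by ring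
        _ ≤ M * M * (P.n + 1) * E := Nat.mul_le_mul (Nat.mul_le_mul_right _ h3) (by omega)
    have v6 : s₉.var xValL = va := (hf₉.var _ rfl).trans w6
    have v7 : s₉.var xValR = vb := (hf₉.var _ rfl).trans w7
    have v8 : s₉.var xIJ = i * Lb + j := (hf₉.var _ rfl).trans w8
    have v9 : s₉.var xOuter = k := (hf₉.var _ rfl).trans w9
    have v10 : s₉.var xLX = Lx := (hf₉.var _ rfl).trans w10
    have v11 : s₉.arr aPair = sp.arr aPair := by rw [hf₉.arr _ rfl, w11, hsp]
    have hI₉ : JoinInv P E S x a b s₀ sp ((i * Lb + j) * Lx + k) s₉ := hI₈.congr (hf₉.arr _ rfl)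
    refine wp_assign_seq (by simp [v6, v7]; omega) ?_
    have f1 : Expr.eval s₉ (.var xValL + .var xValR - 1) = va + vb - 1 := by simp [v6, v7]
    rw [f1]
    refine wp_assign_seq (by simp [v8, v9, v10, v11, hcX]; omega) ?_
    have f2 : Expr.eval (s₉.setVar xCand (va + vb - 1))
        (.get aPair (.var xIJ * .const 3) * .var xLX + .var xOuter) = cellX b s₀ sp i j * Lx + k := by
      simp [v8, v9, v10, v11, hcX]
    rw [f2]
    set s₁₀ := (s₉.setVar xCand (va + vb - 1)).setVar xCell (cellX b s₀ sp i j * Lx + k) with hs₁₀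
    have hE₁₀ : Env P E S s₁₀ := (hE₉.setVar rfl).setVar rfl
    refine wp_mono (wp_relax hb hE₁₀ (x := x)
      (by simp [hs₁₀]; rw [hf₉.var _ rfl, w1]) hxE (cell := cellX b s₀ sp i j * Lx + k)
      (by simp [hs₁₀]) c3 (cand := va + vb - 1) (by simp [hs₁₀])) ?_
    rintro t₁₁ s₁₁ hb₁₁ hf₁₁ ⟨ht₁₁, hrel⟩
    have hI₁₀ : JoinInv P E S x a b s₀ sp ((i * Lb + j) * Lx + k) s₁₀ := hI₉.congr rfl
    have hc := hp.isCombination hj hi hjL hk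
    have hIsSol : P.IsSol (S (2 * x)) (s₀.row P.R E (2 * x) (cellX b s₀ sp i j))
        (s₀.row P.R E (2 * x + 1) k) (va + vb - 1) (s₁₀.arr aSol) := by
      rw [hj.union]
      refine hc.sound hj.disjoint (fun v hv => by simpa using hSa hv)
        (fun v hv => by simpa using hSb hv) hbestA hbestB ha0 hb0 fun v hv => ?_
      have := hsol₉ v hv
      rw [hta₈ _ _ hv.le, htb₈ _ _ hv.le] at this
      exact this
    refine ⟨by simp [Expr.tabAddr]; omega, ?_, ?_, ?_⟩
    · exact hrel.tabSound hxE hk hj.sub hI₁₀.sound hIsSol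
    · intro i' hi' j' hj' k' hk' hlt ha0' hb0'
      rcases Nat.lt_succ_iff_lt_or_eq.1 hlt with h3 | h3
      · exact hrel.mono hxE (by omega) (hI₁₀.complete i' hi' j' hj' k' hk' h3 ha0' hb0')
      · obtain ⟨h4, rfl⟩ := mul_add_inj hk' hk h3
        obtain ⟨rfl, rfl⟩ := mul_add_inj hj' hjL h4
        exact hrel.le_cand (by omega)
    · intro x' hx' hne cell p hp
      exact (hrel.other x' hx' cell (.inl hne) p hp).trans (hI₁₀.other x' hx' hne cell p hp)
  · exact ⟨by simp [Expr.tabAddr]; omega, hskip (.inr (by simpa [w7] using h2))⟩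
  · exact ⟨by simp [Expr.tabAddr]; omega, hskip (.inl (by simpa [w6] using h1))⟩

end WordRAM

open Prob

namespace WordRAM

variable {P : Prob} {E M B : ℕ} {S : ℕ → Finset ℕ} {s s' : Store}

/-- Fill the pair table number `k` for the sides `2 * y₁ + b₁` and `2 * y₂ + b₂` and their union on the
side `2 * y + b`, where the variables `y`, `y₁`, `y₂` hold nodes. -/
def Program.pairTableOf (d k y b y₁ b₁ y₂ b₂ : ℕ) : Program :=
  .seq (.assign xK (.const k)) <|
  .seq (.assign xSide (2 * .var y + .const b)) <|
  .seq (.assign xS (2 * .var y₁ + .const b₁)) <|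
  .seq (.assign xS' (2 * .var y₂ + .const b₂)) (.pairTable d)

theorem wp_pairTableOf (hb : Bounds P B M E) (hE3 : 3 ≤ E) (hs : Env P E S s)
    {k y b y₁ b₁ y₂ b₂ x x₁ x₂ : ℕ} (hy : xK ≠ y ∧ xSide ≠ y ∧ xS ≠ y ∧ xS' ≠ y)
    (hy₁ : xK ≠ y₁ ∧ xSide ≠ y₁ ∧ xS ≠ y₁ ∧ xS' ≠ y₁)
    (hy₂ : xK ≠ y₂ ∧ xSide ≠ y₂ ∧ xS ≠ y₂ ∧ xS' ≠ y₂) (hx : s.var y = x) (hx₁ : s.var y₁ = x₁)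
    (hx₂ : s.var y₂ = x₂) (heE : 2 * x + b < E) (heE₁ : 2 * x₁ + b₁ < E) (heE₂ : 2 * x₂ + b₂ < E)
    (hk3 : k < 3) (hl : ∀ e < E, HasList P E M S e s) (hS₁ : S (2 * x₁ + b₁) ⊆ S (2 * x + b))
    (hS₂ : S (2 * x₂ + b₂) ⊆ S (2 * x + b)) :
    wp B (.pairTableOf P.d k y b y₁ b₁ y₂ b₂) s fun t s' => t ≤ 324 * (M * M * (M * P.R)) ∧
      P.IsPairTable (S (2 * x + b)) (s.arr aLen (2 * x₁ + b₁)) (s.row P.R E (2 * x₁ + b₁))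
        (s.arr aLen (2 * x₂ + b₂)) (s.row P.R E (2 * x₂ + b₂))
        (s.arr aLen (2 * x + b)) (s.row P.R E (2 * x + b))
        (fun i j => s'.arr aPair ((i * s.arr aLen (2 * x₂ + b₂) + j) * 3 + k)) ∧
      ∀ k' < 3, k' ≠ k → ∀ j, s'.arr aPair (j * 3 + k') = s.arr aPair (j * 3 + k') := by
  have hEB := hb.E_le
  have hX : 1 ≤ M * M * (M * P.R) :=
    Nat.mul_pos (Nat.mul_pos hb.M_pos hb.M_pos) hb.MR_pos
  obtain ⟨hy0, hy1, hy2, hy3⟩ := hy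
  obtain ⟨hz0, hz1, hz2, hz3⟩ := hy₁
  obtain ⟨hw0, hw1, hw2, hw3⟩ := hy₂
  refine wp_assign_seq (by simp; omega) (wp_assign_seq ?_ (wp_assign_seq ?_ (wp_assign_seq ?_ ?_)))
  · simp [hy0.symm, hx]; omega
  · simp [hz0.symm, hz1.symm, hx₁]; omega
  · simp [hw0.symm, hw1.symm, hw2.symm, hx₂]; omega
  simp only [eval_add, eval_mul, eval_two, eval_var, eval_const, setVar_var, if_neg hy0.symm,
    if_neg hz0.symm, if_neg hz1.symm, if_neg hw0.symm, if_neg hw1.symm, if_neg hw2.symm, hx, hx₁, hx₂]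
  set s₁ := (((s.setVar xK k).setVar xSide (2 * x + b)).setVar xS (2 * x₁ + b₁)).setVar xS'
    (2 * x₂ + b₂) with hs₁
  have hE₁ : Env P E S s₁ := (((hs.setVar rfl).setVar rfl).setVar rfl).setVar rfl
  have hl₁ : ∀ e < E, HasList P E M S e s₁ := fun e he => (hl e he).congr rfl fun _ _ _ => rfl
  refine wp_mono (wp_pairTable hb hE3 hE₁ (e := 2 * x + b) (e₁ := 2 * x₁ + b₁) (e₂ := 2 * x₂ + b₂)
    (k := k) (by simp [hs₁]) heE (by simp [hs₁]) heE₁ (by simp [hs₁]) heE₂ (by simp [hs₁]) hk3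
    (hl₁ _ heE) (hl₁ _ heE₁) (hl₁ _ heE₂) hS₁ hS₂) ?_
  rintro t s₂ hb₂ hf₂ ⟨h1, h2, h3⟩
  exact ⟨by simp; omega, h2, h3⟩

/-- Compute the table of the node that is the join number `xStep`. -/
def Program.joinStep (d : ℕ) : Program :=
  .seq (.assign xNode (.get aX (.var xStep))) <|
  .seq (.assign xLeft (.get aLeft (.var xStep))) <|
  .seq (.assign xRight (.get aRight (.var xStep))) <|
  .seq (.pairTableOf d 0 xNode 0 xLeft 0 xRight 0) <|
  .seq (.pairTableOf d 1 xLeft 1 xRight 0 xNode 1) <|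
  .seq (.pairTableOf d 2 xRight 1 xLeft 0 xNode 1) <|
  .seq (.assign xLR (.get aLen (2 * .var xRight))) <|
  .seq (.assign xLX (.get aLen (2 * .var xNode + 1))) <|
  .seq (.assign xLLo (.get aLen (2 * .var xLeft + 1))) <|
  .seq (.assign xLRo (.get aLen (2 * .var xRight + 1))) <|
  .seq (.assign xCnt (.get aLen (2 * .var xLeft) * .var xLR * .var xLX)) <|
  .forLt xT xCnt .combine

/-- Once all combinations have been handled, the table of the join is correct. -/
theorem JoinInv.nodeTable {x a b : ℕ} {s₀ sp : Store} (hj : IsJoin P.n (E / 2) S x a b)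
    (hl : ∀ e < E, HasList P E M S e s₀) (hp : PairTables P E S x a b s₀ sp)
    (ha : NodeTable P E S s₀ a s₀) (hbt : NodeTable P E S s₀ b s₀)
    (h : JoinInv P E S x a b s₀ sp
      (s₀.arr aLen (2 * a) * s₀.arr aLen (2 * b) * s₀.arr aLen (2 * x + 1)) s) :
    NodeTable P E S s₀ x s := by
  have hxE := hj.lt
  have haE := hj.left_lt
  have hbE := hj.right_lt
  intro r hr k hk
  refine ⟨fun h0 => h.sound r hr k hk h0, fun χ hχ hsig hv => ?_⟩
  rw [hj.union] at hχ hsig hv ⊢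
  have hχa : ∀ v ∈ S (2 * a), χ v < P.q := fun v hv => hχ v (Finset.mem_union_left _ hv)
  have hχb : ∀ v ∈ S (2 * b), χ v < P.q := fun v hv => hχ v (Finset.mem_union_right _ hv)
  obtain ⟨i, hi, hi'⟩ := (hl (2 * a) (by omega)).list.complete _ (adm_coloured hχa)
  obtain ⟨j, hjb, hj'⟩ := (hl (2 * b) (by omega)).list.complete _ (adm_coloured hχb)
  have hc := hp.isCombination hj hi hjb hk
  have hcell : cellX b s₀ sp i j = r := by
    refine (hl (2 * x) (by omega)).list.inj _ (hp.inner i hi j hjb).1 _ hr fun p hp' => ?_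
    rw [← hsig p hp', coloured_union hj.disjoint,
      sig_add Finset.subset_union_left Finset.subset_union_right, ← hi' p hp', ← hj' p hp',
      ← hc.union p hp']
    rfl
  have hSa : ∀ v ∈ S (2 * a), v < P.n := fun v hv => by
    simpa using hj.sub (by rw [hj.union]; exact Finset.mem_union_left _ hv)
  have hSb : ∀ v ∈ S (2 * b), v < P.n := fun v hv => by
    simpa using hj.sub (by rw [hj.union]; exact Finset.mem_union_right _ hv)
  obtain ⟨h1, h2, h3⟩ := hc.complete hj.disjoint hSa hSb (ha i hi _ (hp.left j hjb k hk).1)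
    (hbt j hjb _ (hp.right i hi k hk).1) hχ (fun p hp => (hi' p hp).symm)
    (fun p hp => (hj' p hp).symm) hv
  obtain ⟨h4, h5⟩ := h.complete i hi j hjb k hk (mul_add_lt (mul_add_lt hi hjb) hk) h1 h2
  rw [hcell] at h4 h5
  exact ⟨h4, h5.trans h3⟩

set_option maxHeartbeats 1000000 in
/-- One join: the loop runs over the at most `M ^ 3` triples of a row of the inner list of `a`, one of
the inner list of `b`, and one of the outer list of `x`. -/
theorem wp_joinStep (hb : Bounds P B M E) (hs : Env P E S s) {x a b : ℕ}
    (hj : IsJoin P.n (E / 2) S x a b) (hl : ∀ e < E, HasList P E M S e s)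
    (ha : NodeTable P E S s a s) (hbt : NodeTable P E S s b s)
    (hx : s.arr aX (s.var xStep) = x) (hxa : s.arr aLeft (s.var xStep) = a)
    (hxb : s.arr aRight (s.var xStep) = b)
    (htab : ∀ cell, ∀ p ≤ P.n, s.tab P.n (E / 2) x cell p = 0) :
    wp B (.joinStep P.d) s fun t s' => t ≤ 1450 * (M * M * (M * P.R)) ∧ NodeTable P E S s x s' ∧
      ∀ x' < E / 2, x' ≠ x → ∀ cell, ∀ p ≤ P.n,
        s'.tab P.n (E / 2) x' cell p = s.tab P.n (E / 2) x' cell p := by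
  have hX : 1 ≤ M * M * (M * P.R) :=
    Nat.mul_pos (Nat.mul_pos hb.M_pos hb.M_pos) hb.MR_pos
  have hxE := hj.lt
  have haE := hj.left_lt
  have hbE := hj.right_lt
  have hE3 : 3 ≤ E := by have := hj.left_ne; omega
  have hEB := hb.E_le
  have hMa := (hl (2 * a) (by omega)).len_le
  have hMb := (hl (2 * b) (by omega)).len_le
  have hMx := (hl (2 * x + 1) (by omega)).len_le
  have hab : S (2 * a) ⊆ S (2 * x) := by rw [hj.union]; exact Finset.subset_union_left
  have hbb : S (2 * b) ⊆ S (2 * x) := by rw [hj.union]; exact Finset.subset_union_right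
  have hxa' : S (2 * x + 1) ⊆ S (2 * a + 1) := by
    rw [hj.compl, hj.left_compl]; exact Finset.sdiff_subset_sdiff (le_refl _) hab
  have hxb' : S (2 * x + 1) ⊆ S (2 * b + 1) := by
    rw [hj.compl, hj.right_compl]; exact Finset.sdiff_subset_sdiff (le_refl _) hbb
  have hba' : S (2 * b) ⊆ S (2 * a + 1) := by
    rw [hj.left_compl]
    exact fun v hv => Finset.mem_sdiff.2 ⟨hj.sub (hbb hv), Finset.disjoint_right.1 hj.disjoint hv⟩
  have hab' : S (2 * a) ⊆ S (2 * b + 1) := by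
    rw [hj.right_compl]
    exact fun v hv => Finset.mem_sdiff.2 ⟨hj.sub (hab hv), Finset.disjoint_left.1 hj.disjoint hv⟩
  refine wp_assign_seq (by simp) (wp_assign_seq (by simp) (wp_assign_seq (by simp) ?_))
  simp only [eval_get, eval_var, setVar_var, setVar_arr]
  simp only [reduceIte, Nat.reduceEqDiff, hx, hxa, hxb]
  set s₁ := ((s.setVar xNode x).setVar xLeft a).setVar xRight b with hs₁
  have hE₁ : Env P E S s₁ := ((hs.setVar rfl).setVar rfl).setVar rfl
  have q1 : s₁.var xNode = x := by simp [hs₁]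
  have q2 : s₁.var xLeft = a := by simp [hs₁]
  have q3 : s₁.var xRight = b := by simp [hs₁]
  have q4 : s₁.arr = s.arr := rfl
  clear_value s₁
  have hrow : ∀ s' : Store, s'.arr aRow = s.arr aRow → s'.row = s.row := fun s' h => addr_row_lt h
  have hlist : ∀ s' : Store, s'.arr aRow = s.arr aRow → s'.arr aLen = s.arr aLen →
      ∀ e < E, HasList P E M S e s' := fun s' h h' e he =>
    (hl e he).congr (by rw [h']) fun _ _ _ => by rw [hrow s' h]
  refine wp_call_seq (wp_pairTableOf hb hE3 hE₁ (by decide) (by decide) (by decide) q1 q2 q3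
    (by omega) (by omega) (by omega) (by omega) (hlist s₁ (by rw [q4]) (by rw [q4])) hab hbb) ?_
  rintro t₂ s₂ hb₂ hf₂ ⟨ht₂, hp₂, ho₂⟩
  have l₂ : s₂.arr aLen = s.arr aLen := by rw [hf₂.arr _ rfl, q4]
  have r₂ : s₂.arr aRow = s.arr aRow := by rw [hf₂.arr _ rfl, q4]
  have hE₂ := hE₁.frame hf₂ rfl
  refine wp_call_seq (wp_pairTableOf hb hE3 hE₂ (by decide) (by decide) (by decide)
    ((hf₂.var _ rfl).trans q2) ((hf₂.var _ rfl).trans q3) ((hf₂.var _ rfl).trans q1)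
    (by omega) (by omega) (by omega) (by omega) (hlist s₂ r₂ l₂) hba' hxa') ?_
  rintro t₃ s₃ hb₃ hf₃ ⟨ht₃, hp₃, ho₃⟩
  have l₃ : s₃.arr aLen = s.arr aLen := by rw [hf₃.arr _ rfl, l₂]
  have r₃ : s₃.arr aRow = s.arr aRow := by rw [hf₃.arr _ rfl, r₂]
  have hE₃ := hE₂.frame hf₃ rfl
  refine wp_call_seq (wp_pairTableOf hb hE3 hE₃ (by decide) (by decide) (by decide)
    ((hf₃.var _ rfl).trans ((hf₂.var _ rfl).trans q3))
    ((hf₃.var _ rfl).trans ((hf₂.var _ rfl).trans q2))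
    ((hf₃.var _ rfl).trans ((hf₂.var _ rfl).trans q1))
    (by omega) (by omega) (by omega) (by omega) (hlist s₃ r₃ l₃) hab' hxb') ?_
  rintro t₄ s₄ hb₄ hf₄ ⟨ht₄, hp₄, ho₄⟩
  have l₄ : s₄.arr aLen = s.arr aLen := by rw [hf₄.arr _ rfl, l₃]
  have r₄ : s₄.arr aRow = s.arr aRow := by rw [hf₄.arr _ rfl, r₃]
  have hE₄ := hE₃.frame hf₄ rfl
  rw [q4, hrow s₁ (by rw [q4])] at hp₂
  rw [l₂, hrow s₂ r₂] at hp₃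
  rw [l₃, hrow s₃ r₃] at hp₄
  have hpt : PairTables P E S x a b s s₄ := by
    refine ⟨fun i hi j hj => ?_, fun j hj k hk => ?_, fun i hi k hk => ?_⟩
    · beta_reduce
      rw [ho₄ 0 (by omega) (by omega), ho₃ 0 (by omega) (by omega)]
      exact hp₂ i hi j hj
    · beta_reduce
      rw [ho₄ 1 (by omega) (by omega)]
      exact hp₃ j hj k hk
    · exact hp₄ i hi k hk
  have q1' : s₄.var xNode = x := (hf₄.var _ rfl).trans ((hf₃.var _ rfl).trans ((hf₂.var _ rfl).trans q1))
  have q2' : s₄.var xLeft = a := (hf₄.var _ rfl).trans ((hf₃.var _ rfl).trans ((hf₂.var _ rfl).trans q2))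
  have q3' : s₄.var xRight = b := (hf₄.var _ rfl).trans ((hf₃.var _ rfl).trans ((hf₂.var _ rfl).trans q3))
  have q5 : s₄.arr aTab = s.arr aTab := by
    rw [hf₄.arr _ rfl, hf₃.arr _ rfl, hf₂.arr _ rfl, q4]
  have hcube : s.arr aLen (2 * a) * s.arr aLen (2 * b) * s.arr aLen (2 * x + 1) ≤ M * M * M :=
    Nat.mul_le_mul (Nat.mul_le_mul hMa hMb) hMx
  have hcubeB := hb.cube_le
  have hsq : s.arr aLen (2 * a) * s.arr aLen (2 * b) ≤ B :=
    (Nat.mul_le_mul hMa hMb).trans ((Nat.le_mul_of_pos_right _ hb.M_pos).trans hcubeB)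
  refine wp_assign_seq (by simp [q3']; omega) (wp_assign_seq (by simp [q1']; omega)
    (wp_assign_seq (by simp [q2']; omega) (wp_assign_seq (by simp [q3']; omega)
    (wp_assign_seq (by simp [q1', q2', q3', l₄]; omega) ?_))))
  simp only [eval_get, eval_var, eval_mul, eval_add, eval_two, eval_one, setVar_var, setVar_arr]
  simp only [reduceIte, Nat.reduceEqDiff, q1', q2', q3', l₄]
  set s₅ := ((((s₄.setVar xLR (s.arr aLen (2 * b))).setVar xLX (s.arr aLen (2 * x + 1))).setVar xLLo
    (s.arr aLen (2 * a + 1))).setVar xLRo (s.arr aLen (2 * b + 1))).setVar xCnt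
    (s.arr aLen (2 * a) * s.arr aLen (2 * b) * s.arr aLen (2 * x + 1)) with hs₅
  have hE₅ : Env P E S s₅ :=
    ((((hE₄.setVar rfl).setVar rfl).setVar rfl).setVar rfl).setVar rfl
  have w1 : s₅.var xNode = x := by simp [hs₅, q1']
  have w2 : s₅.var xLeft = a := by simp [hs₅, q2']
  have w3 : s₅.var xRight = b := by simp [hs₅, q3']
  have w4 : s₅.var xLR = s.arr aLen (2 * b) := by simp [hs₅]
  have w5 : s₅.var xLX = s.arr aLen (2 * x + 1) := by simp [hs₅]
  have w6 : s₅.var xLLo = s.arr aLen (2 * a + 1) := by simp [hs₅]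
  have w7 : s₅.var xLRo = s.arr aLen (2 * b + 1) := by simp [hs₅]
  have w8 : s₅.var xCnt = s.arr aLen (2 * a) * s.arr aLen (2 * b) * s.arr aLen (2 * x + 1) := by
    simp [hs₅]
  have w9 : s₅.arr = s₄.arr := rfl
  clear_value s₅
  have htabeq : ∀ s' : Store, s'.arr aTab = s.arr aTab → s'.tab = s.tab := by
    intro s' h
    funext n nodes x cell p
    unfold Store.tab; rw [h]
  refine wp_forLt (fun t s' => JoinInv P E S x a b s s₄ t s') (350 * P.R) rfl rfl rfl ?_ ?_ ?_
  · have h5 : (s₅.setVar xT 0).tab = s.tab := htabeq _ (by rw [setVar_arr, w9, q5])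
    refine ⟨fun i _ k _ h0 => ?_, ?_, ?_⟩
    · rw [h5] at h0
      exact absurd (htab _ _ (le_refl _)) h0
    · intro i _ j _ k _ h
      exact absurd h (Nat.not_lt_zero _)
    · rw [h5]
      exact fun _ _ _ _ _ _ => rfl
  · intro t s₆ ht hb₆ hf₆ hx₆ hI
    rw [w8] at ht
    refine wp_mono (wp_combine hb (hE₅.frame hf₆ rfl) hj hl hpt (by rw [hf₆.arr _ rfl, w9]) ha hbt
      ((hf₆.var _ rfl).trans w1) ((hf₆.var _ rfl).trans w2) ((hf₆.var _ rfl).trans w3) hx₆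
      ((hf₆.var _ rfl).trans w4) ((hf₆.var _ rfl).trans w5) ((hf₆.var _ rfl).trans w6)
      ((hf₆.var _ rfl).trans w7) ht hI) ?_
    rintro t' s₇ _ _ ⟨h1, h2⟩
    exact ⟨h1, h2.congr rfl⟩
  · intro t s₆ ht hb₆ hf₆ hx₆ hI
    rw [w8] at ht hI
    refine ⟨?_, hI.nodeTable hj hl hpt ha hbt, hI.other⟩
    have := loop_time ht (le_refl _) hb.R_pos hcube
      (Nat.mul_pos (Nat.mul_pos hb.M_pos hb.M_pos) hb.M_pos)
    rw [mul_assoc (M * M)] at this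
    simp
    omega

/-- Compute the tables of all inner nodes. -/
def Program.joins (d : ℕ) : Program := .forLt xStep xSteps (.joinStep d)

theorem wp_joins (hb : Bounds P B M E) (hs : Env P E S s) {K : ℕ}
    (hj : JoinSeq P.n (E / 2) K S (s.arr aLeaf) (s.arr aX) (s.arr aLeft) (s.arr aRight))
    (hK : s.var xSteps = K) (hl : ∀ e < E, HasList P E M S e s)
    (hleaf : ∀ v < P.n, NodeTable P E S s (s.arr aLeaf v) s)
    (htab : ∀ x < E / 2, (∀ v < P.n, x ≠ s.arr aLeaf v) → ∀ cell, ∀ p ≤ P.n,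
      s.tab P.n (E / 2) x cell p = 0) :
    wp B (.joins P.d) s fun t s' => t ≤ 1464 * (K * (M * M * (M * P.R))) ∧
      ∀ t < K, NodeTable P E S s (s.arr aX t) s' := by
  have hX : 1 ≤ M * M * (M * P.R) :=
    Nat.mul_pos (Nat.mul_pos hb.M_pos hb.M_pos) hb.MR_pos
  have hK1 : 1 ≤ K := by obtain ⟨t, ht, _⟩ := hj.top; omega
  refine wp_forLt (fun k s' => (∀ v < P.n, NodeTable P E S s (s.arr aLeaf v) s') ∧
      (∀ t < K, t < k → NodeTable P E S s (s.arr aX t) s') ∧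
      ∀ x < E / 2, (∀ v < P.n, x ≠ s.arr aLeaf v) → (∀ t < k, x ≠ s.arr aX t) → ∀ cell, ∀ p ≤ P.n,
        s'.tab P.n (E / 2) x cell p = 0) (1450 * (M * M * (M * P.R))) rfl rfl rfl
    ⟨hleaf, by simp, fun x hx h _ => htab x hx h⟩ ?_ ?_
  · rintro k s₁ hk hb₁ hf₁ hx₁ ⟨h1, h2, h3⟩
    rw [hK] at hk
    have r8 : s₁.row = s.row := addr_row_lt (hf₁.arr _ rfl)
    have r9 : s₁.arr aLen = s.arr aLen := hf₁.arr _ rfl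
    have hl₁ : ∀ e < E, HasList P E M S e s₁ := fun e he =>
      (hl e he).congr (by rw [r9]) fun _ _ _ => by rw [r8]
    have hnt : ∀ x s', NodeTable P E S s₁ x s' ↔ NodeTable P E S s x s' := by
      intro x s'
      unfold NodeTable
      rw [r8, r9]
    have hready : ∀ y, ((∃ v < P.n, y = s.arr aLeaf v) ∨ ∃ t' < k, y = s.arr aX t') →
        NodeTable P E S s y s₁ ∧ y ≠ s.arr aX k := by
      rintro y (⟨v, hv, rfl⟩ | ⟨t', ht', rfl⟩)
      · exact ⟨h1 v hv, (hj.not_leaf k hk v hv).symm⟩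
      · exact ⟨h2 t' (by omega) ht', hj.inj k hk t' ht'⟩
    obtain ⟨ha, hane⟩ := hready _ (hj.left_ready k hk)
    obtain ⟨hb', hbne⟩ := hready _ (hj.right_ready k hk)
    have hjoin : IsJoin P.n (E / 2) S (s.arr aX k) (s.arr aLeft k) (s.arr aRight k) :=
      ⟨hj.lt k hk, hj.left_lt k hk, hj.right_lt k hk, hane, hbne, hj.sub _ (hj.lt k hk),
        hj.union k hk, hj.disjoint k hk, hj.compl _ (hj.lt k hk), hj.compl _ (hj.left_lt k hk),
        hj.compl _ (hj.right_lt k hk)⟩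
    refine wp_mono (wp_joinStep hb (hs.frame hf₁ rfl) hjoin hl₁ ((hnt _ _).2 ha) ((hnt _ _).2 hb')
      (by rw [hf₁.arr _ rfl, hx₁]) (by rw [hf₁.arr _ rfl, hx₁]) (by rw [hf₁.arr _ rfl, hx₁])
      (h3 _ (hj.lt k hk) (hj.not_leaf k hk) fun t ht => (hj.inj k hk t ht).symm)) ?_
    rintro t s₂ hb₂ hf₂ ⟨ht, h4, h5⟩
    have hkeep : ∀ y < E / 2, y ≠ s.arr aX k → NodeTable P E S s y s₁ → NodeTable P E S s y s₂ :=
      fun y hy hne h => HasTable.congr h (hj.sub _ hy) (h5 y hy hne)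
    refine ⟨ht, fun v hv => hkeep _ (hj.leaf_lt v hv) (hj.not_leaf k hk v hv).symm (h1 v hv),
      fun t htK htk => ?_, fun x hx hne hne' cell p hp => ?_⟩
    · rcases Nat.lt_succ_iff_lt_or_eq.1 htk with hlt | rfl
      · exact hkeep _ (hj.lt t htK) (hj.inj k hk t hlt) (h2 t htK hlt)
      · exact (hnt _ _).1 h4
    · exact (h5 x hx (hne' k (by omega)) cell p hp).trans
        (h3 x hx hne (fun t ht => hne' t (by omega)) cell p hp)
  · rintro t s₁ ht hb₁ hf₁ hx₁ ⟨_, h2, h3⟩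
    rw [hK] at ht h2
    exact ⟨loop_time ht (le_refl _) hX (le_refl _) hK1, fun t ht => h2 t ht ht⟩

end WordRAM

open Prob

/-! ### The answer -/

namespace Prob

variable {P : Prob}

theorem Valid.congr_outside {S : Finset ℕ} {χ κ κ' : ℕ → ℕ} (hS : ∀ v ∈ S, v < P.n)
    (h : ∀ p < P.R, κ p = κ' p) (hv : P.Valid S χ κ) : P.Valid S χ κ' := fun v hvS =>
  (allowed_congr fun jj hjj => by simp only [h _ (pos_lt hjj (hS v hvS))]).1 (hv v hvS)

/-- The colouring `χ` of all vertices is feasible. -/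
def Feasible (P : Prob) (χ : ℕ → ℕ) : Prop :=
  (∀ v < P.n, χ v < P.q) ∧ P.Valid (Finset.range P.n) χ 0

/-- The answer `flag`, `sol` solves the problem. -/
def Solved (P : Prob) (flag : ℕ) (sol : ℕ → ℕ) : Prop :=
  (flag = 0 ∧ ∀ χ, ¬ P.Feasible χ) ∨
    (flag = 1 ∧ P.Feasible sol ∧ ∀ χ, P.Feasible χ →
      P.cost (Finset.range P.n) sol ≤ P.cost (Finset.range P.n) χ)

theorem sig_range {l : Multiset (ℕ × ℕ)} {p : ℕ} (hn : 1 ≤ P.n) :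
    P.sig (Finset.range P.n) l p = 0 := if_pos (by simpa using Nat.mod_lt _ hn)

/-- A correct entry of the table of the root is a solution of the problem. -/
theorem IsBest.solved {row κ sol : ℕ → ℕ} {tv : ℕ} (hn : 1 ≤ P.n) (hrow : ∀ p < P.R, row p = 0)
    (hκ : ∀ p < P.R, κ p = 0) (h : P.IsBest (Finset.range P.n) row κ tv sol) :
    (tv = 0 → P.Solved 0 sol) ∧ (tv ≠ 0 → P.Solved 1 sol) := by
  have hlt : ∀ v ∈ Finset.range P.n, v < P.n := fun v hv => by simpa using hv
  have key : ∀ χ, P.Feasible χ → tv ≠ 0 ∧ tv ≤ P.cost (Finset.range P.n) χ + 1 := fun χ hχ =>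
    h.complete χ (fun v hv => hχ.1 v (hlt v hv)) (fun p hp => by rw [sig_range hn, hrow p hp])
      (hχ.2.congr_outside hlt fun p hp => (hκ p hp).symm)
  refine ⟨fun h0 => .inl ⟨rfl, fun χ hχ => (key χ hχ).1 h0⟩, fun h0 => .inr ⟨rfl, ?_, ?_⟩⟩
  · have := h.sound h0
    exact ⟨fun v hv => this.lt v (by simpa using hv), this.valid.congr_outside hlt hκ⟩
  · intro χ hχ
    have h1 := (h.sound h0).val
    have h2 := (key χ hχ).2
    omega

theorem Solved.congr {flag : ℕ} {sol sol' : ℕ → ℕ} (h : P.Solved flag sol)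
    (he : ∀ v < P.n, sol' v = sol v) : P.Solved flag sol' := by
  have he' : ∀ v ∈ Finset.range P.n, sol' v = sol v := fun v hv => he v (by simpa using hv)
  rcases h with h | ⟨h1, ⟨h2, h3⟩, h4⟩
  · exact .inl h
  · refine .inr ⟨h1, ⟨fun v hv => by rw [he v hv]; exact h2 v hv, fun v hv => ?_⟩, fun χ hχ => ?_⟩
    · rw [coloured_congr he', he' v hv]; exact h3 v hv
    · rw [cost_congr he']; exact h4 χ hχ

end Prob

namespace WordRAM

notation "aOut" => 0
notation "xAns" => 0

variable {P : Prob} {E M B : ℕ} {S : ℕ → Finset ℕ} {s s' : Store}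

/-- Write the answer, which is in the table of the node of the last join. -/
def Program.output : Program :=
  .seq (.assign xNode (.get aX (.var xSteps - 1))) <|
  .ite (.get aTab (.tabAddr (.var xNode) 0 (.var xN)))
    (.seq (.forLt xW xN (.store aOut (.var xW) (.get aTab (.tabAddr (.var xNode) 0 (.var xW)))))
      (.assign xAns 1))
    (.assign xAns 0)

/-- The complement of the set of all vertices has the zero row as a signature, so that the answer stands
in an entry of the table of the last join. -/
theorem wp_output (hb : Bounds P B M E) (hs : Env P E S s) {x : ℕ}
    (hx : s.arr aX (s.var xSteps - 1) = x) (hxE : x < E / 2) (hSx : S (2 * x) = Finset.range P.n)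
    (hl : ∀ e < E, HasList P E M S e s)
    (ht : NodeTable P E S s x s) :
    wp B .output s fun t s' => t ≤ 100 * P.R ∧ P.Solved (s'.var xAns) (s'.arr aOut) := by
  have hnR : P.n ≤ P.R := Nat.le_mul_of_pos_left _ (Nat.mul_pos two_pos hb.c_pos)
  have hR1 := hb.R_pos
  have hl₁ := hl (2 * x) (by omega)
  have hl₂ := hl (2 * x + 1) (by omega)
  have hbest := ht 0 hl₁.len_pos 0 hl₂.len_pos
  rw [hSx, zero_mul, zero_add] at hbest
  obtain ⟨hz, hnz⟩ := hbest.solved hb.n_pos hl₁.zero hl₂.zero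
  have hMM : 0 < M * M := Nat.mul_pos hb.M_pos hb.M_pos
  refine wp_assign_seq (by simp [hb.one_le]) ?_
  simp only [eval_get, eval_sub, eval_var, eval_one, hx]
  set s₁ := s.setVar xNode x with hs₁
  have hE₁ : Env P E S s₁ := hs.setVar rfl
  have q1 : s₁.var xNode = x := by simp [hs₁]
  have q2 : s₁.tab = s.tab := rfl
  have q3 : s₁.arr = s.arr := rfl
  clear_value s₁
  have heval : Expr.eval s₁ (.get aTab (.tabAddr (.var xNode) 0 (.var xN)))
      = s.tab P.n (E / 2) x 0 P.n := by
    simp [Expr.tabAddr, Store.tab, hE₁.n, hE₁.nodes, q1, q3]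
  refine wp_ite (ok_tabAddr hb hE₁ trivial (by simp) trivial (by simpa [q1]) hMM
    (by simp [hE₁.n])) (fun h => ?_) (fun h => wp_assign (by simp) ?_)
  · rw [heval] at h
    refine wp_call_seq (Q₁ := fun t s' => t ≤ 50 * P.R ∧
      ∀ w < P.n, s'.arr aOut w = s.tab P.n (E / 2) x 0 w) ?_ ?_
    · refine wp_forLt (fun k s' => ∀ w < k, s'.arr aOut w = s.tab P.n (E / 2) x 0 w) 20
        rfl rfl rfl (by simp) ?_ ?_
      · intro w s₂ hw hb₂ hf₂ hx₂ hI
        rw [hE₁.n] at hw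
        have hE₂ := hE₁.frame hf₂ rfl
        have r1 : s₂.var xNode = x := (hf₂.var _ rfl).trans q1
        have r2 : s₂.arr aTab = s.arr aTab := by rw [hf₂.arr _ rfl, q3]
        refine wp_store trivial (ok_tabAddr hb hE₂ trivial (by simp) trivial (by simpa [r1])
          hMM (by simp [hx₂]; omega)) ⟨by simp [Expr.tabAddr], fun w' hw' => ?_⟩
        have he : Expr.eval s₂ (.get aTab (.tabAddr (.var xNode) 0 (.var xW)))
            = s.tab P.n (E / 2) x 0 w := by
          simp [Expr.tabAddr, Store.tab, hE₂.n, hE₂.nodes, r1, r2, hx₂]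
        rw [he]
        rcases Nat.lt_succ_iff_lt_or_eq.1 hw' with hlt | rfl
        · simp [hx₂, hlt.ne, hI w' hlt]
        · simp [hx₂]
      · intro t s₂ ht hb₂ hf₂ hx₂ hI
        rw [hE₁.n] at ht hI
        exact ⟨by omega, hI⟩
    · rintro t s₂ hb₂ hf₂ ⟨ht₂, hI⟩
      refine wp_assign (by simp [hb.one_le]) ⟨by simp [Expr.tabAddr]; omega, ?_⟩
      have := (hnz h).congr hI
      simpa using this
  · rw [heval] at h
    have := hz h
    refine ⟨by simp [Expr.tabAddr]; omega, ?_⟩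
    rcases this with h | ⟨h, _⟩
    · exact .inl ⟨by simp, h.2⟩
    · simp at h

end WordRAM

open Prob

namespace WordRAM

variable {P : Prob} {E M B : ℕ} {S : ℕ → Finset ℕ} {s s' : Store}

theorem NodeTable.congr_lists {s₀ s₀' : Store} {x : ℕ} (h : NodeTable P E S s₀ x s)
    (h₁ : s₀'.arr aRow = s₀.arr aRow) (h₂ : s₀'.arr aLen = s₀.arr aLen) :
    NodeTable P E S s₀' x s := by
  unfold NodeTable
  rw [h₂, addr_row_lt h₁]
  exact h

/-- The dynamic programming algorithm. -/
def Program.solve (off d : ℕ) : Program :=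
  .seq (.enumerateAll off d) <| .seq (.leafTables off d) <| .seq (.joins d) .output

theorem wp_solve (hb : Bounds P B M E) (hs : Env P E S s) (hM : ListBound P M E S) {K : ℕ}
    (hj : JoinSeq P.n (E / 2) K S (s.arr aLeaf) (s.arr aX) (s.arr aLeft) (s.arr aRight))
    (hK : s.var xSteps = K) (hrow : ∀ k, s.arr aRow k = 0) (htab : ∀ k, s.arr aTab k = 0)
    (hsol : ∀ k, s.arr aSol k = 0) :
    wp B (.solve P.off P.d) s fun t s' =>
      t ≤ 450 * (E * (M * (P.n * P.q * (M * P.R)))) + 850 * (P.n * (P.q * (M * P.R))) +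
        1464 * (K * (M * M * (M * P.R))) + 100 * P.R ∧
      P.Solved (s'.var xAns) (s'.arr aOut) := by
  obtain ⟨T, hTK, hTK', hT⟩ := hj.top
  have hE : 1 ≤ E := by have := hj.lt T hTK; omega
  refine wp_call_seq (wp_enumerateAll hb hs hM hE fun e _ p _ => hrow _) ?_
  rintro t₁ s₁ hb₁ hf₁ ⟨ht₁, hl₁⟩
  have hE₁ := hs.frame hf₁ rfl
  have a₁ : s₁.arr aLeaf = s.arr aLeaf := hf₁.arr _ rfl
  refine wp_call_seq (wp_leafTables hb hE₁ (K := K) (X := s.arr aX) (A := s.arr aLeft)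
    (A' := s.arr aRight) (by rw [a₁]; exact hj) hl₁ (fun w _ => by rw [hf₁.arr _ rfl]; exact hsol w)
    fun x _ cell p _ => by unfold Store.tab; rw [hf₁.arr _ rfl]; exact htab _) ?_
  rintro t₂ s₂ hb₂ hf₂ ⟨ht₂, hn₂, hz₂⟩
  have hE₂ := hE₁.frame hf₂ rfl
  have hlist : ∀ s' : Store, s'.arr aRow = s₁.arr aRow → s'.arr aLen = s₁.arr aLen →
      ∀ e < E, HasList P E M S e s' := fun s' h h' e he =>
    (hl₁ e he).congr (by rw [h']) fun _ _ _ => by rw [addr_row_lt h]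
  have a₂ : s₂.arr aLeaf = s₁.arr aLeaf := hf₂.arr _ rfl
  have hj₂ : JoinSeq P.n (E / 2) K S (s₂.arr aLeaf) (s₂.arr aX) (s₂.arr aLeft) (s₂.arr aRight) := by
    rw [a₂, a₁, hf₂.arr aX rfl, hf₁.arr aX rfl, hf₂.arr aLeft rfl, hf₁.arr aLeft rfl,
      hf₂.arr aRight rfl, hf₁.arr aRight rfl]
    exact hj
  refine wp_call_seq (wp_joins hb hE₂ hj₂
    ((hf₂.var _ rfl).trans ((hf₁.var _ rfl).trans hK)) (hlist s₂ (hf₂.arr _ rfl) (hf₂.arr _ rfl))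
    (fun v hv => by
      rw [a₂]; exact (hn₂ v hv).congr_lists (hf₂.arr _ rfl) (hf₂.arr _ rfl))
    (by rw [a₂]; exact hz₂)) ?_
  rintro t₃ s₃ hb₃ hf₃ ⟨ht₃, hn₃⟩
  have hx : s₃.arr aX (s₃.var xSteps - 1) = s₂.arr aX T := by
    rw [hf₃.arr aX rfl, hf₃.var xSteps rfl, hf₂.var xSteps rfl, hf₁.var xSteps rfl, hK]
    congr 1
    omega
  have hxT : s₂.arr aX T = s.arr aX T := by rw [hf₂.arr aX rfl, hf₁.arr aX rfl]
  refine wp_mono (wp_output hb (hE₂.frame hf₃ rfl) hx (hj₂.lt T hTK) (by rw [hxT]; exact hT)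
    (hlist s₃ ((hf₃.arr _ rfl).trans (hf₂.arr _ rfl))
      ((hf₃.arr _ rfl).trans (hf₂.arr _ rfl)))
    ((hn₃ T hTK).congr_lists (hf₃.arr _ rfl) (hf₃.arr _ rfl))) ?_
  rintro t₄ s₄ hb₄ hf₄ ⟨ht₄, h⟩
  exact ⟨by omega, h⟩

end WordRAM

open Prob

/-! ### The powers of the digraph in memory -/

namespace WordRAM

notation "xRad" => 63
notation "xNN" => 64
notation "aAdj" => 0
notation "aProd" => 19

variable {B : ℕ} {s s' : Store}

/-- `Reach A n k u v`: there is a directed walk with at most `k` edges from `u` to `v` in the digraph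
with the adjacency matrix `A`. -/
def Reach (A : ℕ → ℕ) (n : ℕ) : ℕ → ℕ → ℕ → Prop
  | 0, u, v => u = v
  | k + 1, u, v => ∃ w < n, Reach A n k u w ∧ (A (w * n + v) ≠ 0 ∨ w = v)

/-- Multiply the matrix `aH` from the right by the adjacency matrix with ones on the diagonal. -/
def Program.mulAdj : Program :=
  .seq (.forLt xU xN <| .forLt xV xN <|
    .seq (.assign xVal 0) <|
    .seq (.forLt xW xN <|
      .ite (.get aH (.var xU * .var xN + .var xW))
        (.ite (.get aAdj (.var xW * .var xN + .var xV) + .eqE (.var xW) (.var xV))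
          (.assign xVal 1) .skip) .skip) <|
    .store aProd (.var xU * .var xN + .var xV) (.var xVal)) <|
  .forLt xT xNN <| .store aH (.var xT) (.get aProd (.var xT))

/-- Compute the adjacency matrix of the `r`-th power of the digraph, with ones on the diagonal. -/
def Program.power (r : ℕ) : Program :=
  .seq (.assign xNN (.var xN * .var xN)) <|
  .seq (.forLt xU xN <| .store aH (.var xU * .var xN + .var xU) 1) <|
  .seq (.assign xRad (.const r)) <| .forLt xJ xRad .mulAdj

theorem wp_mulAdj {n : ℕ} (hn : 1 ≤ n) (hnn : 2 * (n * n) ≤ B) (hN : s.var xN = n)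
    (hNN : s.var xNN = n * n) (hA : ∀ k, s.arr aAdj k ≤ 1) (hH : ∀ k, s.arr aH k ≤ 1)
    (hH0 : ∀ k, n * n ≤ k → s.arr aH k = 0) :
    wp B .mulAdj s fun t s' => t ≤ 150 * (n * (n * n)) ∧ (∀ k, s'.arr aH k ≤ 1) ∧
      (∀ k, n * n ≤ k → s'.arr aH k = 0) ∧
      ∀ u < n, ∀ v < n, s'.arr aH (u * n + v) ≠ 0 ↔
        ∃ w < n, s.arr aH (u * n + w) ≠ 0 ∧ (s.arr aAdj (w * n + v) ≠ 0 ∨ w = v) := by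
  have hnn1 : 1 ≤ n * n := Nat.mul_pos hn hn
  have hB : 1 ≤ B := by omega
  have hcell : ∀ {u v}, u < n → v < n → u * n + v ≤ B := fun hu hv => by
    have := mul_add_lt hu hv; omega
  have hcell' : ∀ {u}, u < n → u * n ≤ B := fun hu => by
    have := hcell hu hu; omega
  have h2 : 2 ≤ B := by omega
  -- `F u v b`: the value `b` is the entry `(u, v)` of the product
  set F : ℕ → ℕ → ℕ → Prop := fun u v b => b ≤ 1 ∧ (b ≠ 0 ↔
    ∃ w < n, s.arr aH (u * n + w) ≠ 0 ∧ (s.arr aAdj (w * n + v) ≠ 0 ∨ w = v)) with hF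
  refine wp_call_seq (Q₁ := fun t s' => t ≤ 100 * (n * (n * n)) ∧
    ∀ u < n, ∀ v < n, F u v (s'.arr aProd (u * n + v))) ?_ ?_
  · refine wp_forLt (fun k s' => ∀ u < k, ∀ v < n, F u v (s'.arr aProd (u * n + v))) (80 * (n * n))
      rfl rfl rfl (by simp) ?_ ?_
    · intro u s₁ hu hb₁ hf₁ hx₁ hI
      rw [hN] at hu
      have n₁ : s₁.var xN = n := (hf₁.var _ rfl).trans hN
      refine wp_forLt (fun k s' => (∀ u' < u, ∀ v < n, F u' v (s'.arr aProd (u' * n + v))) ∧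
        ∀ v < k, F u v (s'.arr aProd (u * n + v))) (60 * n)
        rfl rfl rfl ⟨by simpa using hI, by simp⟩ ?_ ?_
      · rintro v s₂ hv hb₂ hf₂ hx₂ ⟨hI₂, hI₂'⟩
        rw [n₁] at hv
        have n₂ : s₂.var xN = n := (hf₂.var _ rfl).trans n₁
        have u₂ : s₂.var xU = u := (hf₂.var _ rfl).trans hx₁
        refine wp_assign_seq (by simp) ?_
        rw [eval_zero]
        set s₃ := s₂.setVar xVal 0 with hs₃
        have n₃ : s₃.var xN = n := by simp [hs₃, n₂]
        have u₃ : s₃.var xU = u := by simp [hs₃, u₂]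
        have v₃ : s₃.var xV = v := by simp [hs₃, hx₂]
        have z₃ : s₃.var xVal = 0 := by simp [hs₃]
        have a₃ : s₃.arr = s₂.arr := rfl
        clear_value s₃
        have hH₃ : s₃.arr aH = s.arr aH := by rw [a₃, hf₂.arr _ rfl, hf₁.arr _ rfl]
        have hA₃ : s₃.arr aAdj = s.arr aAdj := by rw [a₃, hf₂.arr _ rfl, hf₁.arr _ rfl]
        refine wp_call_seq (Q₁ := fun t s' => t ≤ 40 * n ∧ F u v (s'.var xVal)) ?_ ?_
        · refine wp_forLt (fun k s' => s'.var xVal ≤ 1 ∧ (s'.var xVal ≠ 0 ↔ ∃ w < k,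
            s.arr aH (u * n + w) ≠ 0 ∧ (s.arr aAdj (w * n + v) ≠ 0 ∨ w = v))) 26
            rfl rfl rfl (by simp [z₃]) ?_ ?_
          · rintro w s₄ hw hb₄ hf₄ hx₄ ⟨hI₄, hI₄'⟩
            rw [n₃] at hw
            have n₄ : s₄.var xN = n := (hf₄.var _ rfl).trans n₃
            have u₄ : s₄.var xU = u := (hf₄.var _ rfl).trans u₃
            have v₄ : s₄.var xV = v := (hf₄.var _ rfl).trans v₃
            have hH₄ : s₄.arr aH = s.arr aH := by rw [hf₄.arr _ rfl, hH₃]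
            have hA₄ : s₄.arr aAdj = s.arr aAdj := by rw [hf₄.arr _ rfl, hA₃]
            have step : ∀ b : ℕ, b ≤ 1 → (b ≠ 0 ↔ s₄.var xVal ≠ 0 ∨
                (s.arr aH (u * n + w) ≠ 0 ∧ (s.arr aAdj (w * n + v) ≠ 0 ∨ w = v))) →
                b ≤ 1 ∧ (b ≠ 0 ↔ ∃ w' < w + 1, s.arr aH (u * n + w') ≠ 0 ∧
                  (s.arr aAdj (w' * n + v) ≠ 0 ∨ w' = v)) := by
              intro b hb hb'
              refine ⟨hb, hb'.trans ?_⟩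
              rw [hI₄']
              constructor
              · rintro (⟨w', h, h'⟩ | h)
                exacts [⟨w', by omega, h'⟩, ⟨w, by omega, h⟩]
              · rintro ⟨w', h, h'⟩
                rcases Nat.lt_succ_iff_lt_or_eq.1 h with h | rfl
                exacts [.inl ⟨w', h, h'⟩, .inr h']
            refine wp_ite (by simp [u₄, n₄, hx₄, hcell hu hw, hcell' hu]) (fun h => ?_) (fun h => ?_)
            · have h' : s.arr aH (u * n + w) ≠ 0 := by simpa [u₄, n₄, hx₄, hH₄] using h
              refine wp_ite ⟨by simp [v₄, n₄, hx₄, hcell hw hv, hcell' hw], ok_eqE hb₄ hB trivial trivial,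
                ?_⟩ (fun h2 => wp_assign (by simpa) ?_) (fun h2 => wp_skip ?_)
              · have := hA (w * n + v)
                simp [v₄, n₄, hx₄, hA₄]
                split <;> omega
              · have h2' : s.arr aAdj (w * n + v) ≠ 0 ∨ w = v := by
                  by_contra hc
                  push Not at hc
                  simp [v₄, n₄, hx₄, hA₄, hc] at h2
                exact ⟨by simp, by simpa using step 1 (le_refl _) (by simp [h', h2'])⟩
              · have h2' : ¬ (s.arr aAdj (w * n + v) ≠ 0 ∨ w = v) := by
                  simp [v₄, n₄, hx₄, hA₄] at h2
                  tauto
                exact ⟨by simp, by simpa using step _ hI₄ (by simp only [h2', and_false, or_false])⟩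
            · have h' : ¬ s.arr aH (u * n + w) ≠ 0 := by simpa [u₄, n₄, hx₄, hH₄] using h
              exact wp_skip ⟨by simp, by simpa using step _ hI₄ (by simp only [h', false_and, or_false])⟩
          · intro t s₄ ht hb₄ hf₄ hx₄ hI₄
            rw [n₃] at ht hI₄
            exact ⟨by omega, hI₄⟩
        · rintro t₄ s₄ hb₄ hf₄ ⟨ht₄, hI₄⟩
          have n₄ : s₄.var xN = n := (hf₄.var _ rfl).trans n₃
          have u₄ : s₄.var xU = u := (hf₄.var _ rfl).trans u₃
          have v₄ : s₄.var xV = v := (hf₄.var _ rfl).trans v₃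
          have a₄ : s₄.arr aProd = s₂.arr aProd := by rw [hf₄.arr _ rfl, a₃]
          refine wp_store (by simp [u₄, n₄, v₄, hcell hu hv, hcell' hu]) trivial
            ⟨by simp; omega, fun u' hu' v' hv' => ?_, fun v' hv' => ?_⟩
          · have hne : u' * n + v' ≠ u * n + v := fun h => by
              have := (mul_add_inj hv' hv h).1; omega
            simpa [u₄, n₄, v₄, hne, a₄] using hI₂ u' hu' v' hv'
          · rcases Nat.lt_succ_iff_lt_or_eq.1 hv' with hlt | rfl
            · simpa [u₄, n₄, v₄, hlt.ne, a₄] using hI₂' v' hlt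
            · simpa [u₄, n₄, v₄] using hI₄
      · rintro t s₂ ht hb₂ hf₂ hx₂ ⟨hI₂, hI₂'⟩
        rw [n₁] at ht hI₂'
        refine ⟨?_, fun u' hu' v hv => ?_⟩
        · have := loop_time ht (le_refl _) hn (le_refl _) hn
          omega
        · rcases Nat.lt_succ_iff_lt_or_eq.1 hu' with hlt | rfl
          exacts [hI₂ u' hlt v hv, hI₂' v hv]
    · intro t s₁ ht hb₁ hf₁ hx₁ hI
      rw [hN] at ht hI
      have := loop_time ht (le_refl _) hnn1 (le_refl _) hn
      exact ⟨by omega, hI⟩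
  · rintro t₁ s₁ hb₁ hf₁ ⟨ht₁, hI₁⟩
    have c₁ : s₁.var xNN = n * n := (hf₁.var _ rfl).trans hNN
    have a₁ : s₁.arr aH = s.arr aH := hf₁.arr _ rfl
    refine wp_forLt (fun k s' => (∀ j < k, s'.arr aH j = s₁.arr aProd j) ∧
      ∀ j, k ≤ j → s'.arr aH j = s.arr aH j) 10 rfl rfl rfl ⟨by simp, fun j _ => by simp [a₁]⟩ ?_ ?_
    · rintro k s₂ hk hb₂ hf₂ hx₂ ⟨h1, h2⟩
      refine wp_store trivial trivial ⟨by simp, fun j hj => ?_, fun j hj => ?_⟩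
      · rcases Nat.lt_succ_iff_lt_or_eq.1 hj with hlt | rfl
        · simpa [hx₂, hlt.ne] using h1 j hlt
        · simp [hx₂, hf₂.arr aProd rfl]
      · have : j ≠ k := by omega
        simpa [hx₂, this] using h2 j (by omega)
    · rintro t s₂ ht hb₂ hf₂ hx₂ ⟨h1, h2⟩
      rw [c₁] at ht h1 h2
      have h3 : n * n ≤ n * (n * n) := Nat.le_mul_of_pos_left _ hn
      refine ⟨by omega, fun k => ?_, fun k hk => by rw [h2 k hk, hH0 k hk], fun u hu v hv => ?_⟩
      · rcases Nat.lt_or_ge k (n * n) with hk | hk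
        · rw [h1 k hk, ← Nat.div_add_mod' k n]
          exact (hI₁ _ (Nat.div_lt_of_lt_mul hk) _ (Nat.mod_lt _ hn)).1
        · rw [h2 k hk]; exact hH k
      · rw [h1 _ (mul_add_lt hu hv)]
        exact (hI₁ u hu v hv).2

theorem wp_power {n r : ℕ} (hn : 1 ≤ n) (hnn : 2 * (n * n) ≤ B) (hr : r ≤ B) (hN : s.var xN = n)
    (hA : ∀ k, s.arr aAdj k ≤ 1) (hH0 : ∀ k, s.arr aH k = 0) :
    wp B (.power r) s fun t s' => t ≤ (200 * (r + 1)) * (n * (n * n)) ∧ (∀ k, s'.arr aH k ≤ 1) ∧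
      ∀ u < n, ∀ v < n, s'.arr aH (u * n + v) ≠ 0 ↔ Reach (s.arr aAdj) n r u v := by
  have hnn1 : 1 ≤ n * n := Nat.mul_pos hn hn
  have hn3 : n * n ≤ n * (n * n) := Nat.le_mul_of_pos_left _ hn
  have hn4 : n ≤ n * n := Nat.le_mul_of_pos_left _ hn
  refine wp_assign_seq (by simp [hN]; omega) ?_
  simp only [eval_mul, eval_var, hN]
  set s₁ := s.setVar xNN (n * n) with hs₁
  have n₁ : s₁.var xN = n := by simp [hs₁, hN]
  have c₁ : s₁.var xNN = n * n := by simp [hs₁]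
  have a₁ : s₁.arr = s.arr := rfl
  clear_value s₁
  refine wp_call_seq (Q₁ := fun t s' => t ≤ 40 * (n * (n * n)) ∧ (∀ k, s'.arr aH k ≤ 1) ∧
    (∀ k, n * n ≤ k → s'.arr aH k = 0) ∧
    ∀ u < n, ∀ v < n, s'.arr aH (u * n + v) ≠ 0 ↔ u = v) ?_ ?_
  · refine wp_forLt (fun i s' => (∀ k, s'.arr aH k ≤ 1) ∧
      (∀ k, n * n ≤ k → s'.arr aH k = 0) ∧
      ∀ u < n, ∀ v < n, s'.arr aH (u * n + v) ≠ 0 ↔ u = v ∧ u < i) 20 rfl rfl rfl ?_ ?_ ?_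
    · simp [a₁, hH0]
    · rintro i s₂ hi hb₂ hf₂ hx₂ ⟨h1, h2, h3⟩
      rw [n₁] at hi
      have n₂ : s₂.var xN = n := (hf₂.var _ rfl).trans n₁
      have hii := mul_add_lt hi hi
      refine wp_store (by simp [hx₂, n₂]; omega) (by simp; omega)
        ⟨by simp, fun k => ?_, fun k hk => ?_, fun u hu v hv => ?_⟩
      · simp only [eval_add, eval_mul, eval_var, eval_one, hx₂, n₂, setVar_arr, setArr_arr]
        split
        exacts [le_refl _, h1 k]
      · have : k ≠ i * n + i := by omega
        simpa [hx₂, n₂, this] using h2 k hk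
      · simp only [eval_add, eval_mul, eval_var, eval_one, hx₂, n₂, setVar_arr, setArr_arr, true_and]
        split
        · rename_i h
          obtain ⟨rfl, rfl⟩ := mul_add_inj hv hi h
          simp
        · rename_i h
          rw [h3 u hu v hv]
          refine and_congr_right fun huv => ?_
          subst huv
          have : u ≠ i := fun hui => h (by rw [hui])
          omega
    · rintro t s₂ ht hb₂ hf₂ hx₂ ⟨h1, h2, h3⟩
      rw [n₁] at ht h3
      exact ⟨by omega, h1, h2, fun u hu v hv => by rw [h3 u hu v hv]; exact and_iff_left hu⟩
  · rintro t₂ s₂ hb₂ hf₂ ⟨ht₂, h1, h2, h3⟩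
    have n₂ : s₂.var xN = n := (hf₂.var _ rfl).trans n₁
    have c₂ : s₂.var xNN = n * n := (hf₂.var _ rfl).trans c₁
    have a₂ : s₂.arr aAdj = s.arr aAdj := by rw [hf₂.arr _ rfl, a₁]
    refine wp_assign_seq (by simpa) ?_
    rw [eval_const]
    refine wp_forLt (fun i s' => (∀ k, s'.arr aH k ≤ 1) ∧ (∀ k, n * n ≤ k → s'.arr aH k = 0) ∧
      ∀ u < n, ∀ v < n, s'.arr aH (u * n + v) ≠ 0 ↔ Reach (s.arr aAdj) n i u v)
      (150 * (n * (n * n))) rfl rfl rfl ⟨h1, h2, h3⟩ ?_ ?_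
    · rintro i s₃ hi hb₃ hf₃ hx₃ ⟨k1, k2, k3⟩
      have n₃ : s₃.var xN = n := by rw [hf₃.var _ rfl]; simp [n₂]
      have c₃ : s₃.var xNN = n * n := by rw [hf₃.var _ rfl]; simp [c₂]
      have a₃ : s₃.arr aAdj = s.arr aAdj := by rw [hf₃.arr _ rfl]; simp [a₂]
      refine wp_mono (wp_mulAdj hn hnn n₃ c₃ (by rw [a₃]; exact hA) k1 k2) ?_
      rintro t s₄ hb₄ hf₄ ⟨ht, l1, l2, l3⟩
      refine ⟨ht, l1, l2, fun u hu v hv => ?_⟩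
      rw [setVar_arr, l3 u hu v hv, a₃]
      exact exists_congr fun w => and_congr_right fun hw => by rw [k3 u hu w hw]
    · rintro t s₃ ht hb₃ hf₃ hx₃ ⟨k1, _, k3⟩
      simp only [setVar_var, reduceIte] at ht k3
      refine ⟨?_, k1, k3⟩
      have h5 : t ≤ r * (150 * (n * (n * n)) + 8) + 6 := ht
      have h6 : r * (150 * (n * (n * n)) + 8) ≤ 158 * (r * (n * (n * n))) := by
        calc r * (150 * (n * (n * n)) + 8) ≤ r * (158 * (n * (n * n))) :=
              Nat.mul_le_mul_left _ (by omega)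
          _ = _ := by ring
      have h7 : 200 * (r + 1) * (n * (n * n)) = 200 * (r * (n * (n * n))) + 200 * (n * (n * n)) := by
        ring
      simp
      omega

end WordRAM

open Prob

/-! ### The order of the joins -/

namespace WordRAM

notation "aTree" => 1
notation "aDone" => 6

variable {B : ℕ} {s s' : Store}

/-- What the program uses of the tree, which is rooted at the leaf of the vertex `0`. The nodes are
`0, …, m - 1`; `par x` is the parent of `x`, and `side x` is the set of vertices whose leaves are below
`x`, except that `side (leaf 0)` is `{0}`; the additional node `m` stands for the whole vertex set. -/
structure TreeData (n m : ℕ) (adj : ℕ → ℕ → Prop) (leaf par : ℕ → ℕ) (side : ℕ → Finset ℕ) : Prop where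
  n_pos : 1 ≤ n
  symm : ∀ x y, x < m → y < m → adj x y → adj y x
  leaf_lt : ∀ v < n, leaf v < m
  leaf_inj : ∀ v < n, ∀ w < n, leaf v = leaf w → v = w
  side_leaf : ∀ v < n, side (leaf v) = {v}
  side_sub : ∀ x < m, side x ⊆ Finset.range n
  side_top : side m = Finset.range n
  not_leaf : ∀ x < m, ∀ a < m, ∀ b < m, adj x a → adj x b → a ≠ b → ∀ v < n, x ≠ leaf v
  children : ∀ x < m, ∀ a < m, ∀ b < m, adj x a → adj x b → a ≠ b → a ≠ par x → b ≠ par x →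
    side x = side a ∪ side b ∧ Disjoint (side a) (side b) ∧
      ∀ y < m, adj x y → y ≠ par x → y = a ∨ y = b
  par_par : ∀ x < m, ∀ a < m, adj x a → x ≠ leaf 0 → a ≠ leaf 0 → a = par x → x ≠ par a
  leaf_adj : ∀ v < n, v ≠ 0 → ∀ y < m, adj (leaf v) y → y = par (leaf v)
  progress : ∀ D : ℕ → Prop, (∀ v < n, v ≠ 0 → D (leaf v)) → (∃ x < m, ¬ D x ∧ x ≠ leaf 0) →
    ∃ x < m, ∃ a < m, ∃ b < m, ¬ D x ∧ D a ∧ D b ∧ a ≠ b ∧ adj x a ∧ adj x b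
  root_adj : ∃ y < m, adj (leaf 0) y
  side_root_adj : ∀ y < m, adj (leaf 0) y → y ≠ leaf 0 ∧ side y = Finset.range n \ {0}

/-- The first `K` joins of a join sequence. -/
structure PartialJoins (n N K : ℕ) (side : ℕ → Finset ℕ) (leaf X A A' : ℕ → ℕ) : Prop where
  lt : ∀ t < K, X t < N
  left_lt : ∀ t < K, A t < N
  right_lt : ∀ t < K, A' t < N
  union : ∀ t < K, side (X t) = side (A t) ∪ side (A' t)
  disjoint : ∀ t < K, Disjoint (side (A t)) (side (A' t))
  not_leaf : ∀ t < K, ∀ v < n, X t ≠ leaf v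
  inj : ∀ t < K, ∀ t' < t, X t' ≠ X t
  left_ready : ∀ t < K, (∃ v < n, A t = leaf v) ∨ ∃ t' < t, A t = X t'
  right_ready : ∀ t < K, (∃ v < n, A' t = leaf v) ∨ ∃ t' < t, A' t = X t'

theorem PartialJoins.push {n N K : ℕ} {side : ℕ → Finset ℕ} {leaf X A A' Y L L' : ℕ → ℕ}
    (h : PartialJoins n N K side leaf X A A') (hY : ∀ t < K, Y t = X t) (hL : ∀ t < K, L t = A t)
    (hL' : ∀ t < K, L' t = A' t) (h₁ : Y K < N) (h₂ : L K < N) (h₃ : L' K < N)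
    (h₄ : side (Y K) = side (L K) ∪ side (L' K)) (h₅ : Disjoint (side (L K)) (side (L' K)))
    (h₆ : ∀ v < n, Y K ≠ leaf v) (h₇ : ∀ t < K, X t ≠ Y K)
    (h₈ : (∃ v < n, L K = leaf v) ∨ ∃ t < K, L K = X t)
    (h₉ : (∃ v < n, L' K = leaf v) ∨ ∃ t < K, L' K = X t) :
    PartialJoins n N (K + 1) side leaf Y L L' := by
  have key : ∀ p : ℕ → Prop, (∀ t < K, p t) → p K → ∀ t < K + 1, p t := fun p hp hK t ht => by
    rcases Nat.lt_succ_iff_lt_or_eq.1 ht with ht | rfl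
    exacts [hp t ht, hK]
  refine ⟨key _ (fun t ht => ?_) h₁, key _ (fun t ht => ?_) h₂, key _ (fun t ht => ?_) h₃,
    key _ (fun t ht => ?_) h₄, key _ (fun t ht => ?_) h₅, key _ (fun t ht => ?_) h₆,
    key _ (fun t ht t' ht' => ?_) (fun t ht => ?_), key _ (fun t ht => ?_) ?_,
    key _ (fun t ht => ?_) ?_⟩
  · rw [hY t ht]; exact h.lt t ht
  · rw [hL t ht]; exact h.left_lt t ht
  · rw [hL' t ht]; exact h.right_lt t ht
  · rw [hY t ht, hL t ht, hL' t ht]; exact h.union t ht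
  · rw [hL t ht, hL' t ht]; exact h.disjoint t ht
  · rw [hY t ht]; exact h.not_leaf t ht
  · rw [hY t ht, hY t' (by omega)]; exact h.inj t ht t' ht'
  · rw [hY t ht]; exact h₇ t ht
  · rcases h.left_ready t ht with h | ⟨t', h, h'⟩
    · exact .inl (by rwa [hL t ht])
    · exact .inr ⟨t', h, by rw [hL t ht, hY t' (by omega), h']⟩
  · exact h₈.imp id fun ⟨t, h, h'⟩ => ⟨t, h, by rw [hY t h, h']⟩
  · rcases h.right_ready t ht with h | ⟨t', h, h'⟩
    · exact .inl (by rwa [hL' t ht])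
    · exact .inr ⟨t', h, by rw [hL' t ht, hY t' (by omega), h']⟩
  · exact h₉.imp id fun ⟨t, h, h'⟩ => ⟨t, h, by rw [hY t h, h']⟩

/-- Run `p` if none of the values of the expressions is zero. -/
def Program.guard : List Expr → Program → Program
  | [], p => p
  | e :: es, p => .ite e (.guard es p) .skip

theorem wp_guard {p : Program} {Q : ℕ → Store → Prop} (es : List Expr) (hok : ∀ e ∈ es, e.Ok B s)
    (h₁ : (∀ e ∈ es, e.eval s ≠ 0) →
      wp B p s fun t s' => Q ((es.map fun e => e.cost + 1).sum + t) s')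
    (h₂ : (∃ e ∈ es, e.eval s = 0) → ∀ t ≤ (es.map fun e => e.cost + 1).sum + 1, Q t s) :
    wp B (.guard es p) s Q := by
  induction es generalizing Q with
  | nil =>
    have := h₁ (by simp)
    simpa [Program.guard] using this
  | cons e es ih =>
    refine wp_ite (hok e List.mem_cons_self) (fun h => ?_) (fun h => wp_skip ?_)
    · refine ih (fun e' he' => hok e' (List.mem_cons_of_mem _ he')) (fun h' => ?_) ?_
      · have := h₁ (by
          intro e' he'
          rcases List.mem_cons.1 he' with rfl | he'
          exacts [h, h' e' he'])
        simpa [add_assoc] using this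
      · rintro ⟨e', he', h'⟩ t ht
        refine h₂ ⟨e', List.mem_cons_of_mem _ he', h'⟩ _ ?_
        simp only [List.map_cons, List.sum_cons]
        omega
    · refine h₂ ⟨e, List.mem_cons_self, h⟩ _ ?_
      simp only [List.map_cons, List.sum_cons]
      omega

/-- Append the join of the nodes `xLeft` and `xRight` to the node `xNode` to the join sequence. -/
def Program.pushJoin : Program :=
  .seq (.store aX (.var xSteps) (.var xNode)) <|
  .seq (.store aLeft (.var xSteps) (.var xLeft)) <|
  .seq (.store aRight (.var xSteps) (.var xRight)) <|
  .seq (.forLt xW xN <| .store aMask (2 * .var xNode * .var xN + .var xW)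
    (.get aMask (2 * .var xLeft * .var xN + .var xW) +
      .get aMask (2 * .var xRight * .var xN + .var xW))) <|
  .assign xSteps (.var xSteps + 1)

theorem wp_pushJoin {n m x a b : ℕ} {T U : Finset ℕ} (hn : 1 ≤ n) (hN : s.var xN = n)
    (hB : 2 * (m + 1) * n ≤ B) (hK : s.var xSteps < m) (hx : s.var xNode = x) (hxm : x ≤ m)
    (ha : s.var xLeft = a) (ham : a ≤ m) (hb : s.var xRight = b) (hbm : b ≤ m) (hxa : x ≠ a)
    (hxb : x ≠ b)
    (hma : ∀ w < n, s.arr aMask (2 * a * n + w) = if w ∈ T then 1 else 0)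
    (hmb : ∀ w < n, s.arr aMask (2 * b * n + w) = if w ∈ U then 1 else 0) (hTU : Disjoint T U) :
    wp B .pushJoin s fun t s' => t ≤ 60 * n ∧ s'.var xSteps = s.var xSteps + 1 ∧
      (∀ t, s'.arr aX t = if t = s.var xSteps then x else s.arr aX t) ∧
      (∀ t, s'.arr aLeft t = if t = s.var xSteps then a else s.arr aLeft t) ∧
      (∀ t, s'.arr aRight t = if t = s.var xSteps then b else s.arr aRight t) ∧
      (∀ w < n, s'.arr aMask (2 * x * n + w) = if w ∈ T ∪ U then 1 else 0) ∧
      ∀ y, y ≠ x → ∀ w < n, s'.arr aMask (2 * y * n + w) = s.arr aMask (2 * y * n + w) := by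
  have hmul : ∀ {y w}, y ≤ m → w < n → 2 * y ≤ B ∧ 2 * y * n ≤ B ∧ 2 * y * n + w ≤ B := by
    intro y w hy hw
    have h1 : 2 * y * n + w < 2 * (m + 1) * n := mul_add_lt (by omega) hw
    have h2 : 2 * y ≤ 2 * y * n := Nat.le_mul_of_pos_right _ hn
    omega
  have hmm : 2 * (m + 1) ≤ 2 * (m + 1) * n := Nat.le_mul_of_pos_right _ hn
  refine wp_store_seq trivial trivial (wp_store_seq trivial trivial
    (wp_store_seq trivial trivial ?_))
  simp only [eval_var, setArr_var, hx, ha, hb]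
  set s₁ := ((s.setArr aX (s.var xSteps) x).setArr aLeft (s.var xSteps) a).setArr aRight
    (s.var xSteps) b with hs₁
  have v₁ : s₁.var = s.var := rfl
  have a₁ : ∀ k, s₁.arr aX k = if k = s.var xSteps then x else s.arr aX k := fun k => by simp [hs₁]
  have a₂ : ∀ k, s₁.arr aLeft k = if k = s.var xSteps then a else s.arr aLeft k := fun k => by
    simp [hs₁]
  have a₃ : ∀ k, s₁.arr aRight k = if k = s.var xSteps then b else s.arr aRight k := fun k => by
    simp [hs₁]
  have a₄ : s₁.arr aMask = s.arr aMask := rfl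
  clear_value s₁
  refine wp_call_seq (Q₁ := fun t s' => t ≤ 40 * n ∧
    (∀ w < n, s'.arr aMask (2 * x * n + w) = if w ∈ T ∪ U then 1 else 0) ∧
      ∀ y, y ≠ x → ∀ w < n, s'.arr aMask (2 * y * n + w) = s.arr aMask (2 * y * n + w)) ?_ ?_
  · refine wp_forLt (fun k s' => (∀ w < k, s'.arr aMask (2 * x * n + w) = if w ∈ T ∪ U then 1 else 0) ∧
      ∀ y, y ≠ x → ∀ w < n, s'.arr aMask (2 * y * n + w) = s.arr aMask (2 * y * n + w)) 26
      rfl rfl rfl ⟨by simp, fun y _ w _ => by simp [a₄]⟩ ?_ ?_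
    · rintro w s₂ hw hb₂ hf₂ hx₂ ⟨h1, h2⟩
      rw [v₁, hN] at hw
      have n₂ : s₂.var xN = n := by rw [hf₂.var _ rfl, v₁, hN]
      have x₂ : s₂.var xNode = x := by rw [hf₂.var _ rfl, v₁, hx]
      have l₂ : s₂.var xLeft = a := by rw [hf₂.var _ rfl, v₁, ha]
      have r₂ : s₂.var xRight = b := by rw [hf₂.var _ rfl, v₁, hb]
      have e1 : s₂.arr aMask (2 * a * n + w) = if w ∈ T then 1 else 0 := by
        rw [h2 a hxa.symm w hw, hma w hw]
      have e2 : s₂.arr aMask (2 * b * n + w) = if w ∈ U then 1 else 0 := by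
        rw [h2 b hxb.symm w hw, hmb w hw]
      have e3 : s₂.arr aMask (2 * a * n + w) + s₂.arr aMask (2 * b * n + w)
          = if w ∈ T ∪ U then 1 else 0 := by
        rw [e1, e2]
        by_cases hT : w ∈ T
        · simp [hT, Finset.disjoint_left.1 hTU hT]
        · simp [hT]
      have e4 : (if w ∈ T ∪ U then 1 else 0) ≤ B := by split <;> omega
      obtain ⟨b1, b2, b3⟩ := hmul hxm hw
      obtain ⟨c1, c2, c3⟩ := hmul ham hw
      obtain ⟨d1, d2, d3⟩ := hmul hbm hw
      have hB2 : 2 ≤ B := by omega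
      refine wp_store (by simp [x₂, n₂, hx₂, b1, b2, b3, hB2]) (by
        simp only [ok_add, ok_get, ok_mul, ok_two, ok_var, eval_add, eval_get, eval_mul, eval_two,
          eval_var, l₂, r₂, n₂, hx₂, c1, c2, c3, d1, d2, d3, hB2, e3, e4, and_self])
        ⟨by simp, fun w' hw' => ?_, fun y hy w' hw' => ?_⟩
      · simp only [eval_add, eval_get, eval_mul, eval_two,
          eval_var, l₂, r₂, n₂, hx₂, x₂, e3, setVar_arr, setArr_arr]
        rcases Nat.lt_succ_iff_lt_or_eq.1 hw' with hlt | rfl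
        · simpa [hlt.ne] using h1 w' hlt
        · simp
      · have hne : 2 * y * n + w' ≠ 2 * x * n + w := fun h => by
          have := (mul_add_inj hw' hw h).1; omega
        simpa [x₂, n₂, hx₂, hne] using h2 y hy w' hw'
    · rintro t s₂ ht hb₂ hf₂ hx₂ ⟨h1, h2⟩
      rw [v₁, hN] at ht h1
      exact ⟨by omega, h1, h2⟩
  · rintro t₂ s₂ hb₂ hf₂ ⟨ht₂, h1, h2⟩
    have k₂ : s₂.var xSteps = s.var xSteps := by rw [hf₂.var _ rfl, v₁]
    refine wp_assign (by simp [k₂]; omega) ⟨by simp; omega, by simp [k₂], ?_, ?_, ?_, h1, h2⟩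
    · exact fun k => by rw [setVar_arr, hf₂.arr _ rfl, a₁]
    · exact fun k => by rw [setVar_arr, hf₂.arr _ rfl, a₂]
    · exact fun k => by rw [setVar_arr, hf₂.arr _ rfl, a₃]

/-- The invariant of the search for a join sequence. A node `x` is done, `s.arr aDone x ≠ 0`, if it is
a leaf different from the root or the node of a join that has been found. -/
structure TreeInv (n m : ℕ) (adj : ℕ → ℕ → Prop) (leaf par : ℕ → ℕ) (side : ℕ → Finset ℕ)
    (s : Store) : Prop where
  joins : PartialJoins n (m + 1) (s.var xSteps) side leaf (s.arr aX) (s.arr aLeft) (s.arr aRight)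
  node_lt : ∀ t < s.var xSteps, s.arr aX t < m
  done_node : ∀ t < s.var xSteps, s.arr aDone (s.arr aX t) ≠ 0
  done_leaf : ∀ v < n, v ≠ 0 → s.arr aDone (leaf v) ≠ 0
  done_root : s.arr aDone (leaf 0) = 0
  cases : ∀ x < m, s.arr aDone x ≠ 0 → (∃ v < n, x = leaf v) ∨ ∃ t < s.var xSteps, x = s.arr aX t
  closed : ∀ x < m, ∀ y < m, s.arr aDone x ≠ 0 → adj x y → y ≠ par x → s.arr aDone y ≠ 0
  mask : ∀ x < m, s.arr aDone x ≠ 0 ∨ x = leaf 0 → ∀ w < n,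
    s.arr aMask (2 * x * n + w) = if w ∈ side x then 1 else 0

variable {n m : ℕ} {adj : ℕ → ℕ → Prop} {leaf par : ℕ → ℕ} {side : ℕ → Finset ℕ}

theorem TreeInv.congr (h : TreeInv n m adj leaf par side s) (hv : s'.var xSteps = s.var xSteps)
    (ha : s'.arr = s.arr) : TreeInv n m adj leaf par side s' := by
  obtain ⟨h1, h2, h3, h4, h5, h6, h7, h8⟩ := h
  rw [← hv, ← ha] at *
  exact ⟨h1, h2, h3, h4, h5, h6, h7, h8⟩

/-- Distinct joins have distinct nodes, and none of them is the root. -/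
theorem TreeInv.steps_lt (ht : TreeData n m adj leaf par side) (h : TreeInv n m adj leaf par side s) :
    s.var xSteps < m := by
  have hinj : Set.InjOn (s.arr aX) (Finset.range (s.var xSteps)) := by
    intro t htK t' htK' he
    simp only [Finset.coe_range, Set.mem_Iio] at htK htK'
    rcases lt_trichotomy t t' with hlt | rfl | hlt
    · exact absurd he (h.joins.inj t' htK' t hlt)
    · rfl
    · exact absurd he.symm (h.joins.inj t htK t' hlt)
  have hsub : (Finset.range (s.var xSteps)).image (s.arr aX) ⊆ (Finset.range m).erase (leaf 0) := by
    intro x hx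
    obtain ⟨t, htK, rfl⟩ := Finset.mem_image.1 hx
    rw [Finset.mem_range] at htK
    exact Finset.mem_erase.2 ⟨h.joins.not_leaf t htK 0 ht.n_pos, Finset.mem_range.2 (h.node_lt t htK)⟩
  have := Finset.card_le_card hsub
  have hm := ht.leaf_lt 0 ht.n_pos
  rw [Finset.card_image_of_injOn hinj, Finset.card_erase_of_mem (Finset.mem_range.2 hm)] at this
  simp at this
  omega

/-- The triple `(x, a, b)` is a join that can be carried out next. -/
def Enabled (adj : ℕ → ℕ → Prop) (s : Store) (x a b : ℕ) : Prop :=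
  s.arr aDone x = 0 ∧ s.arr aDone a ≠ 0 ∧ s.arr aDone b ≠ 0 ∧ a ≠ b ∧ adj x a ∧ adj x b

theorem TreeInv.enabled_children (ht : TreeData n m adj leaf par side)
    (h : TreeInv n m adj leaf par side s) {x a b : ℕ} (hx : x < m) (ha : a < m) (hb : b < m)
    (he : Enabled adj s x a b) : side x = side a ∪ side b ∧ Disjoint (side a) (side b) ∧
      ∀ y < m, adj x y → y ≠ par x → y = a ∨ y = b := by
  obtain ⟨hdx, hda, hdb, hab, hxa, hxb⟩ := he
  have hleaf := ht.not_leaf x hx a ha b hb hxa hxb hab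
  have hroot : ∀ y, s.arr aDone y ≠ 0 → y ≠ leaf 0 := fun y hy h0 => hy (h0 ▸ h.done_root)
  -- a done node is not the parent of `x`, since otherwise its child `x` would be done
  have hpar : ∀ y < m, s.arr aDone y ≠ 0 → adj x y → y ≠ par x := by
    intro y hy hdy hxy hyp
    exact h.closed y hy x hx hdy (ht.symm x y hx hy hxy)
      (ht.par_par x hx y hy hxy (hleaf 0 ht.n_pos) (hroot y hdy) hyp) hdx
  exact ht.children x hx a ha b hb hxa hxb hab (hpar a ha hda hxa) (hpar b hb hdb hxb)

/-- A node all of whose children are done becomes done, and the join of its children extends the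
sequence. -/
theorem TreeInv.push (ht : TreeData n m adj leaf par side) (h : TreeInv n m adj leaf par side s)
    {x a b : ℕ} (hx : x < m) (ha : a < m) (hb : b < m) (he : Enabled adj s x a b)
    (hK : s'.var xSteps = s.var xSteps + 1)
    (hX : ∀ t, s'.arr aX t = if t = s.var xSteps then x else s.arr aX t)
    (hA : ∀ t, s'.arr aLeft t = if t = s.var xSteps then a else s.arr aLeft t)
    (hA' : ∀ t, s'.arr aRight t = if t = s.var xSteps then b else s.arr aRight t)
    (hm : ∀ w < n, s'.arr aMask (2 * x * n + w) = if w ∈ side a ∪ side b then 1 else 0)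
    (hm' : ∀ y, y ≠ x → ∀ w < n, s'.arr aMask (2 * y * n + w) = s.arr aMask (2 * y * n + w))
    (hd : ∀ y, s'.arr aDone y = if y = x then 1 else s.arr aDone y) :
    TreeInv n m adj leaf par side s' := by
  obtain ⟨hun, hdis, hch⟩ := h.enabled_children ht hx ha hb he
  obtain ⟨hdx, hda, hdb, hab, hxa, hxb⟩ := he
  have hleaf := ht.not_leaf x hx a ha b hb hxa hxb hab
  have hXne : ∀ t < s.var xSteps, s.arr aX t ≠ x := fun t htK hx' => h.done_node t htK (hx' ▸ hdx)
  have hmono : ∀ y, s.arr aDone y ≠ 0 → s'.arr aDone y ≠ 0 := fun y hy => by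
    rw [hd]; split <;> simp [hy]
  have hXlt : ∀ t < s.var xSteps, s'.arr aX t = s.arr aX t := fun t htK => by
    rw [hX, if_neg htK.ne]
  have hXK : s'.arr aX (s.var xSteps) = x := by rw [hX, if_pos rfl]
  have hAK : s'.arr aLeft (s.var xSteps) = a := by rw [hA, if_pos rfl]
  have hAK' : s'.arr aRight (s.var xSteps) = b := by rw [hA', if_pos rfl]
  constructor
  · rw [hK]
    refine h.joins.push hXlt (fun t htK => by rw [hA, if_neg htK.ne])
      (fun t htK => by rw [hA', if_neg htK.ne]) ?_ ?_ ?_ ?_ ?_ ?_ ?_ ?_ ?_ <;>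
      simp only [hXK, hAK, hAK']
    · omega
    · omega
    · omega
    · exact hun
    · exact hdis
    · exact hleaf
    · exact hXne
    · exact h.cases a ha hda
    · exact h.cases b hb hdb
  · intro t htK
    rcases Nat.lt_succ_iff_lt_or_eq.1 (hK ▸ htK) with hlt | rfl
    · rw [hXlt t hlt]; exact h.node_lt t hlt
    · rw [hXK]; exact hx
  · intro t htK
    rcases Nat.lt_succ_iff_lt_or_eq.1 (hK ▸ htK) with hlt | rfl
    · rw [hXlt t hlt]; exact hmono _ (h.done_node t hlt)
    · rw [hXK, hd, if_pos rfl]; exact one_ne_zero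
  · exact fun v hv hv0 => hmono _ (h.done_leaf v hv hv0)
  · rw [hd, if_neg (hleaf 0 ht.n_pos).symm, h.done_root]
  · intro y hy hdy
    rw [hd] at hdy
    by_cases hyx : y = x
    · exact .inr ⟨s.var xSteps, by omega, by rw [hXK, hyx]⟩
    · rw [if_neg hyx] at hdy
      refine (h.cases y hy hdy).imp id fun ⟨t, htK, h'⟩ => ⟨t, by omega, by rw [hXlt t htK, h']⟩
  · intro y hy z hz hdy hyz hzp
    rw [hd] at hdy
    by_cases hyx : y = x
    · subst hyx
      rcases hch z hz hyz hzp with rfl | rfl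
      exacts [hmono _ hda, hmono _ hdb]
    · rw [if_neg hyx] at hdy
      exact hmono _ (h.closed y hy z hz hdy hyz hzp)
  · intro y hy hy' w hw
    by_cases hyx : y = x
    · subst hyx
      rw [hm w hw, hun]
    · rw [hm' y hyx w hw]
      refine h.mask y hy (hy'.imp (fun h' => ?_) id) w hw
      rwa [hd, if_neg hyx] at h'

/-- Carry out the join that is encoded in `xT` if it is enabled. -/
def Program.tryJoin : Program :=
  .seq (.assign xIJ (.var xT / .var xM)) <|
  .seq (.assign xRight (.var xT - .var xIJ * .var xM)) <|
  .seq (.assign xNode (.var xIJ / .var xM)) <|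
  .seq (.assign xLeft (.var xIJ - .var xNode * .var xM)) <|
  .guard [1 - .get aDone (.var xNode), .get aDone (.var xLeft), .get aDone (.var xRight),
      1 - .eqE (.var xLeft) (.var xRight), .get aTree (.var xNode * .var xM + .var xLeft),
      .get aTree (.var xNode * .var xM + .var xRight)]
    (.seq .pushJoin (.store aDone (.var xNode) 1))

set_option maxHeartbeats 800000 in
theorem wp_tryJoin {tree : ℕ → ℕ} {x a b : ℕ} (htree : s.arr aTree = tree)
    (ht : TreeData n m (fun x y => tree (x * m + y) ≠ 0) leaf par side)
    (hN : s.var xN = n) (hM : s.var xM = m) (hB : 2 * (m + 1) * n ≤ B) (hmm : m * m * m ≤ B)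
    (hx : x < m) (ha : a < m) (hb : b < m) (hT : s.var xT = (x * m + a) * m + b)
    (h : TreeInv n m (fun x y => tree (x * m + y) ≠ 0) leaf par side s)
    (hd1 : ∀ y, s.arr aDone y ≤ 1) :
    wp B .tryJoin s fun t s' => t ≤ 150 * n ∧
      TreeInv n m (fun x y => tree (x * m + y) ≠ 0) leaf par side s' ∧
      (∀ y, s'.arr aDone y ≤ 1) ∧ (∀ y, s.arr aDone y ≠ 0 → s'.arr aDone y ≠ 0) ∧
      (s.var xSteps < s'.var xSteps ∨ (s'.var xSteps = s.var xSteps ∧ s'.arr aDone = s.arr aDone ∧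
        ¬ Enabled (fun x y => tree (x * m + y) ≠ 0) s x a b)) := by
  have hn := ht.n_pos
  have hm1 : 1 ≤ m := by omega
  have hmB : m * m ≤ B := le_trans (Nat.le_mul_of_pos_right _ hm1) hmm
  have hab := mul_add_lt hx ha
  have hxb := mul_add_lt hx hb
  have hxab := mul_add_lt hab hb
  have hKm := h.steps_lt ht
  refine wp_bdd fun hbd => ?_
  have e1 : Expr.eval s (.var xT / .var xM) = x * m + a := by simp [hT, hM, mul_add_div' hb]
  refine wp_assign_seq (by simp) ?_
  rw [e1]
  refine wp_assign_seq (by simp [hM]; omega) ?_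
  have e2 : Expr.eval (s.setVar xIJ (x * m + a)) (.var xT - .var xIJ * .var xM) = b := by
    simp [hT, hM]
  rw [e2]
  refine wp_assign_seq (by simp) ?_
  have e3 : Expr.eval ((s.setVar xIJ (x * m + a)).setVar xRight b) (.var xIJ / .var xM) = x := by
    simp [hM, mul_add_div' ha]
  rw [e3]
  refine wp_assign_seq (by simp [hM]; omega) ?_
  have e4 : Expr.eval (((s.setVar xIJ (x * m + a)).setVar xRight b).setVar xNode x)
      (.var xIJ - .var xNode * .var xM) = a := by simp [hM]
  rw [e4]
  set s₁ := (((s.setVar xIJ (x * m + a)).setVar xRight b).setVar xNode x).setVar xLeft a with hs₁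
  have n₁ : s₁.var xN = n := by simp [hs₁, hN]
  have m₁ : s₁.var xM = m := by simp [hs₁, hM]
  have x₁ : s₁.var xNode = x := by simp [hs₁]
  have a₁ : s₁.var xLeft = a := by simp [hs₁]
  have b₁ : s₁.var xRight = b := by simp [hs₁]
  have k₁ : s₁.var xSteps = s.var xSteps := by simp [hs₁]
  have c₁ : s₁.arr = s.arr := rfl
  have hI₁ : TreeInv n m (fun x y => tree (x * m + y) ≠ 0) leaf par side s₁ := h.congr k₁ c₁
  have bd₁ : Bdd B s₁ := by
    refine ⟨fun y => ?_, hbd.2⟩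
    have := hbd.1 y
    have hmm1 : m ≤ m * m := Nat.le_mul_of_pos_right _ hm1
    simp only [hs₁, setVar_var]
    split_ifs <;> omega
  clear_value s₁
  have hB1 : 1 ≤ B := by omega
  refine wp_guard _ ?_ (fun hall => ?_) (fun hex => ?_)
  · intro e he
    simp only [List.mem_cons, List.not_mem_nil, or_false] at he
    rcases he with rfl | rfl | rfl | rfl | rfl | rfl
    · simpa
    · trivial
    · trivial
    · exact ⟨hB1, ok_eqE bd₁ hB1 trivial trivial⟩
    · simp [x₁, m₁, a₁]; omega
    · simp [x₁, m₁, b₁]; omega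
  · simp only [List.forall_mem_cons, eval_sub, eval_one, eval_get, eval_var, eval_eqE, eval_add,
      eval_mul, x₁, a₁, b₁, m₁, c₁, htree] at hall
    obtain ⟨h1, h2, h3, h4, h5, h6, -⟩ := hall
    have hen : Enabled (fun x y => tree (x * m + y) ≠ 0) s x a b := by
      refine ⟨by omega, h2, h3, fun hab => by simp [hab] at h4, h5, h6⟩
    have hxa : x ≠ a := fun hh => h2 (hh ▸ hen.1)
    have hxb : x ≠ b := fun hh => h3 (hh ▸ hen.1)
    obtain ⟨-, hdis, -⟩ := h.enabled_children ht hx ha hb hen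
    refine wp_call_seq (wp_pushJoin hn n₁ hB (by rw [k₁]; exact hKm) x₁ hx.le a₁ ha.le b₁ hb.le hxa hxb
      (hI₁.mask a ha (.inl (by rw [c₁]; exact h2))) (hI₁.mask b hb (.inl (by rw [c₁]; exact h3)))
      hdis) ?_
    rintro t₂ s₂ hb₂ hf₂ ⟨ht₂, g1, g2, g3, g4, g5, g6⟩
    have x₂ : s₂.var xNode = x := (hf₂.var _ rfl).trans x₁
    have d₂ : s₂.arr aDone = s.arr aDone := by rw [hf₂.arr _ rfl, c₁]
    have d₃ : ∀ y, (s₂.setArr aDone (s₂.var xNode) 1).arr aDone y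
        = if y = x then 1 else s.arr aDone y := by
      intro y
      rw [x₂, setArr_arr, d₂]
      simp
    refine wp_store trivial (by simpa) ⟨by simp; omega, ?_, ?_, ?_, .inl ?_⟩
    · rw [k₁] at g1 g2 g3 g4
      rw [c₁] at g2 g3 g4 g6
      refine h.push ht hx ha hb hen g1 ?_ ?_ ?_ ?_ ?_ d₃
      · exact fun t => by simpa using g2 t
      · exact fun t => by simpa using g3 t
      · exact fun t => by simpa using g4 t
      · exact fun w hw => by simpa using g5 w hw
      · exact fun y hy w hw => by simpa using g6 y hy w hw
    · intro y
      rw [eval_var, eval_one, d₃]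
      split
      exacts [le_refl _, hd1 y]
    · intro y hy
      rw [eval_var, eval_one, d₃]
      split
      exacts [one_ne_zero, hy]
    · rw [setArr_var, g1, k₁]
      omega
  · intro t htt
    refine ⟨?_, hI₁, fun y => by rw [c₁]; exact hd1 y, fun y hy => by rwa [c₁], .inr ⟨k₁, by rw [c₁], ?_⟩⟩
    · simp at htt
      simp
      omega
    · rintro ⟨h1, h2, h3, h4, h5, h6⟩
      obtain ⟨e, he, h0⟩ := hex
      simp only [List.mem_cons, List.not_mem_nil, or_false] at he
      rcases he with rfl | rfl | rfl | rfl | rfl | rfl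
      · simp [x₁, c₁, h1] at h0
      · simp [a₁, c₁, h2] at h0
      · simp [b₁, c₁, h3] at h0
      · simp [a₁, b₁, h4] at h0
      · simp [x₁, m₁, a₁, c₁, htree] at h0; exact h5 h0
      · simp [x₁, m₁, b₁, c₁, htree] at h0; exact h6 h0

end WordRAM

open Prob

namespace WordRAM

notation "xCube" => 65

variable {B : ℕ} {s s' : Store} {n m : ℕ} {leaf par : ℕ → ℕ} {side : ℕ → Finset ℕ} {tree : ℕ → ℕ}

/-- Mark the leaves. -/
def Program.initLeaves : Program :=
  .forLt xV xN <|
  .seq (.store aMask (2 * .get aLeaf (.var xV) * .var xN + .var xV) 1) <|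
  .ite (.var xV) (.store aDone (.get aLeaf (.var xV)) 1) .skip

theorem wp_initLeaves {adj : ℕ → ℕ → Prop} (hleaf : ∀ v < n, s.arr aLeaf v = leaf v)
    (ht : TreeData n m adj leaf par side) (hN : s.var xN = n) (hB : 2 * (m + 1) * n ≤ B)
    (hmask : ∀ k, s.arr aMask k = 0) (hdone : ∀ k, s.arr aDone k = 0) (hK : s.var xSteps = 0) :
    wp B .initLeaves s fun t s' => t ≤ 40 * n ∧ TreeInv n m adj leaf par side s' ∧
      ∀ y, s'.arr aDone y ≤ 1 := by
  have hn := ht.n_pos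
  have hmm : 2 * (m + 1) ≤ 2 * (m + 1) * n := Nat.le_mul_of_pos_right _ hn
  have hmul : ∀ {y w}, y ≤ m → w < n → 2 * y ≤ B ∧ 2 * y * n ≤ B ∧ 2 * y * n + w ≤ B := by
    intro y w hy hw
    have h1 : 2 * y * n + w < 2 * (m + 1) * n := mul_add_lt (by omega) hw
    have h2 : 2 * y ≤ 2 * y * n := Nat.le_mul_of_pos_right _ hn
    omega
  refine wp_forLt (fun k s' => (∀ v < k, ∀ w < n, s'.arr aMask (2 * leaf v * n + w) = if w = v then 1 else 0) ∧
    (∀ v < n, k ≤ v → ∀ w < n, s'.arr aMask (2 * leaf v * n + w) = 0) ∧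
    (∀ y, s'.arr aDone y ≤ 1) ∧ ∀ y, s'.arr aDone y ≠ 0 ↔ ∃ v < k, v ≠ 0 ∧ y = leaf v) 26 rfl rfl rfl
    ⟨by simp, fun v _ _ w _ => by simp [hmask], fun y => by simp [hdone], fun y => by simp [hdone]⟩ ?_ ?_
  · rintro k s₁ hk hb₁ hf₁ hx₁ ⟨h1, h2, h3, h4⟩
    rw [hN] at hk
    have n₁ : s₁.var xN = n := (hf₁.var _ rfl).trans hN
    have l₁ : s₁.arr aLeaf k = leaf k := by rw [hf₁.arr _ rfl, hleaf k hk]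
    obtain ⟨b1, b2, b3⟩ := hmul (ht.leaf_lt k hk).le hk
    have hB2 : 2 ≤ B := by omega
    refine wp_store_seq (by simp [hx₁, l₁, n₁, b1, b2, b3, hB2]) (by simp; omega) ?_
    simp only [eval_add, eval_mul, eval_two, eval_get, eval_var, eval_one, hx₁, l₁, n₁]
    set s₂ := s₁.setArr aMask (2 * leaf k * n + k) 1 with hs₂
    have hm₁ : ∀ v < k + 1, ∀ w < n, s₂.arr aMask (2 * leaf v * n + w) = if w = v then 1 else 0 := by
      intro v hv w hw
      simp only [hs₂, setArr_arr, true_and]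
      split
      · rename_i h
        obtain ⟨h5, rfl⟩ := mul_add_inj hw hk h
        rw [if_pos (ht.leaf_inj w hw v (by omega) (by omega))]
      · rename_i h
        rcases Nat.lt_succ_iff_lt_or_eq.1 hv with hv | rfl
        · exact h1 v hv w hw
        · rw [h2 v hk (le_refl _) w hw, if_neg (fun hh => h (by rw [hh]))]
    have hm₂ : ∀ v < n, k + 1 ≤ v → ∀ w < n, s₂.arr aMask (2 * leaf v * n + w) = 0 := by
      intro v hv hkv w hw
      have hne : 2 * leaf v * n + w ≠ 2 * leaf k * n + k := fun h => by
        have := ht.leaf_inj v hv k hk (by have := (mul_add_inj hw hk h).1; omega)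
        omega
      simp only [hs₂, setArr_arr, hne, and_false, if_false]
      exact h2 v hv (by omega) w hw
    have d₂ : s₂.arr aDone = s₁.arr aDone := rfl
    have x₂ : s₂.var xV = k := hx₁
    have l₂ : s₂.arr aLeaf k = leaf k := l₁
    clear_value s₂
    refine wp_ite trivial (fun h => wp_store trivial (by simp; omega) ?_) (fun h => wp_skip ?_)
    · have hk0 : k ≠ 0 := by simpa [x₂] using h
      refine ⟨by simp, fun v hv w hw => by simpa using hm₁ v hv w hw,
        fun v hv hkv w hw => by simpa using hm₂ v hv hkv w hw, fun y => ?_, fun y => ?_⟩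
      · simp only [setVar_arr, setArr_arr, eval_get, eval_var, x₂, l₂, eval_one, d₂, true_and]
        split
        exacts [le_refl _, h3 y]
      · simp only [setVar_arr, setArr_arr, eval_get, eval_var, x₂, l₂, eval_one, d₂, true_and]
        split
        · rename_i hy
          exact ⟨fun _ => ⟨k, by omega, hk0, hy⟩, fun _ => one_ne_zero⟩
        · rename_i hy
          rw [h4]
          refine ⟨fun ⟨v, hv, h'⟩ => ⟨v, by omega, h'⟩, fun ⟨v, hv, h', h''⟩ => ⟨v, ?_, h', h''⟩⟩
          rcases Nat.lt_succ_iff_lt_or_eq.1 hv with hv | rfl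
          exacts [hv, absurd h'' hy]
    · have hk0 : k = 0 := by simpa [x₂] using h
      subst hk0
      refine ⟨by simp, fun v hv w hw => by simpa using hm₁ v hv w hw,
        fun v hv hkv w hw => by simpa using hm₂ v hv hkv w hw, fun y => by simp [d₂, h3], fun y => ?_⟩
      rw [setVar_arr, d₂, h4]
      simp
  · rintro t s₁ ht' hb₁ hf₁ hx₁ ⟨h1, h2, h3, h4⟩
    rw [hN] at ht' h1 h2 h4
    have k₁ : s₁.var xSteps = 0 := (hf₁.var _ rfl).trans hK
    refine ⟨by omega, ⟨?_, ?_, ?_, fun v hv hv0 => (h4 _).2 ⟨v, hv, hv0, rfl⟩, ?_, fun x _ hx => ?_, ?_, ?_⟩, h3⟩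
    · rw [k₁]
      constructor <;> simp
    · rw [k₁]; simp
    · rw [k₁]; simp
    · by_contra h
      obtain ⟨v, hv, hv0, h⟩ := (h4 _).1 h
      exact hv0 (ht.leaf_inj 0 hn v hv h).symm
    · obtain ⟨v, hv, hv0, h⟩ := (h4 _).1 hx
      exact .inl ⟨v, hv, h⟩
    · intro x _ y hy hx hxy hyp
      obtain ⟨v, hv, hv0, rfl⟩ := (h4 _).1 hx
      exact absurd (ht.leaf_adj v hv hv0 y hy hxy) hyp
    · intro x _ hx w hw
      have : ∃ v < n, x = leaf v := by
        rcases hx with hx | hx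
        · obtain ⟨v, hv, _, h⟩ := (h4 _).1 hx
          exact ⟨v, hv, h⟩
        · exact ⟨0, hn, hx⟩
      obtain ⟨v, hv, rfl⟩ := this
      rw [h1 v hv w hw, ht.side_leaf v hv]
      simp

/-- Find all joins except for the last one. -/
def Program.sweeps : Program :=
  .seq (.assign xCube (.var xM * .var xM * .var xM)) <| .forLt xJ xM <| .forLt xT xCube .tryJoin

/-- All nodes except for the root are done. -/
def Complete (m root : ℕ) (s : Store) : Prop := ∀ x < m, x ≠ root → s.arr aDone x ≠ 0

/-- Each sweep over the tree finds a new join as long as a node is not done, so `m` sweeps suffice. -/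
theorem wp_sweeps (htree : s.arr aTree = tree)
    (ht : TreeData n m (fun x y => tree (x * m + y) ≠ 0) leaf par side)
    (hN : s.var xN = n) (hM : s.var xM = m) (hB : 2 * (m + 1) * n ≤ B) (hmm : m * m * m ≤ B)
    (h : TreeInv n m (fun x y => tree (x * m + y) ≠ 0) leaf par side s)
    (hd1 : ∀ y, s.arr aDone y ≤ 1) :
    wp B .sweeps s fun t s' => t ≤ 200 * (m * (m * m * m * n)) ∧
      TreeInv n m (fun x y => tree (x * m + y) ≠ 0) leaf par side s' ∧ Complete m (leaf 0) s' := by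
  have hn := ht.n_pos
  have hm : 1 ≤ m := by have := ht.leaf_lt 0 hn; omega
  have hm3 : 1 ≤ m * m * m := Nat.mul_pos (Nat.mul_pos hm hm) hm
  refine wp_assign_seq ?_ ?_
  · simp only [ok_mul, ok_var, eval_mul, eval_var, hM, true_and]
    exact ⟨le_trans (Nat.le_mul_of_pos_right _ hm) hmm, hmm⟩
  simp only [eval_mul, eval_var, hM]
  set s₁ := s.setVar xCube (m * m * m) with hs₁
  have n₁ : s₁.var xN = n := by simp [hs₁, hN]
  have m₁ : s₁.var xM = m := by simp [hs₁, hM]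
  have c₁ : s₁.var xCube = m * m * m := by simp [hs₁]
  have a₁ : s₁.arr aTree = tree := by simp [hs₁, htree]
  have hI₁ : TreeInv n m (fun x y => tree (x * m + y) ≠ 0) leaf par side s₁ :=
    h.congr (by simp [hs₁]) rfl
  have d₁ : ∀ y, s₁.arr aDone y ≤ 1 := hd1
  clear_value s₁
  refine wp_forLt (fun k s' => TreeInv n m (fun x y => tree (x * m + y) ≠ 0) leaf par side s' ∧
    (∀ y, s'.arr aDone y ≤ 1) ∧ (k ≤ s'.var xSteps ∨ Complete m (leaf 0) s'))
    (170 * (m * m * m * n)) rfl rfl rfl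
    ⟨hI₁.congr (by simp) rfl, d₁, .inl (Nat.zero_le _)⟩ ?_ ?_
  · rintro k s₂ hk hb₂ hf₂ hx₂ ⟨g1, g2, g3⟩
    have n₂ : s₂.var xN = n := (hf₂.var _ rfl).trans n₁
    have m₂ : s₂.var xM = m := (hf₂.var _ rfl).trans m₁
    have c₂ : s₂.var xCube = m * m * m := (hf₂.var _ rfl).trans c₁
    have a₂ : s₂.arr aTree = tree := by rw [hf₂.arr _ rfl, a₁]
    refine wp_forLt (fun t s' => TreeInv n m (fun x y => tree (x * m + y) ≠ 0) leaf par side s' ∧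
      (∀ y, s'.arr aDone y ≤ 1) ∧ (∀ y, s₂.arr aDone y ≠ 0 → s'.arr aDone y ≠ 0) ∧
      (s₂.var xSteps < s'.var xSteps ∨ (s'.var xSteps = s₂.var xSteps ∧ s'.arr aDone = s₂.arr aDone ∧
        ∀ x < m, ∀ a < m, ∀ b < m, (x * m + a) * m + b < t →
          ¬ Enabled (fun x y => tree (x * m + y) ≠ 0) s₂ x a b))) (150 * n) rfl rfl rfl
      ⟨g1.congr (by simp) rfl, g2, fun _ => id, .inr ⟨by simp, rfl, by simp⟩⟩ ?_ ?_
    · rintro t s₃ htm hb₃ hf₃ hx₃ ⟨k1, k2, k3, k4⟩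
      rw [c₂] at htm
      obtain ⟨xa, b, hb, rfl⟩ : ∃ xa b, b < m ∧ t = xa * m + b :=
        ⟨t / m, t % m, Nat.mod_lt _ hm, (Nat.div_add_mod' t m).symm⟩
      have hxa : xa < m * m := by
        by_contra h
        have := Nat.mul_le_mul_right m (not_lt.1 h)
        omega
      obtain ⟨x, a, ha, rfl⟩ : ∃ x a, a < m ∧ xa = x * m + a :=
        ⟨xa / m, xa % m, Nat.mod_lt _ hm, (Nat.div_add_mod' xa m).symm⟩
      have hx : x < m := by
        by_contra h
        have := Nat.mul_le_mul_right m (not_lt.1 h)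
        omega
      refine wp_mono (wp_tryJoin (by rw [hf₃.arr _ rfl, a₂]) ht ((hf₃.var _ rfl).trans n₂)
        ((hf₃.var _ rfl).trans m₂) hB hmm hx ha hb hx₃ k1 k2) ?_
      rintro t' s₄ hb₄ hf₄ ⟨ht₄, l1, l2, l3, l4⟩
      refine ⟨ht₄, l1.congr (by simp) rfl, l2, fun y hy => l3 y (k3 y hy), ?_⟩
      simp only [setVar_var, setVar_arr, Nat.reduceEqDiff, reduceIte]
      rcases k4 with k4 | ⟨k4, k5, k6⟩
      · left
        rcases l4 with l4 | ⟨l4, _⟩ <;> omega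
      · rcases l4 with l4 | ⟨l4, l5, l6⟩
        · left; omega
        · refine .inr ⟨by omega, by rw [l5, k5], fun x' hx' a' ha' b' hb' hlt => ?_⟩
          rcases Nat.lt_succ_iff_lt_or_eq.1 hlt with hlt | heq
          · exact k6 x' hx' a' ha' b' hb' hlt
          · obtain ⟨hxa', rfl⟩ := mul_add_inj hb' hb heq
            obtain ⟨rfl, rfl⟩ := mul_add_inj ha' ha hxa'
            unfold Enabled at l6 ⊢
            rwa [k5] at l6
    · rintro t s₃ htm hb₃ hf₃ hx₃ ⟨k1, k2, k3, k4⟩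
      rw [c₂] at htm k4
      refine ⟨?_, k1.congr (by simp) rfl, k2, ?_⟩
      · have := loop_time htm (le_refl _) hn (le_refl _) hm3
        omega
      · simp only [setVar_var, Nat.reduceEqDiff, reduceIte]
        rcases g3 with g3 | g3
        · rcases k4 with k4 | ⟨_, k5, k6⟩
          · left; omega
          · right
            by_contra hc
            unfold Complete at hc
            push Not at hc
            obtain ⟨x₀, hx₀, hx₀r, hx₀d⟩ := hc
            rw [setVar_arr, k5] at hx₀d
            obtain ⟨x, hx, a, ha, b, hb, p1, p2, p3, p4, p5, p6⟩ :=
              ht.progress (fun y => s₂.arr aDone y ≠ 0) g1.done_leaf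
                ⟨x₀, hx₀, not_not.2 hx₀d, hx₀r⟩
            exact k6 x hx a ha b hb (mul_add_lt (mul_add_lt hx ha) hb)
              ⟨not_not.1 p1, p2, p3, p4, p5, p6⟩
        · exact .inr fun x hx hxr => k3 x (g3 x hx hxr)
  · rintro t s₂ htm hb₂ hf₂ hx₂ ⟨g1, g2, g3⟩
    rw [m₁] at htm g3
    refine ⟨?_, g1, ?_⟩
    · have := loop_time htm (le_refl _) (Nat.mul_pos hm3 hn) (le_refl _) hm
      have h1 : 1 ≤ m * (m * m * m * n) := Nat.mul_pos hm (Nat.mul_pos hm3 hn)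
      simp
      omega
    · rcases g3 with g3 | g3
      · have := g1.steps_lt ht
        omega
      · exact g3

/-- The last join, of the root and its neighbor. -/
def Program.topJoin : Program :=
  .seq (.assign xLeft (.get aLeaf 0)) <|
  .seq (.forLt xV xM <| .ite (.get aTree (.var xLeft * .var xM + .var xV))
    (.assign xRight (.var xV)) .skip) <|
  .seq (.assign xNode (.var xM)) .pushJoin

/-- Fill in the complements. -/
def Program.complements : Program :=
  .forLt xNode xNodes <| .forLt xW xN <|
  .store aMask ((2 * .var xNode + 1) * .var xN + .var xW)
    (1 - .get aMask (2 * .var xNode * .var xN + .var xW))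

/-- Compute the vertex sets of the nodes and a join sequence. -/
def Program.findJoins : Program := .seq .initLeaves <| .seq .sweeps <| .seq .topJoin .complements

/-- The sets on the sides of the nodes: `side x` for the side `2 * x`, and its complement for the side
`2 * x + 1`. -/
def sideSet (n : ℕ) (side : ℕ → Finset ℕ) (e : ℕ) : Finset ℕ :=
  if e % 2 = 0 then side (e / 2) else Finset.range n \ side (e / 2)

theorem sideSet_even (n : ℕ) (side : ℕ → Finset ℕ) (x : ℕ) : sideSet n side (2 * x) = side x := by
  simp [sideSet]

theorem sideSet_odd (n : ℕ) (side : ℕ → Finset ℕ) (x : ℕ) :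
    sideSet n side (2 * x + 1) = Finset.range n \ side x := by
  have h1 : (2 * x + 1) % 2 = 1 := by omega
  have h2 : (2 * x + 1) / 2 = x := by omega
  simp [sideSet, h1, h2]

/-- The last join, of the leaf of the vertex `0` and its neighbour, to the additional node `m`. -/
theorem wp_topJoin (htree : s.arr aTree = tree)
    (ht : TreeData n m (fun x y => tree (x * m + y) ≠ 0) leaf par side)
    (hleaf : ∀ v < n, s.arr aLeaf v = leaf v) (hN : s.var xN = n) (hM : s.var xM = m)
    (hB : 2 * (m + 1) * n ≤ B) (hmm : m * m * m ≤ B)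
    (h : TreeInv n m (fun x y => tree (x * m + y) ≠ 0) leaf par side s)
    (hc : Complete m (leaf 0) s) :
    wp B .topJoin s fun t s' => t ≤ 100 * (m * n) ∧ s'.var xSteps ≤ m ∧
      JoinSeq n (m + 1) (s'.var xSteps) (sideSet n side) leaf (s'.arr aX) (s'.arr aLeft) (s'.arr aRight) ∧
      ∀ x < m + 1, ∀ w < n, s'.arr aMask (2 * x * n + w) = if w ∈ side x then 1 else 0 := by
  have hn := ht.n_pos
  have h0 := ht.leaf_lt 0 hn
  have hm : 1 ≤ m := by omega
  have hmm2 : m * m ≤ B := le_trans (Nat.le_mul_of_pos_right _ hm) hmm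
  have hmn : m ≤ m * n := Nat.le_mul_of_pos_right _ hn
  have hnm : n ≤ m * n := Nat.le_mul_of_pos_left _ hm
  refine wp_assign_seq (by simp) ?_
  simp only [eval_get, eval_zero, hleaf 0 hn]
  set s₁ := s.setVar xLeft (leaf 0) with hs₁
  have n₁ : s₁.var xN = n := by simp [hs₁, hN]
  have m₁ : s₁.var xM = m := by simp [hs₁, hM]
  have l₁ : s₁.var xLeft = leaf 0 := by simp [hs₁]
  have k₁ : s₁.var xSteps = s.var xSteps := by simp [hs₁]
  have a₁ : s₁.arr = s.arr := rfl
  clear_value s₁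
  refine wp_call_seq (Q₁ := fun t s' => t ≤ 30 * m ∧
    s'.var xRight < m ∧ tree (leaf 0 * m + s'.var xRight) ≠ 0) ?_ ?_
  · refine wp_forLt (fun k s' => (∃ y < k, tree (leaf 0 * m + y) ≠ 0) →
      s'.var xRight < m ∧ tree (leaf 0 * m + s'.var xRight) ≠ 0) 16 rfl rfl rfl (by simp) ?_ ?_
    · intro y s₂ hy hb₂ hf₂ hx₂ hI
      rw [m₁] at hy
      have m₂ : s₂.var xM = m := (hf₂.var _ rfl).trans m₁
      have l₂ : s₂.var xLeft = leaf 0 := (hf₂.var _ rfl).trans l₁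
      have a₂ : s₂.arr aTree = tree := by rw [hf₂.arr _ rfl, a₁, htree]
      have := mul_add_lt h0 hy
      refine wp_ite (by simp [m₂, l₂, hx₂]; omega) (fun hh => wp_assign trivial ?_) (fun hh => wp_skip ?_)
      · have hh' : tree (leaf 0 * m + y) ≠ 0 := by simpa [m₂, l₂, hx₂, a₂] using hh
        exact ⟨by simp, fun _ => by simp [hx₂, hy, hh']⟩
      · have hh' : tree (leaf 0 * m + y) = 0 := by simpa [m₂, l₂, hx₂, a₂] using hh
        refine ⟨by simp, fun ⟨z, hz, hz'⟩ => ?_⟩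
        rcases Nat.lt_succ_iff_lt_or_eq.1 hz with hz | rfl
        · simpa using hI ⟨z, hz, hz'⟩
        · exact absurd hh' hz'
    · intro t s₂ htm hb₂ hf₂ hx₂ hI
      rw [m₁] at htm hI
      exact ⟨by omega, hI ht.root_adj⟩
  · rintro t₂ s₂ hb₂ hf₂ ⟨ht₂, hy, hadj⟩
    set y := s₂.var xRight with hy'
    obtain ⟨hy0, hsy⟩ := ht.side_root_adj y hy hadj
    have k₂ : s₂.var xSteps = s.var xSteps := (hf₂.var _ rfl).trans k₁
    have hKm := h.steps_lt ht
    have a₂ : ∀ a, Program.writesArr a (.forLt xV xM <|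
        .ite (.get aTree (.var xLeft * .var xM + .var xV)) (.assign xRight (.var xV)) .skip) = false →
        s₂.arr a = s.arr a := fun a ha => by rw [hf₂.arr a ha, a₁]
    have hside0 : side (leaf 0) = {0} := ht.side_leaf 0 hn
    refine wp_assign_seq trivial ?_
    rw [eval_var, hf₂.var xM rfl, m₁]
    refine wp_mono (wp_pushJoin (x := m) (a := leaf 0) (b := y) (T := side (leaf 0)) (U := side y) hn
      (by simp [hf₂.var xN rfl, n₁]) hB (by simpa [k₂]) (by simp) (le_refl _)
      (by simp [hf₂.var xLeft rfl, l₁]) h0.le (by simp [hy']) hy.le (by omega) (by omega) ?_ ?_ ?_) ?_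
    · intro w hw
      rw [setVar_arr, a₂ _ rfl]
      exact h.mask _ h0 (.inr rfl) w hw
    · intro w hw
      rw [setVar_arr, a₂ _ rfl]
      exact h.mask y hy (.inl (hc y hy hy0)) w hw
    · rw [hside0, hsy]
      exact Finset.disjoint_sdiff
    rintro t₃ s₃ hb₃ hf₃ ⟨ht₃, g1, g2, g3, g4, g5, g6⟩
    simp only [setVar_var, setVar_arr, Nat.reduceEqDiff, reduceIte, k₂] at g1 g2 g3 g4
    rw [a₂ _ rfl] at g2 g3 g4
    have hXlt : ∀ t < s.var xSteps, s₃.arr aX t = s.arr aX t := fun t htK => by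
      rw [g2, if_neg htK.ne]
    have hXK : s₃.arr aX (s.var xSteps) = m := by rw [g2, if_pos rfl]
    have hAK : s₃.arr aLeft (s.var xSteps) = leaf 0 := by rw [g3, if_pos rfl]
    have hAK' : s₃.arr aRight (s.var xSteps) = y := by rw [g4, if_pos rfl]
    have hun : side m = side (leaf 0) ∪ side y := by
      rw [ht.side_top, hside0, hsy, Finset.union_sdiff_of_subset]
      simpa using Nat.lt_of_succ_le hn
    have hsub : ∀ x < m + 1, side x ⊆ Finset.range n := by
      intro x hx
      rcases Nat.lt_succ_iff_lt_or_eq.1 hx with hx | rfl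
      exacts [ht.side_sub x hx, ht.side_top.le]
    have hjoins : PartialJoins n (m + 1) (s₃.var xSteps) side leaf (s₃.arr aX) (s₃.arr aLeft)
        (s₃.arr aRight) := by
      rw [g1]
      refine h.joins.push hXlt (fun t htK => by rw [g3, if_neg htK.ne])
        (fun t htK => by rw [g4, if_neg htK.ne]) ?_ ?_ ?_ ?_ ?_ ?_ ?_ ?_ ?_ <;>
        simp only [hXK, hAK, hAK']
      · omega
      · omega
      · omega
      · exact hun
      · rw [hside0, hsy]; exact Finset.disjoint_sdiff
      · exact fun v hv hmv => by have := ht.leaf_lt v hv; omega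
      · exact fun t htK => (h.node_lt t htK).ne
      · exact .inl ⟨0, hn, rfl⟩
      · exact h.cases y hy (hc y hy hy0)
    refine ⟨by simp; omega, by omega, ?_, ?_⟩
    · exact {
        sub := fun x hx => by rw [sideSet_even]; exact hsub x hx
        compl := fun x _ => by rw [sideSet_odd, sideSet_even]
        leaf_lt := fun v hv => (ht.leaf_lt v hv).trans (Nat.lt_succ_self m)
        leaf_set := fun v hv => by rw [sideSet_even]; exact ht.side_leaf v hv
        lt := hjoins.lt
        left_lt := hjoins.left_lt
        right_lt := hjoins.right_lt
        union := fun t htK => by simp only [sideSet_even]; exact hjoins.union t htK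
        disjoint := fun t htK => by simp only [sideSet_even]; exact hjoins.disjoint t htK
        not_leaf := hjoins.not_leaf
        inj := hjoins.inj
        left_ready := hjoins.left_ready
        right_ready := hjoins.right_ready
        top := ⟨s.var xSteps, by omega, by omega, by rw [sideSet_even, hXK]; exact ht.side_top⟩ }
    · intro x hx w hw
      rcases Nat.lt_succ_iff_lt_or_eq.1 hx with hx | rfl
      · rw [g6 x hx.ne w hw, setVar_arr, a₂ _ rfl]
        refine h.mask x hx ?_ w hw
        by_cases hx0 : x = leaf 0
        exacts [.inr hx0, .inl (hc x hx hx0)]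
      · rw [g5 w hw, hun]

theorem wp_complements (hn : 1 ≤ n) (hN : s.var xN = n) (hNodes : s.var xNodes = m + 1)
    (hB : 2 * (m + 1) * n ≤ B)
    (h : ∀ x < m + 1, ∀ w < n, s.arr aMask (2 * x * n + w) = if w ∈ side x then 1 else 0) :
    wp B .complements s fun t s' => t ≤ 60 * ((m + 1) * n) ∧
      ∀ e < 2 * (m + 1), ∀ w < n,
        s'.arr aMask (e * n + w) = if w ∈ sideSet n side e then 1 else 0 := by
  refine wp_forLt (fun k s' => (∀ x < m + 1, ∀ w < n, s'.arr aMask (2 * x * n + w) = if w ∈ side x then 1 else 0) ∧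
    ∀ x < k, ∀ w < n, s'.arr aMask ((2 * x + 1) * n + w) = if w ∈ side x then 0 else 1) (46 * n)
    rfl rfl rfl ⟨h, by simp⟩ ?_ ?_
  · rintro x s₁ hx hb₁ hf₁ hx₁ ⟨g1, g2⟩
    rw [hNodes] at hx
    have n₁ : s₁.var xN = n := (hf₁.var _ rfl).trans hN
    refine wp_forLt (fun k s' => (∀ x < m + 1, ∀ w < n, s'.arr aMask (2 * x * n + w) = if w ∈ side x then 1 else 0) ∧
      (∀ y < x, ∀ w < n, s'.arr aMask ((2 * y + 1) * n + w) = if w ∈ side y then 0 else 1) ∧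
      ∀ w < k, s'.arr aMask ((2 * x + 1) * n + w) = if w ∈ side x then 0 else 1) 30
      rfl rfl rfl ⟨g1, g2, by simp⟩ ?_ ?_
    · rintro w s₂ hw hb₂ hf₂ hx₂ ⟨k1, k2, k3⟩
      rw [n₁] at hw
      have n₂ : s₂.var xN = n := (hf₂.var _ rfl).trans n₁
      have x₂ : s₂.var xNode = x := (hf₂.var _ rfl).trans hx₁
      have b1 : (2 * x + 1) * n + w < 2 * (m + 1) * n := mul_add_lt (by omega) hw
      have b2 : 2 * x * n + w < 2 * (m + 1) * n := mul_add_lt (by omega) hw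
      have b3 : 2 * (m + 1) ≤ 2 * (m + 1) * n := Nat.le_mul_of_pos_right _ hn
      refine wp_store (by simp [x₂, n₂, hx₂]; omega) (by simp [x₂, n₂, hx₂]; omega)
        ⟨by simp, fun y hy w' hw' => ?_, fun y hy w' hw' => ?_, fun w' hw' => ?_⟩
      · have hne : 2 * y * n + w' ≠ (2 * x + 1) * n + w := fun hh => by
          have := (mul_add_inj hw' hw hh).1; omega
        simpa [x₂, n₂, hx₂, hne] using k1 y hy w' hw'
      · have hne : (2 * y + 1) * n + w' ≠ (2 * x + 1) * n + w := fun hh => by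
          have := (mul_add_inj hw' hw hh).1; omega
        simpa [x₂, n₂, hx₂, hne] using k2 y hy w' hw'
      · rcases Nat.lt_succ_iff_lt_or_eq.1 hw' with hlt | rfl
        · simpa [x₂, n₂, hx₂, hlt.ne] using k3 w' hlt
        · simp [x₂, n₂, hx₂, k1 x hx w' hw]
          split <;> simp
    · rintro t s₂ htm hb₂ hf₂ hx₂ ⟨k1, k2, k3⟩
      rw [n₁] at htm k3
      refine ⟨by omega, k1, fun y hy => ?_⟩
      rcases Nat.lt_succ_iff_lt_or_eq.1 hy with hlt | rfl
      exacts [k2 y hlt, k3]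
  · rintro t s₁ htm hb₁ hf₁ hx₁ ⟨g1, g2⟩
    rw [hNodes] at htm g2
    refine ⟨loop_time htm (le_refl _) hn (le_refl _) (by omega), fun e he w hw => ?_⟩
    obtain ⟨x, rfl | rfl⟩ : ∃ x, e = 2 * x ∨ e = 2 * x + 1 := ⟨e / 2, by omega⟩
    · rw [sideSet_even]; exact g1 x (by omega) w hw
    · rw [sideSet_odd, g2 x (by omega) w hw]
      simp [hw]

theorem wp_findJoins (htree : s.arr aTree = tree)
    (ht : TreeData n m (fun x y => tree (x * m + y) ≠ 0) leaf par side)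
    (hleaf : ∀ v < n, s.arr aLeaf v = leaf v) (hN : s.var xN = n) (hM : s.var xM = m)
    (hNodes : s.var xNodes = m + 1) (hB : 2 * (m + 1) * n ≤ B) (hmm : m * m * m ≤ B)
    (hmask : ∀ k, s.arr aMask k = 0) (hdone : ∀ k, s.arr aDone k = 0) (hK : s.var xSteps = 0) :
    wp B .findJoins s fun t s' => t ≤ 500 * (m * (m * m * m * n)) ∧ s'.var xSteps ≤ m ∧
      JoinSeq n (m + 1) (s'.var xSteps) (sideSet n side) leaf (s'.arr aX) (s'.arr aLeft) (s'.arr aRight) ∧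
      ∀ e < 2 * (m + 1), ∀ w < n,
        s'.arr aMask (e * n + w) = if w ∈ sideSet n side e then 1 else 0 := by
  have hn := ht.n_pos
  have hm : 1 ≤ m := by have := ht.leaf_lt 0 hn; omega
  refine wp_call_seq (wp_initLeaves hleaf ht hN hB hmask hdone hK) ?_
  rintro t₁ s₁ hb₁ hf₁ ⟨ht₁, h1, h2⟩
  refine wp_call_seq (wp_sweeps (by rw [hf₁.arr _ rfl, htree]) ht ((hf₁.var _ rfl).trans hN)
    ((hf₁.var _ rfl).trans hM) hB hmm h1 h2) ?_
  rintro t₂ s₂ hb₂ hf₂ ⟨ht₂, h3, h4⟩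
  refine wp_call_seq (wp_topJoin (by rw [hf₂.arr _ rfl, hf₁.arr _ rfl, htree]) ht
    (by rw [hf₂.arr _ rfl, hf₁.arr _ rfl]; exact hleaf)
    ((hf₂.var _ rfl).trans ((hf₁.var _ rfl).trans hN))
    ((hf₂.var _ rfl).trans ((hf₁.var _ rfl).trans hM)) hB hmm h3 h4) ?_
  rintro t₃ s₃ hb₃ hf₃ ⟨ht₃, h5, h6, h7⟩
  refine wp_mono (wp_complements hn
    ((hf₃.var _ rfl).trans ((hf₂.var _ rfl).trans ((hf₁.var _ rfl).trans hN)))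
    ((hf₃.var _ rfl).trans ((hf₂.var _ rfl).trans ((hf₁.var _ rfl).trans hNodes))) hB h7) ?_
  rintro t₄ s₄ hb₄ hf₄ ⟨ht₄, h8⟩
  rw [hf₄.var xSteps rfl, hf₄.arr aX rfl, hf₄.arr aLeft rfl, hf₄.arr aRight rfl]
  refine ⟨?_, h5, h6, h8⟩
  have e1 : m * n ≤ m * (m * m * m * n) := by
    refine Nat.mul_le_mul_left _ (Nat.le_mul_of_pos_left _ ?_)
    exact Nat.mul_pos (Nat.mul_pos hm hm) hm
  have e2 : n ≤ m * n := Nat.le_mul_of_pos_left _ hm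
  have e3 : (m + 1) * n = m * n + n := Nat.succ_mul m n
  omega

end WordRAM

open Prob

/-! ### The program -/

namespace WordRAM

variable {B : ℕ} {s s' : Store}

/-- Write the values `f 0, …, f (L - 1)` into the array `a`. -/
def Program.load (a : ℕ) (f : ℕ → ℕ) : ℕ → Program
  | 0 => .skip
  | k + 1 => .seq (.load a f k) (.store a (.const k) (.const (f k)))

theorem wp_load {a : ℕ} {f : ℕ → ℕ} {L : ℕ} (hL : L ≤ B) (hf : ∀ k, f k ≤ B) :
    wp B (.load a f L) s fun t s' => t ≤ 3 * L + 1 ∧ s'.var = s.var ∧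
      (∀ b, b ≠ a → s'.arr b = s.arr b) ∧ ∀ j, s'.arr a j = if j < L then f j else s.arr a j := by
  induction L with
  | zero => exact wp_skip ⟨by omega, rfl, fun _ _ => rfl, by simp⟩
  | succ L ih =>
    refine wp_call_seq (ih (by omega)) ?_
    rintro t s₁ _ _ ⟨h1, h2, h3, h4⟩
    refine wp_store (by simp; omega) (hf L) ⟨by simp; omega, h2, fun b hb => ?_, fun j => ?_⟩
    · rw [← h3 b hb]
      funext j
      simp [hb]
    · simp only [setArr_arr, eval_const, true_and, h4]
      rcases lt_trichotomy j L with h | rfl | h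
      · simp [h, h.ne, h.trans (Nat.lt_succ_self L)]
      · simp
      · have h5 : ¬ j < L + 1 := by omega
        have h6 : ¬ j < L := by omega
        simp [h.ne', h5, h6]

/-- The program that solves the colouring problem with `q` colours, `c` counters, the offset `off`, the
cap `d`, the table `ok` of allowed counts and the costs `wt`, in the `r`-th power of the digraph. -/
def Program.main (c q off d r : ℕ) (ok wt : ℕ → ℕ) : Program :=
  .seq (.load aOk ok (q * (2 * c) * (d + 1))) <|
  .seq (.load aWt wt q) <|
  .seq (.assign xR (.const (2 * c) * .var xN)) <|
  .seq (.assign xE (2 * (.var xM + 1))) <|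
  .seq (.assign xNQ (.var xN * .const q)) <|
  .seq (.assign xC (.const (2 * c))) <|
  .seq (.assign xQ (.const q)) <|
  .seq (.assign xNodes (.var xM + 1)) <|
  .seq (.power r) <|
  .seq .findJoins (.solve off d)

/-- The problem that `Program.main` solves when the matrix of the power of the digraph is `H`. -/
def problem (n c q off d : ℕ) (ok wt H : ℕ → ℕ) : Prob :=
  ⟨n, c, q, off, d, H, fun k => if k < q * (2 * c) * (d + 1) then ok k else 0,
    fun k => if k < q then wt k else 0⟩

/-- The running time of `Program.main`. -/
def mainTime (n m c q d r M : ℕ) : ℕ :=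
  10 * (q * (2 * c) * (d + 1) + q) + 100 + 200 * (r + 1) * (n * (n * n)) +
    500 * (m * (m * m * m * n)) +
    (450 * (2 * (m + 1) * (M * (n * q * (M * (2 * c * n))))) + 850 * (n * (q * (M * (2 * c * n)))) +
        1464 * (m * (M * M * (M * (2 * c * n)))) + 100 * (2 * c * n))

set_option maxHeartbeats 800000 in
/-- The program for a complete problem. Words have to be large enough for the tables, and `M` has to bound
the number of signatures, for every matrix `H` that the power of the digraph can have. -/
theorem wp_main {n m c q off d r M : ℕ} {ok wt tree leaf par : ℕ → ℕ} {side : ℕ → Finset ℕ}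
    (hb : ∀ H : ℕ → ℕ, (∀ k, H k ≤ 1) → Bounds (problem n c q off d ok wt H) B M (2 * (m + 1)))
    (hM : ∀ H : ℕ → ℕ, (∀ k, H k ≤ 1) →
      (∀ u < n, ∀ v < n, H (u * n + v) ≠ 0 ↔ Reach (s.arr aAdj) n r u v) →
      ListBound (problem n c q off d ok wt H) M (2 * (m + 1)) (sideSet n side))
    (hok : ∀ k, ok k ≤ 1) (hwt : ∀ k, wt k ≤ 1) (hr : r ≤ B) (hnn : 2 * (n * n) ≤ B)
    (hmmm : m * m * m ≤ B) (htree : s.arr aTree = tree)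
    (ht : TreeData n m (fun x y => tree (x * m + y) ≠ 0) leaf par side)
    (hleaf : ∀ v < n, s.arr aLeaf v = leaf v) (hN : s.var xN = n) (hMv : s.var xM = m)
    (hvar : ∀ x, 2 ≤ x → s.var x = 0) (harr : ∀ a, 3 ≤ a → ∀ k, s.arr a k = 0)
    (hadj : ∀ k, s.arr aAdj k ≤ 1) :
    wp B (.main c q off d r ok wt) s fun t s' => t ≤ mainTime n m c q d r M ∧
      ∃ H : ℕ → ℕ, (∀ k, H k ≤ 1) ∧
        (∀ u < n, ∀ v < n, H (u * n + v) ≠ 0 ↔ Reach (s.arr aAdj) n r u v) ∧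
        (problem n c q off d ok wt H).Solved (s'.var xAns) (s'.arr aOut) := by
  have hb₀ := hb 0 (fun _ => Nat.zero_le _)
  have hB1 := hb₀.one_le
  have hn : 1 ≤ n := hb₀.n_pos
  have hLB : q * (2 * c) * (d + 1) ≤ B := hb₀.ok_le
  have hqB : q ≤ B := by have := hb₀.q_le; simp only [problem] at this; omega
  have hnq : n * q ≤ B := hb₀.nq_le
  have hE : 2 * (m + 1) ≤ B := hb₀.E_le
  have hEn : 2 * (m + 1) * n ≤ B := hb₀.en_le
  have hRB : 2 * c * n ≤ B := by
    refine le_trans ?_ hb₀.row_le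
    calc 2 * c * n = 1 * (2 * c * n) * 1 := by ring
      _ ≤ M * (2 * c * n) * (2 * (m + 1)) :=
        Nat.mul_le_mul (Nat.mul_le_mul_right _ hb₀.M_pos) (by omega)
  have hcB : 2 * c ≤ B := le_trans (Nat.le_mul_of_pos_right _ hn) hRB
  refine wp_call_seq (wp_load hLB fun k => (hok k).trans hB1) ?_
  rintro t₁ s₁ _ _ ⟨ht₁, v₁, a₁, o₁⟩
  refine wp_call_seq (wp_load hqB fun k => (hwt k).trans hB1) ?_
  rintro t₂ s₂ _ _ ⟨ht₂, v₂, a₂, o₂⟩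
  have v₂' : s₂.var = s.var := v₂.trans v₁
  refine wp_assign_seq (by simp [v₂', hN]; omega) ?_
  refine wp_assign_seq (by simp [v₂', hMv]; omega) ?_
  refine wp_assign_seq (by simp [v₂', hN]; omega) ?_
  refine wp_assign_seq (by simp; omega) ?_
  refine wp_assign_seq (by simp; omega) ?_
  refine wp_assign_seq (by simp [v₂', hMv]; omega) ?_
  simp only [eval_add, eval_mul, eval_var, eval_const, eval_one, eval_two, setVar_var, v₂', hN, hMv]
  simp only [reduceIte, OfNat.one_ne_ofNat, OfNat.zero_ne_ofNat]
  set s₃ := (((((s₂.setVar xR (2 * c * n)).setVar xE (2 * (m + 1))).setVar xNQ (n * q)).setVar xC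
    (2 * c)).setVar xQ q).setVar xNodes (m + 1) with hs₃
  have w1 : s₃.var xN = n := by simp [hs₃, v₂', hN]
  have w2 : s₃.var xM = m := by simp [hs₃, v₂', hMv]
  have w3 : s₃.var xR = 2 * c * n := by simp [hs₃]
  have w4 : s₃.var xE = 2 * (m + 1) := by simp [hs₃]
  have w5 : s₃.var xNQ = n * q := by simp [hs₃]
  have w6 : s₃.var xC = 2 * c := by simp [hs₃]
  have w7 : s₃.var xQ = q := by simp [hs₃]
  have w8 : s₃.var xNodes = m + 1 := by simp [hs₃]
  have w9 : s₃.var xSteps = 0 := by simp [hs₃, v₂', hvar]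
  have w10 : s₃.arr = s₂.arr := rfl
  clear_value s₃
  have ar : ∀ a, a ≠ aOk → a ≠ aWt → s₃.arr a = s.arr a := fun a h1 h2 => by
    rw [w10, a₂ a h2, a₁ a h1]
  have hok₃ : s₃.arr aOk = (problem n c q off d ok wt 0).ok := by
    funext k
    rw [w10, a₂ _ (by decide), o₁, harr _ (by omega)]
    rfl
  have hwt₃ : s₃.arr aWt = (problem n c q off d ok wt 0).wt := by
    funext k
    rw [w10, o₂, a₁ _ (by decide), harr _ (by omega)]
    rfl
  refine wp_call_seq (wp_power hn hnn hr w1 (by rw [ar _ (by decide) (by decide)]; exact hadj)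
    (by rw [ar _ (by decide) (by decide)]; exact harr _ (by omega))) ?_
  rintro t₄ s₄ _ hf₄ ⟨ht₄, h1, h2⟩
  rw [ar _ (by decide) (by decide)] at h2
  refine wp_call_seq (wp_findJoins (tree := tree) (leaf := leaf) (par := par) (side := side)
    (by rw [hf₄.arr _ rfl, ar _ (by decide) (by decide), htree]) ht
    (by rw [hf₄.arr _ rfl, ar _ (by decide) (by decide)]; exact hleaf)
    ((hf₄.var _ rfl).trans w1) ((hf₄.var _ rfl).trans w2) ((hf₄.var _ rfl).trans w8) hEn hmmm
    (by rw [hf₄.arr _ rfl, ar _ (by decide) (by decide)]; exact harr _ (by omega))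
    (by rw [hf₄.arr _ rfl, ar _ (by decide) (by decide)]; exact harr _ (by omega))
    ((hf₄.var _ rfl).trans w9)) ?_
  rintro t₅ s₅ _ hf₅ ⟨ht₅, h3, h4, h5⟩
  set H := s₄.arr aH with hH
  have hNe : 2 * (m + 1) / 2 = m + 1 := by omega
  have hEnv : Env (problem n c q off d ok wt H) (2 * (m + 1)) (sideSet n side) s₅ := {
    n := (hf₅.var _ rfl).trans ((hf₄.var _ rfl).trans w1)
    width := (hf₅.var _ rfl).trans ((hf₄.var _ rfl).trans w3)
    sides := (hf₅.var _ rfl).trans ((hf₄.var _ rfl).trans w4)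
    nq := (hf₅.var _ rfl).trans ((hf₄.var _ rfl).trans w5)
    c := (hf₅.var _ rfl).trans ((hf₄.var _ rfl).trans w6)
    q := (hf₅.var _ rfl).trans ((hf₄.var _ rfl).trans w7)
    nodes := by rw [hNe]; exact (hf₅.var _ rfl).trans ((hf₄.var _ rfl).trans w8)
    h := hf₅.arr _ rfl
    ok := (hf₅.arr _ rfl).trans ((hf₄.arr _ rfl).trans hok₃)
    wt := (hf₅.arr _ rfl).trans ((hf₄.arr _ rfl).trans hwt₃)
    mask := h5 }
  have z : ∀ a, 3 ≤ a → a ≠ aOk → a ≠ aWt → (Program.power r).writesArr a = false →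
      Program.findJoins.writesArr a = false → ∀ k, s₅.arr a k = 0 := fun a e1 e2 e3 e4 e5 k => by
    rw [hf₅.arr _ e5, hf₄.arr _ e4, ar _ e2 e3, harr _ e1]
  have hl₅ : ∀ v < n, s₅.arr aLeaf v = leaf v := fun v hv => by
    rw [hf₅.arr _ rfl, hf₄.arr _ rfl, ar _ (by decide) (by decide), hleaf v hv]
  have hjs : JoinSeq n (m + 1) (s₅.var xSteps) (sideSet n side) (s₅.arr aLeaf) (s₅.arr aX)
      (s₅.arr aLeft) (s₅.arr aRight) := {
    h4 with
    leaf_lt := fun v hv => by rw [hl₅ v hv]; exact h4.leaf_lt v hv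
    leaf_set := fun v hv => by rw [hl₅ v hv]; exact h4.leaf_set v hv
    not_leaf := fun t htK v hv => by rw [hl₅ v hv]; exact h4.not_leaf t htK v hv
    left_ready := fun t htK => (h4.left_ready t htK).imp
      (fun ⟨v, hv, h⟩ => ⟨v, hv, by rw [hl₅ v hv]; exact h⟩) id
    right_ready := fun t htK => (h4.right_ready t htK).imp
      (fun ⟨v, hv, h⟩ => ⟨v, hv, by rw [hl₅ v hv]; exact h⟩) id }
  refine wp_mono (wp_solve (P := problem n c q off d ok wt H) (hb H h1) hEnv (hM H h1 h2)
    (K := s₅.var xSteps) (by rw [hNe]; exact hjs) rfl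
    (z _ (by decide) (by decide) (by decide) rfl rfl)
    (z _ (by decide) (by decide) (by decide) rfl rfl)
    (z _ (by decide) (by decide) (by decide) rfl rfl)) ?_
  rintro t₆ s₆ _ hf₆ ⟨ht₆, h6⟩
  refine ⟨?_, H, h1, h2, h6⟩
  have hstep : s₅.var xSteps * (M * M * (M * (2 * c * n))) ≤ m * (M * M * (M * (2 * c * n))) :=
    Nat.mul_le_mul_right _ h3
  simp only [problem, Prob.R] at ht₆
  unfold mainTime
  simp only [cost_add, cost_mul, cost_var, cost_const, cost_one, cost_two]
  omega

end WordRAM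

open Prob

/-! ### Trees and branch decompositions -/

namespace SimpleGraph

variable {W : Type*} {T : SimpleGraph W} {x y z a b : W}

/-- From `x` there is a step towards any other node `z`. -/
theorem IsTree.exists_closer (hT : T.IsTree) (h : x ≠ z) : ∃ y, T.Adj x y ∧ T.dist z y < T.dist z x := by
  obtain ⟨p, hp⟩ := hT.connected.exists_walk_length_eq_dist x z
  cases p with
  | nil => exact absurd rfl h
  | cons hxy p =>
    refine ⟨_, hxy, ?_⟩
    have := dist_le p
    rw [Walk.length_cons] at hp
    rw [dist_comm, dist_comm (u := z) (v := x)]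
    omega

/-- The step from `x` towards `z` is unique, since the path from `x` to `z` is. -/
theorem IsTree.closer_unique (hT : T.IsTree) (ha : T.Adj x a) (hb : T.Adj x b)
    (ha' : T.dist z a < T.dist z x) (hb' : T.dist z b < T.dist z x) : a = b := by
  have key : ∀ y, T.Adj x y → T.dist z y < T.dist z x →
      ∃ p : T.Walk x z, p.IsPath ∧ p.snd = y := by
    intro y hy hy'
    obtain ⟨p, hp⟩ := hT.connected.exists_walk_length_eq_dist y z
    refine ⟨.cons hy p, Walk.isPath_of_length_eq_dist _ ?_, by simp⟩
    have := hT.dist_eq_dist_add_one_of_adj z hy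
    rw [Walk.length_cons, hp, dist_comm, dist_comm (u := x)]
    omega
  obtain ⟨p, hp, rfl⟩ := key a ha ha'
  obtain ⟨p', hp', rfl⟩ := key b hb hb'
  have := congrArg Subtype.val ((hT.isAcyclic.subsingleton_path x z).elim ⟨p, hp⟩ ⟨p', hp'⟩)
  simp only at this
  rw [this]

theorem IsTree.dist_lt_or_lt (hT : T.IsTree) (h : T.Adj a b) :
    T.dist z a < T.dist z b ∨ T.dist z b < T.dist z a := (hT.dist_ne_of_adj z h).lt_or_gt

/-- The component of `a` in `T` without the edge `a b` consists of the nodes that are closer to `a`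
than to `b`. -/
theorem IsTree.reachable_deleteEdges_iff (hT : T.IsTree) (hab : T.Adj a b) :
    (T.deleteEdges {s(a, b)}).Reachable a z ↔ T.dist z a < T.dist z b := by
  have key : ∀ {a b}, T.dist z a < T.dist z b → (T.deleteEdges {s(a, b)}).Reachable a z := by
    classical
    intro a b h
    obtain ⟨p, hp⟩ := hT.connected.exists_walk_length_eq_dist a z
    refine ⟨p.toDeleteEdge _ fun he => ?_⟩
    have hb := p.snd_mem_support_of_mem_edges he
    have h1 := dist_le (p.dropUntil b hb)
    have h2 := p.length_dropUntil_le_length hb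
    rw [hp] at h2
    rw [dist_comm, dist_comm (u := z)] at h
    omega
  refine ⟨fun h => ?_, key⟩
  by_contra hc
  have h1 := (hT.dist_lt_or_lt hab).resolve_left hc
  have h2 := key h1
  rw [Sym2.eq_swap] at h2
  exact isAcyclic_iff_forall_adj_isBridge.1 hT.isAcyclic hab (h.trans h2.symm)

end SimpleGraph

namespace BranchDecomposition

variable {V W : Type*} (D : BranchDecomposition V W) (v₀ : V)

theorem isTree : D.tree.IsTree := D.subcubic.isTree

theorem isLeaf (v : V) : D.tree.IsLeaf (D.toLeaf v) := D.bijOn.mapsTo (Set.mem_univ v)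

theorem toLeaf_injective : Function.Injective D.toLeaf := Set.injOn_univ.1 D.bijOn.injOn

theorem exists_toLeaf {x : W} (h : D.tree.IsLeaf x) : ∃ v, D.toLeaf v = x := by
  obtain ⟨v, -, hv⟩ := D.bijOn.surjOn h
  exact ⟨v, hv⟩

/-- The vertices on the side of `x` of the edge `x y` of the tree. -/
def sideOf (x y : W) : Set V :=
  {v | D.tree.dist (D.toLeaf v) x < D.tree.dist (D.toLeaf v) y}

theorem cut_eq_sideOf (e : D.tree.Dart) : D.cut e = D.sideOf e.fst e.snd := by
  ext v
  exact D.isTree.reachable_deleteEdges_iff e.adj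

open Classical in
/-- The parent of a node, when the tree is rooted at the leaf of `v₀`; the root is its own parent. -/
noncomputable def parent (x : W) : W :=
  if h : ∃ y, D.tree.Adj x y ∧
      D.tree.dist (D.toLeaf v₀) y < D.tree.dist (D.toLeaf v₀) x then h.choose else x

variable {v₀} {x y a b : W}

theorem adj_parent (h : x ≠ D.toLeaf v₀) : D.tree.Adj x (D.parent v₀ x) ∧
    D.tree.dist (D.toLeaf v₀) (D.parent v₀ x) < D.tree.dist (D.toLeaf v₀) x := by
  have h' := D.isTree.exists_closer h
  rw [parent, dif_pos h']
  exact h'.choose_spec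

theorem eq_parent (h : D.tree.Adj x y)
    (h' : D.tree.dist (D.toLeaf v₀) y < D.tree.dist (D.toLeaf v₀) x) : y = D.parent v₀ x := by
  have hx : x ≠ D.toLeaf v₀ := fun hx => by rw [hx] at h'; simp at h'
  exact D.isTree.closer_unique h (D.adj_parent hx).1 h' (D.adj_parent hx).2

/-- Neighbors that are not parents are children. -/
theorem parent_eq (h : D.tree.Adj x y) (h' : y ≠ D.parent v₀ x) :
    D.parent v₀ y = x ∧ D.tree.dist (D.toLeaf v₀) x < D.tree.dist (D.toLeaf v₀) y := by
  have h1 : D.tree.dist (D.toLeaf v₀) x < D.tree.dist (D.toLeaf v₀) y :=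
    (D.isTree.dist_lt_or_lt h).resolve_right fun h1 => h' (D.eq_parent h h1)
  exact ⟨(D.eq_parent h.symm h1).symm, h1⟩

theorem not_isLeaf (ha : D.tree.Adj x a) (hb : D.tree.Adj x b) (hab : a ≠ b) : ¬ D.tree.IsLeaf x := by
  intro h
  obtain ⟨c, hc⟩ := Set.ncard_eq_one.1 h
  have h1 : a ∈ D.tree.neighborSet x := ha
  have h2 : b ∈ D.tree.neighborSet x := hb
  rw [hc] at h1 h2
  exact hab (h1.trans h2.symm)

theorem eq_of_isLeaf (h : D.tree.IsLeaf x) (ha : D.tree.Adj x a) (hb : D.tree.Adj x b) : a = b := by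
  by_contra hab
  exact D.not_isLeaf ha hb hab h

/-- The vertices below an inner node are those below one of its two children: the path from `x` to the
leaf of such a vertex starts with one of the children. -/
theorem children (ha : D.tree.Adj x a) (hb : D.tree.Adj x b) (hab : a ≠ b)
    (ha' : a ≠ D.parent v₀ x) (hb' : b ≠ D.parent v₀ x) :
    D.sideOf x (D.parent v₀ x) = D.sideOf a (D.parent v₀ a) ∪ D.sideOf b (D.parent v₀ b) ∧
      Disjoint (D.sideOf a (D.parent v₀ a)) (D.sideOf b (D.parent v₀ b)) ∧
      ∀ y, D.tree.Adj x y → y ≠ D.parent v₀ x → y = a ∨ y = b := by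
  have hx := D.not_isLeaf ha hb hab
  obtain ⟨hp, -⟩ := D.adj_parent (v₀ := v₀) (x := x) fun h => hx (h ▸ D.isLeaf v₀)
  set p := D.parent v₀ x with hpd
  have := D.subcubic.finite
  have hsub : ({a, b, p} : Set W) ⊆ D.tree.neighborSet x := by
    rintro y (rfl | rfl | rfl)
    exacts [ha, hb, hp]
  have hcard : ({a, b, p} : Set W).ncard = 3 := Set.ncard_eq_three.2 ⟨a, b, p, hab, ha', hb', rfl⟩
  have hN : ({a, b, p} : Set W) = D.tree.neighborSet x :=
    Set.eq_of_subset_of_ncard_le hsub (by rw [hcard, D.subcubic.degree_eq_three x hx])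
  have hcases : ∀ y, D.tree.Adj x y → y = a ∨ y = b ∨ y = p := fun y hy => by
    have : y ∈ ({a, b, p} : Set W) := hN ▸ hy
    simpa using this
  rw [(D.parent_eq ha ha').1, (D.parent_eq hb hb').1]
  have hz : ∀ v, ∃ y, D.tree.Adj x y ∧ ∀ y', D.tree.Adj x y' →
      (D.tree.dist (D.toLeaf v) y' < D.tree.dist (D.toLeaf v) x ↔ y' = y) := by
    intro v
    obtain ⟨y, hy, hy'⟩ := D.isTree.exists_closer (z := D.toLeaf v) (x := x) fun h =>
      hx (h ▸ D.isLeaf v)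
    exact ⟨y, hy, fun y' h => ⟨fun h' => D.isTree.closer_unique h hy h' hy', fun h' => h' ▸ hy'⟩⟩
  refine ⟨?_, ?_, fun y hy hyp => ?_⟩
  · ext v
    obtain ⟨y, hy, hy'⟩ := hz v
    have h1 : D.tree.dist (D.toLeaf v) x < D.tree.dist (D.toLeaf v) p ↔ p ≠ y := by
      rw [ne_eq, ← hy' p hp]
      have := D.isTree.dist_ne_of_adj (D.toLeaf v) hp
      omega
    simp only [sideOf, Set.mem_ofPred_eq, Set.mem_union]
    rw [h1, hy' a ha, hy' b hb]
    constructor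
    · intro h
      rcases hcases y hy with rfl | rfl | rfl
      exacts [.inl rfl, .inr rfl, absurd rfl h]
    · rintro (rfl | rfl)
      exacts [ha'.symm, hb'.symm]
  · rw [Set.disjoint_left]
    intro v hva hvb
    exact hab (D.isTree.closer_unique ha hb hva hvb)
  · rcases hcases y hy with h | h | h
    exacts [.inl h, .inr h, absurd h hyp]

/-- Below a leaf there is only its own vertex. -/
theorem sideOf_toLeaf {v : V} (h : D.tree.Adj (D.toLeaf v) y) : D.sideOf (D.toLeaf v) y = {v} := by
  ext u
  simp only [sideOf, Set.mem_ofPred_eq, Set.mem_singleton_iff]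
  constructor
  · intro hu
    by_contra hne
    obtain ⟨y', hy', hy''⟩ := D.isTree.exists_closer (x := D.toLeaf v) (z := D.toLeaf u)
      fun h => hne (D.toLeaf_injective h).symm
    rw [D.eq_of_isLeaf (D.isLeaf v) hy' h] at hy''
    omega
  · rintro rfl
    rw [SimpleGraph.dist_self]
    exact D.isTree.connected.pos_dist_of_ne h.ne

theorem sideOf_compl (h : D.tree.Adj x y) : (D.sideOf x y)ᶜ = D.sideOf y x := by
  ext u
  simp only [sideOf, Set.mem_ofPred_eq, Set.mem_compl_iff]
  have := D.isTree.dist_ne_of_adj (D.toLeaf u) h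
  omega

/-- If some node other than the root is not done, then a deepest such node can be joined. -/
theorem exists_join (D' : W → Prop) (hleaf : ∀ v, v ≠ v₀ → D' (D.toLeaf v))
    (h : ∃ x, ¬ D' x ∧ x ≠ D.toLeaf v₀) :
    ∃ x a b, ¬ D' x ∧ D' a ∧ D' b ∧ a ≠ b ∧ D.tree.Adj x a ∧ D.tree.Adj x b := by
  have := D.subcubic.finite
  obtain ⟨x, ⟨hx, hx0⟩, hmax⟩ := Set.exists_max_image {x | ¬ D' x ∧ x ≠ D.toLeaf v₀}
    (D.tree.dist (D.toLeaf v₀)) (Set.toFinite _) h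
  have hxl : ¬ D.tree.IsLeaf x := by
    intro hl
    obtain ⟨v, rfl⟩ := D.exists_toLeaf hl
    exact hx (hleaf v fun hv => hx0 (by rw [hv]))
  have h3 := D.subcubic.degree_eq_three x hxl
  have hp : D.parent v₀ x ∈ D.tree.neighborSet x := (D.adj_parent hx0).1
  obtain ⟨a, b, hab, hN⟩ := Set.ncard_eq_two.1
    (show (D.tree.neighborSet x \ {D.parent v₀ x}).ncard = 2 by
      rw [Set.ncard_sdiff_singleton_of_mem hp, h3])
  have key : ∀ y ∈ D.tree.neighborSet x \ {D.parent v₀ x}, D' y ∧ D.tree.Adj x y := by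
    rintro y ⟨hy, hyp⟩
    have h1 := (D.parent_eq hy hyp).2
    refine ⟨?_, hy⟩
    by_contra hc
    refine absurd (hmax y ⟨hc, fun h0 => ?_⟩) (not_le.2 h1)
    rw [h0] at h1
    simp at h1
  obtain ⟨ha, ha'⟩ := key a (by rw [hN]; simp)
  obtain ⟨hb, hb'⟩ := key b (by rw [hN]; simp)
  exact ⟨x, a, b, hx, ha, hb, hab, ha', hb'⟩

theorem exists_adj_root : ∃ y, D.tree.Adj (D.toLeaf v₀) y := by
  obtain ⟨y, hy⟩ := Set.ncard_eq_one.1 (D.isLeaf v₀)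
  exact ⟨y, by rw [← SimpleGraph.mem_neighborSet, hy]; rfl⟩

theorem parent_of_adj_root (h : D.tree.Adj (D.toLeaf v₀) y) : D.parent v₀ y = D.toLeaf v₀ := by
  refine (D.eq_parent h.symm ?_).symm
  rw [SimpleGraph.dist_self]
  exact D.isTree.connected.pos_dist_of_ne h.ne

/-- A subcubic tree with `n` leaves has `2 * n - 2` nodes. -/
theorem card_eq (D : BranchDecomposition V W) [Finite V] [Finite W] : Nat.card W + 2 = 2 * Nat.card V := by
  classical
  have := Fintype.ofFinite W
  have := Fintype.ofFinite V
  have h1 := D.isTree.card_edgeFinset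
  have h2 := D.tree.sum_degrees_eq_twice_card_edges
  have hdeg : ∀ x, D.tree.degree x = (D.tree.neighborSet x).ncard := fun x => by
    rw [← SimpleGraph.card_neighborSet_eq_degree, Set.ncard_eq_toFinset_card', Set.toFinset_card]
  have h3 : ∀ x, D.tree.degree x + 2 * (if D.tree.IsLeaf x then 1 else 0) = 3 := by
    intro x
    rw [hdeg]
    by_cases hx : D.tree.IsLeaf x
    · rw [if_pos hx]
      have : (D.tree.neighborSet x).ncard = 1 := hx
      omega
    · rw [if_neg hx, D.subcubic.degree_eq_three x hx]
  have h4 : (Finset.univ.filter fun x => D.tree.IsLeaf x).card = Fintype.card V := by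
    rw [← Finset.card_univ, ← Finset.card_image_of_injective Finset.univ D.toLeaf_injective]
    congr 1
    ext x
    simp only [Finset.mem_filter, Finset.mem_univ, true_and, Finset.mem_image]
    exact ⟨fun h => D.exists_toLeaf h, fun ⟨v, hv⟩ => hv ▸ D.isLeaf v⟩
  have h5 := Finset.sum_congr rfl fun x (_ : x ∈ (Finset.univ : Finset W)) => h3 x
  rw [Finset.sum_add_distrib, ← Finset.mul_sum, Finset.sum_boole, h2, h4] at h5
  simp at h5
  rw [Nat.card_eq_fintype_card, Nat.card_eq_fintype_card]
  omega

end BranchDecomposition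

/-! ### Induced matchings and the number of signatures -/

/-- Every induced matching of the bipartite graph that the relation `R` defines between `A` and `C` has
at most `ν` edges. -/
def MatchingBound {V : Type*} (R : V → V → Prop) (A C : Set V) (ν : ℕ) : Prop :=
  ∀ I : Finset (V × V), (∀ e ∈ I, e.1 ∈ A ∧ e.2 ∈ C ∧ R e.1 e.2) →
    (∀ e ∈ I, ∀ e' ∈ I, e ≠ e' → ¬ R e.1 e'.2) → I.card ≤ ν

theorem MatchingBound.flip {V : Type*} {R : V → V → Prop} {A C : Set V} {ν : ℕ}
    (h : MatchingBound R A C ν) : MatchingBound (fun x y => R y x) C A ν := by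
  intro I h₁ h₂
  rw [← Finset.card_map (Equiv.prodComm V V).toEmbedding]
  refine h _ (fun e he => ?_) fun e he e' he' hne => ?_
  · obtain ⟨e, he₀, rfl⟩ := Finset.mem_map.1 he
    obtain ⟨h3, h4, h5⟩ := h₁ e he₀
    exact ⟨h4, h3, h5⟩
  · obtain ⟨e, he₀, rfl⟩ := Finset.mem_map.1 he
    obtain ⟨e', he₀', rfl⟩ := Finset.mem_map.1 he'
    exact h₂ e' he₀' e he₀ fun h => hne (by rw [h])

namespace Digraph

variable {V : Type*} {G : Digraph V}

theorem matchingBound_adj [Finite V] (A : Set V) :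
    MatchingBound G.Adj A Aᶜ (G.between A Aᶜ).inducedMatchingNumber := by
  have := Fintype.ofFinite V
  intro I h₁ h₂
  have hfst : ∀ e ∈ I, ∀ e' ∈ I, e.1 = e'.1 → e = e' := fun e he e' he' h => by
    by_contra hne
    exact h₂ e he e' he' hne (h ▸ (h₁ e' he').2.2)
  have hsnd : ∀ e ∈ I, ∀ e' ∈ I, e.2 = e'.2 → e = e' := fun e he e' he' h => by
    by_contra hne
    exact h₂ e he e' he' hne (h ▸ (h₁ e he).2.2)
  refine le_csSup ⟨Fintype.card (V × V), ?_⟩ ⟨I, ⟨fun e he => h₁ e he, ?_, ?_⟩, rfl⟩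
  · rintro k ⟨M, -, rfl⟩
    exact Finset.card_le_univ M
  · rintro e he e' he' hne ⟨x, hx | hx, hx' | hx'⟩
    · exact hne (hfst e he e' he' (hx.symm.trans hx'))
    · exact (h₁ e' he').2.1 (hx' ▸ hx ▸ (h₁ e he).1)
    · exact (h₁ e he).2.1 (hx ▸ hx' ▸ (h₁ e' he').1)
    · exact hne (hsnd e he e' he' (hx.symm.trans hx'))
  · rintro x y ⟨hxA, hyA, hxy⟩ e he e' he' hne ⟨hm, hm'⟩
    have key : ∀ e ∈ I, Meets (x, y) e → x = e.1 ∨ y = e.2 := by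
      rintro e he ⟨z, hz | hz, hz' | hz'⟩
      · exact .inl (hz.symm.trans hz')
      · exact absurd (show e.2 ∈ A from hz' ▸ hz ▸ hxA) (h₁ e he).2.1
      · exact absurd (h₁ e he).1 (show e.1 ∉ A from hz' ▸ hz ▸ hyA)
      · exact .inr (hz.symm.trans hz')
    rcases key e he hm with h | h <;> rcases key e' he' hm' with h' | h'
    · exact hne (hfst e he e' he' (h.symm.trans h'))
    · exact h₂ e he e' he' hne (h ▸ h' ▸ hxy)
    · exact h₂ e' he' e he (Ne.symm hne) (h ▸ h' ▸ hxy)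
    · exact hne (hsnd e he e' he' (h.symm.trans h'))

/-- There is a directed walk with at most `k` edges from `u` to `v`. -/
def Within (G : Digraph V) (k : ℕ) (u v : V) : Prop := ∃ i ≤ k, G.HasWalk i u v

theorem edist_le_iff {k : ℕ} {u v : V} : G.edist u v ≤ k ↔ G.Within k u v := by
  constructor
  · intro h
    have h1 : G.edist u v < (k + 1 : ℕ) := lt_of_le_of_lt h (by exact_mod_cast Nat.lt_succ_self k)
    simp only [edist, iInf_lt_iff] at h1
    obtain ⟨i, hi, hik⟩ := h1
    exact ⟨i, by have : i < k + 1 := by exact_mod_cast hik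
                 omega, hi⟩
  · rintro ⟨i, hi, h⟩
    exact (iInf₂_le i h).trans (by exact_mod_cast hi)

theorem HasWalk.append {i j : ℕ} {u v w : V} (h : G.HasWalk i u v) (h' : G.HasWalk j v w) :
    G.HasWalk (i + j) u w := by
  induction h with
  | nil => rwa [zero_add]
  | cons h _ ih => rw [Nat.add_right_comm]; exact .cons h (ih h')

/-- A walk that leaves `A` does so along some edge. -/
theorem HasWalk.exists_crossing {A : Set V} {i : ℕ} {u v : V} (h : G.HasWalk i u v) (hu : u ∈ A)
    (hv : v ∉ A) : ∃ k j a b, k + 1 + j = i ∧ G.HasWalk k u a ∧ G.HasWalk j b v ∧ a ∈ A ∧ b ∉ A ∧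
      G.Adj a b := by
  induction h with
  | nil => exact absurd hu hv
  | @cons i u w v huw p ih =>
    by_cases hw : w ∈ A
    · obtain ⟨k, j, a, b, h1, h2, h3, h4⟩ := ih hw hv
      exact ⟨k + 1, j, a, b, by omega, .cons huw h2, h3, h4⟩
    · exact ⟨0, i, u, w, by omega, .nil u, p, hu, hw, huw⟩

/-- In the power of a digraph, the induced matchings from `A` to its complement are at most `r` times as
large as in the digraph: among the pairs whose connecting walks cross the cut at the same step, the
crossing edges form an induced matching. -/
theorem matchingBound_within {A : Set V} {ν : ℕ} (h : MatchingBound G.Adj A Aᶜ ν) (r : ℕ) :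
    MatchingBound (G.Within r) A Aᶜ (r * ν) := by
  classical
  intro I h₁ h₂
  have hc : ∀ e : V × V, ∃ k a b, e ∈ I → k < r ∧ G.Within k e.1 a ∧ G.Within (r - 1 - k) b e.2 ∧
      a ∈ A ∧ b ∉ A ∧ G.Adj a b := by
    intro e
    by_cases he : e ∈ I
    · obtain ⟨hA, hC, i, hi, hw⟩ := h₁ e he
      obtain ⟨k, j, a, b, h3, h4, h5, h6⟩ := hw.exists_crossing hA hC
      exact ⟨k, a, b, fun _ => ⟨by omega, ⟨k, le_rfl, h4⟩, ⟨j, by omega, h5⟩, h6⟩⟩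
    · exact ⟨0, e.1, e.1, fun h => absurd h he⟩
  choose step src tgt hstep using hc
  have hlt : ∀ e ∈ I, ∀ e' ∈ I, e ≠ e' → step e = step e' → ¬ G.Adj (src e) (tgt e') := by
    intro e he e' he' hne hs hadj
    obtain ⟨h3, ⟨i, hi, hw⟩, -⟩ := hstep e he
    obtain ⟨-, -, ⟨j, hj, hw'⟩, -⟩ := hstep e' he'
    exact h₂ e he e' he' hne ⟨i + (j + 1), by omega, hw.append (.cons hadj hw')⟩
  have hinj : ∀ e ∈ I, ∀ e' ∈ I, step e = step e' → (src e, tgt e) = (src e', tgt e') → e = e' := by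
    intro e he e' he' hs heq
    by_contra hne
    rw [Prod.mk.injEq] at heq
    exact hlt e he e' he' hne hs (heq.2 ▸ (hstep e he).2.2.2.2.2)
  rw [Finset.card_eq_sum_card_fiberwise (f := step) (t := Finset.range r) fun e he => by
    simpa using (hstep e he).1]
  refine (Finset.sum_le_card_nsmul _ _ ν fun k _ => ?_).trans (by simp)
  rw [← Finset.card_image_of_injOn (s := I.filter fun e => step e = k)
    (f := fun e => (src e, tgt e))]
  · refine h _ (fun x hx => ?_) fun x hx x' hx' hne => ?_
    · obtain ⟨e, he, rfl⟩ := Finset.mem_image.1 hx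
      exact (hstep e (Finset.mem_filter.1 he).1).2.2.2
    · obtain ⟨e, he, rfl⟩ := Finset.mem_image.1 hx
      obtain ⟨e', he', rfl⟩ := Finset.mem_image.1 hx'
      obtain ⟨he, hs⟩ := Finset.mem_filter.1 he
      obtain ⟨he', hs'⟩ := Finset.mem_filter.1 he'
      exact hlt e he e' he' (fun h => hne (by rw [h])) (hs.trans hs'.symm)
  · intro e he e' he' heq
    obtain ⟨he, hs⟩ := Finset.mem_filter.1 he
    obtain ⟨he', hs'⟩ := Finset.mem_filter.1 he'
    exact hinj e he e' he' (hs.trans hs'.symm) heq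

end Digraph

section Count

variable {V : Type*} {R : V → V → Prop} {C : Set V} {ν d : ℕ}

open Classical in
/-- A multiset can be reduced to one with at most `d * ν` elements with the same capped counts. In a
minimal such multiset every element is needed at some `w` with at most `d` occurrences; a minimal set of
such witnesses `w` has private elements, hence gives an induced matching. -/
theorem MatchingBound.exists_small {A : Set V} (h : MatchingBound R A C ν) (hC : C.Finite)
    (X : Multiset V) (hX : ∀ x ∈ X, x ∈ A) : ∃ Y ≤ X, Multiset.card Y ≤ d * ν ∧
      ∀ w ∈ C, min d (Y.countP (R · w)) = min d (X.countP (R · w)) := by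
  -- a minimal multiset with these counts
  obtain ⟨Y, ⟨hYX, hY⟩, hmin⟩ := WellFounded.has_min (measure (Multiset.card (α := V))).wf
    {Y | Y ≤ X ∧ ∀ w ∈ C, min d (Y.countP (R · w)) = min d (X.countP (R · w))} ⟨X, le_rfl, fun _ _ => rfl⟩
  have hwit : ∀ x ∈ Y, ∃ w ∈ C, R x w ∧ Y.countP (R · w) ≤ d := by
    intro x hx
    by_contra! hc
    refine hmin (Y.erase x) ⟨(Multiset.erase_le x Y).trans hYX, fun w hw => ?_⟩
      (Multiset.card_erase_lt_of_mem hx)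
    rw [← hY w hw]
    by_cases hxw : R x w
    · have h1 := hc w hw hxw
      have h2 : Y.countP (R · w) = (Y.erase x).countP (R · w) + 1 := by
        conv_lhs => rw [← Multiset.cons_erase hx, Multiset.countP_cons_of_pos (p := (R · w)) _ hxw]
      omega
    · conv_rhs => rw [← Multiset.cons_erase hx, Multiset.countP_cons_of_neg (p := (R · w)) _ hxw]
  -- a minimal set of witnesses
  obtain ⟨W, ⟨hWC, hW⟩, hWmin⟩ := WellFounded.has_min (measure (Finset.card (α := V))).wf
    {W | (∀ w ∈ W, w ∈ C ∧ Y.countP (R · w) ≤ d) ∧ ∀ x ∈ Y, ∃ w ∈ W, R x w}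
    ⟨hC.toFinset.filter fun w => Y.countP (R · w) ≤ d, by simp, fun x hx => by
      obtain ⟨w, hw, hxw, hd⟩ := hwit x hx
      exact ⟨w, by simp [hw, hd], hxw⟩⟩
  have hpriv : ∀ w, ∃ x, w ∈ W → x ∈ Y ∧ R x w ∧ ∀ w' ∈ W, R x w' → w' = w := by
    intro w
    by_cases hw : w ∈ W
    · have h1 : ¬ ∀ x ∈ Y, ∃ w' ∈ W.erase w, R x w' := fun h1 =>
        hWmin (W.erase w) ⟨fun w' hw' => hWC w' (Finset.mem_of_mem_erase hw'), h1⟩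
          (Finset.card_erase_lt_of_mem hw)
      push Not at h1
      obtain ⟨x, hx, hx'⟩ := h1
      have h2 : ∀ w' ∈ W, R x w' → w' = w := fun w' hw' hR => by
        by_contra hne
        exact hx' w' (Finset.mem_erase.2 ⟨hne, hw'⟩) hR
      obtain ⟨w', hw', hR⟩ := hW x hx
      exact ⟨x, fun _ => ⟨hx, h2 w' hw' hR ▸ hR, h2⟩⟩
    · exact ⟨w, fun h => absurd h hw⟩
  choose priv hpriv using hpriv
  refine ⟨Y, hYX, ?_, hY⟩
  have hWν : W.card ≤ ν := by
    rw [← Finset.card_image_of_injective (f := fun w => (priv w, w)) W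
      fun a b hab => (Prod.mk.inj hab).2]
    refine h _ (fun e he => ?_) fun e he e' he' hne hR => ?_
    · obtain ⟨w, hw, rfl⟩ := Finset.mem_image.1 he
      exact ⟨hX _ (Multiset.mem_of_le hYX (hpriv w hw).1), (hWC w hw).1, (hpriv w hw).2.1⟩
    · obtain ⟨w, hw, rfl⟩ := Finset.mem_image.1 he
      obtain ⟨w', hw', rfl⟩ := Finset.mem_image.1 he'
      exact hne (by rw [(hpriv w hw).2.2 w' hw' hR])
  have hcard : ∀ Z : Multiset V, (∀ x ∈ Z, ∃ w ∈ W, R x w) →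
      Multiset.card Z ≤ ∑ w ∈ W, Z.countP (R · w) := by
    intro Z
    induction Z using Multiset.induction with
    | empty => simp
    | cons x Z ih =>
      intro hZ
      obtain ⟨w, hw, hxw⟩ := hZ x (Multiset.mem_cons_self x Z)
      have h1 := ih fun y hy => hZ y (Multiset.mem_cons_of_mem hy)
      have h2 : ∑ w ∈ W, Z.countP (R · w) < ∑ w ∈ W, (x ::ₘ Z).countP (R · w) :=
        Finset.sum_lt_sum (fun w' _ => Multiset.countP_le_of_le _ (Multiset.le_cons_self Z x))
          ⟨w, hw, by rw [Multiset.countP_cons_of_pos (p := (R · w)) _ hxw]; omega⟩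
      rw [Multiset.card_cons]
      omega
  calc Multiset.card Y ≤ ∑ w ∈ W, Y.countP (R · w) := hcard Y hW
    _ ≤ W.card * d := Finset.sum_le_card_nsmul _ _ _ fun w hw => (hWC w hw).2
    _ ≤ d * ν := by rw [mul_comm]; exact Nat.mul_le_mul_left _ hWν

/-- There are at most `(|A| + 1) ^ k` multisets of at most `k` elements of `A`. -/
theorem exists_finset_multiset [DecidableEq V] (A : Finset V) (k : ℕ) :
    ∃ T : Finset (Multiset V), T.card ≤ (A.card + 1) ^ k ∧
      ∀ X : Multiset V, Multiset.card X ≤ k → (∀ x ∈ X, x ∈ A) → X ∈ T := by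
  induction k with
  | zero => exact ⟨{0}, by simp, fun X hX _ => by simpa using hX⟩
  | succ k ih =>
    obtain ⟨T, hT, hT'⟩ := ih
    refine ⟨T ∪ (A ×ˢ T).image fun x => x.1 ::ₘ x.2, ?_, fun X hX hXA => ?_⟩
    · refine (Finset.card_union_le _ _).trans ?_
      refine (Nat.add_le_add_left Finset.card_image_le _).trans ?_
      rw [Finset.card_product, pow_succ]
      nlinarith
    · rcases X.empty_or_exists_mem with rfl | ⟨x, hx⟩
      · exact Finset.mem_union_left _ (hT' 0 (by simp) (by simp))
      · obtain ⟨Y, rfl⟩ := Multiset.exists_cons_of_mem hx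
        refine Finset.mem_union_right _ (Finset.mem_image.2 ⟨(x, Y), ?_, rfl⟩)
        rw [Multiset.card_cons] at hX
        exact Finset.mem_product.2 ⟨hXA x hx, hT' Y (by omega) fun y hy =>
          hXA y (Multiset.mem_cons_of_mem hy)⟩

end Count

namespace Prob

variable {P : Prob} {S : Finset ℕ}

/-- The vertices that count at the positions of the block `jj`. -/
def block (P : Prob) (jj : ℕ) (l : Multiset (ℕ × ℕ)) : Multiset ℕ :=
  (l.filter fun x => x.1 = jj / 2 + P.off).map Prod.snd

/-- Whether `u` counts at `w` in the direction `dir`: whether `u` is in the out-ball of `w` (`dir`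
even), or in the in-ball (`dir` odd). -/
def Counts (P : Prob) (dir u w : ℕ) : Prop :=
  if dir % 2 = 0 then P.h (w * P.n + u) ≠ 0 else P.h (u * P.n + w) ≠ 0

open Classical in
theorem total_eq_countP (hh : ∀ k, P.h k ≤ 1) {jj w : ℕ} (hw : w < P.n) (l : Multiset (ℕ × ℕ)) :
    P.total l (jj * P.n + w) = (P.block jj l).countP (P.Counts jj · w) := by
  induction l using Multiset.induction with
  | empty => simp [total, block]
  | cons x l ih =>
    rw [total_cons, ih, vecAt, pos_div hw, pos_mod hw, block, block]
    by_cases hx : x.1 = jj / 2 + P.off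
    · rw [if_pos hx, Multiset.filter_cons_of_pos (p := fun x : ℕ × ℕ => x.1 = jj / 2 + P.off) _ hx, Multiset.map_cons, Multiset.countP_cons,
        add_comm]
      congr 1
      have h1 := hh (w * P.n + x.2)
      have h2 := hh (x.2 * P.n + w)
      unfold Counts
      by_cases hd : jj % 2 = 0 <;> simp only [hd, if_true, if_false] <;> split_ifs <;> omega
    · rw [if_neg hx, Multiset.filter_cons_of_neg (p := fun x : ℕ × ℕ => x.1 = jj / 2 + P.off) _ hx, zero_add]

/-- The number of signatures: a signature is determined by one small multiset for each block. -/
theorem IsPartialList.le_pow {ν₀ ν₁ len : ℕ} {row : ℕ → ℕ → ℕ} (hh : ∀ k, P.h k ≤ 1)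
    (h₀ : MatchingBound (P.Counts 0) S (Finset.range P.n \ S) ν₀)
    (h₁ : MatchingBound (P.Counts 1) S (Finset.range P.n \ S) ν₁) (hl : P.IsPartialList S len row) :
    len ≤ (S.card + 1) ^ (P.c * (P.d * (ν₀ + ν₁))) := by
  classical
  set ν : ℕ → ℕ := fun jj => if jj % 2 = 0 then ν₀ else ν₁ with hν
  have hmb : ∀ jj, MatchingBound (P.Counts jj) S (Finset.range P.n \ S) (ν jj) := fun jj => by
    rcases Nat.mod_two_eq_zero_or_one jj with h | h
    · have : P.Counts jj = P.Counts 0 := by funext u w; simp [Counts, h]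
      simpa [hν, h, this] using h₀
    · have : P.Counts jj = P.Counts 1 := by funext u w; simp [Counts, h]
      simpa [hν, h, this] using h₁
  have hfin : ((Finset.range P.n : Set ℕ) \ S).Finite := (Finset.finite_toSet _).sdiff
  choose T hT hT' using fun jj => exists_finset_multiset S (P.d * ν jj)
  have hex : ∀ i : Fin len, ∀ jj : Fin (2 * P.c), ∃ Y ∈ T jj, ∀ w < P.n, w ∉ S →
      row i (jj * P.n + w) = min P.d (Y.countP (P.Counts jj · w)) := by
    intro i jj
    obtain ⟨l, hl₁, hl₂⟩ := hl.sound i i.2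
    have hmem : ∀ x ∈ P.block jj l, x ∈ S := fun x hx => by
      obtain ⟨y, hy, rfl⟩ := Multiset.mem_map.1 hx
      exact (hl₁ y (Multiset.mem_filter.1 hy).1).2
    obtain ⟨Y, hY, hY', hY''⟩ := (hmb jj).exists_small (d := P.d) hfin (P.block jj l) hmem
    refine ⟨Y, hT' jj Y hY' fun x hx => hmem x (Multiset.mem_of_le hY hx), fun w hw hwS => ?_⟩
    rw [hl₂ _ (pos_lt jj.2 hw), sig, pos_mod hw, if_neg hwS, total_eq_countP hh hw]
    exact (hY'' w ⟨by simpa using hw, hwS⟩).symm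
  choose Y hYT hYrow using hex
  have hinj : Function.Injective Y := by
    intro i i' hii
    refine Fin.ext (hl.inj i i.2 i' i'.2 fun p hp => ?_)
    have hn : 0 < P.n := by
      rcases Nat.eq_zero_or_pos P.n with h | h
      · simp [R, h] at hp
      · exact h
    have hw := Nat.mod_lt p hn
    by_cases hS : p % P.n ∈ S
    · obtain ⟨l, -, h1⟩ := hl.sound i i.2
      obtain ⟨l', -, h2⟩ := hl.sound i' i'.2
      rw [h1 p hp, h2 p hp, sig, sig, if_pos hS, if_pos hS]
    · have hjj : p / P.n < 2 * P.c := Nat.div_lt_of_lt_mul (by rwa [R, mul_comm] at hp)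
      have hpe : p / P.n * P.n + p % P.n = p := by rw [mul_comm]; exact Nat.div_add_mod p P.n
      have h1 := hYrow i ⟨_, hjj⟩ _ hw hS
      have h2 := hYrow i' ⟨_, hjj⟩ _ hw hS
      rw [hii] at h1
      simp only [hpe] at h1 h2
      rw [h1, h2]
  have hcard : len ≤ (Fintype.piFinset fun jj : Fin (2 * P.c) => T jj).card := by
    rw [← Fintype.card_fin len, ← Finset.card_univ, ← Finset.card_image_of_injective _ hinj]
    refine Finset.card_le_card fun y hy => ?_
    obtain ⟨i, -, rfl⟩ := Finset.mem_image.1 hy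
    exact Fintype.mem_piFinset.2 fun jj => hYT i jj
  refine hcard.trans ?_
  rw [Fintype.card_piFinset]
  refine le_trans (Finset.prod_le_prod' (g := fun jj : Fin (2 * P.c) => (S.card + 1) ^ (P.d * ν jj))
    fun jj _ => hT jj) (le_of_eq ?_)
  rw [Finset.prod_pow_eq_pow_sum, Fin.sum_univ_eq_sum_range (fun jj => P.d * ν jj)]
  congr 1
  induction P.c with
  | zero => simp
  | succ c ih =>
    rw [show 2 * (c + 1) = 2 * c + 1 + 1 by ring, Finset.sum_range_succ, Finset.sum_range_succ, ih]
    have e1 : ν (2 * c) = ν₀ := by simp [hν]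
    have e2 : ν (2 * c + 1) = ν₁ := by simp [hν, Nat.add_mod]
    rw [e1, e2]
    ring

end Prob

open Prob

/-! ### The input in memory -/

theorem encodeRel_ne_zero {n : ℕ} {R : Fin n → Fin n → Prop} (u v : Fin n) :
    encodeRel R (u * n + v) ≠ 0 ↔ R u v := by
  unfold encodeRel
  constructor
  · intro h
    by_cases h' : ∃ u' v' : Fin n, (u : ℕ) * n + v = u' * n + v' ∧ R u' v'
    · obtain ⟨u', v', he, hR⟩ := h'
      obtain ⟨h1, h2⟩ := WordRAM.mul_add_inj v.2 v'.2 he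
      rwa [Fin.ext h1, Fin.ext h2]
    · exact absurd (if_neg h') h
  · intro h
    rw [if_pos ⟨u, v, rfl, h⟩]
    exact one_ne_zero

theorem encodeRel_le_one {n : ℕ} (R : Fin n → Fin n → Prop) (k : ℕ) : encodeRel R k ≤ 1 := by
  unfold encodeRel
  split <;> omega

theorem Digraph.HasWalk.snoc {V : Type*} {G : Digraph V} {i : ℕ} {u v w : V} (h : G.HasWalk i u v)
    (h' : G.Adj v w) : G.HasWalk (i + 1) u w := h.append (.cons h' (.nil w))

theorem Digraph.HasWalk.exists_snoc {V : Type*} {G : Digraph V} {i : ℕ} {u v : V}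
    (h : G.HasWalk (i + 1) u v) : ∃ w, G.HasWalk i u w ∧ G.Adj w v := by
  induction i generalizing u with
  | zero =>
    cases h with
    | cons h p =>
      cases p
      exact ⟨u, .nil u, h⟩
  | succ i ih =>
    cases h with
    | cons h p =>
      obtain ⟨w, hw, hw'⟩ := ih p
      exact ⟨w, .cons h hw, hw'⟩

theorem WordRAM.reach_iff {n : ℕ} (G : Digraph (Fin n)) (k : ℕ) (u v : Fin n) :
    Reach (encodeRel G.Adj) n k u v ↔ G.Within k u v := by
  induction k generalizing v with
  | zero =>
    constructor
    · intro h
      obtain rfl := Fin.ext h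
      exact ⟨0, le_rfl, .nil u⟩
    · rintro ⟨i, hi, h⟩
      obtain rfl := Nat.le_zero.1 hi
      cases h
      rfl
  | succ k ih =>
    constructor
    · rintro ⟨w, hw, h1, h2⟩
      obtain ⟨i, hi, h⟩ := (ih ⟨w, hw⟩).1 h1
      rcases h2 with h2 | h2
      · exact ⟨i + 1, by omega, h.snoc ((encodeRel_ne_zero ⟨w, hw⟩ v).1 h2)⟩
      · obtain rfl : (⟨w, hw⟩ : Fin n) = v := Fin.ext h2
        exact ⟨i, by omega, h⟩
    · rintro ⟨i, hi, h⟩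
      cases i with
      | zero => exact ⟨v, v.2, (ih v).2 ⟨0, by omega, h⟩, .inr rfl⟩
      | succ i =>
        obtain ⟨w, hw, hwv⟩ := h.exists_snoc
        exact ⟨w, w.2, (ih w).2 ⟨i, by omega, hw⟩, .inl ((encodeRel_ne_zero w v).2 hwv)⟩

section NatSet

variable {n : ℕ}

open Classical in
/-- A set of vertices as a finite set of natural numbers. -/
noncomputable def natSet (A : Set (Fin n)) : Finset ℕ :=
  (Finset.range n).filter fun v => ∃ h : v < n, ⟨v, h⟩ ∈ A

theorem mem_natSet {A : Set (Fin n)} {v : ℕ} : v ∈ natSet A ↔ ∃ h : v < n, ⟨v, h⟩ ∈ A := by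
  simp only [natSet, Finset.mem_filter, Finset.mem_range]
  exact ⟨fun h => h.2, fun h => ⟨h.1, h⟩⟩

theorem natSet_subset (A : Set (Fin n)) : natSet A ⊆ Finset.range n := fun _ hv =>
  Finset.mem_range.2 (mem_natSet.1 hv).1

theorem natSet_union (A C : Set (Fin n)) : natSet (A ∪ C) = natSet A ∪ natSet C := by
  ext v
  simp only [mem_natSet, Finset.mem_union, Set.mem_union]
  exact exists_or

theorem natSet_disjoint {A C : Set (Fin n)} (h : Disjoint A C) : Disjoint (natSet A) (natSet C) := by
  rw [Finset.disjoint_left]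
  intro v hv hv'
  obtain ⟨h1, h2⟩ := mem_natSet.1 hv
  obtain ⟨_, h3⟩ := mem_natSet.1 hv'
  exact Set.disjoint_left.1 h h2 h3

theorem natSet_univ : natSet (Set.univ : Set (Fin n)) = Finset.range n := by
  ext v; simp [mem_natSet]

theorem natSet_compl (A : Set (Fin n)) : natSet Aᶜ = Finset.range n \ natSet A := by
  ext v
  simp only [mem_natSet, Finset.mem_sdiff, Finset.mem_range, Set.mem_compl_iff, not_exists]
  exact ⟨fun ⟨h, h'⟩ => ⟨h, fun _ => h'⟩, fun ⟨h, h'⟩ => ⟨h, h' h⟩⟩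

theorem natSet_singleton (v : Fin n) : natSet {v} = {(v : ℕ)} := by
  ext u
  simp only [mem_natSet, Set.mem_singleton_iff, Finset.mem_singleton, Fin.ext_iff]
  exact ⟨fun h => h.2, fun h => ⟨h ▸ v.2, h⟩⟩

theorem MatchingBound.natSet {R : Fin n → Fin n → Prop} {R' : ℕ → ℕ → Prop} {A C : Set (Fin n)}
    {ν : ℕ} (h : MatchingBound R A C ν) (hR : ∀ u v : Fin n, R' u v ↔ R u v) {A' C' : Set ℕ}
    (hA : ∀ u ∈ A', u ∈ natSet A) (hC : ∀ u ∈ C', u ∈ natSet C) : MatchingBound R' A' C' ν := by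
  classical
  intro I h₁ h₂
  set J : Finset (Fin n × Fin n) := Finset.univ.filter fun e => ((e.1 : ℕ), (e.2 : ℕ)) ∈ I with hJ
  have hI : I ⊆ J.image fun e => ((e.1 : ℕ), (e.2 : ℕ)) := by
    intro e he
    obtain ⟨h3, h4, -⟩ := h₁ e he
    obtain ⟨h3, -⟩ := mem_natSet.1 (hA _ h3)
    obtain ⟨h4, -⟩ := mem_natSet.1 (hC _ h4)
    exact Finset.mem_image.2 ⟨(⟨e.1, h3⟩, ⟨e.2, h4⟩), by simpa [hJ] using he, rfl⟩
  refine (Finset.card_le_card hI).trans (Finset.card_image_le.trans (h J ?_ ?_))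
  · intro e he
    obtain ⟨h3, h4, h5⟩ := h₁ _ (Finset.mem_filter.1 he).2
    exact ⟨(mem_natSet.1 (hA _ h3)).2, (mem_natSet.1 (hC _ h4)).2, (hR _ _).1 h5⟩
  · intro e he e' he' hne hR'
    refine h₂ _ (Finset.mem_filter.1 he).2 _ (Finset.mem_filter.1 he').2 (fun heq => hne ?_)
      ((hR _ _).2 hR')
    rw [Prod.mk.injEq] at heq
    exact Prod.ext (Fin.ext heq.1) (Fin.ext heq.2)

end NatSet

namespace BranchDecomposition

variable {n m : ℕ} (D : BranchDecomposition (Fin n) (Fin m)) (v₀ : Fin n)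

open Classical in
/-- The vertices whose leaves are below the node `x` when the tree is rooted at the leaf of `v₀`,
except that the set of the root is `{v₀}`. -/
noncomputable def below (x : Fin m) : Set (Fin n) :=
  if x = D.toLeaf v₀ then {v₀} else D.sideOf x (D.parent v₀ x)

/-- The sets `below x` for the nodes of the tree, and all vertices for other arguments. -/
noncomputable def side (x : ℕ) : Finset ℕ :=
  if h : x < m then natSet (D.below v₀ ⟨x, h⟩) else Finset.range n

theorem side_val (x : Fin m) : D.side v₀ x = natSet (D.below v₀ x) := dif_pos x.2

theorem below_of_ne {x : Fin m} (h : x ≠ D.toLeaf v₀) :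
    D.below v₀ x = D.sideOf x (D.parent v₀ x) := if_neg h

theorem ne_root {x y : Fin m} (h : D.tree.Adj x y) (h' : y ≠ D.parent v₀ x) : y ≠ D.toLeaf v₀ := by
  rintro rfl
  have := (D.parent_eq h h').2
  simp at this

theorem below_toLeaf (v : Fin n) : D.below v₀ (D.toLeaf v) = {v} := by
  by_cases h : D.toLeaf v = D.toLeaf v₀
  · rw [below, if_pos h, D.toLeaf_injective h]
  · rw [D.below_of_ne v₀ h, D.sideOf_toLeaf (D.adj_parent h).1]

/-- A branch decomposition has what the search for the joins uses, with the parents towards the root. -/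
theorem treeData (hn : 0 < n) : WordRAM.TreeData n m (fun x y => encodeRel D.tree.Adj (x * m + y) ≠ 0)
    (fun k => if h : k < n then (D.toLeaf ⟨k, h⟩ : ℕ) else 0)
    (fun x => if h : x < m then (D.parent ⟨0, hn⟩ ⟨x, h⟩ : ℕ) else 0) (D.side ⟨0, hn⟩) := by
  set v₀ : Fin n := ⟨0, hn⟩ with hv₀
  have hadj : ∀ x y : Fin m, encodeRel D.tree.Adj (x * m + y) ≠ 0 ↔ D.tree.Adj x y :=
    encodeRel_ne_zero
  have hleaf : ∀ v : Fin n, (if h : (v : ℕ) < n then (D.toLeaf ⟨v, h⟩ : ℕ) else 0) = D.toLeaf v :=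
    fun v => dif_pos v.2
  have hpar : ∀ x : Fin m, (if h : (x : ℕ) < m then (D.parent v₀ ⟨x, h⟩ : ℕ) else 0) = D.parent v₀ x :=
    fun x => dif_pos x.2
  have hside := D.side_val v₀
  -- all arguments below the bounds are values of elements of `Fin n` and `Fin m`
  constructor
  · exact hn
  · intro x y hx hy h
    exact (hadj ⟨y, hy⟩ ⟨x, hx⟩).2 ((hadj ⟨x, hx⟩ ⟨y, hy⟩).1 h).symm
  · intro v hv
    rw [hleaf ⟨v, hv⟩]
    exact Fin.is_lt _
  · intro v hv w hw h
    rw [hleaf ⟨v, hv⟩, hleaf ⟨w, hw⟩] at h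
    exact congrArg Fin.val (D.toLeaf_injective (Fin.ext h))
  · intro v hv
    rw [hleaf ⟨v, hv⟩, hside, D.below_toLeaf, natSet_singleton]
  · intro x hx
    rw [hside ⟨x, hx⟩]
    exact natSet_subset _
  · exact dif_neg (lt_irrefl m)
  · intro x hx a ha b hb h h' hab v hv heq
    rw [hleaf ⟨v, hv⟩] at heq
    refine D.not_isLeaf ((hadj ⟨x, hx⟩ ⟨a, ha⟩).1 h) ((hadj ⟨x, hx⟩ ⟨b, hb⟩).1 h')
      (fun h => hab (congrArg Fin.val h)) ?_
    rw [show (⟨x, hx⟩ : Fin m) = D.toLeaf ⟨v, hv⟩ from Fin.ext heq]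
    exact D.isLeaf _
  · intro x hx a ha b hb hxa hxb hab hap hbp
    have hxa := (hadj ⟨x, hx⟩ ⟨a, ha⟩).1 hxa
    have hxb := (hadj ⟨x, hx⟩ ⟨b, hb⟩).1 hxb
    rw [hpar ⟨x, hx⟩] at hap hbp
    have hab' : (⟨a, ha⟩ : Fin m) ≠ ⟨b, hb⟩ := fun h => hab (congrArg Fin.val h)
    have hap' : (⟨a, ha⟩ : Fin m) ≠ D.parent v₀ ⟨x, hx⟩ := fun h => hap (congrArg Fin.val h)
    have hbp' : (⟨b, hb⟩ : Fin m) ≠ D.parent v₀ ⟨x, hx⟩ := fun h => hbp (congrArg Fin.val h)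
    have hx0 : (⟨x, hx⟩ : Fin m) ≠ D.toLeaf v₀ := fun h =>
      D.not_isLeaf hxa hxb hab' (h ▸ D.isLeaf v₀)
    obtain ⟨h1, h2, h3⟩ := D.children hxa hxb hab' hap' hbp'
    rw [hside ⟨x, hx⟩, hside ⟨a, ha⟩, hside ⟨b, hb⟩, D.below_of_ne v₀ hx0,
      D.below_of_ne v₀ (D.ne_root v₀ hxa hap'), D.below_of_ne v₀ (D.ne_root v₀ hxb hbp'), h1,
      natSet_union]
    refine ⟨rfl, natSet_disjoint h2, fun y hy hxy hyp => ?_⟩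
    rw [hpar ⟨x, hx⟩] at hyp
    exact (h3 ⟨y, hy⟩ ((hadj ⟨x, hx⟩ ⟨y, hy⟩).1 hxy) fun h => hyp (congrArg Fin.val h)).imp
      (congrArg Fin.val) (congrArg Fin.val)
  · intro x hx a ha hxa hx0 ha0 hap hpa
    rw [hpar ⟨x, hx⟩] at hap
    rw [hpar ⟨a, ha⟩] at hpa
    rw [hleaf v₀] at hx0 ha0
    have h1 := (D.adj_parent (v₀ := v₀) (x := ⟨x, hx⟩) fun h => hx0 (congrArg Fin.val h)).2
    have h2 := (D.adj_parent (v₀ := v₀) (x := ⟨a, ha⟩) fun h => ha0 (congrArg Fin.val h)).2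
    rw [← show (⟨a, ha⟩ : Fin m) = D.parent v₀ ⟨x, hx⟩ from Fin.ext hap] at h1
    rw [← show (⟨x, hx⟩ : Fin m) = D.parent v₀ ⟨a, ha⟩ from Fin.ext hpa] at h2
    omega
  · intro v hv hv0 y hy h
    rw [hleaf ⟨v, hv⟩] at h ⊢
    rw [hpar]
    have hne : D.toLeaf ⟨v, hv⟩ ≠ D.toLeaf v₀ := fun h =>
      hv0 (congrArg Fin.val (D.toLeaf_injective h))
    exact congrArg Fin.val (D.eq_of_isLeaf (D.isLeaf ⟨v, hv⟩) ((hadj _ ⟨y, hy⟩).1 h)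
      (D.adj_parent hne).1)
  · rintro D' hD ⟨x, hx, hx', hx0⟩
    obtain ⟨x, a, b, h1, h2, h3, h4, h5, h6⟩ := D.exists_join (v₀ := v₀) (fun x => D' x)
      (fun v hv => by
        have := hD v v.2 fun h => hv (Fin.ext h)
        rwa [hleaf] at this)
      ⟨⟨x, hx⟩, hx', fun h => hx0 ((congrArg Fin.val h).trans (hleaf v₀).symm)⟩
    exact ⟨x, x.2, a, a.2, b, b.2, h1, h2, h3, fun h => h4 (Fin.ext h), (hadj x a).2 h5,
      (hadj x b).2 h6⟩
  · obtain ⟨y, hy⟩ := D.exists_adj_root (v₀ := v₀)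
    refine ⟨y, y.2, ?_⟩
    rw [hleaf v₀]
    exact (hadj _ y).2 hy
  · intro y hy h
    rw [hleaf v₀] at h ⊢
    have h := (hadj _ ⟨y, hy⟩).1 h
    have hne : (⟨y, hy⟩ : Fin m) ≠ D.toLeaf v₀ := h.ne.symm
    refine ⟨fun h => hne (Fin.ext h), ?_⟩
    rw [hside ⟨y, hy⟩, D.below_of_ne v₀ hne, D.parent_of_adj_root h, ← D.sideOf_compl h,
      D.sideOf_toLeaf h, natSet_compl, natSet_singleton]

/-- The cuts between the two sides of the nodes have matching bounds of sum at most the width. -/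
theorem exists_matchingBound (G : Digraph (Fin n)) (e : ℕ) :
    ∃ A : Set (Fin n), WordRAM.sideSet n (D.side v₀) e = natSet A ∧
      ∃ ν ν', ν + ν' ≤ D.bimimWidth G ∧ MatchingBound G.Adj A Aᶜ ν ∧ MatchingBound G.Adj Aᶜ A ν' := by
  have key : ∀ x, ∃ A : Set (Fin n), D.side v₀ x = natSet A ∧
      ∃ ν ν', ν + ν' ≤ D.bimimWidth G ∧ MatchingBound G.Adj A Aᶜ ν ∧
        MatchingBound G.Adj Aᶜ A ν' := by
    intro x
    by_cases hx : x < m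
    · refine ⟨D.below v₀ ⟨x, hx⟩, dif_pos hx, ?_⟩
      have hd : ∃ y z, D.tree.Adj y z ∧ D.below v₀ ⟨x, hx⟩ = D.sideOf y z := by
        by_cases h : (⟨x, hx⟩ : Fin m) = D.toLeaf v₀
        · obtain ⟨y, hy⟩ := D.exists_adj_root (v₀ := v₀)
          exact ⟨_, y, hy, by rw [below, if_pos h, D.sideOf_toLeaf hy]⟩
        · exact ⟨_, _, (D.adj_parent h).1, D.below_of_ne v₀ h⟩
      obtain ⟨y, z, hyz, hA⟩ := hd
      refine ⟨_, (G.between (D.below v₀ ⟨x, hx⟩)ᶜ (D.below v₀ ⟨x, hx⟩)).inducedMatchingNumber, ?_,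
        G.matchingBound_adj _, ?_⟩
      · have : Finite D.tree.Dart := Finite.of_injective _ SimpleGraph.Dart.toProd_injective
        refine le_trans (le_of_eq ?_) (le_ciSup (f := fun e => G.bimimVal (D.cut e))
          (Set.finite_range _).bddAbove ⟨(y, z), hyz⟩)
        rw [D.cut_eq_sideOf, ← hA]
        rfl
      · have := G.matchingBound_adj (D.below v₀ ⟨x, hx⟩)ᶜ
        rwa [compl_compl] at this
    · refine ⟨Set.univ, by rw [natSet_univ]; exact dif_neg hx, 0, 0, Nat.zero_le _, ?_, ?_⟩ <;>
      · intro I h₁ _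
        refine (Finset.card_eq_zero.2 (Finset.eq_empty_of_forall_notMem fun e he => ?_)).le
        first
          | exact (h₁ e he).2.1 trivial
          | exact (h₁ e he).1 trivial
  obtain ⟨A, h1, ν, ν', h2, h3, h4⟩ := key (e / 2)
  unfold WordRAM.sideSet
  split
  · exact ⟨A, h1, ν, ν', h2, h3, h4⟩
  · exact ⟨Aᶜ, by rw [h1, natSet_compl], ν', ν, by omega, by rwa [compl_compl], by rwa [compl_compl]⟩

end BranchDecomposition

/-- The lists of signatures are short. -/
theorem WordRAM.listBound {n m r E : ℕ} {P : Prob} (hP : P.n = n) (hn : 2 ≤ n) (hh : ∀ k, P.h k ≤ 1)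
    (G : Digraph (Fin n)) (D : BranchDecomposition (Fin n) (Fin m)) (v₀ : Fin n)
    (hH : ∀ u < n, ∀ v < n, P.h (u * n + v) ≠ 0 ↔ Reach (encodeRel G.Adj) n r u v) :
    ListBound P (n ^ (P.c * (P.d * (r * D.bimimWidth G)))) E (sideSet n (D.side v₀)) := by
  subst hP
  intro e _
  obtain ⟨A, hA, ν, ν', hν, h1, h2⟩ := D.exists_matchingBound v₀ G e
  rw [hA]
  refine ⟨natSet_subset A, fun len row hl => ?_⟩
  have hW : ∀ u v : Fin P.n, P.h (u * P.n + v) ≠ 0 ↔ G.Within r u v := fun u v =>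
    (hH u u.2 v v.2).trans (reach_iff G r u v)
  have hC : ∀ u : ℕ, u ∈ (Finset.range P.n : Set ℕ) \ (natSet A : Set ℕ) → u ∈ natSet Aᶜ := by
    intro u hu
    rw [natSet_compl]
    simpa using hu
  by_cases hfull : natSet A = Finset.range P.n
  · -- outside the set of all vertices there is nothing to count
    have hlen : len ≤ 1 := by
      by_contra hc
      refine absurd (hl.inj 0 (by omega) 1 (by omega) fun p hp => ?_) (by omega)
      obtain ⟨l, -, hl'⟩ := hl.sound 1 (by omega)
      rw [hl.zero p hp, hl' p hp, hfull, sig_range (by omega)]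
    exact hlen.trans (Nat.one_le_pow _ _ (by omega))
  · have hcard : (natSet A).card + 1 ≤ P.n := by
      have := Finset.card_lt_card (Finset.ssubset_iff_subset_ne.2 ⟨natSet_subset A, hfull⟩)
      rwa [Finset.card_range] at this
    have b₀ : MatchingBound (P.Counts 0) (natSet A) (Finset.range P.n \ natSet A) (r * ν') := by
      refine ((G.matchingBound_within (A := Aᶜ) (by rwa [compl_compl]) r).flip).natSet ?_
        (fun u hu => by rw [compl_compl]; exact hu) hC
      intro u v
      simp only [Counts, Nat.zero_mod, if_true]
      exact hW v u
    have b₁ : MatchingBound (P.Counts 1) (natSet A) (Finset.range P.n \ natSet A) (r * ν) :=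
      (G.matchingBound_within h1 r).natSet (fun u v => by simpa [Counts] using hW u v)
        (fun u hu => hu) hC
    refine (hl.le_pow hh b₀ b₁).trans ?_
    refine (Nat.pow_le_pow_left hcard _).trans (Nat.pow_le_pow_right (by omega) ?_)
    rw [← Nat.mul_add]
    exact Nat.mul_le_mul_left _ (Nat.mul_le_mul_left _ (Nat.mul_le_mul_left _ (by omega)))

/-- An edge that is not a loop forces positive width. -/
theorem BranchDecomposition.one_le_bimimWidth {n m : ℕ} (D : BranchDecomposition (Fin n) (Fin m))
    {G : Digraph (Fin n)} {u v : Fin n} (h : G.Adj u v) (hne : u ≠ v) : 1 ≤ D.bimimWidth G := by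
  obtain ⟨A, hA, ν, ν', hν, h1, -⟩ := D.exists_matchingBound u G (2 * (D.toLeaf u : ℕ))
  rw [WordRAM.sideSet_even, D.side_val, D.below_toLeaf] at hA
  have hmem : ∀ x, x ∈ A ↔ x = u := fun x => by
    have : (x : ℕ) ∈ natSet A ↔ (x : ℕ) ∈ natSet {u} := by rw [hA]
    simpa [mem_natSet] using this
  have := h1 {(u, v)} (by simp [hmem, hne.symm, h]) (by simp +contextual)
  rw [Finset.card_singleton] at this
  omega

open Prob

/-! ### Colouring problems with counting constraints -/

/-- For a finite or co-finite set, membership depends only on the number capped at the `d`-value. -/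
theorem FiniteOrCofinite.min_mem_iff {μ : Set ℕ} (h : FiniteOrCofinite μ) {d : ℕ} (hd : dValue μ ≤ d)
    (t : ℕ) : min d t ∈ μ ↔ t ∈ μ := by
  rcases le_total t d with htd | htd
  · rw [min_eq_right htd]
  rw [min_eq_left htd]
  -- the supremum of a finite set bounds it, and that of an infinite set is not smaller
  have key : ∀ ν : Set ℕ, ν.Finite → ν.Nonempty →
      (1 + min (⨆ x ∈ ν, (x : ℕ∞)) (⨆ x ∈ νᶜ, (x : ℕ∞))).toNat ≤ d → ∀ t ≥ d, t ∉ ν := by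
    intro ν hν hne hle t ht hmem
    obtain ⟨k, hk, hmax⟩ := Set.exists_max_image ν id hν hne
    have h1 : (⨆ x ∈ ν, (x : ℕ∞)) = k :=
      le_antisymm (iSup₂_le fun x hx => by exact_mod_cast hmax x hx) (le_iSup₂ (f := fun x (_ : x ∈ ν) =>
        (x : ℕ∞)) k hk)
    have h2 : (k : ℕ∞) ≤ ⨆ x ∈ νᶜ, (x : ℕ∞) := by
      refine le_trans (?_ : (k : ℕ∞) ≤ (k + 1 : ℕ)) (le_iSup₂ (f := fun x (_ : x ∈ νᶜ) => (x : ℕ∞)) (k + 1)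
        fun hc => ?_)
      · exact_mod_cast Nat.le_succ k
      · have := hmax _ hc
        simp only [id] at this
        omega
    rw [h1, min_eq_left h2, show (1 + (k : ℕ∞)) = ((1 + k : ℕ) : ℕ∞) by push_cast; rfl,
      ENat.toNat_natCast] at hle
    have := hmax t hmem
    simp only [id] at this
    omega
  unfold dValue at hd
  split_ifs at hd with hc
  · rcases hc with rfl | rfl <;> simp
  · push Not at hc
    rcases h with h | h
    · have h' := key μ h hc.2 hd
      exact iff_of_false (h' d le_rfl) (h' t htd)
    · have h' := key μᶜ h (Set.nonempty_compl.2 hc.1) (by rwa [compl_compl, min_comm])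
      exact iff_of_true (not_not.1 (h' d le_rfl)) (not_not.1 (h' t htd))

/-- A problem of the following kind: colour the vertices of a digraph with the colours `0, …, q - 1`, at
minimum cost, such that at a vertex of colour `col` the number of vertices of colour `j + off` in the
out-ball is in `μ col (2 * j)` and in the in-ball in `μ col (2 * j + 1)`, for `j < c`. -/
structure CountingProblem where
  q : ℕ
  c : ℕ
  off : ℕ
  d : ℕ
  μ : ℕ → ℕ → Set ℕ
  wt : ℕ → ℕ
  c_pos : 1 ≤ c
  off_le : c + off ≤ q
  cap : ∀ col jj t, min d t ∈ μ col jj ↔ t ∈ μ col jj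
  wt_le : ∀ k, wt k ≤ 1

namespace CountingProblem

variable (Q : CountingProblem) {n : ℕ} (G : Digraph (Fin n)) (r : ℕ)

/-- The number of vertices of colour `jj / 2 + off` in the ball of `v` that belongs to `jj`: the
out-ball if `jj` is even, and the in-ball if `jj` is odd. -/
noncomputable def count (jj : ℕ) (v : Fin n) (χ : ℕ → ℕ) : ℕ :=
  {u : Fin n | (if jj % 2 = 0 then G.Within r v u else G.Within r u v) ∧ χ u = jj / 2 + Q.off}.ncard

/-- The colouring `χ` satisfies the constraints. -/
def Correct (χ : ℕ → ℕ) : Prop :=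
  ∀ v : Fin n, χ v < Q.q ∧ ∀ jj < 2 * Q.c, Q.count G r jj v χ ∈ Q.μ (χ v) jj

/-- The answer `flag`, `sol` is right. -/
def Solves (flag : ℕ) (sol : ℕ → ℕ) : Prop :=
  (flag = 0 ∧ ∀ χ, ¬ Q.Correct G r χ) ∨
    (flag = 1 ∧ Q.Correct G r sol ∧ ∀ χ, Q.Correct G r χ →
      ∑ v : Fin n, Q.wt (sol v) ≤ ∑ v : Fin n, Q.wt (χ v))

open Classical in
/-- The table of the allowed capped counts. -/
noncomputable def ok (k : ℕ) : ℕ :=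
  if k % (Q.d + 1) ∈ Q.μ (k / (Q.d + 1) / (2 * Q.c)) (k / (Q.d + 1) % (2 * Q.c)) then 1 else 0

theorem ok_le_one (k : ℕ) : Q.ok k ≤ 1 := by
  unfold ok
  split <;> omega

/-- The form of the problem that the machine solves. -/
noncomputable def prob (n : ℕ) (H : ℕ → ℕ) : Prob := WordRAM.problem n Q.c Q.q Q.off Q.d Q.ok Q.wt H

variable {Q G r} {H : ℕ → ℕ}

theorem total_eq_count (hH1 : ∀ k, H k ≤ 1)
    (hH : ∀ u < n, ∀ v < n, H (u * n + v) ≠ 0 ↔ WordRAM.Reach (encodeRel G.Adj) n r u v) (jj : ℕ)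
    (v : Fin n) (χ : ℕ → ℕ) :
    (Q.prob n H).total (coloured (Finset.range n) χ) (jj * n + v) = Q.count G r jj v χ := by
  classical
  have hW : ∀ u v : Fin n, H (u * n + v) ≠ 0 ↔ G.Within r u v := fun u v =>
    (hH u u.2 v v.2).trans (WordRAM.reach_iff G r u v)
  have h1 : (Q.prob n H).total (coloured (Finset.range n) χ) (jj * n + v) =
      ∑ u ∈ Finset.range n, (Q.prob n H).vecAt (χ u) u (jj * n + v) := by
    simp [total, coloured, Finset.sum]
  rw [h1, Finset.sum_range, count, Set.ncard_eq_toFinset_card', Set.toFinset_ofPred,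
    Finset.card_filter]
  refine Finset.sum_congr rfl fun u _ => ?_
  have hd : (jj * n + v) / n = jj := pos_div (P := Q.prob n H) v.2
  have hm : (jj * n + v) % n = v := pos_mod (P := Q.prob n H) v.2
  have e1 := hH1 (v * n + u)
  have e2 := hH1 (u * n + v)
  have w1 := hW v u
  have w2 := hW u v
  simp only [vecAt, prob, WordRAM.problem, hd, hm]
  by_cases hc : χ u = jj / 2 + Q.off
  · by_cases hp : jj % 2 = 0
    · simp only [hc, hp, if_true, and_true, ← w1]
      split <;> omega
    · simp only [hc, hp, if_true, if_false, and_true, ← w2]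
      split <;> omega
  · simp [hc]

theorem feasible_iff (hH1 : ∀ k, H k ≤ 1)
    (hH : ∀ u < n, ∀ v < n, H (u * n + v) ≠ 0 ↔ WordRAM.Reach (encodeRel G.Adj) n r u v) (χ : ℕ → ℕ) :
    (Q.prob n H).Feasible χ ↔ Q.Correct G r χ := by
  have hok : ∀ v : Fin n, χ v < Q.q → ∀ jj < 2 * Q.c,
      ((Q.prob n H).ok ((χ v * (2 * Q.c) + jj) * (Q.d + 1) +
        min Q.d ((Q.prob n H).total (coloured (Finset.range n) χ) (jj * n + v))) ≠ 0 ↔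
      Q.count G r jj v χ ∈ Q.μ (χ v) jj) := by
    intro v hv jj hjj
    rw [total_eq_count hH1 hH, ← Q.cap]
    set t := min Q.d (Q.count G r jj v χ) with ht
    have ht' : t < Q.d + 1 := by omega
    have hlt : (χ v * (2 * Q.c) + jj) * (Q.d + 1) + t < Q.q * (2 * Q.c) * (Q.d + 1) :=
      WordRAM.mul_add_lt (WordRAM.mul_add_lt hv hjj) ht'
    have e1 : ((χ v * (2 * Q.c) + jj) * (Q.d + 1) + t) % (Q.d + 1) = t := by
      exact Nat.mul_add_mod_of_lt ht'
    have e2 : ((χ v * (2 * Q.c) + jj) * (Q.d + 1) + t) / (Q.d + 1) = χ v * (2 * Q.c) + jj := by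
      rw [mul_comm, Nat.mul_add_div (by omega), Nat.div_eq_of_lt ht', add_zero]
    have e3 : (χ v * (2 * Q.c) + jj) % (2 * Q.c) = jj := by
      exact Nat.mul_add_mod_of_lt hjj
    have e4 : (χ v * (2 * Q.c) + jj) / (2 * Q.c) = χ v := by
      rw [mul_comm, Nat.mul_add_div (by omega), Nat.div_eq_of_lt hjj, add_zero]
    simp only [prob, WordRAM.problem, if_pos hlt, ok]
    split_ifs with h <;> rw [e1, e2, e3, e4] at h <;> simp [h]
  constructor
  · rintro ⟨h1, h2⟩ v
    exact ⟨h1 v v.2, fun jj hjj => (hok v (h1 v v.2) jj hjj).1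
      (h2 v (Finset.mem_range.2 v.2) jj hjj)⟩
  · intro h
    exact ⟨fun v hv => (h ⟨v, hv⟩).1, fun v hv jj hjj =>
      (hok ⟨v, Finset.mem_range.1 hv⟩ (h ⟨v, Finset.mem_range.1 hv⟩).1 jj hjj).2
        ((h ⟨v, Finset.mem_range.1 hv⟩).2 jj hjj)⟩

theorem solves_of_solved (hH1 : ∀ k, H k ≤ 1)
    (hH : ∀ u < n, ∀ v < n, H (u * n + v) ≠ 0 ↔ WordRAM.Reach (encodeRel G.Adj) n r u v) {flag : ℕ}
    {sol : ℕ → ℕ} (h : (Q.prob n H).Solved flag sol) : Q.Solves G r flag sol := by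
  have hcost : ∀ χ, Q.Correct G r χ →
      (Q.prob n H).cost (Finset.range n) χ = ∑ v : Fin n, Q.wt (χ v) := by
    intro χ hχ
    rw [cost, Finset.sum_range]
    exact Finset.sum_congr rfl fun v _ => if_pos (hχ v).1
  rcases h with ⟨h1, h2⟩ | ⟨h1, h2, h3⟩
  · exact .inl ⟨h1, fun χ hχ => h2 χ ((feasible_iff hH1 hH χ).2 hχ)⟩
  · have h2' := (feasible_iff hH1 hH sol).1 h2
    refine .inr ⟨h1, h2', fun χ hχ => ?_⟩
    rw [← hcost sol h2', ← hcost χ hχ]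
    exact h3 χ ((feasible_iff hH1 hH χ).2 hχ)

/-- If the constraints at a vertex depend only on its own colour, then all vertices may receive the same
colour. -/
theorem solves_of_local {good : ℕ → Prop} (hn : 0 < n)
    (h : ∀ χ, Q.Correct G r χ ↔ ∀ v : Fin n, χ v < Q.q ∧ good (χ v)) :
    (¬ (∃ b < Q.q, good b) → ∀ sol, Q.Solves G r 0 sol) ∧
    ∀ b < Q.q, good b → (∀ b' < Q.q, good b' → Q.wt b ≤ Q.wt b') → ∀ sol, (∀ v < n, sol v = b) →
      Q.Solves G r 1 sol := by
  refine ⟨fun hno sol => .inl ⟨rfl, fun χ hχ => hno ⟨_, (h χ).1 hχ ⟨0, hn⟩⟩⟩,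
    fun b hb hg hbest sol hsol => .inr ⟨rfl, (h sol).2 fun v => ?_, fun χ hχ =>
      Finset.sum_le_sum fun v _ => ?_⟩⟩
  · rw [hsol v v.2]; exact ⟨hb, hg⟩
  · rw [hsol v v.2]
    exact hbest _ ((h χ).1 hχ v).1 ((h χ).1 hχ v).2

theorem correct_iff_of_d_eq_zero (hd : Q.d = 0) (χ : ℕ → ℕ) :
    Q.Correct G r χ ↔ ∀ v : Fin n, χ v < Q.q ∧ ∀ jj < 2 * Q.c, 0 ∈ Q.μ (χ v) jj := by
  unfold Correct
  refine forall_congr' fun v => and_congr_right fun _ => forall₂_congr fun jj _ => ?_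
  rw [← Q.cap, hd, Nat.zero_min]

/-- The constraints if all balls are trivial. -/
theorem correct_iff_of_within (hW : ∀ u v, G.Within r u v ↔ u = v) (χ : ℕ → ℕ) :
    Q.Correct G r χ ↔ ∀ v : Fin n, χ v < Q.q ∧
      ∀ jj < 2 * Q.c, (if χ v = jj / 2 + Q.off then 1 else 0) ∈ Q.μ (χ v) jj := by
  unfold Correct
  refine forall_congr' fun v => and_congr_right fun _ => forall₂_congr fun jj _ => ?_
  suffices h : Q.count G r jj v χ = if χ v = jj / 2 + Q.off then 1 else 0 by rw [h]
  have hball : ∀ u, (if jj % 2 = 0 then G.Within r v u else G.Within r u v) ↔ u = v := fun u => by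
    split
    · rw [hW, eq_comm]
    · rw [hW]
  unfold count
  simp only [hball]
  split_ifs with hc
  · rw [Set.ncard_eq_one]
    exact ⟨v, by ext u; simp only [Set.mem_ofPred_eq, Set.mem_singleton_iff]; exact
      ⟨fun h => h.1, fun h => ⟨h, h ▸ hc⟩⟩⟩
  · rw [Set.ncard_eq_zero]
    ext u
    simp only [Set.mem_ofPred_eq, Set.mem_empty_iff_false, iff_false, not_and]
    rintro rfl
    exact hc

end CountingProblem

theorem Digraph.within_zero_iff {V : Type*} {G : Digraph V} {u v : V} : G.Within 0 u v ↔ u = v := by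
  constructor
  · rintro ⟨i, hi, h⟩
    obtain rfl := Nat.le_zero.1 hi
    cases h
    rfl
  · rintro rfl
    exact ⟨0, le_rfl, .nil u⟩

theorem Digraph.within_iff_of_loops {V : Type*} {G : Digraph V} (h : ∀ u v, G.Adj u v → u = v) (r : ℕ)
    (u v : V) : G.Within r u v ↔ u = v := by
  constructor
  · rintro ⟨i, -, hw⟩
    induction hw with
    | nil => rfl
    | cons ha _ ih => rw [h _ _ ha, ih]
  · rintro rfl
    exact ⟨0, Nat.zero_le _, .nil u⟩

open Prob

/-! ### Running times -/

namespace WordRAM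

variable {B : ℕ} {s : Store}

/-- Give all vertices the colour `b`. -/
def Program.fill (b : ℕ) : Program :=
  .seq (.forLt xV xN (.store aOut (.var xV) (.const b))) (.assign xAns 1)

theorem wp_fill {n b : ℕ} (hN : s.var xN = n) (hn : 1 ≤ n) (hnB : n ≤ B) (hb : b ≤ B) :
    wp B (.fill b) s fun t s' => t ≤ 30 * n ∧ s'.var xAns = 1 ∧ ∀ v < n, s'.arr aOut v = b := by
  refine wp_call_seq (Q₁ := fun t s' => t ≤ 20 * n ∧ ∀ v < n, s'.arr aOut v = b) ?_ ?_
  · refine wp_forLt (fun k s' => ∀ v < k, s'.arr aOut v = b) 3 rfl rfl rfl (by simp) ?_ ?_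
    · intro k s₁ hk hb₁ hf₁ hx₁ hI
      refine wp_store trivial hb ⟨by simp, fun v hv => ?_⟩
      simp only [setVar_arr, setArr_arr, eval_var, eval_const, hx₁, true_and]
      split
      · rfl
      · exact hI v (by omega)
    · intro t s₁ ht _ _ _ hI
      rw [hN] at ht hI
      exact ⟨by omega, hI⟩
  · rintro t s₁ _ _ ⟨ht, hI⟩
    refine wp_assign (by simp; omega) ⟨by simp; omega, by simp, hI⟩

open Classical in
/-- The program for a problem that has the solutions in which all colours have the property `good`. -/
noncomputable def Program.uniform (q : ℕ) (good : ℕ → Prop) (wt : ℕ → ℕ) : Program :=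
  if h : ∃ b < q, good b ∧ ∀ b' < q, good b' → wt b ≤ wt b' then .fill h.choose else .assign xAns 0

theorem wp_uniform {Q : CountingProblem} {n r : ℕ} {G : Digraph (Fin n)} {good : ℕ → Prop}
    (h : ∀ χ, Q.Correct G r χ ↔ ∀ v : Fin n, χ v < Q.q ∧ good (χ v)) (hN : s.var xN = n) (hn : 1 ≤ n)
    (hnB : n ≤ B) (hqB : Q.q ≤ B) :
    wp B (.uniform Q.q good Q.wt) s fun t s' =>
      t ≤ 30 * n ∧ Q.Solves G r (s'.var xAns) (s'.arr aOut) := by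
  obtain ⟨h1, h2⟩ := CountingProblem.solves_of_local hn h
  unfold Program.uniform
  split_ifs with hex
  · obtain ⟨hb, hg, hbest⟩ := hex.choose_spec
    refine wp_mono (wp_fill hN hn hnB (hb.le.trans hqB)) ?_
    rintro t s' _ _ ⟨ht, hans, hout⟩
    exact ⟨ht, hans ▸ h2 _ hb hg hbest _ hout⟩
  · have hno : ¬ ∃ b < Q.q, good b := by
      rintro ⟨b, hb⟩
      obtain ⟨b, ⟨hb, hg⟩, hmin⟩ := WellFounded.has_min (measure Q.wt).wf
        {b | b < Q.q ∧ good b} ⟨b, hb⟩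
      exact hex ⟨b, hb, hg, fun b' hb' hg' => not_lt.1 (hmin b' ⟨hb', hg'⟩)⟩
    exact wp_assign (by simp) ⟨by simp; omega, by simpa using h1 hno _⟩

/-- Set `xFlag` if there is an edge that is not a loop. -/
def Program.findEdge : Program :=
  .forLt xU xN <| .forLt xV xN <|
  .ite (.get aAdj (.var xU * .var xN + .var xV))
    (.ite (.eqE (.var xU) (.var xV)) .skip (.assign xFlag 1)) .skip

theorem wp_findEdge {n : ℕ} (hn : 1 ≤ n) (hnn : n * n ≤ B) (hN : s.var xN = n)
    (hF : s.var xFlag = 0) :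
    wp B .findEdge s fun t s' => t ≤ 100 * (n * n) ∧
      (s'.var xFlag ≠ 0 ↔ ∃ u < n, ∃ v < n, s.arr aAdj (u * n + v) ≠ 0 ∧ u ≠ v) := by
  have hB : 1 ≤ B := le_trans (Nat.mul_pos hn hn) hnn
  refine wp_forLt (fun k s' => s'.var xFlag ≠ 0 ↔
    ∃ u < k, ∃ v < n, s.arr aAdj (u * n + v) ≠ 0 ∧ u ≠ v) (60 * n) rfl rfl rfl (by simp [hF]) ?_ ?_
  · intro u s₁ hu hb₁ hf₁ hx₁ hI₁
    rw [hN] at hu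
    have n₁ : s₁.var xN = n := (hf₁.var _ rfl).trans hN
    refine wp_forLt (fun k s' => s'.var xFlag ≠ 0 ↔
      (∃ u' < u, ∃ v < n, s.arr aAdj (u' * n + v) ≠ 0 ∧ u' ≠ v) ∨
        ∃ v < k, s.arr aAdj (u * n + v) ≠ 0 ∧ u ≠ v) 40 rfl rfl rfl (by simpa using hI₁) ?_ ?_
    · intro v s₂ hv hb₂ hf₂ hx₂ hI₂
      rw [n₁] at hv
      have n₂ : s₂.var xN = n := (hf₂.var _ rfl).trans n₁
      have u₂ : s₂.var xU = u := (hf₂.var _ rfl).trans hx₁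
      have a₂ : s₂.arr aAdj = s.arr aAdj := by rw [hf₂.arr _ rfl, hf₁.arr _ rfl]
      have hcell := mul_add_lt hu hv
      have step : ∀ b : ℕ, (b ≠ 0 ↔ s₂.var xFlag ≠ 0 ∨ (s.arr aAdj (u * n + v) ≠ 0 ∧ u ≠ v)) →
          (b ≠ 0 ↔ (∃ u' < u, ∃ v < n, s.arr aAdj (u' * n + v) ≠ 0 ∧ u' ≠ v) ∨
            ∃ v' < v + 1, s.arr aAdj (u * n + v') ≠ 0 ∧ u ≠ v') := by
        intro b hb
        rw [hb, hI₂, or_assoc]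
        refine or_congr_right ⟨?_, ?_⟩
        · rintro (⟨v', h, h'⟩ | h)
          exacts [⟨v', by omega, h'⟩, ⟨v, by omega, h⟩]
        · rintro ⟨v', h, h'⟩
          rcases Nat.lt_succ_iff_lt_or_eq.1 h with h | rfl
          exacts [.inl ⟨v', h, h'⟩, .inr h']
      refine wp_ite (by simp [u₂, n₂, hx₂]; omega) (fun h => ?_) (fun h => ?_)
      · have h' : s.arr aAdj (u * n + v) ≠ 0 := by simpa [u₂, n₂, hx₂, a₂] using h
        refine wp_ite (ok_eqE hb₂ hB trivial trivial) (fun he => wp_skip ?_)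
          (fun he => wp_assign (by simpa) ?_)
        · have he' : u = v := by simpa [u₂, hx₂] using he
          exact ⟨by simp, by simpa using step (s₂.var xFlag) (by simp [he'])⟩
        · have he' : u ≠ v := by simpa [u₂, hx₂] using he
          exact ⟨by simp, by simpa using step 1 (by simp [he', h'])⟩
      · have h' : s.arr aAdj (u * n + v) = 0 := by simpa [u₂, n₂, hx₂, a₂] using h
        exact wp_skip ⟨by simp, by simpa using step (s₂.var xFlag) (by simp [h'])⟩
    · intro t s₂ ht hb₂ hf₂ hx₂ hI₂
      rw [n₁] at ht hI₂
      refine ⟨by omega, ?_⟩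
      simp only [setVar_var, Nat.reduceEqDiff, reduceIte]
      rw [hI₂]
      constructor
      · rintro (⟨u', h, h'⟩ | h)
        exacts [⟨u', by omega, h'⟩, ⟨u, by omega, h⟩]
      · rintro ⟨u', h, h'⟩
        rcases Nat.lt_succ_iff_lt_or_eq.1 h with h | rfl
        exacts [.inl ⟨u', h, h'⟩, .inr h']
  · intro t s₁ ht hb₁ hf₁ hx₁ hI₁
    rw [hN] at ht hI₁
    refine ⟨?_, hI₁⟩
    have := Nat.mul_le_mul_left n hn
    nlinarith

/-- The whole program for a problem with `d, r ≥ 1`: if all edges are loops, then all balls are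
trivial, and otherwise the width of every branch decomposition is positive. -/
noncomputable def Program.complete (Q : CountingProblem) (r : ℕ) : Program :=
  .seq .findEdge <| .ite (.var xFlag)
    (.seq (.assign xFlag 0) <| .seq (.assign xU 0) <| .seq (.assign xV 0) <|
      .main Q.c Q.q Q.off Q.d r Q.ok Q.wt)
    (.uniform Q.q (fun col => ∀ jj < 2 * Q.c, (if col = jj / 2 + Q.off then 1 else 0) ∈ Q.μ col jj)
      Q.wt)

section Time

variable {n m c q d r M : ℕ}

/-- The products of the parameters that occur in the running time and as sizes of numbers are at most
`q * M ^ 3 * n ^ 2`, if `n * c ≤ M`. -/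
theorem product_bounds (hn : 2 ≤ n) (hm : m + 2 = 2 * n) (hc : 1 ≤ c) (hcq : c ≤ q)
    (hM : n * c ≤ M) : 1 ≤ M ∧ n ≤ M ∧ c * n ≤ M ∧
    q * c ≤ q * (M * M * M) * (n * n) ∧ q * 1 ≤ q * (M * M * M) * (n * n) ∧
    n * (n * n) ≤ q * (M * M * M) * (n * n) ∧ n * n ≤ q * (M * M * M) * (n * n) ∧
    M * M * M ≤ q * (M * M * M) * (n * n) ∧
    m * (m * m * m * n) ≤ 16 * (q * (M * M * M) * (n * n)) ∧
    (m + 1) * (M * (n * q * (M * (c * n)))) ≤ 2 * (q * (M * M * M) * (n * n)) ∧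
    n * (q * (M * (c * n))) ≤ q * (M * M * M) * (n * n) ∧
    m * (M * M * (M * (c * n))) ≤ 2 * (q * (M * M * M) * (n * n)) ∧
    M * M * (n * n) ≤ q * (M * M * M) * (n * n) ∧ n * q ≤ q * (M * M * M) * (n * n) := by
  have hcn : c * n ≤ M := by rwa [mul_comm]
  have hnM : n ≤ M := le_trans (Nat.le_mul_of_pos_right _ hc) hM
  have hcM : c ≤ M := le_trans (Nat.le_mul_of_pos_left _ (by omega)) hM
  have hM1 : 1 ≤ M := by omega
  have hq : 1 ≤ q := by omega
  have hnn : 1 ≤ n * n := Nat.mul_pos (by omega) (by omega)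
  have hnn' : n ≤ n * n := Nat.le_mul_of_pos_left _ (by omega)
  have hMM : M ≤ M * M := Nat.le_mul_of_pos_left _ hM1
  have hMM3 : M * M ≤ M * M * M := Nat.le_mul_of_pos_right _ hM1
  have hM3 : M ≤ M * M * M := hMM.trans hMM3
  have gen : ∀ a b e, a ≤ q → b ≤ M * M * M → e ≤ n * n → a * b * e ≤ q * (M * M * M) * (n * n) :=
    fun a b e ha hb he => Nat.mul_le_mul (Nat.mul_le_mul ha hb) he
  refine ⟨hM1, hnM, hcn, ?_, ?_, ?_, ?_, ?_, ?_, ?_, ?_, ?_, ?_, ?_⟩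
  · have := gen q c 1 le_rfl (hcM.trans hM3) hnn
    rwa [mul_one] at this
  · have := gen q 1 1 le_rfl (hM1.trans hM3) hnn
    rwa [mul_one] at this
  · have := gen 1 n (n * n) hq (hnM.trans hM3) le_rfl
    rwa [one_mul] at this
  · have := gen 1 1 (n * n) hq (hM1.trans hM3) le_rfl
    rwa [one_mul, one_mul] at this
  · have := gen 1 (M * M * M) 1 hq le_rfl hnn
    rwa [one_mul, mul_one] at this
  · have h1 : m ≤ 2 * n := by omega
    calc m * (m * m * m * n) ≤ 2 * n * (2 * n * (2 * n) * (2 * n) * n) := by gcongr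
      _ = 16 * (1 * (n * n * n) * (n * n)) := by ring
      _ ≤ _ := Nat.mul_le_mul_left _ (gen _ _ _ hq (by gcongr) le_rfl)
  · calc (m + 1) * (M * (n * q * (M * (c * n)))) ≤ 2 * n * (M * (n * q * (M * M))) := by
          gcongr; omega
      _ = _ := by ring
  · calc n * (q * (M * (c * n))) ≤ n * (q * (M * M)) := by gcongr
      _ = q * (M * M) * n := by ring
      _ ≤ _ := gen _ _ _ le_rfl hMM3 hnn'
  · calc m * (M * M * (M * (c * n))) ≤ 2 * n * (M * M * (M * (q * n))) := by gcongr; omega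
      _ = _ := by ring
  · have := gen 1 (M * M) (n * n) hq hMM3 le_rfl
    rwa [one_mul] at this
  · have := gen q 1 n le_rfl (hM1.trans hM3) hnn'
    rwa [mul_one, mul_comm] at this

theorem mainTime_le (hn : 2 ≤ n) (hm : m + 2 = 2 * n) (hc : 1 ≤ c) (hcq : c ≤ q) (hM : n * c ≤ M) :
    mainTime n m c q d r M ≤ 20000 * ((d + 1) * (r + 1) * (q * (M * M * M) * (n * n))) := by
  obtain ⟨b1, -, b3, b4, b5, b6, -, b8, b9, b10, b11, b12, -, -⟩ := product_bounds hn hm hc hcq hM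
  set X := q * (M * M * M) * (n * n) with hX
  set Y := (d + 1) * (r + 1) * X with hY
  have hM3 : M ≤ M * M * M := by rw [mul_assoc]; exact Nat.le_mul_of_pos_right _ (Nat.mul_pos b1 b1)
  have y1 : X ≤ Y := Nat.le_mul_of_pos_left _ (Nat.mul_pos (Nat.succ_pos d) (Nat.succ_pos r))
  have y2 : (d + 1) * X ≤ Y := Nat.mul_le_mul_right _ (Nat.le_mul_of_pos_right _ (Nat.succ_pos r))
  have y3 : (r + 1) * X ≤ Y := Nat.mul_le_mul_right _ (Nat.le_mul_of_pos_left _ (Nat.succ_pos d))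
  have z1 : (d + 1) * (q * c) ≤ (d + 1) * X := Nat.mul_le_mul_left _ b4
  have z2 : (r + 1) * (n * (n * n)) ≤ (r + 1) * X := Nat.mul_le_mul_left _ b6
  have e : mainTime n m c q d r M = 20 * ((d + 1) * (q * c)) + 10 * q + 100 +
      200 * ((r + 1) * (n * (n * n))) + 500 * (m * (m * m * m * n)) +
      1800 * ((m + 1) * (M * (n * q * (M * (c * n))))) + 1700 * (n * (q * (M * (c * n)))) +
      2928 * (m * (M * M * (M * (c * n)))) + 200 * (c * n) := by
    unfold mainTime
    ring
  omega

/-- Words bounded by the claimed running time suffice for all addresses and values of the program. -/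
theorem bounds_problem {off : ℕ} {ok wt H : ℕ → ℕ} {N : ℕ} (hn : 2 ≤ n) (hm : m + 2 = 2 * n)
    (hc : 1 ≤ c) (hcq : c + off ≤ q) (hM : n * c ≤ M) (hwt : ∀ k, wt k ≤ 1)
    (hH : ∀ k, H k ≤ 1) (hN : 20 * ((d + 1) * (r + 1) * (q * (M * M * M) * (n * n))) ≤ N) :
    Bounds (problem n c q off d ok wt H) N M (2 * (m + 1)) := by
  obtain ⟨b1, b2, b3, b4, b5, -, b7, b8, -, -, -, -, b13, b14⟩ :=
    product_bounds hn hm hc (show c ≤ q by omega) hM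
  set X := q * (M * M * M) * (n * n) with hX
  set Y := (d + 1) * (r + 1) * X with hY
  have y1 : X ≤ Y := Nat.le_mul_of_pos_left _ (Nat.mul_pos (Nat.succ_pos d) (Nat.succ_pos r))
  have y2 : (d + 1) * X ≤ Y := Nat.mul_le_mul_right _ (Nat.le_mul_of_pos_right _ (Nat.succ_pos r))
  have z1 : (d + 1) * (q * c) ≤ (d + 1) * X := Nat.mul_le_mul_left _ b4
  have z2 : (d + 1) * 1 ≤ (d + 1) * X := Nat.mul_le_mul_left _ (by omega)
  have hME : M * (c * n) * (m + 1) ≤ 2 * X := by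
    calc M * (c * n) * (m + 1) ≤ M * M * (2 * n) := by gcongr; omega
      _ ≤ M * M * (2 * (n * n)) := by gcongr; exact Nat.le_mul_of_pos_left _ (by omega)
      _ = 2 * (M * M * (n * n)) := by ring
      _ ≤ 2 * X := by omega
  have hen : (m + 1) * n ≤ 2 * (n * n) := by
    calc (m + 1) * n ≤ 2 * n * n := by gcongr; omega
      _ = _ := by ring
  have hcell : M * M * (n + 1) * (m + 1) ≤ 4 * (M * M * (n * n)) := by
    calc M * M * (n + 1) * (m + 1) ≤ M * M * (2 * n) * (2 * n) := by gcongr <;> omega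
      _ = _ := by ring
  refine ⟨?_, hc, ?_, b1, ?_, ?_, ?_, ?_, hcq, ?_, ?_, ?_, ?_, ?_, fun k => ?_, hH⟩
  · exact (by omega : 1 ≤ n)
  · exact (by omega : 1 ≤ q)
  · calc M * (2 * c * n) * (2 * (m + 1)) = 4 * (M * (c * n) * (m + 1)) := by ring
      _ ≤ N := by omega
  · exact (by omega : n * n ≤ N)
  · calc 2 * (m + 1) * n = 2 * ((m + 1) * n) := by ring
      _ ≤ N := by omega
  · exact (by omega : 2 * d + 2 ≤ N)
  · exact (by omega : 2 * q ≤ N)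
  · exact (by omega : n * q ≤ N)
  · calc M * M * (n + 1) * (2 * (m + 1)) = 2 * (M * M * (n + 1) * (m + 1)) := by ring
      _ ≤ N := by omega
  · exact (by omega : M * M * M ≤ N)
  · calc q * (2 * c) * (d + 1) = 2 * ((d + 1) * (q * c)) := by ring
      _ ≤ N := by omega
  · simp only [problem]
    split
    exacts [hwt k, Nat.zero_le _]

end Time

theorem wp.computes {p : Program} {N : ℕ} {Q : Store → Prop} (h : wp N p s fun t s' => t ≤ N ∧ Q s')
    (hs : Bdd N s) : p.Computes s N Q := by
  obtain ⟨t, s', hr, ht, hQ⟩ := h hs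
  exact ⟨t, s', hr, ht, hQ⟩

theorem bdd_encodeInput {n m N : ℕ} (G : Digraph (Fin n)) (D : BranchDecomposition (Fin n) (Fin m))
    (hN : 1 ≤ N) (hn : n ≤ N) (hm : m ≤ N) : Bdd N (encodeInput G D) := by
  constructor
  · intro x
    match x with
    | 0 => exact hn
    | 1 => exact hm
    | _ + 2 => exact Nat.zero_le _
  · intro a i
    match a with
    | 0 => exact (encodeRel_le_one _ _).trans hN
    | 1 => exact (encodeRel_le_one _ _).trans hN
    | 2 =>
      simp only [encodeInput]
      split
      exacts [(Fin.is_lt _).le.trans hm, Nat.zero_le _]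
    | _ + 3 => exact Nat.zero_le _

theorem _root_.BranchDecomposition.two_le {n m : ℕ} (D : BranchDecomposition (Fin n) (Fin m)) :
    2 ≤ n ∧ m + 2 = 2 * n := by
  have h1 := D.card_eq
  have h2 := D.subcubic.two_le
  rw [Nat.card_fin, Nat.card_fin] at h1
  rw [Nat.card_fin] at h2
  omega

/-- For `M = n ^ (c * e)`, lower terms such as `M ^ 2 * n ^ 3 * c` are below `M ^ 3 * n ^ 2`. -/
theorem mul_le_pow {n c e : ℕ} (hn : 2 ≤ n) (hc : 1 ≤ c) (he : 1 ≤ e) : n * c ≤ n ^ (c * e) := by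
  obtain ⟨k, rfl⟩ : ∃ k, c = k + 1 := ⟨c - 1, by omega⟩
  have h1 : k + 1 ≤ n ^ k := (Nat.lt_two_pow_self (n := k)).trans_le (Nat.pow_le_pow_left hn k)
  calc n * (k + 1) ≤ n * n ^ k := Nat.mul_le_mul_left _ h1
    _ = n ^ (k + 1) := by rw [pow_succ, mul_comm]
    _ ≤ _ := Nat.pow_le_pow_right (by omega) (Nat.le_mul_of_pos_right _ he)

/-- The program is correct and fast enough when `d` and `r` are positive: the expensive part only runs if
there is an edge that is not a loop, and then the exponent is positive. -/
theorem computes_complete (Q : CountingProblem) {r : ℕ} (hr : 1 ≤ r) (hd : 1 ≤ Q.d) {n m N : ℕ}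
    (G : Digraph (Fin n)) (D : BranchDecomposition (Fin n) (Fin m))
    (hN : N = 30000 * (Q.d + 1) * (r + 1) *
      (Q.q * n ^ (3 * (Q.c * (Q.d * (r * D.bimimWidth G))) + 2))) :
    (Program.complete Q r).Computes (encodeInput G D) N fun s =>
      Q.Solves G r (s.var 0) (s.arr 0) := by
  obtain ⟨hn, hm⟩ := D.two_le
  have hcq : Q.c ≤ Q.q := by have := Q.off_le; omega
  have hq : 1 ≤ Q.q := Q.c_pos.trans hcq
  set w := D.bimimWidth G with hw
  set M := n ^ (Q.c * (Q.d * (r * w))) with hM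
  have hM1 : 1 ≤ M := Nat.one_le_pow _ _ (by omega)
  set Y := (Q.d + 1) * (r + 1) * (Q.q * (M * M * M) * (n * n)) with hY
  have hN' : N = 30000 * Y := by rw [hN, hY, hM]; ring
  have hrq : ∀ {k}, k ≤ Q.q * (M * M * M) * (n * n) → (r + 1) * k ≤ Y := fun {k} hk => by
    rw [hY]
    exact Nat.mul_le_mul (Nat.le_mul_of_pos_left _ (Nat.succ_pos _)) hk
  have hM3 : 1 ≤ M * M * M := Nat.mul_pos (Nat.mul_pos hM1 hM1) hM1
  have hnn1 : 1 ≤ n * n := Nat.mul_pos (by omega) (by omega)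
  have hnY : (r + 1) * (n * n) ≤ Y := hrq (Nat.le_mul_of_pos_left _ (Nat.mul_pos hq hM3))
  have hqY : (r + 1) * Q.q ≤ Y := hrq (by rw [mul_assoc]; exact Nat.le_mul_of_pos_right _ (Nat.mul_pos hM3 hnn1))
  have hnn : n ≤ n * n := Nat.le_mul_of_pos_left _ (by omega)
  have hnY' : n * n ≤ Y := le_trans (Nat.le_mul_of_pos_left _ (Nat.succ_pos r)) hnY
  have hqY' : Q.q ≤ Y := le_trans (Nat.le_mul_of_pos_left _ (Nat.succ_pos r)) hqY
  have hrY : r + 1 ≤ Y := le_trans (Nat.le_mul_of_pos_right _ hq) hqY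
  refine wp.computes ?_ (bdd_encodeInput G D (by omega) (by omega) (by omega))
  refine wp_call_seq (wp_findEdge (n := n) (by omega) (by omega) rfl rfl) ?_
  rintro t₁ s₁ _ hf₁ ⟨ht₁, hflag⟩
  have n₁ : s₁.var xN = n := hf₁.var _ rfl
  have hedge : s₁.var xFlag ≠ 0 ↔ ∃ u v, G.Adj u v ∧ u ≠ v := by
    rw [hflag]
    constructor
    · rintro ⟨u, hu, v, hv, h, hne⟩
      exact ⟨⟨u, hu⟩, ⟨v, hv⟩, (encodeRel_ne_zero (R := G.Adj) ⟨u, hu⟩ ⟨v, hv⟩).1 h,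
        fun h => hne (congrArg Fin.val h)⟩
    · rintro ⟨u, v, h, hne⟩
      exact ⟨u, u.2, v, v.2, (encodeRel_ne_zero (R := G.Adj) u v).2 h, fun h => hne (Fin.ext h)⟩
  refine wp_ite trivial (fun h => ?_) (fun h => ?_)
  · obtain ⟨u, v, huv, hne⟩ := hedge.1 h
    have hw1 : 1 ≤ w := D.one_le_bimimWidth huv hne
    have hMn : n * Q.c ≤ M := mul_le_pow hn Q.c_pos (Nat.mul_pos hd (Nat.mul_pos hr hw1))
    have hB : ∀ H : ℕ → ℕ, (∀ k, H k ≤ 1) →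
        Bounds (problem n Q.c Q.q Q.off Q.d Q.ok Q.wt H) N M (2 * (m + 1)) := fun H hH =>
      bounds_problem (r := r) hn hm Q.c_pos Q.off_le hMn Q.wt_le hH (by omega)
    refine wp_assign_seq (by simp) ?_
    refine wp_assign_seq (by simp) ?_
    refine wp_assign_seq (by simp) ?_
    simp only [eval_zero]
    set s₂ := ((s₁.setVar xFlag 0).setVar xU 0).setVar xV 0 with hs₂
    have arr₂ : s₂.arr = (encodeInput G D).arr := by
      funext a
      exact hf₁.arr a rfl
    have var₂ : ∀ x, x ≠ xFlag → x ≠ xU → x ≠ xV → s₂.var x = (encodeInput G D).var x := by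
      intro x h1 h2 h3
      simp only [hs₂, setVar_var, h1, h2, h3, if_false]
      refine hf₁.var x ?_
      simp [Program.findEdge, Program.forLt, Program.writesVar, h1, h2, h3]
    have var₀ : ∀ x, 2 ≤ x → (encodeInput G D).var x = 0 := by
      intro x hx
      match x with
      | _ + 2 => rfl
    have zero₂ : ∀ x, 2 ≤ x → s₂.var x = 0 := by
      intro x hx
      by_cases h1 : x = xFlag
      · simp [hs₂, h1]
      by_cases h2 : x = xU
      · simp [hs₂, h2]
      by_cases h3 : x = xV
      · simp [hs₂, h3]
      rw [var₂ x h1 h2 h3, var₀ x hx]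
    have hmmm : m * m * m ≤ N := by
      obtain ⟨-, b2, -, -, -, -, -, b8, -⟩ := product_bounds hn hm Q.c_pos hcq hMn
      have h1 : m * m * m ≤ 8 * (M * M * M) := by
        calc m * m * m ≤ 2 * M * (2 * M) * (2 * M) := by gcongr <;> omega
          _ = _ := by ring
      have h2 : M * M * M ≤ Y := le_trans (Nat.le_mul_of_pos_left _ (Nat.succ_pos r)) (hrq b8)
      omega
    clear_value s₂
    refine wp_mono (wp_main (s := s₂) (n := n) (m := m) (M := M) hB (fun H hH1 hH => ?_) Q.ok_le_one
      Q.wt_le (by omega) (by omega) hmmm (by rw [arr₂]; rfl)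
      (D.treeData (by omega)) (fun v _ => by rw [arr₂]; rfl)
      (var₂ _ (by decide) (by decide) (by decide)) (var₂ _ (by decide) (by decide) (by decide)) zero₂
      (fun a ha k => ?_) fun k => ?_) ?_
    · rw [arr₂] at hH
      exact listBound (P := problem n Q.c Q.q Q.off Q.d Q.ok Q.wt H) rfl hn hH1 G D _ hH
    · rw [arr₂]
      match a with
      | _ + 3 => rfl
    · rw [arr₂]
      exact encodeRel_le_one _ _
    · rintro t s' _ _ ⟨ht, H, hH1, hH, hsol⟩
      rw [arr₂] at hH
      refine ⟨?_, CountingProblem.solves_of_solved hH1 hH hsol⟩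
      have := mainTime_le (d := Q.d) (r := r) hn hm Q.c_pos hcq hMn
      simp
      omega
  · have hloop : ∀ u v, G.Adj u v → u = v := fun u v huv => by
      by_contra hne
      exact hedge.2 ⟨u, v, huv, hne⟩ h
    refine wp_mono (wp_uniform
      (CountingProblem.correct_iff_of_within (Digraph.within_iff_of_loops hloop r)) n₁ (by omega)
      (by omega) (by omega)) ?_
    rintro t s' _ _ ⟨ht, hsol⟩
    exact ⟨by simp; omega, hsol⟩

/-- Counting problems can be solved in the claimed time, with a constant that depends only on `r` and
the cap. -/
theorem exists_program (Q : CountingProblem) (r : ℕ) : ∃ p : Program, ∀ (n m : ℕ) (G : Digraph (Fin n))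
    (D : BranchDecomposition (Fin n) (Fin m)),
    p.Computes (encodeInput G D) (30000 * (Q.d + 1) * (r + 1) *
      (Q.q * n ^ (3 * (Q.c * (Q.d * (r * D.bimimWidth G))) + 2))) fun s =>
        Q.Solves G r (s.var 0) (s.arr 0) := by
  have huni : ∀ good : ℕ → Prop, (∀ n (G : Digraph (Fin n)) χ, Q.Correct G r χ ↔
      ∀ v : Fin n, χ v < Q.q ∧ good (χ v)) → ∃ p : Program, ∀ (n m : ℕ) (G : Digraph (Fin n))
      (D : BranchDecomposition (Fin n) (Fin m)),
      p.Computes (encodeInput G D) (30000 * (Q.d + 1) * (r + 1) *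
        (Q.q * n ^ (3 * (Q.c * (Q.d * (r * D.bimimWidth G))) + 2))) fun s =>
          Q.Solves G r (s.var 0) (s.arr 0) := by
    intro good hgood
    refine ⟨.uniform Q.q good Q.wt, fun n m G D => ?_⟩
    obtain ⟨hn, hm⟩ := D.two_le
    have hq : 1 ≤ Q.q := by have := Q.off_le; have := Q.c_pos; omega
    have h1 : n ≤ n ^ (3 * (Q.c * (Q.d * (r * D.bimimWidth G))) + 2) :=
      Nat.le_self_pow (by omega) n
    set X := Q.q * n ^ (3 * (Q.c * (Q.d * (r * D.bimimWidth G))) + 2) with hX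
    have h2 : n ≤ X := h1.trans (Nat.le_mul_of_pos_left _ hq)
    have h3 : Q.q ≤ X := Nat.le_mul_of_pos_right _ (by omega)
    have h4 : 30000 * X ≤ 30000 * (Q.d + 1) * (r + 1) * X := by
      rw [mul_assoc 30000]
      exact Nat.mul_le_mul_right _ (Nat.le_mul_of_pos_right _
        (Nat.mul_pos (Nat.succ_pos _) (Nat.succ_pos _)))
    refine wp.computes (wp_mono (wp_uniform (hgood n G) rfl (by omega) (by omega) (by omega)) ?_)
      (bdd_encodeInput G D (by omega) (by omega) (by omega))
    rintro t s' _ _ ⟨ht, hsol⟩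
    exact ⟨by omega, hsol⟩
  rcases Nat.eq_zero_or_pos Q.d with hd | hd
  · exact huni (fun col => ∀ jj < 2 * Q.c, 0 ∈ Q.μ col jj) fun n G χ =>
      CountingProblem.correct_iff_of_d_eq_zero hd χ
  rcases Nat.eq_zero_or_pos r with rfl | hr
  · exact huni (fun col => ∀ jj < 2 * Q.c, (if col = jj / 2 + Q.off then 1 else 0) ∈ Q.μ col jj)
      fun n G χ => CountingProblem.correct_iff_of_within
      (fun _ _ => Digraph.within_zero_iff) χ
  · exact ⟨.complete Q r, fun n m G D => computes_complete Q hr hd G D rfl⟩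

end WordRAM

open Prob

/-! ### Vertex subset and vertex partitioning problems -/

/-- A generalized domination problem as a colouring problem: the colour `1` is for the vertices of the
set. -/
noncomputable def SigmaRho.countingProblem (P : SigmaRho) (opt : Objective) : CountingProblem where
  q := 2
  c := 1
  off := 1
  d := P.dValue
  μ col jj :=
    if jj % 2 = 0 then if col = 1 then P.sigmaOut else P.rhoOut
    else if col = 1 then P.sigmaIn else P.rhoIn
  wt col :=
    match opt with
    | .minimize => if col = 1 then 1 else 0
    | .maximize => if col = 1 then 0 else 1
  c_pos := le_rfl
  off_le := le_rfl
  cap col jj t := by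
    have h1 : _root_.dValue P.sigmaOut ≤ P.dValue := (le_max_left _ _).trans (le_max_left _ _)
    have h2 : _root_.dValue P.sigmaIn ≤ P.dValue := (le_max_right _ _).trans (le_max_left _ _)
    have h3 : _root_.dValue P.rhoOut ≤ P.dValue := (le_max_left _ _).trans (le_max_right _ _)
    have h4 : _root_.dValue P.rhoIn ≤ P.dValue := (le_max_right _ _).trans (le_max_right _ _)
    split_ifs
    exacts [P.sigmaOut_fc.min_mem_iff h1 t, P.rhoOut_fc.min_mem_iff h3 t,
      P.sigmaIn_fc.min_mem_iff h2 t, P.rhoIn_fc.min_mem_iff h4 t]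
  wt_le col := by cases opt <;> simp only <;> split <;> omega

theorem SigmaRho.correct_iff {P : SigmaRho} {opt : Objective} {r n : ℕ} {G : Digraph (Fin n)}
    {χ : ℕ → ℕ} {S : Set (Fin n)} (hχ : ∀ v : Fin n, χ v < 2) (hS : ∀ v : Fin n, v ∈ S ↔ χ v = 1) :
    (P.countingProblem opt).Correct G r χ ↔ P.DistDominates r G S := by
  have h0 : ∀ v, (P.countingProblem opt).count G r 0 v χ = (G.outBall r v ∩ S).ncard := fun v => by
    refine congrArg Set.ncard (Set.ext fun u => ?_)
    simp [countingProblem, Digraph.outBall, Digraph.edist_le_iff, hS]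
  have h1 : ∀ v, (P.countingProblem opt).count G r 1 v χ = (G.inBall r v ∩ S).ncard := fun v => by
    refine congrArg Set.ncard (Set.ext fun u => ?_)
    simp [countingProblem, Digraph.inBall, Digraph.edist_le_iff, hS]
  refine forall_congr' fun v => ?_
  have h2 : (∀ jj < 2 * (P.countingProblem opt).c,
      (P.countingProblem opt).count G r jj v χ ∈ (P.countingProblem opt).μ (χ v) jj) ↔
      (G.outBall r v ∩ S).ncard ∈ (P.countingProblem opt).μ (χ v) 0 ∧
        (G.inBall r v ∩ S).ncard ∈ (P.countingProblem opt).μ (χ v) 1 := by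
    rw [← h0, ← h1]
    constructor
    · exact fun h => ⟨h 0 (by simp [countingProblem]), h 1 (by simp [countingProblem])⟩
    · rintro ⟨h3, h4⟩ jj hjj
      have : jj = 0 ∨ jj = 1 := by simp only [countingProblem] at hjj; omega
      rcases this with rfl | rfl
      exacts [h3, h4]
  rw [h2, and_iff_right (show χ v < (P.countingProblem opt).q from hχ v), hS]
  by_cases hv : χ v = 1 <;> simp [countingProblem, hv]

theorem SigmaRho.correctAnswer_of_solves {P : SigmaRho} {opt : Objective} {r n : ℕ}
    {G : Digraph (Fin n)} {s : WordRAM.Store}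
    (h : (P.countingProblem opt).Solves G r (s.var 0) (s.arr 0)) : P.CorrectAnswer r opt G s := by
  classical
  set ind : Set (Fin n) → ℕ → ℕ := fun S k => if ∃ h : k < n, ⟨k, h⟩ ∈ S then 1 else 0 with hind
  have hind2 : ∀ S (v : Fin n), ind S v < 2 := fun S v => by
    simp only [hind]; split <;> omega
  have hind1 : ∀ S (v : Fin n), v ∈ S ↔ ind S v = 1 := fun S v => by
    simp only [hind, Fin.is_lt, Fin.eta, exists_true_left]
    split_ifs with h <;> simp [h]
  have hcor : ∀ S, P.DistDominates r G S → (P.countingProblem opt).Correct G r (ind S) := fun S hS =>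
    (correct_iff (hind2 S) (hind1 S)).2 hS
  rcases h with ⟨h1, h2⟩ | ⟨h1, h2, h3⟩
  · exact .inr ⟨h1, fun ⟨S, hS⟩ => h2 _ (hcor S hS)⟩
  · have hsol : ∀ v : Fin n, s.arr 0 v < 2 := fun v => (h2 v).1
    refine .inl ⟨h1, (correct_iff hsol fun v => Iff.rfl).1 h2, fun S hS => ?_⟩
    have h4 := h3 _ (hcor S hS)
    have hcard : ∀ (χ : ℕ → ℕ) (S : Set (Fin n)), (∀ v : Fin n, v ∈ S ↔ χ v = 1) →
        S.ncard = ∑ v : Fin n, if χ v = 1 then 1 else 0 := by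
      intro χ S hS
      rw [Finset.sum_boole, Set.ncard_eq_toFinset_card', Nat.cast_id]
      congr 1
      ext v
      simp [hS]
    have c1 := hcard (s.arr 0) (outputSet s) fun v => Iff.rfl
    have c2 := hcard (ind S) S (hind1 S)
    cases opt with
    | minimize =>
      simp only [countingProblem] at h4 ⊢
      omega
    | maximize =>
      -- the costs are the sizes of the complements
      have hsum : ∀ χ : ℕ → ℕ, (∑ v : Fin n, if χ v = 1 then 1 else 0) +
          (∑ v : Fin n, if χ v = 1 then 0 else 1) = n := by
        intro χ
        rw [← Finset.sum_add_distrib]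
        refine (Finset.sum_congr rfl fun v _ => ?_).trans (by simp : ∑ _v : Fin n, 1 = n)
        split <;> rfl
      have e1 := hsum (s.arr 0)
      have e2 := hsum (ind S)
      simp only [countingProblem] at h4 ⊢
      omega

/-- A vertex partitioning problem as a colouring problem. -/
noncomputable def ConstraintMatrix.countingProblem {q : ℕ} (D : ConstraintMatrix q) (hq : 1 ≤ q) :
    CountingProblem where
  q := q
  c := q
  off := 0
  d := D.dValue
  μ col jj :=
    if h : col < q ∧ jj / 2 < q then
      if jj % 2 = 0 then D.out ⟨col, h.1⟩ ⟨jj / 2, h.2⟩ else D.inn ⟨col, h.1⟩ ⟨jj / 2, h.2⟩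
    else Set.univ
  wt _ := 0
  c_pos := hq
  off_le := le_rfl
  cap col jj t := by
    have hle : ∀ i j, max (_root_.dValue (D.out i j)) (_root_.dValue (D.inn i j)) ≤ D.dValue := fun i j =>
      (Finset.le_sup (f := fun j => max (_root_.dValue (D.out i j)) (_root_.dValue (D.inn i j)))
        (Finset.mem_univ j)).trans (Finset.le_sup (f := fun i => Finset.univ.sup fun j =>
          max (_root_.dValue (D.out i j)) (_root_.dValue (D.inn i j))) (Finset.mem_univ i))
    split_ifs with h
    · exact (D.out_fc _ _).min_mem_iff ((le_max_left _ _).trans (hle _ _)) t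
    · exact (D.inn_fc _ _).min_mem_iff ((le_max_right _ _).trans (hle _ _)) t
    · rfl
  wt_le _ := Nat.zero_le _

theorem ConstraintMatrix.correct_iff {q : ℕ} {D : ConstraintMatrix q} (hq : 1 ≤ q) {r n : ℕ}
    {G : Digraph (Fin n)} {χ : ℕ → ℕ} {X : Fin q → Set (Fin n)} (hχ : ∀ v : Fin n, χ v < q)
    (hX : ∀ i v, v ∈ X i ↔ χ v = i) :
    (D.countingProblem hq).Correct G r χ ↔ D.IsDistPartition r G X := by
  have h0 : ∀ (j : Fin q) v, (D.countingProblem hq).count G r (2 * j) v χ =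
      (G.outBall r v ∩ X j).ncard := fun j v => by
    refine congrArg Set.ncard (Set.ext fun u => ?_)
    simp [countingProblem, Digraph.outBall, Digraph.edist_le_iff, hX]
  have h1 : ∀ (j : Fin q) v, (D.countingProblem hq).count G r (2 * j + 1) v χ =
      (G.inBall r v ∩ X j).ncard := fun j v => by
    have e1 : (2 * (j : ℕ) + 1) % 2 = 1 := by omega
    have e2 : (2 * (j : ℕ) + 1) / 2 = j := by omega
    refine congrArg Set.ncard (Set.ext fun u => ?_)
    simp [countingProblem, Digraph.inBall, Digraph.edist_le_iff, hX, e1, e2]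
  have hμ0 : ∀ i j : Fin q, (D.countingProblem hq).μ i (2 * j) = D.out i j := fun i j => by
    simp [countingProblem]
  have hμ1 : ∀ i j : Fin q, (D.countingProblem hq).μ i (2 * j + 1) = D.inn i j := fun i j => by
    have e1 : (2 * (j : ℕ) + 1) % 2 = 1 := by omega
    have e2 : (2 * (j : ℕ) + 1) / 2 = j := by omega
    simp [countingProblem, e1, e2]
  constructor
  · intro h
    refine ⟨fun v => ⟨⟨χ v, hχ v⟩, (hX _ v).2 rfl, fun i hi => Fin.ext ((hX i v).1 hi).symm⟩,
      fun i j v hv => ?_⟩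
    have hi := (hX i v).1 hv
    have h2 := (h v).2 (2 * j) (Nat.mul_lt_mul_of_pos_left j.2 two_pos)
    have h3 := (h v).2 (2 * j + 1) (by have := j.2; simp only [countingProblem]; omega)
    rw [hi, h0, hμ0] at h2
    rw [hi, h1, hμ1] at h3
    exact ⟨h2, h3⟩
  · rintro ⟨-, h⟩ v
    refine ⟨hχ v, fun jj hjj => ?_⟩
    have hjj : jj < 2 * q := hjj
    have h2 := h ⟨χ v, hχ v⟩ ⟨jj / 2, by omega⟩ v ((hX _ v).2 rfl)
    rw [← h0, ← h1, ← hμ0, ← hμ1] at h2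
    rcases Nat.mod_two_eq_zero_or_one jj with hp | hp
    · have e : 2 * (jj / 2) = jj := by omega
      simp only [e] at h2
      exact h2.1
    · have e : 2 * (jj / 2) + 1 = jj := by omega
      simp only [e] at h2
      exact h2.2

theorem ConstraintMatrix.correctAnswer_of_solves {q : ℕ} {D : ConstraintMatrix q} (hq : 1 ≤ q)
    {r n : ℕ} {G : Digraph (Fin n)} {s : WordRAM.Store}
    (h : (D.countingProblem hq).Solves G r (s.var 0) (s.arr 0)) : D.CorrectAnswer r G s := by
  rcases h with ⟨h1, h2⟩ | ⟨h1, h2, -⟩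
  · refine .inr ⟨h1, fun ⟨X, hX⟩ => ?_⟩
    choose f hf hf' using hX.1
    set χ : ℕ → ℕ := fun k => if h : k < n then f ⟨k, h⟩ else 0 with hχ
    have hv : ∀ v : Fin n, χ v = f v := fun v => dif_pos v.2
    refine h2 χ ((correct_iff hq (fun v => by rw [hv]; exact (f v).2) fun i v => ?_).2 hX)
    rw [hv]
    exact ⟨fun h => congrArg Fin.val (hf' v i h).symm, fun h => Fin.ext h ▸ hf v⟩
  · exact .inl ⟨h1, (correct_iff hq (fun v => (h2 v).1) fun i v => Iff.rfl).1 h2⟩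

theorem theorem2 :
    -- distance-`r` vertex subset problems
    (∀ (r : ℕ) (P : SigmaRho) (opt : Objective),
      ∃ (p : WordRAM.Program) (C : ℕ),
        ∀ (n m : ℕ) (G : Digraph (Fin n)) (B : BranchDecomposition (Fin n) (Fin m)),
          1 ≤ B.bimimWidth G →
          p.Computes (encodeInput G B) (C * n ^ (3 * P.dValue * r * B.bimimWidth G + 2))
            (P.CorrectAnswer r opt G)) ∧
    -- distance-`r` vertex partitioning problems; the constant does not depend on `q`
    (∀ r d : ℕ, ∃ C : ℕ,
      ∀ (q : ℕ) (D : ConstraintMatrix q), 1 ≤ q → D.dValue = d →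
        ∃ p : WordRAM.Program,
          ∀ (n m : ℕ) (G : Digraph (Fin n)) (B : BranchDecomposition (Fin n) (Fin m)),
            p.Computes (encodeInput G B) (C * (q * n ^ (3 * q * d * r * B.bimimWidth G + 2)))
              (D.CorrectAnswer r G)) := by
  refine ⟨fun r P opt => ?_, fun r d => ⟨30000 * (d + 1) * (r + 1), fun q D hq hd => ?_⟩⟩
  · obtain ⟨p, hp⟩ := WordRAM.exists_program (P.countingProblem opt) r
    refine ⟨p, 30000 * (P.dValue + 1) * (r + 1) * 2, fun n m G B _ => ?_⟩
    have e : 30000 * (P.dValue + 1) * (r + 1) * 2 * n ^ (3 * P.dValue * r * B.bimimWidth G + 2) =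
        30000 * (P.dValue + 1) * (r + 1) *
          (2 * n ^ (3 * (1 * (P.dValue * (r * B.bimimWidth G))) + 2)) := by ring
    rw [e]
    obtain ⟨t, s', hrun, ht, hs⟩ := hp n m G B
    exact ⟨t, s', hrun, ht, SigmaRho.correctAnswer_of_solves hs⟩
  · obtain ⟨p, hp⟩ := WordRAM.exists_program (D.countingProblem hq) r
    refine ⟨p, fun n m G B => ?_⟩
    have e : 30000 * (d + 1) * (r + 1) * (q * n ^ (3 * q * d * r * B.bimimWidth G + 2)) =
        30000 * (D.dValue + 1) * (r + 1) *
          (q * n ^ (3 * (q * (D.dValue * (r * B.bimimWidth G))) + 2)) := by rw [hd]; ring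
    rw [e]
    obtain ⟨t, s', hrun, ht, hs⟩ := hp n m G B
    exact ⟨t, s', hrun, ht, ConstraintMatrix.correctAnswer_of_solves hq hs⟩
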